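/- Let $n\ge 1$ be an integer, $s>0$, $\delta\in(0,1)$, $k_0\in\mathbb Z$, and put $\varepsilon=\min(ns/2,\,n\delta)$. Let $\vartheta:\mathbb R^n\to[0,\infty)$ be smooth, radial and radially decreasing, with $\vartheta(\xi)=1$ for $|\xi|\le 1$ and $\vartheta(\xi)=0$ for $|\xi|\ge 2$. For $j\in\mathbb Z$ let $\psi_j\ge 0$ be given by $\psi_j(\xi)^2=\vartheta(2^{-1-j}\xi)^2-\vartheta(2^{2-j}\xi)^2$, and for $u\in\mathbb R^n$ let $Q^u_j$ be the Fourier multiplier $$Q^u_j g(x)=\frac1{(2\pi)^n}\int_{\mathbb R^n}\psi_j(\xi)\,e^{i2^{-j}\xi\cdot u}\,\widehat g(\xi)\,e^{ix\cdot\xi}\,d\xi,\qquad \widehat g(\xi)=\int_{\mathbb R^n} g(x)e^{-ix\cdot\xi}\,dx .$$ Let $d\in S^{-ns/2}$, that is, $d\in C^\infty(\mathbb R^n\times\mathbb R^n)$ is complex-valued and $|\partial_\xi^\alpha\partial_x^\beta d(x,\xi)|\le A_{\alpha,\beta}(1+|\xi|^2)^{(-ns/2-|\alpha|)/2}$ for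 all multi-indices $\alpha,\beta$. Let $\varphi:\mathbb R^n\to\mathbb R$ be a phase of order $s$, that is, $\varphi\in C^\infty(\mathbb R^n\setminus\{0\})$ and $|\partial^\alpha\varphi(\xi)|\le c_\alpha|\xi|^{s-|\alpha|}$ for all $\xi\ne0$ and all $\alpha$. Let $$T^\varphi_d f(x)=\frac1{(2\pi)^n}\int_{\mathbb R^n}e^{ix\cdot\xi+i\varphi(\xi)}d(x,\xi)\widehat f(\xi)\,d\xi ,$$ extended to $f\in\mathrm{bmo}$ by duality: $T_d^\varphi f$ is the distribution $g\mapsto\int f\,\big((T_d^{\varphi})^{t}g\big)\,dy$ on Schwartz functions $g$, where $$(T_d^\varphi)^tg(y)=\frac1{(2\pi)^n}\int e^{-iy\cdot\xi+i\varphi(\xi)}\Big(\int e^{ix\cdot\xi}d(x,\xi)g(x)\,dx\Big)d\xi .$$ Here $\mathrm{bmo}$ is the space of locally integrable $f:\mathbb R^n\to\mathbb C$ with $\|f\|_{\mathrm{bmo}}=\sup_Q\frac1{|Q|}\int_Q|f-\mathrm{avg}_Qf|\,dx+\|\vartheta(D)f\|_{L^\infty}<\infty$, the supremum being over all cubes $Q$.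 Then there is a constant $C$, depending only on $n,s,\delta,\vartheta,k_0$ and the constants $A_{\alpha,\beta},c_\alpha$, such that for all such $d$ and $\varphi$, all $u\in\mathbb R^n$ and all $f\in\mathrm{bmo}$ the following holds. For every integer $j\ge k_0$ the function $Q^u_jT^\varphi_df$ is well defined at every point (by an absolutely convergent pairing of $f$ with the transposed operator applied to the translated kernel of $Q^u_j$), and for every integer $k\ge k_0$ the measure $$d\mu_k(x,t)=\sum_{\ell=0}^\infty\big|(Q^u_{k+\ell}\circ T^\varphi_d)f(x)\big|^2\,\delta_{2^{-\ell}}(t)\,dx$$ is a Carleson measure on $\mathbb R^{n+1}_+$, with Carleson norm $$\|d\mu_k\|_{\mathcal C}=\sup_Q\frac{1}{|Q|}\,\mu_k\big(Q\times(0,\ell(Q)]\big)\le C\,2^{-\varepsilon k}\,\|f\|_{\mathrm{bmo}}^2,$$ where the supremum is over all cubes $Q\subset\mathbb R^n$ and $\ell(Q)$ is the side length of $Q$. -/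

import Mathlib

open MeasureTheory
open scoped ENNReal ContDiff

noncomputable section

namespace OscInt

/-- Euclidean space `ℝⁿ`. -/
abbrev Eucl (n : ℕ) : Type := EuclideanSpace ℝ (Fin n)

variable {n : ℕ}

/-- The oscillating factor `e^{iθ}`. -/
def expI (θ : ℝ) : ℂ := Complex.exp (θ * Complex.I)

/-- Integration against the normalised Lebesgue measure `dξ / (2π)ⁿ`. -/
def freqIntegral (F : Eucl n → ℂ) : ℂ :=
  (((2 * Real.pi) ^ n : ℝ) : ℂ)⁻¹ * ∫ ξ : Eucl n, F ξ

/-- The closed axis-parallel cube with corner `a` and side length `r`. -/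
def cube (a : Eucl n) (r : ℝ) : Set (Eucl n) :=
  {x | ∀ i, a i ≤ x i ∧ x i ≤ a i + r}

/-- Littlewood--Paley cut-off: smooth, non-negative, radial and radially decreasing (together:
a monotonically decreasing function of the norm), `1` on the unit ball and `0` outside the ball
of radius `2`. -/
structure IsCutoff (ϑ : Eucl n → ℝ) : Prop where
  smooth : ContDiff ℝ ∞ ϑ
  nonneg : ∀ ξ, 0 ≤ ϑ ξ
  radial_decreasing : ∀ ξ η : Eucl n, ‖ξ‖ ≤ ‖η‖ → ϑ η ≤ ϑ ξ
  eq_one : ∀ ξ : Eucl n, ‖ξ‖ ≤ 1 → ϑ ξ = 1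
  eq_zero : ∀ ξ : Eucl n, 2 ≤ ‖ξ‖ → ϑ ξ = 0

/-- `d` belongs to the Hörmander class `S^m`, with constants `A`:
`|∂_ξ^α ∂_x^β d(x, ξ)| ≤ A ⟨ξ⟩^{m - |α|}`, all partial derivatives of given orders
`a = |α|` and `b = |β|` being collected in the iterated Fréchet derivatives. -/
structure IsAmplitude (m : ℝ) (A : ℕ → ℕ → ℝ) (d : Eucl n → Eucl n → ℂ) : Prop where
  smooth : ContDiff ℝ ∞ (fun p : Eucl n × Eucl n => d p.1 p.2)
  bound : ∀ (a b : ℕ) (x ξ : Eucl n),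
    ‖iteratedFDeriv ℝ a (fun η => iteratedFDeriv ℝ b (fun y => d y η) x) ξ‖
      ≤ A a b * (1 + ‖ξ‖ ^ 2) ^ ((m - a) / 2)

/-- `φ` is a phase of order `s`, with constants `c`: it is smooth away from the origin and
`|∂^α φ(ξ)| ≤ c |ξ|^{s - |α|}` for `ξ ≠ 0` and all `α`. -/
structure IsPhase (s : ℝ) (c : ℕ → ℝ) (φ : Eucl n → ℝ) : Prop where
  smooth : ContDiffOn ℝ ∞ φ {0}ᶜ
  bound : ∀ (a : ℕ) (ξ : Eucl n), ξ ≠ 0 → ‖iteratedFDeriv ℝ a φ ξ‖ ≤ c a * ‖ξ‖ ^ (s - a)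

/-- The `BMO` seminorm: supremum of the mean oscillations over all cubes. -/
def bmoSeminorm (f : Eucl n → ℂ) : ℝ≥0∞ :=
  ⨆ (a : Eucl n) (r : ℝ) (_ : 0 < r),
    (∫⁻ x in cube a r, ‖f x - ⨍ y in cube a r, f y‖ₑ) / volume (cube a r)

/-- The low frequency part `ϑ(D) f`, i.e. convolution of `f` with the inverse Fourier transform
of `ϑ`. -/
def lowFreq (ϑ : Eucl n → ℝ) (f : Eucl n → ℂ) (x : Eucl n) : ℂ :=
  ∫ y : Eucl n, freqIntegral (fun ξ => (ϑ ξ : ℂ) * expI (inner ℝ (x - y) ξ)) * f y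

/-- The norm of local `BMO`: `‖f‖_BMO + ‖ϑ(D) f‖_∞`. -/
def bmoNorm (ϑ : Eucl n → ℝ) (f : Eucl n → ℂ) : ℝ≥0∞ :=
  bmoSeminorm f + eLpNorm (lowFreq ϑ f) ∞ volume

/-- `f` belongs to local `BMO`. -/
def MemBmo (ϑ : Eucl n → ℝ) (f : Eucl n → ℂ) : Prop :=
  LocallyIntegrable f volume ∧ bmoNorm ϑ f < ⊤

/-- The transpose of the oscillatory integral operator
`T f(x) = ∫ e^{i x·ξ + i φ(ξ)} d(x, ξ) f̂(ξ) dξ / (2π)ⁿ`, namely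
`Tᵗ g(y) = ∫ e^{-i y·ξ + i φ(ξ)} (∫ e^{i x·ξ} d(x, ξ) g(x) dx) dξ / (2π)ⁿ`,
so that `∫ (T f) g = ∫ f (Tᵗ g)` for Schwartz functions `f` and `g`. -/
def oioTranspose (d : Eucl n → Eucl n → ℂ) (φ : Eucl n → ℝ) (g : Eucl n → ℂ) (y : Eucl n) : ℂ :=
  freqIntegral fun ξ =>
    expI (-inner ℝ y ξ + φ ξ) * ∫ x : Eucl n, expI (inner ℝ x ξ) * d x ξ * g x

/-- The oscillatory integral operator `T` with amplitude `d` and phase `φ`, extended by duality: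
`T f` is the distribution whose value at a Schwartz function `g` is `∫ f (Tᵗ g)`. (The transpose
`Tᵗ g` is in general not a Schwartz function, as `φ` may be singular at the origin, but it decays
fast enough to be integrated against functions in local `BMO`.) -/
def oio (d : Eucl n → Eucl n → ℂ) (φ : Eucl n → ℝ) (f : Eucl n → ℂ) (g : Eucl n → ℂ) : ℂ :=
  ∫ y : Eucl n, f y * oioTranspose d φ g y

/-- The non-negative function `ψ_j` with `ψ_j(ξ)² = ϑ(2^{-1-j} ξ)² - ϑ(2^{2-j} ξ)²`. -/
def psi (ϑ : Eucl n → ℝ) (j : ℤ) (ξ : Eucl n) : ℝ :=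
  Real.sqrt (ϑ ((2 : ℝ) ^ (-1 - j) • ξ) ^ 2 - ϑ ((2 : ℝ) ^ (2 - j) • ξ) ^ 2)

/-- The convolution kernel of the Fourier multiplier `Q_j^u` with symbol
`ψ_j(ξ) e^{i 2^{-j} ξ·u}`. -/
def lpKernel (ϑ : Eucl n → ℝ) (u : Eucl n) (j : ℤ) (z : Eucl n) : ℂ :=
  freqIntegral fun ξ =>
    (psi ϑ j ξ : ℂ) * expI ((2 : ℝ) ^ (-j) * inner ℝ ξ u) * expI (inner ℝ z ξ)

/-- `Q_j^u` applied to a distribution `L`: the convolution of `L` with the kernel of `Q_j^u`. -/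
def lpPiece (ϑ : Eucl n → ℝ) (u : Eucl n) (j : ℤ) (L : (Eucl n → ℂ) → ℂ) (x : Eucl n) : ℂ :=
  L fun x' => lpKernel ϑ u j (x - x')

/-- The measure `dμ_k(x, t) = ∑_{ℓ ≥ 0} |Q_{k+ℓ}^u (T f)(x)|² δ_{2^{-ℓ}}(t) dx`. -/
def oioMeasure (ϑ : Eucl n → ℝ) (d : Eucl n → Eucl n → ℂ) (φ : Eucl n → ℝ) (u : Eucl n)
    (f : Eucl n → ℂ) (k : ℤ) : Measure (Eucl n × ℝ) :=
  Measure.sum fun l : ℕ =>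
    (volume.withDensity fun x => ‖lpPiece ϑ u (k + l) (oio d φ f) x‖ₑ ^ 2).prod
      (Measure.dirac ((2 : ℝ) ^ (-(l : ℤ))))

/-- The Carleson norm of a measure: supremum of `μ(Q × (0, ℓ(Q)]) / |Q|` over all cubes. -/
def carlesonNorm (μ : Measure (Eucl n × ℝ)) : ℝ≥0∞ :=
  ⨆ (a : Eucl n) (r : ℝ) (_ : 0 < r), μ (cube a r ×ˢ Set.Ioc 0 r) / volume (cube a r)

/-- Carleson measures. -/
def IsCarleson (μ : Measure (Eucl n × ℝ)) : Prop := carlesonNorm μ < ⊤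

end OscInt

end

open MeasureTheory
open scoped ENNReal ContDiff
noncomputable section
namespace OscInt
variable {n : ℕ}

open scoped FourierTransform LineDeriv

/-! ### Fourier integrals of compactly supported symbols -/

/-! Write T for the oscillatory operator, τ = 2^j, and |Q| = r^n for a cube Q of side r. The vector
u only translates: Q_j^u g(x) = Q_j g(x + 2^{-j}u) (`lpKernel_eq`), and translations carry cubes to
cubes, so u drops out. Everything then rests on one mean-square estimate (`exists_sq_mean_bound`):
for j ≥ k₀, ∫_Q |Q_j T f|² ≤ C ‖f‖²_bmo (τ^{-ns} + (τr)^{-nδ}) |Q|. The Carleson norm sees only the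
scales with 2^{-ℓ} ≤ r. From the first such ℓ on, both terms at j = k + ℓ decay geometrically, and
both carry the factor 2^{-εk} up to a constant depending on k₀.

For the estimate, d is cut into dyadic frequency pieces at σ = 2^i. After rescaling, a piece lives
on the unit annulus with a phase of size λ = σ^s (`IsPhase.rescale`). Two facts about it matter. In
T T* the factors e^{iφ} cancel, so the L² bound is uniform in λ (`exists_oscSymbol_bound`,
`lintegral_sq_le_of_tt_star`). The kernel of T is concentrated in the ball of radius λ with L¹ norm
at most Cλ^{n/2}, by Plancherel and Cauchy–Schwarz (`exists_lintegral_ker_tail_sq`). Splitting a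
bounded input at distance λR^{1-δ} from a cube of side R = σr gives a mean square of at most C(1 +
λ^n R^{-nδ}) (`exists_local_sq_estimate`). The order -ns/2 of d contributes σ^{-ns} = λ^{-n}, which
leaves σ^{-ns} + (σr)^{-nδ}. The function f is not bounded, but an annular piece of T sees only the
matching frequency piece of f. The kernel of that piece has mean zero, so the piece is bounded by
the bmo norm (`exists_freqPiece_bound`).

To replace σ by τ and to sum over i, one integrates by parts in Q_j T and gains min(σ/τ, τ/σ)^N
(`low_frequency_gain`, `high_frequency_gain`). The lowest piece contains the singularity of φ at the
origin. There e^{iφ} - 1 is O(|ξ|^s), and a dyadic sum towards the origin yields kernel decay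
(1+|w|)^{-n-γ} with γ = min(s,1)/2, enough to pair with bmo functions (`exists_low_ker_bound`); this
piece also gains τ^{-N}.

All this requires ψ_j to be smooth although it is a square root. The radial profile w of 1 - ϑ is
monotone, so one-sided interpolation gives |w^{(i)}| ≤ C w^{1-η} for every η > 0, and this makes √w
smooth (`IsStep.contDiff_sqrt`). -/

theorem norm_expI (θ : ℝ) : ‖expI θ‖ = 1 := Complex.norm_exp_ofReal_mul_I θ

theorem continuous_expI : Continuous expI := by unfold expI; fun_prop

theorem expI_add (a b : ℝ) : expI (a + b) = expI a * expI b := by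
  unfold expI; rw [← Complex.exp_add]; push_cast; ring_nf

theorem expI_zero : expI 0 = 1 := by simp [expI]

theorem conj_expI (a : ℝ) : (starRingEnd ℂ) (expI a) = expI (-a) := by
  unfold expI; rw [← Complex.exp_conj]; simp

/-- The kernel with Fourier transform `P`. -/
def ker (P : Eucl n → ℂ) (w : Eucl n) : ℂ := freqIntegral fun ξ => P ξ * expI (inner ℝ w ξ)

/-- Smooth functions vanishing outside the ball of radius `4`. -/
structure IsSymbol (P : Eucl n → ℂ) : Prop where
  smooth : ContDiff ℝ ∞ P
  eq_zero : ∀ ζ, 4 ≤ ‖ζ‖ → P ζ = 0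

namespace IsSymbol

variable {P R : Eucl n → ℂ}

theorem hasCompactSupport (hP : IsSymbol P) : HasCompactSupport P :=
  HasCompactSupport.intro (isCompact_closedBall 0 4) fun x hx => hP.eq_zero x (by
    simp only [Metric.mem_closedBall, dist_zero_right, not_le] at hx; exact hx.le)

/-- A symbol as a Schwartz function. -/
def schwartz (hP : IsSymbol P) : SchwartzMap (Eucl n) ℂ :=
  hP.hasCompactSupport.toSchwartzMap hP.smooth

@[simp] theorem coe_schwartz (hP : IsSymbol P) : ⇑hP.schwartz = P := rfl

theorem integrable (hP : IsSymbol P) : Integrable P := hP.schwartz.integrable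

theorem iteratedFDeriv_eq_zero (hP : IsSymbol P) (m : ℕ) {ζ : Eucl n} (hζ : 4 < ‖ζ‖) :
    iteratedFDeriv ℝ m P ζ = 0 := by
  have h : P =ᶠ[nhds ζ] fun _ => 0 := by
    filter_upwards [(isOpen_lt continuous_const continuous_norm).mem_nhds hζ] with x hx
    exact hP.eq_zero x (le_of_lt hx)
  rw [(h.iteratedFDeriv ℝ m).eq_of_nhds]
  simp

theorem exists_bound (hP : IsSymbol P) (N : ℕ) :
    ∃ B, ∀ m ≤ N, ∀ ζ, ‖iteratedFDeriv ℝ m P ζ‖ ≤ B := by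
  have h : ∀ m, ∃ B, ∀ ζ, ‖iteratedFDeriv ℝ m P ζ‖ ≤ B := fun m => by
    obtain ⟨C, hC⟩ := hP.schwartz.decay 0 m
    exact ⟨C, fun ζ => by simpa using hC.2 ζ⟩
  choose B hB using h
  refine ⟨∑ m ∈ Finset.range (N + 1), |B m|, fun m hm ζ => (hB m ζ).trans ((le_abs_self _).trans ?_)⟩
  exact Finset.single_le_sum (f := fun m => |B m|) (fun i _ => abs_nonneg _)
    (Finset.mem_range.2 (Nat.lt_succ_of_le hm))

theorem integral_norm_iteratedFDeriv_le (hP : IsSymbol P) (m : ℕ) {B : ℝ}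
    (hB : ∀ ζ, ‖iteratedFDeriv ℝ m P ζ‖ ≤ B) :
    ∫ ζ, ‖iteratedFDeriv ℝ m P ζ‖ ≤ volume.real (Metric.closedBall (0 : Eucl n) 4) * B := by
  have h0 : 0 ≤ B := (norm_nonneg _).trans (hB 0)
  have h1 : ∀ ζ, ‖iteratedFDeriv ℝ m P ζ‖
      ≤ (Metric.closedBall (0 : Eucl n) 4).indicator (fun _ => B) ζ := by
    intro ζ
    by_cases hζ : ζ ∈ Metric.closedBall (0 : Eucl n) 4
    · simpa [Set.indicator_of_mem hζ] using hB ζ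
    · rw [Set.indicator_of_notMem hζ, hP.iteratedFDeriv_eq_zero m (by simpa using hζ)]; simp
  calc ∫ ζ, ‖iteratedFDeriv ℝ m P ζ‖
      ≤ ∫ ζ, (Metric.closedBall (0 : Eucl n) 4).indicator (fun _ => B) ζ := by
        refine integral_mono_of_nonneg (.of_forall fun _ => norm_nonneg _) ?_ (.of_forall h1)
        exact (integrable_indicator_iff measurableSet_closedBall).2
          (integrableOn_const measure_closedBall_lt_top.ne (by simp))
    _ = _ := by
        rw [integral_indicator measurableSet_closedBall, setIntegral_const, smul_eq_mul]

theorem mul (hP : IsSymbol P) {g : Eucl n → ℂ} (hg : ContDiff ℝ ∞ g) :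
    IsSymbol fun ζ => g ζ * P ζ :=
  ⟨hg.mul hP.smooth, fun ζ h => by simp [hP.eq_zero ζ h]⟩

theorem integrable_iteratedFDeriv (hP : IsSymbol P) (m : ℕ) :
    Integrable fun ζ => ‖iteratedFDeriv ℝ m P ζ‖ := by
  refine Continuous.integrable_of_hasCompactSupport ?_ ?_
  · exact (hP.smooth.continuous_iteratedFDeriv (by exact_mod_cast le_top)).norm
  · exact (hP.hasCompactSupport.iteratedFDeriv m).norm

end IsSymbol

/-- The kernels use angular frequency with dξ/(2π)^n, whereas `𝓕⁻` has 2π in the exponent. The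
dilation by (2π)⁻¹ converts between the two, and the Fourier facts below are transported through it.
-/
theorem ker_eq_fourierInv (P : Eucl n → ℂ) (w : Eucl n) :
    ker P w = (((2 * Real.pi) ^ n : ℝ) : ℂ)⁻¹ * 𝓕⁻ P ((2 * Real.pi)⁻¹ • w) := by
  unfold ker freqIntegral
  rw [Real.fourierInv_eq']
  congr 1
  refine integral_congr_ae (.of_forall fun ξ => ?_)
  simp only [smul_eq_mul, expI]
  rw [mul_comm]
  congr 3
  rw [inner_smul_right, real_inner_comm]
  field_simp

theorem norm_ker_eq (P : Eucl n → ℂ) (w : Eucl n) :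
    ‖ker P w‖ = ((2 * Real.pi) ^ n)⁻¹ * ‖𝓕⁻ P ((2 * Real.pi)⁻¹ • w)‖ := by
  rw [ker_eq_fourierInv, norm_mul, norm_inv, Complex.norm_real, Real.norm_of_nonneg (by positivity)]

theorem norm_ker_le (P : Eucl n → ℂ) (w : Eucl n) : ‖ker P w‖ ≤ ∫ ξ, ‖P ξ‖ := by
  rw [norm_ker_eq, Real.fourierInv_eq]
  have h1 : ((2 * Real.pi) ^ n)⁻¹ ≤ (1 : ℝ) :=
    inv_le_one_of_one_le₀ (one_le_pow₀ (by linarith [Real.pi_gt_three]))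
  refine (mul_le_of_le_one_left (norm_nonneg _) h1).trans ?_
  refine (norm_integral_le_integral_norm _).trans (le_of_eq ?_)
  simp [Circle.norm_smul]

theorem continuous_ker {P : Eucl n → ℂ} (hP : Integrable P) : Continuous (ker P) := by
  have h := (VectorFourier.fourierIntegral_continuous (V := Eucl n) (μ := volume)
    (L := (innerₗ (Eucl n))) Real.continuous_fourierChar
      continuous_inner hP)
  have h2 : Continuous (𝓕⁻ P) := by
    have : (𝓕⁻ P) = fun w => 𝓕 P (-w) := by ext w; exact Real.fourierInv_eq_fourier_neg P w
    rw [this]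
    exact h.comp continuous_neg
  have : ker P = fun w => (((2 * Real.pi) ^ n : ℝ) : ℂ)⁻¹ * 𝓕⁻ P ((2 * Real.pi)⁻¹ • w) :=
    funext fun w => ker_eq_fourierInv P w
  rw [this]
  exact continuous_const.mul (h2.comp (continuous_const_smul _))

theorem one_add_pow_le (N : ℕ) {t : ℝ} (ht : 0 ≤ t) : (1 + t) ^ N ≤ 2 ^ N * (1 + t ^ N) := by
  have := add_pow_le zero_le_one ht N
  rw [one_pow] at this
  refine this.trans ?_
  gcongr
  · norm_num
  · omega

/-- Rapid decay of the kernel of a symbol. -/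
theorem exists_ker_decay (n N : ℕ) : ∃ C : ℝ, 0 ≤ C ∧ ∀ (P : Eucl n → ℂ) (B : ℝ), IsSymbol P →
    (∀ m ≤ N, ∀ ζ, ‖iteratedFDeriv ℝ m P ζ‖ ≤ B) →
    ∀ w, ‖ker P w‖ * (1 + ‖w‖) ^ N ≤ C * B := by
  set V := volume.real (Metric.closedBall (0 : Eucl n) 4)
  refine ⟨2 ^ N * (V + (2 * Real.pi) ^ N * (2 ^ N * ((N + 1) * V))), by positivity, ?_⟩
  intro P B hP hB w
  have hB0 : 0 ≤ B := (norm_nonneg _).trans (hB 0 (Nat.zero_le _) 0)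
  have hI : ∀ m ≤ N, ∫ ζ, ‖iteratedFDeriv ℝ m P ζ‖ ≤ V * B := fun m hm =>
    hP.integral_norm_iteratedFDeriv_le m (hB m hm)
  have h0 : ‖ker P w‖ ≤ V * B := by
    refine (norm_ker_le P w).trans ?_
    have := hI 0 (Nat.zero_le _)
    simpa using this
  have h1 : ‖w‖ ^ N * ‖ker P w‖ ≤ (2 * Real.pi) ^ N * (2 ^ N * ((N + 1) * V)) * B := by
    set v := (2 * Real.pi)⁻¹ • w with hv
    have hw : ‖w‖ = 2 * Real.pi * ‖v‖ := by
      rw [hv, norm_smul, norm_inv, Real.norm_of_nonneg (by positivity)]; field_simp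
    have hk := Real.pow_mul_norm_iteratedFDeriv_fourier_le (V := Eucl n) (f := P) (K := 0)
      (N := N) (hP.smooth.of_le (by exact_mod_cast le_top)) (fun k m hk _ => by
        have : k = 0 := by simpa using hk
        subst this
        simpa using hP.integrable_iteratedFDeriv m) (k := 0) (n := N) le_rfl le_rfl (-v)
    simp only [norm_neg, pow_zero, Nat.cast_zero, mul_zero, zero_add, one_mul,
      Finset.range_one, norm_iteratedFDeriv_zero] at hk
    rw [Finset.sum_product] at hk
    simp only [Finset.sum_singleton, pow_zero, one_mul] at hk
    have hs : ∑ m ∈ Finset.range (N + 1), ∫ ζ, ‖iteratedFDeriv ℝ m P ζ‖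
        ≤ (N + 1) * V * B := by
      refine (Finset.sum_le_card_nsmul _ _ (V * B) fun m hm =>
        hI m (Nat.lt_succ_iff.1 (Finset.mem_range.1 hm))).trans (le_of_eq ?_)
      simp; ring
    have hle : ‖ker P w‖ ≤ ‖𝓕 P (-v)‖ := by
      rw [norm_ker_eq, Real.fourierInv_eq_fourier_neg]
      exact mul_le_of_le_one_left (norm_nonneg _)
        (inv_le_one_of_one_le₀ (one_le_pow₀ (by linarith [Real.pi_gt_three])))
    calc ‖w‖ ^ N * ‖ker P w‖ ≤ (2 * Real.pi * ‖v‖) ^ N * ‖𝓕 P (-v)‖ := by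
          rw [hw]; gcongr
      _ = (2 * Real.pi) ^ N * (‖v‖ ^ N * ‖𝓕 P (-v)‖) := by ring
      _ ≤ (2 * Real.pi) ^ N * (2 ^ N * ((N + 1) * V * B)) := by
          refine mul_le_mul_of_nonneg_left (hk.trans ?_) (by positivity)
          exact mul_le_mul_of_nonneg_left hs (by positivity)
      _ = _ := by ring
  calc ‖ker P w‖ * (1 + ‖w‖) ^ N ≤ ‖ker P w‖ * (2 ^ N * (1 + ‖w‖ ^ N)) := by
        gcongr; exact one_add_pow_le N (norm_nonneg w)
    _ = 2 ^ N * (‖ker P w‖ + ‖w‖ ^ N * ‖ker P w‖) := by ring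
    _ ≤ 2 ^ N * (V * B + (2 * Real.pi) ^ N * (2 ^ N * ((N + 1) * V)) * B) := by gcongr
    _ = _ := by ring

/-! ### Plancherel, Fourier inversion and weighted L² bounds for kernels -/

open scoped FourierTransform LineDeriv

theorem IsSymbol.integrable_ker_rpow {P : Eucl n → ℂ} (hP : IsSymbol P) (N : ℕ) :
    Integrable fun w => (1 + ‖w‖) ^ N * ‖ker P w‖ := by
  obtain ⟨B, hB⟩ := hP.exists_bound (N + (n + 1))
  obtain ⟨C, hC0, hC⟩ := exists_ker_decay n (N + (n + 1))
  have h1 : Integrable fun w : Eucl n => C * B * (1 + ‖w‖) ^ (-((n : ℝ) + 1)) :=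
    (integrable_one_add_norm (by simp)).const_mul _
  refine h1.mono' ?_ (.of_forall fun w => ?_)
  · exact (Continuous.mul (by fun_prop) (continuous_ker hP.integrable).norm).aestronglyMeasurable
  · have h2 := hC P B hP hB w
    have h3 : 0 < 1 + ‖w‖ := by positivity
    rw [Real.norm_of_nonneg (by positivity), Real.rpow_neg h3.le, ← div_eq_mul_inv,
      le_div_iff₀ (by positivity)]
    have h4 : (1 + ‖w‖) ^ ((n : ℝ) + 1) = (1 + ‖w‖) ^ (n + 1) := by exact_mod_cast Real.rpow_natCast _ (n + 1)
    rw [h4]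
    calc _ = ‖ker P w‖ * (1 + ‖w‖) ^ (N + (n + 1)) := by rw [pow_add]; ring
      _ ≤ _ := h2

theorem IsSymbol.integrable_ker {P : Eucl n → ℂ} (hP : IsSymbol P) : Integrable (ker P) := by
  have := hP.integrable_ker_rpow 0
  simp only [pow_zero, one_mul] at this
  exact (integrable_norm_iff (continuous_ker hP.integrable).aestronglyMeasurable).1 this

theorem integral_comp_two_pi_inv_smul {F : Type*} [NormedAddCommGroup F] [NormedSpace ℝ F]
    (g : Eucl n → F) :
    ∫ w : Eucl n, g ((2 * Real.pi)⁻¹ • w) = ((2 * Real.pi) ^ n : ℝ) • ∫ w, g w := by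
  rw [Measure.integral_comp_inv_smul_of_nonneg _ _ (by positivity)]
  simp

/-- Plancherel's theorem for kernels of symbols. -/
theorem integral_ker_mul_conj_ker {P R : Eucl n → ℂ} (hP : IsSymbol P) (hR : IsSymbol R) :
    ∫ w, ker P w * (starRingEnd ℂ) (ker R w)
      = (((2 * Real.pi) ^ n : ℝ) : ℂ)⁻¹ * ∫ ξ, P ξ * (starRingEnd ℂ) (R ξ) := by
  have h := SchwartzMap.integral_inner_fourier_fourier (𝓕⁻ hR.schwartz) (𝓕⁻ hP.schwartz)
  simp only [FourierTransform.fourier_fourierInv_eq] at h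
  simp only [IsSymbol.coe_schwartz, SchwartzMap.fourierInv_coe, RCLike.inner_apply] at h
  set c : ℂ := (((2 * Real.pi) ^ n : ℝ) : ℂ)⁻¹ with hc
  have hc' : (starRingEnd ℂ) c = c := by rw [hc, ← Complex.ofReal_inv, Complex.conj_ofReal]
  obtain ⟨g, hg⟩ : ∃ g : Eucl n → ℂ, g = fun v => c * c * (𝓕⁻ P v *
      (starRingEnd ℂ) (𝓕⁻ R v)) := ⟨_, rfl⟩
  have h2 : ∀ w, ker P w * (starRingEnd ℂ) (ker R w) = g ((2 * Real.pi)⁻¹ • w) := by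
    intro w
    rw [hg]
    simp only [ker_eq_fourierInv, map_mul, ← hc, hc']
    ring
  simp_rw [h2]
  rw [integral_comp_two_pi_inv_smul, hg, integral_const_mul, ← h, Complex.real_smul, ← mul_assoc]
  congr 1
  have h0 : (((2 * Real.pi) ^ n : ℝ) : ℂ) ≠ 0 := by
    exact_mod_cast (by positivity : ((2 * Real.pi) ^ n : ℝ) ≠ 0)
  rw [hc]; field_simp

/-- Fourier inversion for kernels of symbols. -/
theorem integral_ker_mul_expI {P : Eucl n → ℂ} (hP : IsSymbol P) (ξ : Eucl n) :
    ∫ w, ker P w * expI (-inner ℝ w ξ) = P ξ := by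
  have h : 𝓕 (𝓕⁻ hP.schwartz) = hP.schwartz := FourierTransform.fourier_fourierInv_eq _
  have h1 : 𝓕 (𝓕⁻ P) ξ = P ξ := by
    have := congrArg (fun f : SchwartzMap (Eucl n) ℂ => f ξ) h
    simpa only [SchwartzMap.fourier_coe, SchwartzMap.fourierInv_coe, IsSymbol.coe_schwartz] using this
  rw [← h1, Real.fourier_eq']
  set c : ℂ := (((2 * Real.pi) ^ n : ℝ) : ℂ)⁻¹ with hc
  obtain ⟨g, hg⟩ : ∃ g : Eucl n → ℂ, g = fun v => c * (Complex.exp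
      (↑(-2 * Real.pi * inner ℝ v ξ) * Complex.I) • 𝓕⁻ P v) := ⟨_, rfl⟩
  have h2 : ∀ w, ker P w * expI (-inner ℝ w ξ) = g ((2 * Real.pi)⁻¹ • w) := by
    intro w
    rw [hg]
    simp only [ker_eq_fourierInv, smul_eq_mul, expI, ← hc]
    rw [mul_assoc, mul_comm (𝓕⁻ P _)]
    congr 4
    rw [real_inner_smul_left]
    field_simp
  simp_rw [h2]
  rw [integral_comp_two_pi_inv_smul, hg, integral_const_mul, Complex.real_smul, ← mul_assoc]
  have h0 : (((2 * Real.pi) ^ n : ℝ) : ℂ) ≠ 0 := by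
    exact_mod_cast (by positivity : ((2 * Real.pi) ^ n : ℝ) ≠ 0)
  rw [hc, mul_inv_cancel₀ h0, one_mul]

/-- Plancherel with the true constant (2π)^{-n}, which is at most 1, dropped. -/
theorem integral_norm_ker_sq_le {P : Eucl n → ℂ} (hP : IsSymbol P) :
    ∫ w, ‖ker P w‖ ^ 2 ≤ ∫ ξ, ‖P ξ‖ ^ 2 := by
  have h := SchwartzMap.integral_norm_sq_fourier (𝓕⁻ hP.schwartz)
  simp only [FourierTransform.fourier_fourierInv_eq] at h
  simp only [IsSymbol.coe_schwartz, SchwartzMap.fourierInv_coe] at h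
  obtain ⟨g, hg⟩ : ∃ g : Eucl n → ℝ, g = fun v => (((2 * Real.pi) ^ n)⁻¹) ^ 2 * ‖𝓕⁻ P v‖ ^ 2 :=
    ⟨_, rfl⟩
  have h2 : ∀ w, ‖ker P w‖ ^ 2 = g ((2 * Real.pi)⁻¹ • w) := by
    intro w; simp only [hg, norm_ker_eq]; ring
  simp_rw [h2]
  rw [integral_comp_two_pi_inv_smul, hg, integral_const_mul, ← h, smul_eq_mul, ← mul_assoc]
  refine mul_le_of_le_one_left (integral_nonneg fun _ => by positivity) ?_
  have h1 : (1 : ℝ) ≤ (2 * Real.pi) ^ n := one_le_pow₀ (by linarith [Real.pi_gt_three])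
  rw [sq, ← mul_assoc, mul_inv_cancel₀ (by positivity), one_mul]
  exact inv_le_one_of_one_le₀ h1

/-- Directional derivatives of symbols. -/
theorem IsSymbol.exists_deriv {P : Eucl n → ℂ} (hP : IsSymbol P) (m : Eucl n) (N : ℕ) :
    ∃ R, IsSymbol R ∧ (∀ w, ‖ker R w‖ = |inner ℝ w m| ^ N * ‖ker P w‖) ∧
      ∀ ζ, R ζ = iteratedFDeriv ℝ N P ζ fun _ => m := by
  have key : ∀ (f : SchwartzMap (Eucl n) ℂ) (w : Eucl n),
      ‖𝓕⁻ (⇑(∂^{fun _ : Fin N => m} f)) w‖ = (2 * Real.pi * |inner ℝ w m|) ^ N * ‖𝓕⁻ ⇑f w‖ := by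
    induction N with
    | zero => intro f w; simp
    | succ N ih =>
      intro f w
      rw [LineDeriv.iteratedLineDerivOp_succ_right]
      have h0 : (Fin.init fun _ : Fin (N + 1) => m) = fun _ : Fin N => m := rfl
      rw [h0, ih]
      have h1 := SchwartzMap.fourierInv_lineDerivOp_eq f m
      have h2 := congrArg (fun g : SchwartzMap (Eucl n) ℂ => ‖g w‖) h1
      have ht : (inner ℝ · m : Eucl n → ℝ).HasTemperateGrowth := by fun_prop
      simp only [smul_apply, SchwartzMap.smulLeftCLM_apply_apply ht, norm_smul,
        SchwartzMap.fourierInv_coe] at h2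
      rw [h2]
      simp [abs_of_pos Real.pi_pos]
      ring
  refine ⟨⇑(∂^{fun _ : Fin N => m} hP.schwartz : SchwartzMap (Eucl n) ℂ), ⟨SchwartzMap.smooth _ _, fun ζ hζ => ?_⟩,
    fun w => ?_, fun ζ => ?_⟩
  · rw [SchwartzMap.iteratedLineDerivOp_eq_iteratedFDeriv]
    rcases hζ.lt_or_eq with h | h
    · rw [IsSymbol.coe_schwartz, hP.iteratedFDeriv_eq_zero N h]; simp
    -- On the sphere |ζ| = 4 the derivative vanishes by continuity: ζ is the limit of tζ as t
    -- decreases to 1, and the derivative is zero at these points.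
    · have hcl : ζ ∈ closure {x : Eucl n | 4 < ‖x‖} := by
        refine mem_closure_of_tendsto (f := fun t : ℝ => t • ζ) (b := nhdsWithin 1 (Set.Ioi 1)) ?_ ?_
        · have : ContinuousAt (fun t : ℝ => t • ζ) 1 := by fun_prop
          simpa using this.tendsto.mono_left nhdsWithin_le_nhds
        · filter_upwards [self_mem_nhdsWithin] with t ht
          rw [norm_smul]
          have : (1 : ℝ) < t := ht
          rw [Real.norm_of_nonneg (by linarith), ← h]; linarith
      have hc : IsClosed {x : Eucl n | iteratedFDeriv ℝ N P x = 0} :=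
        isClosed_eq (hP.smooth.continuous_iteratedFDeriv (by exact_mod_cast le_top)) continuous_const
      have : iteratedFDeriv ℝ N P ζ = 0 :=
        closure_minimal (fun x hx => hP.iteratedFDeriv_eq_zero N hx) hc hcl
      rw [IsSymbol.coe_schwartz, this]; simp
  · rw [norm_ker_eq, norm_ker_eq, key, IsSymbol.coe_schwartz, real_inner_smul_left, abs_mul, abs_of_pos (by positivity)]
    field_simp
  · rw [SchwartzMap.iteratedLineDerivOp_eq_iteratedFDeriv, IsSymbol.coe_schwartz]

/-- The largest coordinate satisfies |w|² ≤ n|w_l|². Radial weights are thus reached with pure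
coordinate derivatives of the symbol. -/
theorem norm_pow_le_sum_coord (hn : 1 ≤ n) (N : ℕ) (w : Eucl n) :
    ‖w‖ ^ (2 * N) ≤ (n : ℝ) ^ N * ∑ l, |w l| ^ (2 * N) := by
  have : Nonempty (Fin n) := ⟨⟨0, hn⟩⟩
  obtain ⟨l, hl⟩ := Finite.exists_max fun l => |w l|
  have h1 : ‖w‖ ^ 2 ≤ n * |w l| ^ 2 := by
    rw [EuclideanSpace.norm_sq_eq]
    refine (Finset.sum_le_card_nsmul _ _ (|w l| ^ 2) fun i _ => ?_).trans (by simp)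
    rw [Real.norm_eq_abs]
    exact pow_le_pow_left₀ (abs_nonneg _) (hl i) 2
  calc ‖w‖ ^ (2 * N) = (‖w‖ ^ 2) ^ N := by rw [pow_mul]
    _ ≤ (n * |w l| ^ 2) ^ N := by gcongr
    _ = (n : ℝ) ^ N * |w l| ^ (2 * N) := by rw [mul_pow, pow_mul]
    _ ≤ _ := by
      gcongr
      exact Finset.single_le_sum (f := fun l => |w l| ^ (2 * N)) (fun i _ => by positivity)
        (Finset.mem_univ l)

theorem IsSymbol.integral_sq_le {P : Eucl n → ℂ} (hP : IsSymbol P) {B : ℝ} (hB : ∀ ζ, ‖P ζ‖ ≤ B) :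
    ∫ ζ, ‖P ζ‖ ^ 2 ≤ volume.real (Metric.closedBall (0 : Eucl n) 4) * B ^ 2 := by
  have h0 : 0 ≤ B := (norm_nonneg _).trans (hB 0)
  have hi := hP.integral_norm_iteratedFDeriv_le 0 (B := B) (by simpa using hB)
  simp only [norm_iteratedFDeriv_zero] at hi
  calc ∫ ζ, ‖P ζ‖ ^ 2 ≤ ∫ ζ, B * ‖P ζ‖ := by
        refine integral_mono_of_nonneg (.of_forall fun _ => by positivity)
          (hP.integrable.norm.const_mul B) (.of_forall fun ζ => ?_)
        simp only [sq]
        exact mul_le_mul_of_nonneg_right (hB ζ) (norm_nonneg _)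
    _ ≤ B * (volume.real (Metric.closedBall (0 : Eucl n) 4) * B) := by
        rw [integral_const_mul]; gcongr
    _ = _ := by ring

/-- Weighted Plancherel estimate for kernels of symbols oscillating at frequency `lam`. -/
theorem exists_ker_weighted_sq (hn : 1 ≤ n) (N : ℕ) : ∃ C : ℝ, 0 ≤ C ∧
    ∀ (P : Eucl n → ℂ) (B lam : ℝ), IsSymbol P → 0 < lam →
    (∀ m ≤ N, ∀ ζ, ‖iteratedFDeriv ℝ m P ζ‖ ≤ B * lam ^ m) →
    ∫ w, (1 + ‖w‖ / lam) ^ (2 * N) * ‖ker P w‖ ^ 2 ≤ C * B ^ 2 := by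
  set V := volume.real (Metric.closedBall (0 : Eucl n) 4)
  refine ⟨2 ^ (2 * N) * (V + (n : ℝ) ^ N * (n * V)), by positivity, ?_⟩
  intro P B lam hP hlam hB
  have hint : ∀ R : Eucl n → ℂ, IsSymbol R → Integrable fun w => ‖ker R w‖ ^ 2 := by
    intro R hR
    refine (hR.integrable_ker.norm.const_mul (∫ ξ, ‖R ξ‖)).mono'
      ((continuous_ker hR.integrable).norm.pow 2).aestronglyMeasurable (.of_forall fun w => ?_)
    rw [Real.norm_of_nonneg (by positivity), sq]
    exact mul_le_mul_of_nonneg_right (norm_ker_le R w) (norm_nonneg _)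
  -- The N-th derivative of P in direction l has kernel of modulus |w_l|^N |ker P|. By Plancherel it
  -- costs λ^N, which is exactly what the weight (|w|/λ)^N gives back.
  choose R hR1 hR2 hR3 using fun l : Fin n => hP.exists_deriv (EuclideanSpace.single l (1 : ℝ)) N
  have hR4 : ∀ l w, ‖ker (R l) w‖ ^ 2 = |w l| ^ (2 * N) * ‖ker P w‖ ^ 2 := by
    intro l w
    rw [hR2]
    have : inner ℝ w (EuclideanSpace.single l (1 : ℝ)) = w l := by
      rw [EuclideanSpace.inner_single_right]; simp
    rw [this]; ring
  have hR5 : ∀ l, ∫ w, ‖ker (R l) w‖ ^ 2 ≤ V * (B * lam ^ N) ^ 2 := by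
    intro l
    refine (integral_norm_ker_sq_le (hR1 l)).trans ((hR1 l).integral_sq_le fun ζ => ?_)
    rw [hR3]
    refine (ContinuousMultilinearMap.le_opNorm _ _).trans ?_
    simpa using hB N le_rfl ζ
  have h0 : ∫ w, ‖ker P w‖ ^ 2 ≤ V * B ^ 2 :=
    (integral_norm_ker_sq_le hP).trans (hP.integral_sq_le fun ζ => by
      simpa using hB 0 (Nat.zero_le _) ζ)
  have hpt : ∀ w, (1 + ‖w‖ / lam) ^ (2 * N) * ‖ker P w‖ ^ 2 ≤
      2 ^ (2 * N) * (‖ker P w‖ ^ 2 + (n : ℝ) ^ N * (lam ^ (2 * N))⁻¹ * ∑ l, ‖ker (R l) w‖ ^ 2) := by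
    intro w
    have h1 := one_add_pow_le (2 * N) (t := ‖w‖ / lam) (by positivity)
    have h2 := norm_pow_le_sum_coord hn N w
    simp_rw [hR4, ← Finset.sum_mul]
    calc _ ≤ (2 ^ (2 * N) * (1 + (‖w‖ / lam) ^ (2 * N))) * ‖ker P w‖ ^ 2 := by gcongr
      _ = 2 ^ (2 * N) * (‖ker P w‖ ^ 2 + (lam ^ (2 * N))⁻¹ * ‖w‖ ^ (2 * N) * ‖ker P w‖ ^ 2) := by
        rw [div_pow]; ring
      _ ≤ 2 ^ (2 * N) * (‖ker P w‖ ^ 2 + (lam ^ (2 * N))⁻¹ * ((n : ℝ) ^ N * ∑ l, |w l| ^ (2 * N))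
          * ‖ker P w‖ ^ 2) := by gcongr
      _ = _ := by ring
  have hi2 : Integrable fun w => ∑ l, ‖ker (R l) w‖ ^ 2 :=
    integrable_finsetSum _ fun l _ => hint _ (hR1 l)
  calc _ ≤ ∫ w, 2 ^ (2 * N) * (‖ker P w‖ ^ 2
          + (n : ℝ) ^ N * (lam ^ (2 * N))⁻¹ * ∑ l, ‖ker (R l) w‖ ^ 2) := by
        refine integral_mono_of_nonneg (.of_forall fun _ => by positivity) ?_ (.of_forall hpt)
        exact ((hint P hP).add (hi2.const_mul _)).const_mul _
    _ = 2 ^ (2 * N) * (∫ w, ‖ker P w‖ ^ 2) + 2 ^ (2 * N) * ((n : ℝ) ^ N * (lam ^ (2 * N))⁻¹ *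
          ∑ l, ∫ w, ‖ker (R l) w‖ ^ 2) := by
        rw [integral_const_mul, integral_add (hint P hP) (hi2.const_mul _), integral_const_mul,
          integral_finsetSum _ fun l _ => hint _ (hR1 l)]
        ring
    _ ≤ 2 ^ (2 * N) * (V * B ^ 2) + 2 ^ (2 * N) * ((n : ℝ) ^ N * (lam ^ (2 * N))⁻¹ *
          ∑ _l : Fin n, V * (B * lam ^ N) ^ 2) := by
        gcongr with l _
        exact hR5 l
    _ = _ := by
        simp only [Finset.sum_const, Finset.card_univ, Fintype.card_fin, nsmul_eq_mul]
        have : (lam ^ (2 * N))⁻¹ * (lam ^ N) ^ 2 = 1 := by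
          rw [← pow_mul, mul_comm N 2]; exact inv_mul_cancel₀ (by positivity)
        calc _ = 2 ^ (2 * N) * (V * B ^ 2) + 2 ^ (2 * N) * ((n : ℝ) ^ N * (n * V * B ^ 2) *
              ((lam ^ (2 * N))⁻¹ * (lam ^ N) ^ 2)) := by ring
          _ = _ := by rw [this]; ring

/-! ### Polynomial weights, cubes and the Cauchy--Schwarz inequality -/

/-- The weight `(1 + |w|)^{-p}`. -/
def wt (p : ℝ) (w : Eucl n) : ℝ := (1 + ‖w‖) ^ (-p)

theorem wt_pos (p : ℝ) (w : Eucl n) : 0 < wt p w := by unfold wt; positivity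

theorem wt_nonneg (p : ℝ) (w : Eucl n) : 0 ≤ wt p w := (wt_pos p w).le

theorem wt_le_one {p : ℝ} (hp : 0 ≤ p) (w : Eucl n) : wt p w ≤ 1 :=
  Real.rpow_le_one_of_one_le_of_nonpos (by linarith [norm_nonneg w]) (by linarith)

theorem wt_anti {p q : ℝ} (h : p ≤ q) (w : Eucl n) : wt q w ≤ wt p w :=
  Real.rpow_le_rpow_of_exponent_le (by linarith [norm_nonneg w]) (by linarith)

theorem continuous_wt (p : ℝ) : Continuous (wt p : Eucl n → ℝ) := by
  unfold wt
  refine Continuous.rpow_const (by fun_prop) fun x => Or.inl ?_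
  positivity

theorem integrable_wt {p : ℝ} (hp : (n : ℝ) < p) : Integrable (wt p : Eucl n → ℝ) :=
  integrable_one_add_norm (by simpa using hp)

theorem integrable_wt_sub {p : ℝ} (hp : (n : ℝ) < p) (x : Eucl n) :
    Integrable fun z => wt p (x - z) := (integrable_wt hp).comp_sub_left x

theorem integral_wt_sub (p : ℝ) (x : Eucl n) : ∫ z, wt p (x - z) = ∫ z : Eucl n, wt p z :=
  integral_sub_left_eq_self (fun z => wt p z) volume x

theorem wt_neg (p : ℝ) (w : Eucl n) : wt p (-w) = wt p w := by simp [wt]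

theorem wt_natCast (N : ℕ) (w : Eucl n) : wt N w = ((1 + ‖w‖) ^ N)⁻¹ := by
  unfold wt
  rw [Real.rpow_neg (by positivity), Real.rpow_natCast]

theorem le_mul_wt_of_mul_pow_le {a C : ℝ} {N : ℕ} {w : Eucl n} (h : a * (1 + ‖w‖) ^ N ≤ C) :
    a ≤ C * wt N w := by
  rw [wt_natCast, ← div_eq_mul_inv, le_div_iff₀ (by positivity)]
  exact h

theorem integral_wt_pos {p : ℝ} (hp : (n : ℝ) < p) : 0 < ∫ z : Eucl n, wt p z := by
  rw [integral_pos_iff_support_of_nonneg (fun z => wt_nonneg p z) (integrable_wt hp)]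
  have : Function.support (wt p : Eucl n → ℝ) = Set.univ := by
    ext z; simp [(wt_pos p z).ne']
  rw [this]
  exact Measure.measure_univ_pos.2 (NeZero.ne _)

theorem lt_succ_cast (n : ℕ) : (n : ℝ) < ((n + 1 : ℕ) : ℝ) := by push_cast; linarith

theorem isClosed_cube (a : Eucl n) (r : ℝ) : IsClosed (cube a r) := by
  have h : cube a r = ⋂ i, {x : Eucl n | a i ≤ x i} ∩ {x : Eucl n | x i ≤ a i + r} := by
    ext x; simp [cube]
  rw [h]
  refine isClosed_iInter fun i => ?_
  exact (isClosed_le (by fun_prop) (by fun_prop)).inter (isClosed_le (by fun_prop) (by fun_prop))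

theorem measurableSet_cube (a : Eucl n) (r : ℝ) : MeasurableSet (cube a r) :=
  (isClosed_cube a r).measurableSet

theorem volume_cube (a : Eucl n) (r : ℝ) : volume (cube a r) = ENNReal.ofReal r ^ n := by
  have h : cube a r = (WithLp.ofLp : Eucl n → Fin n → ℝ) ⁻¹' Set.Icc (fun i => a i) (fun i => a i + r) := by
    ext x
    simp [cube, Pi.le_def, forall_and]
  rw [h, (PiLp.volume_preserving_ofLp (Fin n)).measure_preimage
    (measurableSet_Icc.nullMeasurableSet), Real.volume_Icc_pi]
  simp

theorem volume_cube_lt_top (a : Eucl n) (r : ℝ) : volume (cube a r) < ⊤ := by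
  rw [volume_cube]; exact ENNReal.pow_lt_top ENNReal.ofReal_lt_top

theorem volume_cube_pos (a : Eucl n) {r : ℝ} (hr : 0 < r) : 0 < volume (cube a r) := by
  rw [volume_cube]; exact ENNReal.pow_pos (ENNReal.ofReal_pos.2 hr) n

theorem volume_real_cube (a : Eucl n) {r : ℝ} (hr : 0 ≤ r) : volume.real (cube a r) = r ^ n := by
  rw [measureReal_def, volume_cube, ENNReal.toReal_pow, ENNReal.toReal_ofReal hr]

theorem lintegral_mul_sq_le {α : Type*} [MeasurableSpace α] (μ : Measure α) {f g : α → ℝ≥0∞}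
    (hf : AEMeasurable f μ) (hg : AEMeasurable g μ) :
    (∫⁻ a, f a * g a ∂μ) ^ 2 ≤ (∫⁻ a, f a ^ 2 ∂μ) * ∫⁻ a, g a ^ 2 ∂μ := by
  have h := ENNReal.lintegral_mul_le_Lp_mul_Lq μ Real.HolderConjugate.two_two hf hg
  have h2 : ∀ x : ℝ≥0∞, (x ^ (1 / (2 : ℝ))) ^ 2 = x := by
    intro x
    rw [← ENNReal.rpow_natCast, ← ENNReal.rpow_mul]; norm_num
  calc (∫⁻ a, f a * g a ∂μ) ^ 2 ≤ ((∫⁻ a, f a ^ (2 : ℝ) ∂μ) ^ (1 / (2 : ℝ)) *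
        (∫⁻ a, g a ^ (2 : ℝ) ∂μ) ^ (1 / (2 : ℝ))) ^ 2 := by gcongr; exact h
    _ = _ := by rw [mul_pow, h2, h2]; simp

theorem ofReal_sq_le_of_lintegral {α : Type*} [MeasurableSpace α] {μ : Measure α} {f : α → ℝ}
    (hf : Integrable f μ) (h0 : ∀ a, 0 ≤ f a) {c : ℝ} (hc : ∫ a, f a ∂μ ≤ c) :
    ∫⁻ a, ENNReal.ofReal (f a) ∂μ ≤ ENNReal.ofReal c := by
  rw [← ofReal_integral_eq_lintegral_ofReal hf (.of_forall h0)]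
  exact ENNReal.ofReal_le_ofReal hc

/-! ### Schur's test for `T T*` -/

/-- If the kernel of `T T*` is integrable, then `T` is bounded on `L²`. -/
theorem lintegral_sq_le_of_tt_star {H : Eucl n → Eucl n → ℂ}
    (hH : Measurable (Function.uncurry H)) {M S Λ p : ℝ} (hp : (n : ℝ) < p) (hS : 0 ≤ S)
    (hdec : ∀ x z, ‖H x z‖ ≤ M * wt p (x - z))
    (hT : ∀ x x', ‖∫ z, H x z * (starRingEnd ℂ) (H x' z)‖ ≤ S * wt p (x - x'))
    {g : Eucl n → ℂ} (hg : Measurable g) (hgb : ∀ z, ‖g z‖ ≤ Λ)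
    {Q E : Set (Eucl n)} (hQf : volume Q < ⊤) (hEf : volume E < ⊤) :
    ∫⁻ x in Q, ‖∫ z in E, H x z * g z‖ₑ ^ 2
      ≤ ENNReal.ofReal (S * ∫ z : Eucl n, wt p z) * ∫⁻ z in E, ‖g z‖ₑ ^ 2 := by
  have hp0 : 0 ≤ p := (Nat.cast_nonneg n).trans hp.le
  have : IsFiniteMeasure (volume.restrict Q) := ⟨by simpa using hQf⟩
  have : IsFiniteMeasure (volume.restrict E) := ⟨by simpa using hEf⟩
  have hM : 0 ≤ M := by
    by_contra h
    have := (norm_nonneg _).trans (hdec 0 0)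
    nlinarith [wt_pos p ((0 : Eucl n) - 0)]
  have hΛ : 0 ≤ Λ := (norm_nonneg _).trans (hgb 0)
  have hHM : ∀ x z, ‖H x z‖ ≤ M := fun x z =>
    (hdec x z).trans (mul_le_of_le_one_right hM (wt_le_one hp0 _))
  set F : Eucl n → ℂ := fun x => ∫ z in E, H x z * g z with hF
  have hFm : Measurable F := by
    refine (StronglyMeasurable.integral_prod_right (ν := volume.restrict E)
      (f := fun x z => H x z * g z) ?_).measurable
    exact (hH.mul (hg.comp measurable_snd)).stronglyMeasurable
  set K := M * Λ * (volume.restrict E).real Set.univ with hK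
  have hFb : ∀ x, ‖F x‖ ≤ K := fun x => norm_integral_le_of_norm_le_const (.of_forall fun z => by
    rw [norm_mul]; exact mul_le_mul (hHM x z) (hgb z) (norm_nonneg _) hM)
  have hK0 : 0 ≤ K := (norm_nonneg _).trans (hFb 0)
  -- Duality: u is the conjugate of T* applied to the restriction of F to Q, so that ∫_Q |F|² = ∫_E
  -- u g, while ∫|u|² is the quadratic form of T T* at F.
  set u : Eucl n → ℂ := fun z => ∫ x in Q, (starRingEnd ℂ) (F x) * H x z with hu
  have hum : Measurable u := by
    refine (StronglyMeasurable.integral_prod_right (ν := volume.restrict Q)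
      (f := fun z x => (starRingEnd ℂ) (F x) * H x z) ?_).measurable
    have h1 : Measurable fun q : Eucl n × Eucl n => H q.2 q.1 := hH.comp measurable_swap
    have h2 : Measurable fun q : Eucl n × Eucl n => (starRingEnd ℂ) (F q.2) :=
      (Complex.continuous_conj.measurable.comp hFm).comp measurable_snd
    exact (h2.mul h1).stronglyMeasurable
  -- the pairing of `F` with itself
  have hFint : IntegrableOn (fun x => ‖F x‖ ^ 2) Q :=
    Integrable.of_bound (hFm.norm.pow_const 2).aestronglyMeasurable (K ^ 2) (.of_forall fun x => by
      rw [Real.norm_of_nonneg (by positivity)]; exact pow_le_pow_left₀ (norm_nonneg _) (hFb x) 2)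
  set A : ℝ := ∫ x in Q, ‖F x‖ ^ 2 with hA
  have hA0 : 0 ≤ A := integral_nonneg fun _ => by positivity
  have hAu : (A : ℂ) = ∫ z in E, u z * g z := by
    have h1 : (A : ℂ) = ∫ x in Q, ∫ z in E, (starRingEnd ℂ) (F x) * (H x z * g z) := by
      rw [hA, ← integral_complex_ofReal]
      refine integral_congr_ae (.of_forall fun x => ?_)
      simp only
      rw [integral_const_mul]
      change _ = (starRingEnd ℂ) (F x) * F x
      rw [mul_comm, Complex.mul_conj, Complex.normSq_eq_norm_sq]
    rw [h1, integral_integral_swap]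
    · refine integral_congr_ae (.of_forall fun z => ?_)
      simp only [hu]
      rw [← integral_mul_const]
      refine integral_congr_ae (.of_forall fun x => ?_)
      simp only; ring
    · refine Integrable.of_bound (C := K * (M * Λ)) ?_ (.of_forall fun q => ?_)
      · exact ((Complex.continuous_conj.measurable.comp (hFm.comp measurable_fst)).mul
          (hH.mul (hg.comp measurable_snd))).aestronglyMeasurable
      · simp only [Function.uncurry, norm_mul, RCLike.norm_conj]
        gcongr
        · exact hFb _
        · exact hHM _ _
        · exact hgb _
  -- the square function of `u`
  have hU : ∫⁻ z, ‖u z‖ₑ ^ 2 ≤ ENNReal.ofReal (S * (∫ z : Eucl n, wt p z) * A) := by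
    set ν := (volume.restrict Q).prod (volume.restrict Q) with hν
    set G : Eucl n → Eucl n × Eucl n → ℂ := fun z q =>
      ((starRingEnd ℂ) (F q.1) * F q.2) * (H q.1 z * (starRingEnd ℂ) (H q.2 z)) with hG
    have hGm : Measurable (Function.uncurry G) := by
      have c1 : Measurable fun q : Eucl n × (Eucl n × Eucl n) => H q.2.1 q.1 :=
        hH.comp ((measurable_fst.comp measurable_snd).prodMk measurable_fst)
      have c2 : Measurable fun q : Eucl n × (Eucl n × Eucl n) => (starRingEnd ℂ) (H q.2.2 q.1) :=
        Complex.continuous_conj.measurable.comp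
          (hH.comp ((measurable_snd.comp measurable_snd).prodMk measurable_fst))
      have c3 : Measurable fun q : Eucl n × (Eucl n × Eucl n) => (starRingEnd ℂ) (F q.2.1) :=
        Complex.continuous_conj.measurable.comp (hFm.comp (measurable_fst.comp measurable_snd))
      have c4 : Measurable fun q : Eucl n × (Eucl n × Eucl n) => F q.2.2 :=
        hFm.comp (measurable_snd.comp measurable_snd)
      exact (c3.mul c4).mul (c1.mul c2)
    -- The decay of H serves only to justify Fubini. The constant M does not enter the final bound.
    have hGb : ∀ z q, ‖G z q‖ ≤ K * K * M * M * wt p (q.1 - z) := by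
      intro z q
      simp only [hG, norm_mul, RCLike.norm_conj]
      calc _ ≤ (K * K) * ((M * wt p (q.1 - z)) * M) := by
            exact mul_le_mul (mul_le_mul (hFb _) (hFb _) (norm_nonneg _) hK0)
              (mul_le_mul (hdec _ _) (hHM _ _) (norm_nonneg _) (mul_nonneg hM (wt_nonneg _ _)))
              (by positivity) (by positivity)
        _ = _ := by ring
    have hGi : Integrable (Function.uncurry G) (volume.prod ν) := by
      have hw : Integrable (fun q : Eucl n × (Eucl n × Eucl n) => K * K * M * M * wt p (q.2.1 - q.1))
          (volume.prod ν) := by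
        have hc : Continuous fun q : Eucl n × (Eucl n × Eucl n) => wt p (q.2.1 - q.1) :=
          (continuous_wt p).comp (by fun_prop)
        refine Integrable.const_mul ?_ _
        rw [integrable_prod_iff' hc.aestronglyMeasurable]
        refine ⟨.of_forall fun q => integrable_wt_sub hp q.1, ?_⟩
        have : (fun q : Eucl n × Eucl n => ∫ z, ‖wt p (q.1 - z)‖) = fun _ => ∫ z : Eucl n, wt p z := by
          ext q
          simp_rw [Real.norm_of_nonneg (wt_nonneg p _)]
          exact integral_wt_sub p q.1
        rw [this]
        exact integrable_const _
      exact hw.mono' hGm.aestronglyMeasurable (.of_forall fun q => hGb q.1 q.2)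
    have hu2 : ∀ z, ((‖u z‖ ^ 2 : ℝ) : ℂ) = ∫ q, G z q ∂ν := by
      intro z
      have h1 : (starRingEnd ℂ) (u z) = ∫ x in Q, F x * (starRingEnd ℂ) (H x z) := by
        rw [hu, ← integral_conj]
        refine integral_congr_ae (.of_forall fun x => ?_)
        simp
      rw [← Complex.normSq_eq_norm_sq, ← Complex.mul_conj, h1, hu, ← integral_prod_mul]
      refine integral_congr_ae (.of_forall fun q => ?_)
      simp only [hG]; ring
    have hui : Integrable fun z => ‖u z‖ ^ 2 := by
      have h1 : Integrable fun z => ∫ q, G z q ∂ν := hGi.integral_prod_left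
      have h2 := h1.norm
      refine h2.congr (.of_forall fun z => ?_)
      simp only [← hu2]
      rw [Complex.norm_real, Real.norm_of_nonneg (by positivity)]
    have h3 : ((∫ z, ‖u z‖ ^ 2 : ℝ) : ℂ) = ∫ q, (∫ z, G z q) ∂ν := by
      rw [← integral_complex_ofReal, ← integral_integral_swap hGi]
      exact integral_congr_ae (.of_forall hu2)
    -- Schur's test for a symmetric weight: |F(x)F(x')| is at most half the sum of the squares, and
    -- each square is integrated against the weight in the other variable.
    have h4 : ∀ q : Eucl n × Eucl n, ‖∫ z, G z q‖ ≤
        (S / 2) * (‖F q.1‖ ^ 2 * wt p (q.1 - q.2)) + (S / 2) * (‖F q.2‖ ^ 2 * wt p (q.2 - q.1)) := by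
      intro q
      simp only [hG]
      rw [integral_const_mul, norm_mul, norm_mul, RCLike.norm_conj]
      have e : wt p (q.2 - q.1) = wt p (q.1 - q.2) := by rw [← wt_neg, neg_sub]
      rw [e]
      calc _ ≤ ‖F q.1‖ * ‖F q.2‖ * (S * wt p (q.1 - q.2)) := by gcongr; exact hT _ _
        _ ≤ (‖F q.1‖ ^ 2 / 2 + ‖F q.2‖ ^ 2 / 2) * (S * wt p (q.1 - q.2)) := by
          have := wt_nonneg p (q.1 - q.2)
          gcongr
          nlinarith [sq_nonneg (‖F q.1‖ - ‖F q.2‖)]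
        _ = _ := by ring
    have hside : Integrable (fun q : Eucl n × Eucl n => ‖F q.1‖ ^ 2 * wt p (q.1 - q.2)) ν ∧
        ∫ q, ‖F q.1‖ ^ 2 * wt p (q.1 - q.2) ∂ν ≤ (∫ z : Eucl n, wt p z) * A := by
      have hi : Integrable (fun q : Eucl n × Eucl n => ‖F q.1‖ ^ 2 * wt p (q.1 - q.2)) ν := by
        refine Integrable.of_bound (C := K ^ 2 * 1) ?_ (.of_forall fun q => ?_)
        · refine (((hFm.comp measurable_fst).norm.pow_const 2).mul ?_).aestronglyMeasurable
          exact ((continuous_wt p).comp (by fun_prop)).measurable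
        · rw [Real.norm_of_nonneg (mul_nonneg (by positivity) (wt_nonneg _ _))]
          exact mul_le_mul (pow_le_pow_left₀ (norm_nonneg _) (hFb _) 2) (wt_le_one hp0 _)
            (wt_nonneg _ _) (by positivity)
      refine ⟨hi, ?_⟩
      rw [integral_prod _ hi, hA, ← integral_const_mul]
      refine integral_mono_of_nonneg (.of_forall fun x => integral_nonneg fun y =>
        mul_nonneg (by positivity) (wt_nonneg _ _)) (hFint.const_mul _) (.of_forall fun x => ?_)
      simp only
      rw [integral_const_mul, mul_comm]
      gcongr
      rw [← integral_wt_sub p x]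
      exact setIntegral_le_integral (integrable_wt_sub hp x) (.of_forall fun z => wt_nonneg _ _)
    have hside2 : Integrable (fun q : Eucl n × Eucl n => ‖F q.2‖ ^ 2 * wt p (q.2 - q.1)) ν ∧
        ∫ q, ‖F q.2‖ ^ 2 * wt p (q.2 - q.1) ∂ν ≤ (∫ z : Eucl n, wt p z) * A := by
      refine ⟨hside.1.swap, ?_⟩
      rw [← integral_prod_swap] at hside
      exact hside.2
    have h5 : ∫ z, ‖u z‖ ^ 2 ≤ S * (∫ z : Eucl n, wt p z) * A := by
      have h6 : ∫ z, ‖u z‖ ^ 2 = ‖((∫ z, ‖u z‖ ^ 2 : ℝ) : ℂ)‖ := by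
        rw [Complex.norm_real, Real.norm_of_nonneg (integral_nonneg fun _ => by positivity)]
      rw [h6, h3]
      refine (norm_integral_le_integral_norm _).trans ((integral_mono_of_nonneg
        (.of_forall fun _ => norm_nonneg _) ?_ (.of_forall h4)).trans ?_)
      · exact (hside.1.const_mul _).add (hside2.1.const_mul _)
      · rw [integral_add (hside.1.const_mul _) (hside2.1.const_mul _), integral_const_mul,
          integral_const_mul]
        have := hside.2
        have := hside2.2
        have h7 : 0 ≤ S / 2 := by positivity
        nlinarith
    have h8 := ofReal_sq_le_of_lintegral hui (fun z => by positivity) h5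
    refine (lintegral_mono fun z => ?_).trans h8
    rw [← ofReal_norm, ENNReal.ofReal_pow (norm_nonneg _)]
  have hFA : ∫⁻ x in Q, ‖F x‖ₑ ^ 2 = ENNReal.ofReal A := by
    rw [hA, ofReal_integral_eq_lintegral_ofReal hFint (.of_forall fun _ => by positivity)]
    refine lintegral_congr fun x => ?_
    rw [← ofReal_norm, ENNReal.ofReal_pow (norm_nonneg _)]
  change ∫⁻ x in Q, ‖F x‖ₑ ^ 2 ≤ _
  rw [hFA]
  -- What follows shows A² ≤ S(∫ wt) A ∫_E |g|². The factor A is cancelled, which is legitimate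
  -- because A is finite and, from here on, positive.
  rcases hA0.eq_or_lt with h0 | h0
  · rw [← h0]; simp
  have h1 : ENNReal.ofReal A ≤ ∫⁻ z in E, ‖u z‖ₑ * ‖g z‖ₑ := by
    have : ENNReal.ofReal A = ‖(A : ℂ)‖ₑ := by
      rw [← ofReal_norm, Complex.norm_real, Real.norm_of_nonneg hA0]
    rw [this, hAu]
    refine (enorm_integral_le_lintegral_enorm _).trans (le_of_eq ?_)
    simp_rw [enorm_mul]
  have hcne : ENNReal.ofReal A ≠ 0 := by simpa using h0
  have h2 : ENNReal.ofReal A * ENNReal.ofReal A ≤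
      ENNReal.ofReal A * (ENNReal.ofReal (S * ∫ z : Eucl n, wt p z) * ∫⁻ z in E, ‖g z‖ₑ ^ 2) := by
    calc ENNReal.ofReal A * ENNReal.ofReal A ≤ (∫⁻ z in E, ‖u z‖ₑ * ‖g z‖ₑ) ^ 2 := by
          rw [← sq]; gcongr
      _ ≤ (∫⁻ z in E, ‖u z‖ₑ ^ 2) * ∫⁻ z in E, ‖g z‖ₑ ^ 2 :=
          lintegral_mul_sq_le _ hum.enorm.aemeasurable hg.enorm.aemeasurable
      _ ≤ ENNReal.ofReal (S * (∫ z : Eucl n, wt p z) * A) * ∫⁻ z in E, ‖g z‖ₑ ^ 2 := by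
          gcongr
          exact (lintegral_mono' Measure.restrict_le_self le_rfl).trans hU
      _ = _ := by
          rw [ENNReal.ofReal_mul' hA0]; ring
  exact (ENNReal.mul_le_mul_iff_right hcne ENNReal.ofReal_ne_top).1 h2

/-! ### Local square estimates for oscillating kernels -/

theorem IsSymbol.integrable_weighted_sq {P : Eucl n → ℂ} (hP : IsSymbol P) (N : ℕ) {lam : ℝ}
    (hlam : 0 < lam) : Integrable fun w => (1 + ‖w‖ / lam) ^ (2 * N) * ‖ker P w‖ ^ 2 := by
  have h1 := (hP.integrable_ker_rpow (2 * N)).const_mul ((1 + lam⁻¹) ^ (2 * N) * ∫ ξ, ‖P ξ‖)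
  have hc := (continuous_ker hP.integrable).norm
  refine h1.mono' (Continuous.aestronglyMeasurable (by fun_prop)) (.of_forall fun w => ?_)
  rw [Real.norm_of_nonneg (by positivity)]
  have h2 : 1 + ‖w‖ / lam ≤ (1 + lam⁻¹) * (1 + ‖w‖) := by
    have : 0 < lam⁻¹ := by positivity
    rw [div_eq_mul_inv]
    nlinarith [norm_nonneg w]
  calc _ ≤ ((1 + lam⁻¹) * (1 + ‖w‖)) ^ (2 * N) * (‖ker P w‖ * ∫ ξ, ‖P ξ‖) := by
        rw [sq]
        gcongr
        exact norm_ker_le P w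
    _ = _ := by rw [mul_pow]; ring

theorem integral_wt_inv_smul (p : ℝ) {lam : ℝ} (hlam : 0 < lam) :
    ∫ w : Eucl n, wt p (lam⁻¹ • w) = lam ^ n * ∫ w : Eucl n, wt p w := by
  rw [Measure.integral_comp_inv_smul_of_nonneg _ _ hlam.le]
  simp

/-- The kernel of a symbol oscillating at frequency `lam` is concentrated on the ball of radius
`lam`, where its `L¹` norm is at most `lam ^ (n / 2)`. -/
theorem exists_lintegral_ker_tail_sq (hn : 1 ≤ n) (N q : ℕ) (hN : 2 * N = q + (n + 1)) :
    ∃ C : ℝ, 0 ≤ C ∧ ∀ (P : Eucl n → ℂ) (B lam ρ : ℝ), IsSymbol P → 0 < lam → 0 ≤ ρ →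
    (∀ m ≤ N, ∀ ζ, ‖iteratedFDeriv ℝ m P ζ‖ ≤ B * lam ^ m) →
    (∫⁻ w in {w : Eucl n | ρ ≤ ‖w‖}, ‖ker P w‖ₑ) ^ 2
      ≤ ENNReal.ofReal (C * B ^ 2 * lam ^ n * ((1 + ρ / lam) ^ q)⁻¹) := by
  obtain ⟨C, hC0, hC⟩ := exists_ker_weighted_sq hn N
  set c := ∫ w : Eucl n, wt ((n + 1 : ℕ) : ℝ) w with hc
  have hc0 : 0 < c := integral_wt_pos (lt_succ_cast n)
  refine ⟨C * c, by positivity, ?_⟩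
  intro P B lam ρ hP hlam hρ hB
  have hset : MeasurableSet {w : Eucl n | ρ ≤ ‖w‖} := measurableSet_le measurable_const measurable_norm
  -- Cauchy–Schwarz with the weight (1+|w|/λ)^N. Of the 2N powers in the square of the second
  -- factor, n+1 make it integrable, with integral of size λ^n, and the other q give the decay
  -- beyond ρ.
  set f : Eucl n → ℝ≥0∞ := fun w => ENNReal.ofReal ((1 + ‖w‖ / lam) ^ N * ‖ker P w‖) with hf
  set g : Eucl n → ℝ≥0∞ := fun w => ENNReal.ofReal (((1 + ‖w‖ / lam) ^ N)⁻¹) with hg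
  have hfg : ∀ w, ‖ker P w‖ₑ = f w * g w := by
    intro w
    simp only [hf, hg]
    rw [← ENNReal.ofReal_mul (by positivity), ← ofReal_norm]
    congr 1
    field_simp
  have hkc := (continuous_ker hP.integrable).norm
  have hfm : Measurable f := by
    have : Continuous fun w => (1 + ‖w‖ / lam) ^ N * ‖ker P w‖ := by fun_prop
    exact this.measurable.ennreal_ofReal
  have hgm : Measurable g := by
    have : Continuous fun w : Eucl n => ((1 + ‖w‖ / lam) ^ N)⁻¹ :=
      Continuous.inv₀ (by fun_prop) fun w => by positivity
    exact this.measurable.ennreal_ofReal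
  have h1 : ∫⁻ w, f w ^ 2 ≤ ENNReal.ofReal (C * B ^ 2) := by
    refine le_trans (le_of_eq ?_) (ofReal_sq_le_of_lintegral (hP.integrable_weighted_sq N hlam)
      (fun w => by positivity) (hC P B lam hP hlam hB))
    refine lintegral_congr fun w => ?_
    simp only [hf]
    rw [← ENNReal.ofReal_pow (by positivity)]
    congr 1; ring
  have h2 : ∫⁻ w in {w : Eucl n | ρ ≤ ‖w‖}, g w ^ 2 ≤
      ENNReal.ofReal (((1 + ρ / lam) ^ q)⁻¹ * (lam ^ n * c)) := by
    have hi : Integrable fun w : Eucl n =>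
        ((1 + ρ / lam) ^ q)⁻¹ * wt ((n + 1 : ℕ) : ℝ) (lam⁻¹ • w) :=
      ((integrable_wt (lt_succ_cast n)).comp_smul (inv_ne_zero hlam.ne')).const_mul _
    have h3 := ofReal_sq_le_of_lintegral hi (fun w => mul_nonneg (by positivity) (wt_nonneg _ _))
      (le_of_eq (by rw [integral_const_mul, integral_wt_inv_smul _ hlam]))
    refine le_trans ?_ h3
    refine (setLIntegral_mono' hset fun w hw => ?_).trans (setLIntegral_le_lintegral _ _)
    simp only [hg]
    rw [← ENNReal.ofReal_pow (by positivity)]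
    refine ENNReal.ofReal_le_ofReal ?_
    have hw' : ρ ≤ ‖w‖ := hw
    rw [wt_natCast, ← mul_inv, inv_pow, ← pow_mul, mul_comm N 2, hN, pow_add, norm_smul, norm_inv,
      Real.norm_of_nonneg hlam.le]
    have e : lam⁻¹ * ‖w‖ = ‖w‖ / lam := by field_simp
    rw [e]
    gcongr
  calc _ = (∫⁻ w in {w : Eucl n | ρ ≤ ‖w‖}, f w * g w) ^ 2 := by simp_rw [hfg]
    _ ≤ (∫⁻ w in {w : Eucl n | ρ ≤ ‖w‖}, f w ^ 2) * ∫⁻ w in {w : Eucl n | ρ ≤ ‖w‖}, g w ^ 2 :=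
        lintegral_mul_sq_le _ hfm.aemeasurable hgm.aemeasurable
    _ ≤ ENNReal.ofReal (C * B ^ 2) * ENNReal.ofReal (((1 + ρ / lam) ^ q)⁻¹ * (lam ^ n * c)) := by
        gcongr
        exact (setLIntegral_le_lintegral _ _).trans h1
    _ = _ := by
        rw [← ENNReal.ofReal_mul (by positivity)]
        congr 1; ring

theorem IsSymbol.conj {P : Eucl n → ℂ} (hP : IsSymbol P) :
    IsSymbol fun ζ => (starRingEnd ℂ) (P ζ) :=
  ⟨Complex.conjCLE.contDiff.comp hP.smooth, fun ζ h => by simp [hP.eq_zero ζ h]⟩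

theorem contDiff_expI_inner (x : Eucl n) : ContDiff ℝ ∞ fun ζ : Eucl n => expI (inner ℝ x ζ) := by
  unfold expI
  have h1 : ContDiff ℝ ∞ fun ζ : Eucl n => ((inner ℝ x ζ : ℝ) : ℂ) :=
    Complex.ofRealCLM.contDiff.comp (contDiff_const.inner ℝ contDiff_id)
  exact (h1.mul contDiff_const).cexp

/-- The kernel of `T T*`. -/
theorem integral_ker_sub_mul_conj {P R : Eucl n → ℂ} (hP : IsSymbol P) (hR : IsSymbol R)
    (x x' : Eucl n) :
    ∫ z, ker P (x - z) * (starRingEnd ℂ) (ker R (x' - z))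
      = ker (fun ζ => P ζ * (starRingEnd ℂ) (R ζ)) (x - x') := by
  have h : ∀ (P : Eucl n → ℂ) (x z : Eucl n),
      ker P (x - z) = ker (fun ζ => expI (inner ℝ x ζ) * P ζ) (-z) := by
    intro P x z
    unfold ker freqIntegral
    congr 1
    refine integral_congr_ae (.of_forall fun ζ => ?_)
    simp only
    rw [inner_sub_left, sub_eq_add_neg, expI_add, inner_neg_left]; ring
  simp_rw [h P x, h R x']
  have h2 := integral_neg_eq_self (μ := (volume : Measure (Eucl n))) (fun w => ker (fun ζ => expI (inner ℝ x ζ) * P ζ) w *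
    (starRingEnd ℂ) (ker (fun ζ => expI (inner ℝ x' ζ) * R ζ) w))
  rw [h2, integral_ker_mul_conj_ker (hP.mul (contDiff_expI_inner x)) (hR.mul (contDiff_expI_inner x'))]
  unfold ker freqIntegral
  congr 1
  refine integral_congr_ae (.of_forall fun ζ => ?_)
  simp only [map_mul, conj_expI]
  rw [inner_sub_left, sub_eq_add_neg, expI_add]; ring

theorem measurable_ker_sub {P : Eucl n → Eucl n → ℂ} (hP : Measurable (Function.uncurry P)) :
    Measurable (Function.uncurry fun x z : Eucl n => ker (P x) (x - z)) := by
  unfold ker freqIntegral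
  refine Measurable.const_mul ?_ _
  refine (StronglyMeasurable.integral_prod_right (ν := (volume : Measure (Eucl n)))
    (f := fun (q : Eucl n × Eucl n) ξ => P q.1 ξ * expI (inner ℝ (q.1 - q.2) ξ)) ?_).measurable
  refine Measurable.stronglyMeasurable ?_
  refine (hP.comp ((measurable_fst.comp measurable_fst).prodMk measurable_snd)).mul ?_
  exact (continuous_expI.comp (by fun_prop)).measurable

/-- The heart of the matter. Near the cube the L² bound from T T* is independent of λ, so only the
volume of the enlarged cube counts. Far from it, the tail of the kernel in L¹ is paired with the sup
norm of g. The hypothesis on P x times the conjugate of P x' is where cancellation of the phase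
enters: no power of λ is lost there. -/
theorem exists_local_sq_estimate (hn : 1 ≤ n) {δ : ℝ} (hδ₀ : 0 < δ) (hδ₁ : δ < 1) :
    ∃ N : ℕ, ∃ C : ℝ, 0 ≤ C ∧ ∀ (P : Eucl n → Eucl n → ℂ) (B lam Λ : ℝ) (g : Eucl n → ℂ)
      (a : Eucl n) (r : ℝ), Measurable (Function.uncurry P) → (∀ x, IsSymbol (P x)) → 1 ≤ lam →
      (∀ x, ∀ m ≤ N, ∀ ζ, ‖iteratedFDeriv ℝ m (P x) ζ‖ ≤ B * lam ^ m) →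
      (∀ x x', ∀ m ≤ n + 1, ∀ ζ,
        ‖iteratedFDeriv ℝ m (fun η => P x η * (starRingEnd ℂ) (P x' η)) ζ‖ ≤ B ^ 2) →
      Measurable g → (∀ z, ‖g z‖ ≤ Λ) → 0 < r →
      ∫⁻ x in cube a r, ‖∫ z, ker (P x) (x - z) * g z‖ₑ ^ 2
        ≤ ENNReal.ofReal (C * (B * Λ) ^ 2 * (1 + lam ^ n * r ^ (-(n * δ))) * r ^ n) := by
  -- With (1-δ)k ≥ nδ, the tail factor (r^{1-δ})^{-q} is at most r^{-nδ} for r ≥ 1. The values of N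
  -- and q are tied by 2N = q + (n+1).
  obtain ⟨k, hk⟩ := exists_nat_ge (n * δ / (1 - δ))
  have h1δ : 0 < 1 - δ := by linarith
  set N := n + 1 + k with hN
  set q := n + 1 + 2 * k with hq
  obtain ⟨C₁, hC₁0, hC₁⟩ := exists_lintegral_ker_tail_sq hn N q (by omega)
  obtain ⟨C₂, hC₂0, hC₂⟩ := exists_ker_decay n (n + 1)
  set c := ∫ w : Eucl n, wt ((n + 1 : ℕ) : ℝ) w with hc
  have hc0 : 0 < c := integral_wt_pos (lt_succ_cast n)
  refine ⟨N, 2 * (C₂ * c * 6 ^ n) + 2 * C₁, by positivity, ?_⟩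
  intro P B lam Λ g a r hPm hP hlam hB hPP hg hgΛ hr
  have hlam0 : 0 < lam := by linarith
  have hΛ : 0 ≤ Λ := (norm_nonneg _).trans (hgΛ 0)
  have hB0 : 0 ≤ B := by
    have := (norm_nonneg _).trans (hB 0 0 (Nat.zero_le _) 0); simpa using this
  set H : Eucl n → Eucl n → ℂ := fun x z => ker (P x) (x - z) with hH
  have hHm : Measurable (Function.uncurry H) := measurable_ker_sub hPm
  have hHdec : ∀ x z, ‖H x z‖ ≤ C₂ * (B * lam ^ N) * wt ((n + 1 : ℕ) : ℝ) (x - z) := by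
    intro x z
    refine le_mul_wt_of_mul_pow_le (hC₂ (P x) _ (hP x) (fun m hm ζ => ?_) (x - z))
    refine (hB x m (by omega) ζ).trans ?_
    gcongr
    omega
  have hHi : ∀ x, Integrable fun z => H x z * g z := by
    intro x
    have h1 : Integrable (H x) := by
      have := (hP x).integrable_ker.comp_sub_left x
      exact this
    exact h1.mul_bdd hg.aestronglyMeasurable (.of_forall hgΛ)
  -- the part of the integral away from the diagonal
  have htail : ∀ (E : Set (Eucl n)) (ρ : ℝ) (x : Eucl n), MeasurableSet E → 0 ≤ ρ →
      (∀ z, ‖x - z‖ < ρ → z ∈ E) → ‖∫ z in Eᶜ, H x z * g z‖ₑ ^ 2 ≤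
        ENNReal.ofReal (C₁ * (B * Λ) ^ 2 * (lam ^ n * ((1 + ρ / lam) ^ q)⁻¹)) := by
    intro E ρ x hE hρ hxE
    have hset : MeasurableSet {w : Eucl n | ρ ≤ ‖w‖} :=
      measurableSet_le measurable_const measurable_norm
    have h1 : ‖∫ z in Eᶜ, H x z * g z‖ₑ ≤
        (∫⁻ w in {w : Eucl n | ρ ≤ ‖w‖}, ‖ker (P x) w‖ₑ) * ENNReal.ofReal Λ := by
      calc ‖∫ z in Eᶜ, H x z * g z‖ₑ ≤ ∫⁻ z in Eᶜ, ‖H x z * g z‖ₑ :=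
            enorm_integral_le_lintegral_enorm _
        _ ≤ ∫⁻ z in Eᶜ, ‖H x z‖ₑ * ENNReal.ofReal Λ := by
            refine lintegral_mono fun z => ?_
            rw [enorm_mul]
            gcongr
            rw [← ofReal_norm]
            exact ENNReal.ofReal_le_ofReal (hgΛ z)
        _ = (∫⁻ z in Eᶜ, ‖H x z‖ₑ) * ENNReal.ofReal Λ := by
            rw [lintegral_mul_const']; exact ENNReal.ofReal_ne_top
        _ ≤ _ := by
            refine mul_le_mul' ?_ le_rfl
            rw [← lintegral_indicator hE.compl, ← lintegral_indicator hset,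
              ← lintegral_sub_left_eq_self _ x]
            refine lintegral_mono fun z => ?_
            by_cases hz : x - z ∈ E
            · simp [hz]
            · have : ρ ≤ ‖z‖ := by
                by_contra h; exact hz (hxE (x - z) (by simpa using h))
              simp [hz, Set.indicator, this, hH]
    calc _ ≤ ((∫⁻ w in {w : Eucl n | ρ ≤ ‖w‖}, ‖ker (P x) w‖ₑ) * ENNReal.ofReal Λ) ^ 2 := by gcongr
      _ ≤ ENNReal.ofReal (C₁ * B ^ 2 * lam ^ n * ((1 + ρ / lam) ^ q)⁻¹) * ENNReal.ofReal (Λ ^ 2) := by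
          rw [mul_pow, ← ENNReal.ofReal_pow hΛ]
          gcongr
          exact hC₁ (P x) B lam ρ (hP x) hlam0 hρ (hB x)
      _ = _ := by
          rw [← ENNReal.ofReal_mul (by positivity)]
          congr 1; ring
  have hconst : ∀ (G : Eucl n → ℂ) (K : ℝ), 0 ≤ K →
      (∀ x ∈ cube a r, ‖G x‖ₑ ^ 2 ≤ ENNReal.ofReal K) →
      ∫⁻ x in cube a r, ‖G x‖ₑ ^ 2 ≤ ENNReal.ofReal (K * r ^ n) := by
    intro G K hK h
    refine (setLIntegral_mono' (measurableSet_cube a r) h).trans (le_of_eq ?_)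
    rw [setLIntegral_const, volume_cube, ← ENNReal.ofReal_pow hr.le, ← ENNReal.ofReal_mul hK]
  -- On small cubes nothing is split off: the tail estimate with E = ∅ and ρ = 0 bounds the square
  -- pointwise by a multiple of λ^n, and r^{-nδ} ≥ 1.
  rcases le_total r 1 with hr1 | hr1
  · have h1 : (1 : ℝ) ≤ r ^ (-(n * δ)) := Real.one_le_rpow_of_pos_of_le_one_of_nonpos hr hr1
      (by have : (0 : ℝ) ≤ n * δ := by positivity
          linarith)
    refine (hconst _ (C₁ * (B * Λ) ^ 2 * lam ^ n) (by positivity) fun x _ => ?_).trans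
      (ENNReal.ofReal_le_ofReal ?_)
    · have := htail ∅ 0 x MeasurableSet.empty le_rfl (fun z h => absurd h (by simp))
      simpa using this
    · refine mul_le_mul_of_nonneg_right ?_ (by positivity)
      calc C₁ * (B * Λ) ^ 2 * lam ^ n ≤ C₁ * (B * Λ) ^ 2 * (1 + lam ^ n * r ^ (-(n * δ))) := by
            gcongr
            have : lam ^ n * 1 ≤ lam ^ n * r ^ (-(n * δ)) := by gcongr
            linarith
        _ ≤ _ := by
            have h2 : 0 ≤ C₂ * c * 6 ^ n := by positivity
            refine mul_le_mul_of_nonneg_right ?_ (by positivity)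
            refine mul_le_mul_of_nonneg_right ?_ (by positivity)
            linarith
  -- This radius balances the two parts: ρ^n = λ^n r^{-nδ} r^n is the admissible excess volume, and
  -- ρ/λ = r^{1-δ} still grows with r.
  · set ρ := lam * r ^ (1 - δ) with hρ
    have hρ0 : 0 < ρ := by positivity
    set b : Eucl n := WithLp.toLp 2 fun i => a i - ρ with hb
    set E := cube b (r + 2 * ρ) with hE
    have hxE : ∀ x ∈ cube a r, ∀ z, ‖x - z‖ < ρ → z ∈ E := by
      intro x hx z hz i
      have h1 : |x i - z i| < ρ := by
        have := (EuclideanSpace.norm_eq (x - z))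
        refine lt_of_le_of_lt ?_ hz
        simpa using PiLp.norm_apply_le (x - z) i
      have h2 := abs_lt.1 h1
      have h3 := hx i
      simp only [hb]
      constructor <;> linarith [h3.1, h3.2, h2.1, h2.2]
    have hsplit : ∀ x, ‖∫ z, H x z * g z‖ₑ ^ 2 ≤
        2 * ‖∫ z in E, H x z * g z‖ₑ ^ 2 + 2 * ‖∫ z in Eᶜ, H x z * g z‖ₑ ^ 2 := by
      intro x
      rw [← integral_add_compl (measurableSet_cube b (r + 2 * ρ)) (hHi x), ← mul_add]
      calc _ ≤ (‖∫ z in E, H x z * g z‖ₑ + ‖∫ z in Eᶜ, H x z * g z‖ₑ) ^ 2 := by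
            gcongr; exact enorm_add_le _ _
        _ ≤ _ := by
            have := ENNReal.rpow_add_le_mul_rpow_add_rpow ‖∫ z in E, H x z * g z‖ₑ
              ‖∫ z in Eᶜ, H x z * g z‖ₑ (p := 2) (by norm_num)
            norm_num at this
            exact this
    have hloc : ∫⁻ x in cube a r, ‖∫ z in E, H x z * g z‖ₑ ^ 2 ≤
        ENNReal.ofReal (C₂ * c * (B * Λ) ^ 2 * (r + 2 * ρ) ^ n) := by
      have h1 := lintegral_sq_le_of_tt_star hHm (lt_succ_cast n) (S := C₂ * B ^ 2) (by positivity)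
        hHdec (fun x x' => by
          rw [hH, integral_ker_sub_mul_conj (hP x) (hP x')]
          refine le_mul_wt_of_mul_pow_le (hC₂ _ _ ?_ (hPP x x') (x - x'))
          exact (hP x').conj.mul (hP x).smooth) hg hgΛ
        (volume_cube_lt_top a r) (volume_cube_lt_top b (r + 2 * ρ))
      refine h1.trans ?_
      calc _ ≤ ENNReal.ofReal (C₂ * B ^ 2 * c) * ∫⁻ z in E, ENNReal.ofReal (Λ ^ 2) := by
            gcongr with z
            rw [← ofReal_norm, ← ENNReal.ofReal_pow (norm_nonneg _)]
            exact ENNReal.ofReal_le_ofReal (pow_le_pow_left₀ (norm_nonneg _) (hgΛ z) 2)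
        _ = _ := by
            rw [setLIntegral_const, hE, volume_cube, ← ENNReal.ofReal_pow (by positivity),
              ← ENNReal.ofReal_mul (by positivity), ← ENNReal.ofReal_mul (by positivity)]
            congr 1; ring
    have hvol : (r + 2 * ρ) ^ n ≤ 6 ^ n * ((1 + lam ^ n * r ^ (-(n * δ))) * r ^ n) := by
      have h1 : ρ ^ n = lam ^ n * r ^ (-(n * δ)) * r ^ n := by
        rw [hρ, mul_pow, mul_assoc, ← Real.rpow_natCast (r ^ (1 - δ)), ← Real.rpow_mul hr.le,
          ← Real.rpow_natCast r n, ← Real.rpow_add hr]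
        congr 2; ring
      have h2 : (r + 2 * ρ) ^ n ≤ (3 * max r ρ) ^ n := by
        gcongr
        nlinarith [le_max_left r ρ, le_max_right r ρ]
      have h3 : (max r ρ) ^ n ≤ r ^ n + ρ ^ n := by
        rcases le_total r ρ with h | h
        · rw [max_eq_right h]; have : 0 ≤ r ^ n := by positivity
          linarith
        · rw [max_eq_left h]; have : 0 ≤ ρ ^ n := by positivity
          linarith
      calc (r + 2 * ρ) ^ n ≤ 3 ^ n * (r ^ n + ρ ^ n) := by
            refine h2.trans ?_; rw [mul_pow]; gcongr
        _ ≤ 6 ^ n * (r ^ n + ρ ^ n) := by gcongr; norm_num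
        _ = _ := by rw [h1]; ring
    have htl : ∫⁻ x in cube a r, ‖∫ z in Eᶜ, H x z * g z‖ₑ ^ 2 ≤
        ENNReal.ofReal (C₁ * (B * Λ) ^ 2 * (lam ^ n * r ^ (-(n * δ))) * r ^ n) := by
      refine (hconst _ _ (by positivity) fun x hx =>
        htail E ρ x (measurableSet_cube _ _) hρ0.le (hxE x hx)).trans (ENNReal.ofReal_le_ofReal ?_)
      gcongr
      have h1 : ρ / lam = r ^ (1 - δ) := by rw [hρ]; field_simp
      rw [h1]
      have h2 : (r ^ (1 - δ)) ^ q ≤ (1 + r ^ (1 - δ)) ^ q := by gcongr; linarith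
      refine (inv_anti₀ (by positivity) h2).trans ?_
      rw [← Real.rpow_natCast, ← Real.rpow_mul hr.le, ← Real.rpow_neg hr.le]
      refine Real.rpow_le_rpow_of_exponent_le hr1 (neg_le_neg ?_)
      have h3 : (n : ℝ) * δ ≤ (1 - δ) * k := by
        rw [div_le_iff₀ h1δ] at hk; linarith
      have h4 : (k : ℝ) ≤ q := by exact_mod_cast (by omega : k ≤ q)
      nlinarith
    calc _ ≤ ∫⁻ x in cube a r, (2 * ‖∫ z in E, H x z * g z‖ₑ ^ 2
            + 2 * ‖∫ z in Eᶜ, H x z * g z‖ₑ ^ 2) := lintegral_mono hsplit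
      _ = 2 * (∫⁻ x in cube a r, ‖∫ z in E, H x z * g z‖ₑ ^ 2)
            + 2 * ∫⁻ x in cube a r, ‖∫ z in Eᶜ, H x z * g z‖ₑ ^ 2 := by
          have hm : ∀ E : Set (Eucl n), Measurable fun x => ∫ z in E, H x z * g z := fun E =>
            (StronglyMeasurable.integral_prod_right (ν := volume.restrict E)
              (f := fun x z => H x z * g z)
              (hHm.mul (hg.comp measurable_snd)).stronglyMeasurable).measurable
          rw [lintegral_add_left (((hm E).enorm.pow_const 2).const_mul 2),
            lintegral_const_mul _ ((hm E).enorm.pow_const 2),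
            lintegral_const_mul _ ((hm Eᶜ).enorm.pow_const 2)]
      _ ≤ 2 * ENNReal.ofReal (C₂ * c * (B * Λ) ^ 2 * (r + 2 * ρ) ^ n) + 2 *
            ENNReal.ofReal (C₁ * (B * Λ) ^ 2 * (lam ^ n * r ^ (-(n * δ))) * r ^ n) := by gcongr
      _ = ENNReal.ofReal (2 * (C₂ * c * (B * Λ) ^ 2 * (r + 2 * ρ) ^ n) + 2 *
            (C₁ * (B * Λ) ^ 2 * (lam ^ n * r ^ (-(n * δ))) * r ^ n)) := by
          rw [ENNReal.ofReal_add (by positivity) (by positivity), ENNReal.ofReal_mul zero_le_two,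
            ENNReal.ofReal_mul zero_le_two, ENNReal.ofReal_ofNat]
      _ ≤ _ := by
          refine ENNReal.ofReal_le_ofReal ?_
          calc _ ≤ 2 * (C₂ * c * (B * Λ) ^ 2 * (6 ^ n * ((1 + lam ^ n * r ^ (-(n * δ))) * r ^ n)))
                + 2 * (C₁ * (B * Λ) ^ 2 * (1 + lam ^ n * r ^ (-(n * δ))) * r ^ n) := by
                gcongr
                linarith
            _ = _ := by ring

/-! ### Square roots of monotone smooth functions -/

theorem abs_sub_taylor_le {v : ℝ → ℝ} (hv : ContDiff ℝ ∞ v) {M : ℝ} (m : ℕ)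
    (hM : ∀ t, |iteratedDeriv (m + 1) v t| ≤ M) (t₀ : ℝ) {x : ℝ} (hx : t₀ ≤ x) :
    |v x - ∑ l ∈ Finset.range (m + 1), iteratedDeriv l v t₀ / l.factorial * (x - t₀) ^ l|
      ≤ M * (x - t₀) ^ (m + 1) := by
  have hM0 : 0 ≤ M := (abs_nonneg _).trans (hM t₀)
  -- The interval is extended by one so that it is nondegenerate even when x = t₀.
  have hlt : t₀ < x + 1 := by linarith
  have he : ∀ l : ℕ, ∀ y ∈ Set.Icc t₀ (x + 1),
      iteratedDerivWithin l v (Set.Icc t₀ (x + 1)) y = iteratedDeriv l v y := fun l y hy =>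
    iteratedDerivWithin_eq_iteratedDeriv (uniqueDiffOn_Icc hlt)
      (hv.contDiffAt.of_le (by exact_mod_cast le_top)) hy
  have h := taylor_mean_remainder_bound (f := v) (n := m) (C := M) hlt.le
    (hv.contDiffOn.of_le (by exact_mod_cast le_top)) (x := x) ⟨hx, by linarith⟩
    (fun y hy => by rw [he _ y hy]; exact hM y)
  rw [taylor_within_apply, Real.norm_eq_abs] at h
  refine le_trans (le_of_eq ?_) (h.trans ?_)
  · congr 2
    refine Finset.sum_congr rfl fun l _ => ?_
    rw [he l t₀ ⟨le_rfl, hlt.le⟩, smul_eq_mul]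
    field_simp
  · refine div_le_self (mul_nonneg hM0 (pow_nonneg (by linarith) _)) ?_
    exact_mod_cast Nat.one_le_iff_ne_zero.2 (Nat.factorial_ne_zero m)

/-- A polynomial with values of size `y` at the integers has coefficients of size `y`. -/
theorem exists_coeff_bound (m : ℕ) : ∃ C : ℝ, 0 ≤ C ∧ ∀ (c : Fin m → ℝ) (y : ℝ),
    (∀ k : Fin m, |∑ l, c l * ((k : ℕ) : ℝ) ^ (l : ℕ)| ≤ y) → ∀ l, |c l| ≤ C * y := by
  set V := Matrix.vandermonde fun k : Fin m => ((k : ℕ) : ℝ) with hV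
  have hdet : IsUnit V.det := by
    rw [isUnit_iff_ne_zero, hV, Matrix.det_vandermonde_ne_zero_iff]
    intro a b h
    have h' : ((a : ℕ) : ℝ) = ((b : ℕ) : ℝ) := h
    exact Fin.ext (by exact_mod_cast h')
  refine ⟨∑ l, ∑ k, |V⁻¹ l k|, by positivity, fun c y h l => ?_⟩
  have h1 : c = V⁻¹.mulVec (V.mulVec c) := by
    rw [Matrix.mulVec_mulVec, Matrix.nonsing_inv_mul _ hdet, Matrix.one_mulVec]
  have h2 : ∀ k, |V.mulVec c k| ≤ y := by
    intro k
    refine le_trans (le_of_eq ?_) (h k)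
    congr 1
    simp only [Matrix.mulVec, dotProduct, hV, Matrix.vandermonde_apply]
    exact Finset.sum_congr rfl fun l _ => mul_comm _ _
  rw [h1]
  calc |V⁻¹.mulVec (V.mulVec c) l| ≤ ∑ k, |V⁻¹ l k| * |V.mulVec c k| := by
        simp only [Matrix.mulVec, dotProduct]
        refine (Finset.abs_sum_le_sum_abs _ _).trans (le_of_eq ?_)
        exact Finset.sum_congr rfl fun k _ => abs_mul _ _
    _ ≤ ∑ k, |V⁻¹ l k| * y := by gcongr with k; exact h2 k
    _ = (∑ k, |V⁻¹ l k|) * y := by rw [Finset.sum_mul]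
    _ ≤ (∑ l, ∑ k, |V⁻¹ l k|) * y := by
        have : 0 ≤ y := (abs_nonneg _).trans (h2 l)
        refine mul_le_mul_of_nonneg_right ?_ this
        exact Finset.single_le_sum (f := fun l => ∑ k, |V⁻¹ l k|) (fun i _ => by positivity)
          (Finset.mem_univ l)

/-- Smooth monotone functions on the line with values in `[0, 1]`, vanishing on the left half line,
with bounded derivatives. -/
structure IsStep (w : ℝ → ℝ) : Prop where
  smooth : ContDiff ℝ ∞ w
  mono : Monotone w
  le_one : ∀ t, w t ≤ 1
  eq_zero : ∀ t ≤ 0, w t = 0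
  bdd : ∀ i : ℕ, ∃ M, ∀ t, |iteratedDeriv i w t| ≤ M

namespace IsStep

variable {w : ℝ → ℝ}

theorem nonneg (hw : IsStep w) (t : ℝ) : 0 ≤ w t := by
  rcases le_total t 0 with h | h
  · exact (hw.eq_zero t h).ge
  · exact (hw.eq_zero 0 le_rfl).ge.trans (hw.mono h)

theorem abs_iteratedDeriv_comp_sub (w : ℝ → ℝ) (i : ℕ) (t x : ℝ) :
    |iteratedDeriv i (fun τ => w (t - τ)) x| = |iteratedDeriv i w (t - x)| := by
  rw [← Real.norm_eq_abs, ← Real.norm_eq_abs, ← norm_iteratedFDeriv_eq_norm_iteratedDeriv,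
    ← norm_iteratedFDeriv_eq_norm_iteratedDeriv]
  have h1 : (fun τ => w (t - τ)) = fun τ => (fun σ => w (t + σ)) (-τ) := by
    ext τ; simp [sub_eq_add_neg]
  rw [h1, norm_iteratedFDeriv_eq_norm_iteratedDeriv]
  refine (congrArg norm (iteratedDeriv_comp_neg i (fun σ => w (t + σ)) x)).trans ?_
  rw [norm_smul, norm_pow, norm_neg, norm_one, one_pow, one_mul, ← norm_iteratedFDeriv_eq_norm_iteratedDeriv,
    iteratedFDeriv_comp_add_left]
  rfl

/-- Interpolation on a one-sided interval. -/
theorem exists_interp (hw : IsStep w) (m : ℕ) : ∃ C : ℝ, 0 ≤ C ∧ ∀ t h : ℝ, 0 < h → ∀ i ≤ m,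
    |iteratedDeriv i w t| * h ^ i ≤ C * (w t + h ^ (m + 1)) := by
  obtain ⟨M, hM⟩ := hw.bdd (m + 1)
  have hM0 : 0 ≤ M := (abs_nonneg _).trans (hM 0)
  obtain ⟨C, hC0, hC⟩ := exists_coeff_bound (m + 1)
  refine ⟨m.factorial * (C * (1 + M * (m + 1) ^ (m + 1))), by positivity, ?_⟩
  intro t h hh i hi
  -- Monotonicity enters here: looking to the left of t, the values w(t - kh) lie in [0, w(t)].
  -- Hence the Taylor polynomial at t is of size w(t) + h^{m+1} at m+1 equidistant nodes, and so are
  -- its coefficients.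
  set v : ℝ → ℝ := fun τ => w (t - τ) with hv
  have hvs : ContDiff ℝ ∞ v := hw.smooth.comp (contDiff_const.sub contDiff_id)
  set c : Fin (m + 1) → ℝ := fun l => iteratedDeriv l v 0 / (l : ℕ).factorial * h ^ (l : ℕ) with hc
  have hy : ∀ k : Fin (m + 1), |∑ l, c l * ((k : ℕ) : ℝ) ^ (l : ℕ)|
      ≤ w t + M * ((m + 1) * h) ^ (m + 1) := by
    intro k
    have h1 := abs_sub_taylor_le hvs m (M := M) (fun x => by
      rw [hv, abs_iteratedDeriv_comp_sub]; exact hM _) 0 (x := k * h) (by positivity)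
    have h2 : ∑ l ∈ Finset.range (m + 1), iteratedDeriv l v 0 / l.factorial * (k * h - 0) ^ l
        = ∑ l, c l * ((k : ℕ) : ℝ) ^ (l : ℕ) := by
      rw [Finset.sum_range]
      refine Finset.sum_congr rfl fun l _ => ?_
      simp only [hc, sub_zero, mul_pow]; ring
    rw [h2, sub_zero] at h1
    have h3 : |v (k * h)| ≤ w t := by
      rw [abs_of_nonneg (hw.nonneg _)]
      exact hw.mono (by have : 0 ≤ (k : ℝ) * h := by positivity
                        linarith)
    have h4 : M * (k * h) ^ (m + 1) ≤ M * ((m + 1) * h) ^ (m + 1) := by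
      gcongr
      have : ((k : ℕ) : ℝ) ≤ ((m + 1 : ℕ) : ℝ) := by exact_mod_cast k.2.le
      push_cast at this; exact this
    calc _ = |v (k * h) - (v (k * h) - ∑ l, c l * ((k : ℕ) : ℝ) ^ (l : ℕ))| := by congr 1; ring
      _ ≤ |v (k * h)| + |v (k * h) - ∑ l, c l * ((k : ℕ) : ℝ) ^ (l : ℕ)| := abs_sub _ _
      _ ≤ _ := by linarith
  have h5 := hC c _ hy ⟨i, Nat.lt_succ_of_le hi⟩
  simp only [hc] at h5
  rw [abs_mul, abs_div, hv, abs_iteratedDeriv_comp_sub, sub_zero, abs_of_pos (pow_pos hh i),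
    Nat.abs_cast] at h5
  have hf : (i.factorial : ℝ) ≤ m.factorial := by exact_mod_cast Nat.factorial_le hi
  have hf0 : (0 : ℝ) < i.factorial := by exact_mod_cast Nat.factorial_pos i
  have hw0 := hw.nonneg t
  calc |iteratedDeriv i w t| * h ^ i
      = i.factorial * (|iteratedDeriv i w t| / i.factorial * h ^ i) := by field_simp
    _ ≤ m.factorial * (C * (w t + M * ((m + 1) * h) ^ (m + 1))) := by gcongr
    _ ≤ m.factorial * (C * ((1 + M * (m + 1) ^ (m + 1)) * (w t + h ^ (m + 1)))) := by
        gcongr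
        rw [mul_pow]
        have h6 : 0 ≤ M * (m + 1 : ℝ) ^ (m + 1) := by positivity
        have h7 : 0 ≤ h ^ (m + 1) := by positivity
        nlinarith
    _ = _ := by ring

/-- Interpolation with m = i gives |w^{(i)}(t)| h^i ≤ C h^{i+1} when w(t) = 0; divide by h^i and let
h tend to 0. -/
theorem iteratedDeriv_eq_zero (hw : IsStep w) {t : ℝ} (ht : w t = 0) (i : ℕ) :
    iteratedDeriv i w t = 0 := by
  obtain ⟨C, hC0, hC⟩ := hw.exists_interp i
  have h1 : ∀ h : ℝ, 0 < h → |iteratedDeriv i w t| ≤ C * h := by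
    intro h hh
    have := hC t h hh i le_rfl
    rw [ht, zero_add, pow_succ, mul_comm (h ^ i), ← mul_assoc] at this
    exact le_of_mul_le_mul_right this (pow_pos hh i)
  have h2 : |iteratedDeriv i w t| ≤ 0 := by
    refine le_of_forall_pos_le_add fun ε hε => ?_
    have := h1 (ε / (C + 1)) (by positivity)
    rw [zero_add]
    refine this.trans ?_
    rw [mul_div_assoc', div_le_iff₀ (by positivity)]
    nlinarith
  exact abs_eq_zero.1 (le_antisymm h2 (abs_nonneg _))

/-- The derivatives of `w` are almost as small as `w`. -/
theorem exists_deriv_bound (hw : IsStep w) (i : ℕ) {η : ℝ} (hη : 0 < η) (hη1 : η < 1) :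
    ∃ C, ∀ t, |iteratedDeriv i w t| ≤ C * w t ^ (1 - η) := by
  -- Interpolation of order m loses the exponent i/(m+1), which this choice makes at most η.
  obtain ⟨k, hk⟩ := exists_nat_ge (i / η)
  set m := k + i with hm
  obtain ⟨C, hC0, hC⟩ := hw.exists_interp m
  refine ⟨2 * C, fun t => ?_⟩
  rcases (hw.nonneg t).eq_or_lt with h0 | h0
  · rw [hw.iteratedDeriv_eq_zero h0.symm, abs_zero, ← h0]
    rw [Real.zero_rpow (by linarith)]; simp
  · have hm1 : (0 : ℝ) < m + 1 := by positivity
    -- The step length balances the two terms of the interpolation inequality: h^{m+1} = w(t).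
    set h := w t ^ (1 / ((m : ℝ) + 1)) with hh
    have hpos : 0 < h := Real.rpow_pos_of_pos h0 _
    have h1 : h ^ (m + 1) = w t := by
      rw [hh, ← Real.rpow_natCast, ← Real.rpow_mul h0.le]
      push_cast
      rw [one_div_mul_cancel hm1.ne', Real.rpow_one]
    have h2 := hC t h hpos i (by omega)
    rw [h1] at h2
    have h3 : h ^ i = w t ^ ((i : ℝ) / (m + 1)) := by
      rw [hh, ← Real.rpow_natCast, ← Real.rpow_mul h0.le]; congr 1; ring
    have h4 : |iteratedDeriv i w t| ≤ 2 * C * w t * (h ^ i)⁻¹ := by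
      rw [← div_eq_mul_inv, le_div_iff₀ (by positivity)]; linarith
    refine h4.trans ?_
    rw [mul_assoc, h3, ← Real.rpow_neg h0.le]
    refine mul_le_mul_of_nonneg_left ?_ (by positivity)
    nth_rewrite 1 [← Real.rpow_one (w t)]
    rw [← Real.rpow_add h0]
    refine Real.rpow_le_rpow_of_exponent_ge h0 (hw.le_one t) ?_
    have h5 : (i : ℝ) / (m + 1) ≤ η := by
      rw [div_le_iff₀ hm1]
      rw [div_le_iff₀ hη] at hk
      have : (0 : ℝ) ≤ i * η := by positivity
      rw [hm]; push_cast; nlinarith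
    linarith

/-- Smooth functions all of whose derivatives are `O(w ^ (p - η))` for all `η > 0`. -/
def Order (w : ℝ → ℝ) (p : ℕ) (G : ℝ → ℝ) : Prop :=
  ContDiff ℝ ∞ G ∧ ∀ (i : ℕ) (η : ℝ), 0 < η → η < 1 →
    ∃ C, ∀ t, ‖iteratedFDeriv ℝ i G t‖ ≤ C * w t ^ ((p : ℝ) - η)

theorem order_self (hw : IsStep w) : Order w 1 w := by
  refine ⟨hw.smooth, fun i η h0 h1 => ?_⟩
  simpa [norm_iteratedFDeriv_eq_norm_iteratedDeriv] using hw.exists_deriv_bound i h0 h1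

/-- No order is lost under differentiation, because the definition grants all derivatives the same
exponent. -/
theorem Order.deriv {p : ℕ} {G : ℝ → ℝ} (hG : Order w p G) : Order w p (deriv G) := by
  refine ⟨hG.1.deriv' , fun i η h0 h1 => ?_⟩
  obtain ⟨C, hC⟩ := hG.2 (i + 1) η h0 h1
  refine ⟨C, fun t => ?_⟩
  have := hC t
  rw [norm_iteratedFDeriv_eq_norm_iteratedDeriv, iteratedDeriv_succ'] at this
  rwa [norm_iteratedFDeriv_eq_norm_iteratedDeriv]

theorem Order.add {p : ℕ} {G K : ℝ → ℝ} (hG : Order w p G) (hK : Order w p K) :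
    Order w p fun t => G t + K t := by
  refine ⟨hG.1.add hK.1, fun i η h0 h1 => ?_⟩
  obtain ⟨C, hC⟩ := hG.2 i η h0 h1
  obtain ⟨D, hD⟩ := hK.2 i η h0 h1
  refine ⟨C + D, fun t => ?_⟩
  have h := iteratedFDeriv_add_apply (x := t) (i := i) (hG.1.contDiffAt.of_le (by exact_mod_cast le_top))
    (hK.1.contDiffAt.of_le (by exact_mod_cast le_top))
  have h2 : (fun t => G t + K t) = G + K := rfl
  rw [h2, h, add_mul]
  exact (norm_add_le _ _).trans (add_le_add (hC t) (hD t))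

/-- The loss η is shared equally by the two factors. Since p, q ≥ 1, both exponents stay positive,
so they add up even where w vanishes. -/
theorem Order.mul (hw : IsStep w) {p q : ℕ} (hp : 1 ≤ p) (hq : 1 ≤ q) {G K : ℝ → ℝ}
    (hG : Order w p G) (hK : Order w q K) : Order w (p + q) fun t => G t * K t := by
  refine ⟨hG.1.mul hK.1, fun i η h0 h1 => ?_⟩
  choose C hC using fun j => hG.2 j (η / 2) (by linarith) (by linarith)
  choose D hD using fun j => hK.2 j (η / 2) (by linarith) (by linarith)
  refine ⟨∑ j ∈ Finset.range (i + 1), (i.choose j : ℝ) * C j * D (i - j), fun t => ?_⟩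
  refine (norm_iteratedFDeriv_mul_le (N := ∞) hG.1 hK.1 t (by exact_mod_cast le_top)).trans ?_
  rw [Finset.sum_mul]
  refine Finset.sum_le_sum fun j _ => ?_
  have hp' : (1 : ℝ) ≤ p := by exact_mod_cast hp
  have hq' : (1 : ℝ) ≤ q := by exact_mod_cast hq
  have h2 : w t ^ (((p + q : ℕ) : ℝ) - η) = w t ^ ((p : ℝ) - η / 2) * w t ^ ((q : ℝ) - η / 2) := by
    rw [← Real.rpow_add_of_nonneg (hw.nonneg t) (by linarith) (by linarith)]
    congr 1; push_cast; ring
  rw [h2]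
  calc _ ≤ (i.choose j : ℝ) * (C j * w t ^ ((p : ℝ) - η / 2)) * (D (i - j) * w t ^ ((q : ℝ) - η / 2)) := by
        have := (norm_nonneg _).trans (hC j t)
        gcongr
        · exact hC j t
        · exact hD (i - j) t
    _ = _ := by ring

theorem Order.const_mul {p : ℕ} {G : ℝ → ℝ} (hG : Order w p G) (c : ℝ) :
    Order w p fun t => c * G t := by
  refine ⟨contDiff_const.mul hG.1, fun i η h0 h1 => ?_⟩
  obtain ⟨C, hC⟩ := hG.2 i η h0 h1
  refine ⟨|c| * C, fun t => ?_⟩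
  have h := iteratedFDeriv_const_smul_apply (a := c) (x := t) (i := i)
    (hG.1.contDiffAt.of_le (by exact_mod_cast le_top))
  have h2 : (fun t => c * G t) = c • G := rfl
  rw [h2, h, norm_smul, Real.norm_eq_abs, mul_assoc]
  exact mul_le_mul_of_nonneg_left (hC t) (abs_nonneg c)

/-- Where w > 0 this is the product rule. At a zero t of w all derivatives of w vanish, so w(x) ≤
M|x-t|^8, while the function is O(w^{1/4}) by taking η = 1/4. It is therefore O(|x-t|²), and its
derivative is 0, in accordance with the convention that 0 to a nonzero real power is 0. -/
theorem hasDerivAt_mul_rpow (hw : IsStep w) {p : ℕ} (hp : 1 ≤ p) {G : ℝ → ℝ} (hG : Order w p G)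
    (t : ℝ) : HasDerivAt (fun t => G t * w t ^ (1 / 2 - (p : ℝ)))
      ((_root_.deriv G t * w t + (1 / 2 - p) * (G t * _root_.deriv w t))
        * w t ^ (1 / 2 - ((p + 1 : ℕ) : ℝ))) t := by
  have hGd : HasDerivAt G (_root_.deriv G t) t :=
    (hG.1.differentiable (by simp)).differentiableAt.hasDerivAt
  have hwd : HasDerivAt w (_root_.deriv w t) t :=
    (hw.smooth.differentiable (by simp)).differentiableAt.hasDerivAt
  have hp' : (1 : ℝ) ≤ p := by exact_mod_cast hp
  rcases (hw.nonneg t).eq_or_lt with h0 | h0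
  · have hz : w t ^ (1 / 2 - ((p + 1 : ℕ) : ℝ)) = 0 := by
      rw [← h0, Real.zero_rpow]; push_cast; linarith
    rw [hz, mul_zero]
    obtain ⟨C, hC⟩ := hG.2 0 (1 / 4) (by norm_num) (by norm_num)
    obtain ⟨M, hM⟩ := hw.bdd 8
    have hM0 : 0 ≤ M := (abs_nonneg _).trans (hM 0)
    have hsmall : ∀ x, w x ≤ M * |x - t| ^ 8 := by
      intro x
      rcases le_total x t with h | h
      · have : w x ≤ w t := hw.mono h
        rw [← h0] at this
        exact this.trans (by positivity)
      · have h1 := abs_sub_taylor_le hw.smooth 7 hM t h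
        have h2 : ∑ l ∈ Finset.range (7 + 1), iteratedDeriv l w t / l.factorial * (x - t) ^ l = 0 :=
          Finset.sum_eq_zero fun l _ => by rw [hw.iteratedDeriv_eq_zero h0.symm]; simp
        rw [h2, sub_zero, abs_of_nonneg (hw.nonneg x)] at h1
        rwa [abs_of_nonneg (by linarith)]
    have hfb : ∀ x, |G x * w x ^ (1 / 2 - (p : ℝ))| ≤ |C| * M ^ (1 / 4 : ℝ) * |x - t| ^ 2 := by
      intro x
      rcases (hw.nonneg x).eq_or_lt with hx | hx
      · rw [← hx, Real.zero_rpow (by linarith)]; simp only [mul_zero, abs_zero]; positivity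
      · rw [abs_mul, abs_of_pos (Real.rpow_pos_of_pos hx _)]
        have h1 : |G x| ≤ |C| * w x ^ ((p : ℝ) - 1 / 4) := by
          have := hC x
          rw [norm_iteratedFDeriv_zero, Real.norm_eq_abs] at this
          exact this.trans (by gcongr; exact le_abs_self C)
        calc |G x| * w x ^ (1 / 2 - (p : ℝ)) ≤ |C| * w x ^ ((p : ℝ) - 1 / 4) * w x ^ (1 / 2 - (p : ℝ)) := by
              gcongr
          _ = |C| * w x ^ (1 / 4 : ℝ) := by
              rw [mul_assoc, ← Real.rpow_add hx]; congr 2; ring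
          _ ≤ |C| * (M * |x - t| ^ 8) ^ (1 / 4 : ℝ) := by
              have := hsmall x
              gcongr
          _ = _ := by
              rw [Real.mul_rpow hM0 (by positivity), ← Real.rpow_natCast (|x - t|) 8,
                ← Real.rpow_mul (abs_nonneg _), ← mul_assoc]
              congr 1
              rw [← Real.rpow_natCast]; norm_num
    rw [hasDerivAt_iff_isLittleO]
    have h3 : G t * w t ^ (1 / 2 - (p : ℝ)) = 0 := by
      rw [← h0, Real.zero_rpow (by linarith), mul_zero]
    simp only [h3, sub_zero, smul_zero]
    have h4 : (fun x => G x * w x ^ (1 / 2 - (p : ℝ))) =O[nhds t] fun x => (x - t) ^ 2 := by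
      refine Asymptotics.IsBigO.of_bound (|C| * M ^ (1 / 4 : ℝ)) (.of_forall fun x => ?_)
      rw [Real.norm_eq_abs, norm_pow, Real.norm_eq_abs]
      exact hfb x
    refine h4.trans_isLittleO ?_
    refine (Asymptotics.isLittleO_iff.2 fun ε hε => ?_)
    filter_upwards [Metric.ball_mem_nhds t hε] with x hx
    rw [Metric.mem_ball, Real.dist_eq] at hx
    rw [norm_pow, Real.norm_eq_abs, sq]
    gcongr
  · have h1 := hGd.mul (hwd.rpow_const (p := 1 / 2 - (p : ℝ)) (Or.inl h0.ne'))
    refine h1.congr_deriv ?_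
    have h2 : w t ^ (1 / 2 - (p : ℝ)) = w t * w t ^ (1 / 2 - ((p + 1 : ℕ) : ℝ)) := by
      nth_rewrite 2 [← Real.rpow_one (w t)]
      rw [← Real.rpow_add h0]; congr 1; push_cast; ring
    have h3 : w t ^ (1 / 2 - (p : ℝ) - 1) = w t ^ (1 / 2 - ((p + 1 : ℕ) : ℝ)) := by
      congr 1; push_cast; ring
    rw [h2, h3]; ring

/-- Differentiation turns a numerator of order p over w^{p-1/2} into one of order p+1 over
w^{p+1/2}. The family is closed, so the induction on k runs over all p and G at once. -/
theorem contDiff_mul_rpow (hw : IsStep w) (k : ℕ) : ∀ {p : ℕ}, 1 ≤ p → ∀ {G : ℝ → ℝ}, Order w p G →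
    ContDiff ℝ k fun t => G t * w t ^ (1 / 2 - (p : ℝ)) := by
  induction k with
  | zero =>
    intro p hp G hG
    refine contDiff_zero.2 (continuous_iff_continuousAt.2 fun t => ?_)
    exact (hw.hasDerivAt_mul_rpow hp hG t).continuousAt
  | succ k ih =>
    intro p hp G hG
    have h := contDiff_succ_iff_deriv (𝕜 := ℝ) (n := (k : ℕ∞))
      (f := fun t => G t * w t ^ (1 / 2 - (p : ℝ)))
    refine h.2 ⟨fun t => (hw.hasDerivAt_mul_rpow hp hG t).differentiableAt, by simp, ?_⟩
    have h2 : _root_.deriv (fun t => G t * w t ^ (1 / 2 - (p : ℝ))) = fun t =>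
        (_root_.deriv G t * w t + (1 / 2 - p) * (G t * _root_.deriv w t))
          * w t ^ (1 / 2 - ((p + 1 : ℕ) : ℝ)) :=
      funext fun t => (hw.hasDerivAt_mul_rpow hp hG t).deriv
    rw [h2]
    exact ih (p := p + 1) (by omega) ((hG.deriv.mul hw hp le_rfl hw.order_self).add
      ((hG.mul hw hp le_rfl hw.order_self.deriv).const_mul _))

theorem contDiff_sqrt (hw : IsStep w) : ContDiff ℝ ∞ fun t => √(w t) := by
  have h : (fun t => √(w t)) = fun t => w t * w t ^ (1 / 2 - ((1 : ℕ) : ℝ)) := by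
    ext t
    rcases (hw.nonneg t).eq_or_lt with h0 | h0
    · rw [← h0]; simp
    · rw [Real.sqrt_eq_rpow]
      nth_rewrite 2 [← Real.rpow_one (w t)]
      rw [← Real.rpow_add h0]; congr 1; norm_num
  rw [h]
  exact contDiff_infty.2 fun k => hw.contDiff_mul_rpow k le_rfl hw.order_self

end IsStep

/-! ### Littlewood--Paley cut-offs -/

/-- Symbols vanishing near the origin. -/
structure IsAnnular (Q : Eucl n → ℂ) : Prop extends IsSymbol Q where
  eq_zero_near : ∀ ζ, ‖ζ‖ ≤ 1 / 4 → Q ζ = 0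

namespace IsCutoff

variable {ϑ : Eucl n → ℝ}

theorem le_one (hϑ : IsCutoff ϑ) (ξ : Eucl n) : ϑ ξ ≤ 1 := by
  rw [← hϑ.eq_one 0 (by simp)]
  exact hϑ.radial_decreasing 0 ξ (by simp)

/-- The radial profile of `1 - ϑ`, starting from the unit sphere. -/
def profile (ϑ : Eucl n → ℝ) (e : Eucl n) (t : ℝ) : ℝ := if t ≤ 0 then 0 else 1 - ϑ ((1 + t) • e)

theorem profile_eq (hϑ : IsCutoff ϑ) {e : Eucl n} (he : ‖e‖ = 1) {t : ℝ} (ht : -1 < t) :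
    profile ϑ e t = 1 - ϑ ((1 + t) • e) := by
  unfold profile
  split_ifs with h
  · rw [hϑ.eq_one, sub_self]
    rw [norm_smul, he, mul_one, Real.norm_of_nonneg (by linarith)]; linarith
  · rfl

/-- Monotonicity is the radial decrease of ϑ. The profile is constant to the left of 0 and to the
right of 1, so its derivatives are bounded by compactness of [0, 1]. -/
theorem isStep_profile (hϑ : IsCutoff ϑ) {e : Eucl n} (he : ‖e‖ = 1) : IsStep (profile ϑ e) := by
  have hnear : ∀ t < 0, profile ϑ e =ᶠ[nhds t] fun _ => 0 := fun t ht => by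
    filter_upwards [Iio_mem_nhds ht] with x hx
    simp [profile, (show x ≤ 0 from le_of_lt hx)]
  have hfar : ∀ t, 1 < t → profile ϑ e =ᶠ[nhds t] fun _ => 1 := fun t ht => by
    filter_upwards [Ioi_mem_nhds ht] with x hx
    have hx' : 1 < x := hx
    rw [hϑ.profile_eq he (by linarith), hϑ.eq_zero, sub_zero]
    rw [norm_smul, he, mul_one, Real.norm_of_nonneg (by linarith)]; linarith
  have hsm : ContDiff ℝ ∞ (profile ϑ e) := by
    refine contDiff_iff_contDiffAt.2 fun t => ?_
    rcases lt_or_ge t 0 with h | h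
    · exact contDiffAt_const.congr_of_eventuallyEq (hnear t h)
    · have h1 : ContDiff ℝ ∞ fun t : ℝ => 1 - ϑ ((1 + t) • e) :=
        contDiff_const.sub (hϑ.smooth.comp ((contDiff_const.add contDiff_id).smul contDiff_const))
      refine h1.contDiffAt.congr_of_eventuallyEq ?_
      filter_upwards [Ioi_mem_nhds (show -1 < t by linarith)] with x hx
      exact hϑ.profile_eq he hx
  refine ⟨hsm, fun s t hst => ?_, fun t => ?_, fun t ht => by simp [profile, ht], fun i => ?_⟩
  · unfold profile
    split_ifs with h1 h2 h2
    · exact le_rfl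
    · linarith [hϑ.le_one ((1 + t) • e)]
    · linarith
    · have := hϑ.radial_decreasing ((1 + s) • e) ((1 + t) • e) (by
        rw [norm_smul, norm_smul, he, Real.norm_of_nonneg (by linarith),
          Real.norm_of_nonneg (by linarith)]
        linarith)
      linarith
  · unfold profile
    split_ifs with h
    · exact zero_le_one
    · linarith [hϑ.nonneg ((1 + t) • e)]
  · have hc : Continuous (iteratedDeriv i (profile ϑ e)) :=
      hsm.continuous_iteratedDeriv i (by exact_mod_cast le_top)
    obtain ⟨M, hM⟩ := (isCompact_Icc (a := (0 : ℝ)) (b := 1)).exists_bound_of_continuousOn hc.continuousOn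
    refine ⟨max M 1, fun t => ?_⟩
    have hcst : ∀ c : ℝ, |c| ≤ 1 → |iteratedDeriv i (fun _ : ℝ => c) t| ≤ 1 := by
      intro c hc
      rw [iteratedDeriv_const]
      split_ifs
      · exact hc
      · simp
    by_cases ht : t ∈ Set.Icc (0 : ℝ) 1
    · exact (hM t ht).trans (le_max_left _ _)
    · refine le_trans ?_ (le_max_right _ _)
      rw [Set.mem_Icc, not_and_or, not_le, not_le] at ht
      rcases ht with ht | ht
      · rw [(hnear t ht).iteratedDeriv_eq]
        exact hcst 0 (by simp)
      · rw [(hfar t ht).iteratedDeriv_eq]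
        exact hcst 1 (by simp)

/-- The function is the square root of the profile composed with |ξ| - 1. Near the origin, where the
norm is not smooth, it vanishes identically. -/
theorem contDiff_sqrt_one_sub (hn : 1 ≤ n) (hϑ : IsCutoff ϑ) : ContDiff ℝ ∞ fun ξ => √(1 - ϑ ξ) := by
  set e : Eucl n := EuclideanSpace.single ⟨0, hn⟩ 1 with he
  have he1 : ‖e‖ = 1 := by simp [he]
  have h : (fun ξ => √(1 - ϑ ξ)) = fun ξ => √(profile ϑ e (‖ξ‖ - 1)) := by
    ext ξ
    by_cases h1 : ‖ξ‖ - 1 ≤ 0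
    · simp [profile, h1, hϑ.eq_one ξ (by linarith)]
    · simp only [profile, h1, if_false]
      have h2 : ‖(1 + (‖ξ‖ - 1)) • e‖ = ‖ξ‖ := by rw [norm_smul, he1]; simp
      have : ϑ ξ = ϑ ((1 + (‖ξ‖ - 1)) • e) :=
        le_antisymm (hϑ.radial_decreasing _ _ h2.le) (hϑ.radial_decreasing _ _ h2.ge)
      rw [this]
  refine contDiff_iff_contDiffAt.2 fun ξ => ?_
  by_cases h0 : ξ = 0
  · refine (contDiffAt_const (c := 0)).congr_of_eventuallyEq ?_
    filter_upwards [Metric.ball_mem_nhds ξ zero_lt_one] with x hx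
    rw [h0, Metric.mem_ball, dist_zero_right] at hx
    simp [hϑ.eq_one x hx.le]
  · rw [h]
    exact ((isStep_profile hϑ he1).contDiff_sqrt.contDiffAt).comp ξ
      ((contDiffAt_norm ℝ h0).sub contDiffAt_const)

/-- For |ξ| ≤ 1/2 the outer cut-off equals 1, and for |ξ| > 1/2 the inner one vanishes. The
difference of squares therefore factors, and the only delicate root is that of 1 - ϑ. -/
theorem psi_zero_eq (hϑ : IsCutoff ϑ) (ξ : Eucl n) : psi ϑ 0 ξ =
    ϑ ((2 : ℝ)⁻¹ • ξ) * (√(1 - ϑ ((4 : ℝ) • ξ)) * √(1 + ϑ ((4 : ℝ) • ξ))) := by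
  have e1 : (2 : ℝ) ^ (-1 - 0 : ℤ) = 2⁻¹ := by norm_num
  have e2 : (2 : ℝ) ^ (2 - 0 : ℤ) = 4 := by norm_num
  unfold psi
  rw [e1, e2, ← Real.sqrt_mul (by linarith [hϑ.le_one ((4 : ℝ) • ξ)])]
  by_cases h : ‖ξ‖ ≤ 1 / 2
  · rw [hϑ.eq_one ((2 : ℝ)⁻¹ • ξ) (by rw [norm_smul]; norm_num; linarith), one_mul]
    congr 1; ring
  · rw [hϑ.eq_zero ((4 : ℝ) • ξ) (by rw [norm_smul]; norm_num; push Not at h; linarith)]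
    simp [Real.sqrt_sq (hϑ.nonneg _)]

/-- The functions `ψ_j` are smooth, because `ϑ` is radially decreasing. -/
theorem isAnnular_psi (hn : 1 ≤ n) (hϑ : IsCutoff ϑ) : IsAnnular fun ξ => (psi ϑ 0 ξ : ℂ) := by
  refine ⟨⟨?_, fun ζ hζ => ?_⟩, fun ζ hζ => ?_⟩
  · suffices hs : ContDiff ℝ ∞ (psi ϑ 0) from Complex.ofRealCLM.contDiff.comp hs
    have h : psi ϑ 0 = fun ξ : Eucl n =>
        ϑ ((2 : ℝ)⁻¹ • ξ) * (√(1 - ϑ ((4 : ℝ) • ξ)) * √(1 + ϑ ((4 : ℝ) • ξ))) :=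
      funext hϑ.psi_zero_eq
    rw [h]
    have h1 : ContDiff ℝ ∞ fun ξ : Eucl n => ϑ ((2 : ℝ)⁻¹ • ξ) :=
      hϑ.smooth.comp (contDiff_const_smul _)
    have h2 : ContDiff ℝ ∞ fun ξ : Eucl n => √(1 - ϑ ((4 : ℝ) • ξ)) :=
      (contDiff_sqrt_one_sub hn hϑ).comp (contDiff_const_smul _)
    have h3 : ContDiff ℝ ∞ fun ξ : Eucl n => √(1 + ϑ ((4 : ℝ) • ξ)) :=
      (contDiff_const.add (hϑ.smooth.comp (contDiff_const_smul _))).sqrt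
        fun ξ => by have := hϑ.nonneg ((4 : ℝ) • ξ); positivity
    exact h1.mul (h2.mul h3)
  · rw [hϑ.psi_zero_eq, hϑ.eq_zero ((2 : ℝ)⁻¹ • ζ) (by rw [norm_smul]; norm_num; linarith)]
    simp
  · rw [hϑ.psi_zero_eq, hϑ.eq_one ((4 : ℝ) • ζ) (by rw [norm_smul]; norm_num; linarith)]
    simp

theorem psi_eq (j : ℤ) (ξ : Eucl n) : psi ϑ j ξ = psi ϑ 0 ((2 : ℝ) ^ (-j) • ξ) := by
  unfold psi
  simp only [smul_smul]
  rw [← zpow_add₀ two_ne_zero, ← zpow_add₀ two_ne_zero]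
  congr 3

end IsCutoff

/-- The `L¹`-normalised dilation `tⁿ κ(t z)`. -/
def dil (t : ℝ) (κ : Eucl n → ℂ) (z : Eucl n) : ℂ := ((t ^ n : ℝ) : ℂ) * κ (t • z)

/-! ### Dilated kernels and the form of the kernel of Q_j^u -/

theorem ker_comp_inv_smul (P : Eucl n → ℂ) {t : ℝ} (ht : 0 < t) (w : Eucl n) :
    ker (fun ξ => P (t⁻¹ • ξ)) w = dil t (ker P) w := by
  unfold ker freqIntegral dil
  have h := Measure.integral_comp_inv_smul_of_nonneg (volume : Measure (Eucl n))
    (fun ξ => P ξ * expI (inner ℝ (t • w) ξ)) ht.le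
  have h2 : ∀ ξ : Eucl n, inner ℝ (t • w) (t⁻¹ • ξ) = inner ℝ w ξ := by
    intro ξ
    rw [real_inner_smul_left, real_inner_smul_right]; field_simp
  simp only [h2] at h
  rw [h, finrank_euclideanSpace, Fintype.card_fin, Complex.real_smul]
  ring

/-- Since ψ_j is a dilate of ψ_0, the kernel is a dilate of a fixed one, and the modulation by u
becomes a translation by 2^{-j}u. This is why all bounds are uniform in u. -/
theorem lpKernel_eq (ϑ : Eucl n → ℝ) (u : Eucl n) (j : ℤ) (z : Eucl n) : lpKernel ϑ u j z =
    dil ((2 : ℝ) ^ j) (ker fun ξ => (psi ϑ 0 ξ : ℂ)) (z + (2 : ℝ) ^ (-j) • u) := by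
  rw [← ker_comp_inv_smul _ (by positivity)]
  unfold lpKernel ker freqIntegral
  congr 1
  refine integral_congr_ae (.of_forall fun ξ => ?_)
  simp only
  rw [mul_assoc, ← expI_add, IsCutoff.psi_eq, inner_add_left, real_inner_smul_left, add_comm,
    real_inner_comm ξ u, ← zpow_neg]

theorem lpPiece_eq (ϑ : Eucl n → ℝ) (u : Eucl n) (j : ℤ) (L : (Eucl n → ℂ) → ℂ) (x : Eucl n) :
    lpPiece ϑ u j L x = L fun x' => dil ((2 : ℝ) ^ j) (ker fun ξ => (psi ϑ 0 ξ : ℂ))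
      (x + (2 : ℝ) ^ (-j) • u - x') := by
  unfold lpPiece
  congr 1
  ext x'
  rw [lpKernel_eq]
  congr 1
  abel

open scoped FourierTransform LineDeriv

/-! ### Amplitudes with compact frequency support -/

/-- The derivative of an amplitude in the `l`-th spatial direction. -/
def dx (l : Fin n) (p : Eucl n → Eucl n → ℂ) (x ζ : Eucl n) : ℂ :=
  fderiv ℝ (fun y => p y ζ) x (EuclideanSpace.single l 1)

/-- Amplitudes supported in `r ≤ |ζ| ≤ 2` with bounds `A` on all their derivatives. -/
structure IsAmp (r : ℝ) (A : ℕ → ℕ → ℝ) (p : Eucl n → Eucl n → ℂ) : Prop where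
  smooth : ContDiff ℝ ∞ fun q : Eucl n × Eucl n => p q.1 q.2
  bound : ∀ a b x ζ,
    ‖iteratedFDeriv ℝ a (fun η => iteratedFDeriv ℝ b (fun y => p y η) x) ζ‖ ≤ A a b
  eq_zero : ∀ x ζ, 2 ≤ ‖ζ‖ → p x ζ = 0
  eq_zero_near : ∀ x ζ, ‖ζ‖ ≤ r → p x ζ = 0

theorem contDiff_iteratedFDeriv_left {p : Eucl n → Eucl n → ℂ}
    (hp : ContDiff ℝ ∞ fun q : Eucl n × Eucl n => p q.1 q.2) (b : ℕ) :
    ContDiff ℝ ∞ fun q : Eucl n × Eucl n => iteratedFDeriv ℝ b (fun y => p y q.2) q.1 := by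
  induction b with
  | zero => exact (continuousMultilinearCurryFin0 ℝ (Eucl n) ℂ).symm.contDiff.comp hp
  | succ b ih =>
    have h1 : ContDiff ℝ ∞ fun q : Eucl n × Eucl n =>
        fderiv ℝ (iteratedFDeriv ℝ b fun y => p y q.2) q.1 := by
      refine ContDiff.fderiv (f := fun (q : Eucl n × Eucl n) y => iteratedFDeriv ℝ b (fun y => p y q.2) y)
        (m := ∞) ?_ contDiff_fst (by simp)
      exact ih.comp (contDiff_snd.prodMk (contDiff_snd.comp contDiff_fst))
    exact (continuousMultilinearCurryLeftEquiv ℝ (fun _ : Fin (b + 1) => Eucl n) ℂ).symm.contDiff.comp h1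

theorem contDiff_dx {p : Eucl n → Eucl n → ℂ}
    (hp : ContDiff ℝ ∞ fun q : Eucl n × Eucl n => p q.1 q.2) (l : Fin n) :
    ContDiff ℝ ∞ fun q : Eucl n × Eucl n => dx l p q.1 q.2 := by
  have h1 : ContDiff ℝ ∞ fun q : Eucl n × Eucl n => fderiv ℝ (fun y => p y q.2) q.1 := by
    refine ContDiff.fderiv (f := fun (q : Eucl n × Eucl n) y => p y q.2)
      (m := ∞) ?_ contDiff_fst (by simp)
    exact hp.comp (contDiff_snd.prodMk (contDiff_snd.comp contDiff_fst))
  exact h1.clm_apply contDiff_const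

theorem contDiff_left {p : Eucl n → Eucl n → ℂ}
    (hp : ContDiff ℝ ∞ fun q : Eucl n × Eucl n => p q.1 q.2) (ζ : Eucl n) :
    ContDiff ℝ ∞ fun x => p x ζ := hp.comp (contDiff_id.prodMk contDiff_const)

theorem contDiff_right {F : Type*} [NormedAddCommGroup F] [NormedSpace ℝ F] {p : Eucl n → Eucl n → F}
    (hp : ContDiff ℝ ∞ fun q : Eucl n × Eucl n => p q.1 q.2) (x : Eucl n) :
    ContDiff ℝ ∞ fun ζ => p x ζ := hp.comp (contDiff_const.prodMk contDiff_id)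

/-- The derivatives of ∂_l p are images of the derivatives of p of one order more under a linear map
that does not depend on p. Bounds for ∂_l p thus depend only on those for p. -/
theorem exists_iteratedFDeriv_dx (l : Fin n) (b : ℕ) :
    ∃ Φ : (Eucl n [×(b + 1)]→L[ℝ] ℂ) →L[ℝ] (Eucl n [×b]→L[ℝ] ℂ),
      ∀ p : Eucl n → Eucl n → ℂ, (ContDiff ℝ ∞ fun q : Eucl n × Eucl n => p q.1 q.2) →
      ∀ x ζ, iteratedFDeriv ℝ b (fun y => dx l p y ζ) x =
        Φ (iteratedFDeriv ℝ (b + 1) (fun y => p y ζ) x) := by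
  let ev : (Eucl n →L[ℝ] ℂ) →L[ℝ] ℂ := ContinuousLinearMap.apply ℝ ℂ (EuclideanSpace.single l 1)
  let cur := (continuousMultilinearCurryRightEquiv' ℝ b (Eucl n) ℂ)
  refine ⟨(ContinuousLinearMap.compContinuousMultilinearMapL ℝ (fun _ : Fin b => Eucl n) _ _ ev).comp
    (cur.toContinuousLinearEquiv : _ →L[ℝ] _), fun p hp x ζ => ?_⟩
  have h1 : (fun y => dx l p y ζ) = ev ∘ fderiv ℝ fun y => p y ζ := rfl
  have h2 : ContDiff ℝ ∞ (fderiv ℝ fun y => p y ζ) := (contDiff_left hp ζ).fderiv_right (by simp)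
  rw [h1, ev.iteratedFDeriv_comp_left h2.contDiffAt (i := b) (by exact_mod_cast le_top),
    iteratedFDeriv_succ_eq_comp_right]
  have h3 : cur (cur.symm (iteratedFDeriv ℝ b (fderiv ℝ fun y => p y ζ) x)) =
    iteratedFDeriv ℝ b (fderiv ℝ fun y => p y ζ) x := cur.apply_symm_apply _
  conv_lhs => rw [← h3]
  rfl

namespace IsAmp

variable {r : ℝ} {A A' : ℕ → ℕ → ℝ} {p q : Eucl n → Eucl n → ℂ}

theorem nonneg (hp : IsAmp r A p) (a b : ℕ) : 0 ≤ A a b := (norm_nonneg _).trans (hp.bound a b 0 0)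

theorem norm_iteratedFDeriv_le (hp : IsAmp r A p) (a : ℕ) (x ζ : Eucl n) :
    ‖iteratedFDeriv ℝ a (p x) ζ‖ ≤ A a 0 := by
  have h := hp.bound a 0 x ζ
  have e : (fun η => iteratedFDeriv ℝ 0 (fun y => p y η) x) =
    (continuousMultilinearCurryFin0 ℝ (Eucl n) ℂ).symm ∘ p x := rfl
  rwa [e, LinearIsometryEquiv.norm_iteratedFDeriv_comp_left] at h

theorem norm_le (hp : IsAmp r A p) (x ζ : Eucl n) : ‖p x ζ‖ ≤ A 0 0 := by
  simpa using hp.norm_iteratedFDeriv_le 0 x ζ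

theorem continuous (hp : IsAmp r A p) : Continuous (Function.uncurry p) := hp.smooth.continuous

theorem contDiff_iteratedFDeriv (hp : IsAmp r A p) (b : ℕ) (x : Eucl n) :
    ContDiff ℝ ∞ fun η => iteratedFDeriv ℝ b (fun y => p y η) x :=
  contDiff_right (p := fun x η => iteratedFDeriv ℝ b (fun y => p y η) x)
    (contDiff_iteratedFDeriv_left hp.smooth b) x

theorem add (hp : IsAmp r A p) (hq : IsAmp r A' q) :
    IsAmp r (fun a b => A a b + A' a b) fun x ζ => p x ζ + q x ζ := by
  refine ⟨hp.smooth.add hq.smooth, fun a b x ζ => ?_, fun x ζ h => ?_, fun x ζ h => ?_⟩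
  · have h1 : (fun η => iteratedFDeriv ℝ b (fun y => p y η + q y η) x) =
        (fun η => iteratedFDeriv ℝ b (fun y => p y η) x) +
          fun η => iteratedFDeriv ℝ b (fun y => q y η) x := by
      ext1 η
      exact iteratedFDeriv_add_apply
        ((contDiff_left hp.smooth η).contDiffAt.of_le (by exact_mod_cast le_top))
        ((contDiff_left hq.smooth η).contDiffAt.of_le (by exact_mod_cast le_top))
    rw [h1, iteratedFDeriv_add_apply
      ((hp.contDiff_iteratedFDeriv b x).contDiffAt.of_le (by exact_mod_cast le_top))
      ((hq.contDiff_iteratedFDeriv b x).contDiffAt.of_le (by exact_mod_cast le_top))]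
    exact (norm_add_le _ _).trans (add_le_add (hp.bound a b x ζ) (hq.bound a b x ζ))
  · rw [hp.eq_zero x ζ h, hq.eq_zero x ζ h, add_zero]
  · rw [hp.eq_zero_near x ζ h, hq.eq_zero_near x ζ h, add_zero]

end IsAmp

/-- Leibniz's rule: bounds of the factors are needed in `r ≤ |ζ| ≤ 2` only. -/
theorem isAmp_mul {r : ℝ} {A : ℕ → ℕ → ℝ} {p : Eucl n → Eucl n → ℂ} {g : Eucl n → ℂ}
    (hp : ContDiff ℝ ∞ fun q : Eucl n × Eucl n => p q.1 q.2) (hA : ∀ a b, 0 ≤ A a b)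
    (hpA : ∀ a b x ζ, r ≤ ‖ζ‖ → ‖ζ‖ ≤ 2 →
      ‖iteratedFDeriv ℝ a (fun η => iteratedFDeriv ℝ b (fun y => p y η) x) ζ‖ ≤ A a b)
    (hg : ContDiff ℝ ∞ g) {B : ℕ → ℝ} (hB0 : ∀ a, 0 ≤ B a)
    (hB : ∀ a ζ, ‖ζ‖ ≤ 2 → ‖iteratedFDeriv ℝ a g ζ‖ ≤ B a)
    (h2 : ∀ x ζ, 2 ≤ ‖ζ‖ → g ζ * p x ζ = 0) (hr : ∀ x ζ, ‖ζ‖ ≤ r → g ζ * p x ζ = 0) :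
    IsAmp r (fun a b => ∑ i ∈ Finset.range (a + 1), (a.choose i : ℝ) * B i * A (a - i) b)
      fun x ζ => g ζ * p x ζ := by
  refine ⟨(hg.comp contDiff_snd).mul hp, fun a b x ζ => ?_, h2, hr⟩
  have h1 : (fun η => iteratedFDeriv ℝ b (fun y => g η * p y η) x) =
      fun η => g η • iteratedFDeriv ℝ b (fun y => p y η) x := by
    ext1 η
    exact iteratedFDeriv_const_smul_apply' (𝕜 := ℝ) (a := g η)
      ((contDiff_left hp η).contDiffAt.of_le (by exact_mod_cast le_top))
  have hpos : 0 ≤ ∑ i ∈ Finset.range (a + 1), (a.choose i : ℝ) * B i * A (a - i) b := by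
    refine Finset.sum_nonneg fun i _ => ?_
    have := hB0 i
    have := hA (a - i) b
    positivity
  have hz : ∀ U : Set (Eucl n), IsOpen U → ζ ∈ U → (∀ y, ∀ η ∈ U, g η * p y η = 0) →
      ‖iteratedFDeriv ℝ a (fun η => iteratedFDeriv ℝ b (fun y => g η * p y η) x) ζ‖ ≤
        ∑ i ∈ Finset.range (a + 1), (a.choose i : ℝ) * B i * A (a - i) b := by
    intro U hU hζ h0
    have h2 : (fun η => iteratedFDeriv ℝ b (fun y => g η * p y η) x) =ᶠ[nhds ζ] fun _ => 0 := by
      filter_upwards [hU.mem_nhds hζ] with η hη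
      have h3 : (fun y => g η * p y η) = fun _ => 0 := funext fun y => h0 y η hη
      rw [h3]; simp
    rw [(h2.iteratedFDeriv ℝ a).eq_of_nhds]
    simpa only [iteratedFDeriv_fun_zero, Pi.zero_apply, norm_zero] using hpos
  rcases lt_or_ge 2 ‖ζ‖ with hζ | hζ
  · exact hz {η | 2 < ‖η‖} (isOpen_lt continuous_const continuous_norm) hζ fun y η hη => h2 y η (le_of_lt hη)
  rcases lt_or_ge ‖ζ‖ r with hζr | hζr
  · exact hz {η | ‖η‖ < r} (isOpen_lt continuous_norm continuous_const) hζr fun y η hη => hr y η (le_of_lt hη)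
  rw [h1]
  have hc : ContDiff ℝ ∞ fun η => iteratedFDeriv ℝ b (fun y => p y η) x :=
    contDiff_right (p := fun x η => iteratedFDeriv ℝ b (fun y => p y η) x)
      (contDiff_iteratedFDeriv_left hp b) x
  refine (norm_iteratedFDeriv_smul_le hg hc ζ (by exact_mod_cast le_top)).trans
    (Finset.sum_le_sum fun i _ => ?_)
  refine mul_le_mul ?_ (hpA _ _ _ _ hζr hζ) (norm_nonneg _) (mul_nonneg (by positivity) (hB0 i))
  exact mul_le_mul_of_nonneg_left (hB i ζ hζ) (by positivity)

theorem exists_bound_closedBall {g : Eucl n → ℂ} (hg : ContDiff ℝ ∞ g) : ∃ B : ℕ → ℝ, (∀ a, 0 ≤ B a) ∧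
    ∀ a ζ, ‖ζ‖ ≤ 2 → ‖iteratedFDeriv ℝ a g ζ‖ ≤ B a := by
  have h : ∀ a : ℕ, ∃ B : ℝ, ∀ ζ ∈ Metric.closedBall (0 : Eucl n) 2, ‖iteratedFDeriv ℝ a g ζ‖ ≤ B :=
    fun a => (isCompact_closedBall (0 : Eucl n) 2).exists_bound_of_continuousOn
      (hg.continuous_iteratedFDeriv (by exact_mod_cast le_top)).continuousOn
  choose B hB using h
  exact ⟨B, fun a => (norm_nonneg _).trans (hB a 0 (by simp)), fun a ζ hζ => hB a ζ (by simpa using hζ)⟩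

namespace IsAmp

variable {r : ℝ} {A A' : ℕ → ℕ → ℝ} {p q : Eucl n → Eucl n → ℂ}

theorem const_mul (hp : IsAmp r A p) {c : ℂ} {M : ℝ} (hc : ‖c‖ ≤ M) :
    IsAmp r (fun a b => M * A a b) fun x ζ => c * p x ζ := by
  refine ⟨contDiff_const.mul hp.smooth, fun a b x ζ => ?_, fun x ζ h => ?_, fun x ζ h => ?_⟩
  · have h1 : (fun η => iteratedFDeriv ℝ b (fun y => c * p y η) x) =
        fun η => c • iteratedFDeriv ℝ b (fun y => p y η) x := by
      ext1 η
      exact iteratedFDeriv_const_smul_apply' (𝕜 := ℝ) (a := c)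
        ((contDiff_left hp.smooth η).contDiffAt.of_le (by exact_mod_cast le_top))
    rw [h1, iteratedFDeriv_const_smul_apply'
      ((hp.contDiff_iteratedFDeriv b x).contDiffAt.of_le (by exact_mod_cast le_top)), norm_smul]
    exact mul_le_mul hc (hp.bound _ _ _ _) (norm_nonneg _) ((norm_nonneg _).trans hc)
  · rw [hp.eq_zero x ζ h, mul_zero]
  · rw [hp.eq_zero_near x ζ h, mul_zero]

/-- The order of quantifiers is the point: A' is fixed before p, so that the constants of the
iterated integrations by parts are uniform over all amplitudes of a class. -/
theorem exists_mul (r : ℝ) (A : ℕ → ℕ → ℝ) {g : Eucl n → ℂ} (hg : ContDiff ℝ ∞ g) :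
    ∃ A', ∀ p, IsAmp r A p → IsAmp r A' fun x ζ => g ζ * p x ζ := by
  obtain ⟨B, hB0, hB⟩ := exists_bound_closedBall hg
  exact ⟨_, fun p hp => isAmp_mul hp.smooth hp.nonneg (fun a b x ζ _ _ => hp.bound a b x ζ) hg hB0 hB
    (fun x ζ h => by rw [hp.eq_zero x ζ h, mul_zero])
    (fun x ζ h => by rw [hp.eq_zero_near x ζ h, mul_zero])⟩

theorem exists_dx (r : ℝ) (A : ℕ → ℕ → ℝ) (l : Fin n) :
    ∃ A', ∀ p : Eucl n → Eucl n → ℂ, IsAmp r A p → IsAmp r A' (dx l p) := by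
  choose Φ hΦ using exists_iteratedFDeriv_dx l
  refine ⟨fun a b => ‖Φ b‖ * A a (b + 1), fun p hp =>
    ⟨contDiff_dx hp.smooth l, fun a b x ζ => ?_, fun x ζ h => ?_, fun x ζ h => ?_⟩⟩
  · have h1 : (fun η => iteratedFDeriv ℝ b (fun y => dx l p y η) x) =
      Φ b ∘ fun η => iteratedFDeriv ℝ (b + 1) (fun y => p y η) x := funext fun η => hΦ b p hp.smooth x η
    rw [h1]
    refine ((Φ b).norm_iteratedFDeriv_comp_left (hp.contDiff_iteratedFDeriv (b + 1) x).contDiffAt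
      (by exact_mod_cast le_top)).trans ?_
    gcongr
    exact hp.bound _ _ _ _
  · have h1 : (fun y => p y ζ) = fun _ => 0 := funext fun y => hp.eq_zero y ζ h
    simp [dx, h1]
  · have h1 : (fun y => p y ζ) = fun _ => 0 := funext fun y => hp.eq_zero_near y ζ h
    simp [dx, h1]

end IsAmp

/-- Frequency dilation of an amplitude. -/
def sc (σ : ℝ) (p : Eucl n → Eucl n → ℂ) (x ξ : Eucl n) : ℂ := p x (σ⁻¹ • ξ)

/-- The inner integral of the transposed operator, tested on a translated kernel. -/
def Sg (p : Eucl n → Eucl n → ℂ) (κ : Eucl n → ℂ) (x ξ : Eucl n) : ℂ :=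
  ∫ x', expI (inner ℝ x' ξ) * p x' ξ * κ (x - x')

/-! ### Integration by parts between the amplitude and the kernel of Q_j -/

theorem Sg_integrable {p : Eucl n → Eucl n → ℂ} {κ : Eucl n → ℂ} {M : ℝ} {ξ : Eucl n}
    (hp : Continuous fun x => p x ξ) (hM : ∀ x, ‖p x ξ‖ ≤ M) (hκ : Integrable κ) (x : Eucl n) :
    Integrable fun x' => expI (inner ℝ x' ξ) * p x' ξ * κ (x - x') := by
  refine (hκ.comp_sub_left x).bdd_mul (c := M) ?_ (.of_forall fun x' => ?_)
  · exact ((continuous_expI.comp (by fun_prop)).mul hp).aestronglyMeasurable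
  · rw [norm_mul, norm_expI, one_mul]; exact hM x'

theorem integrable_dil {κ : Eucl n → ℂ} (hκ : Integrable κ) {t : ℝ} (ht : 0 < t) :
    Integrable (dil t κ) := by
  unfold dil
  exact (hκ.comp_smul ht.ne').const_mul _

theorem ker_const_mul (c : ℂ) (P : Eucl n → ℂ) (w : Eucl n) :
    ker (fun η => c * P η) w = c * ker P w := by
  unfold ker freqIntegral
  simp only [mul_assoc]
  rw [integral_const_mul]; ring

theorem fderiv_ker {Q : Eucl n → ℂ} (hQ : IsSymbol Q) (l : Fin n) :
    Differentiable ℝ (ker Q) ∧ ∀ w, fderiv ℝ (ker Q) w (EuclideanSpace.single l 1) =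
      ker (fun η => Complex.I * (η l : ℂ) * Q η) w := by
  set F : SchwartzMap (Eucl n) ℂ := 𝓕⁻ hQ.schwartz with hF
  have hk : ker Q = fun w => (((2 * Real.pi) ^ n : ℝ) : ℂ)⁻¹ * F ((2 * Real.pi)⁻¹ • w) := by
    ext w; rw [ker_eq_fourierInv, hF, SchwartzMap.fourierInv_coe, IsSymbol.coe_schwartz]
  have hd : ∀ w, HasFDerivAt (fun w => F ((2 * Real.pi)⁻¹ • w))
      ((fderiv ℝ F ((2 * Real.pi)⁻¹ • w)).comp ((2 * Real.pi)⁻¹ • ContinuousLinearMap.id ℝ (Eucl n))) w :=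
    fun w => HasFDerivAt.comp (g := F) w (F.differentiableAt.hasFDerivAt)
      (((2 * Real.pi)⁻¹ • ContinuousLinearMap.id ℝ (Eucl n)).hasFDerivAt (x := w))
  have hd2 : ∀ w, HasFDerivAt (ker Q) ((((2 * Real.pi) ^ n : ℝ) : ℂ)⁻¹ •
      (fderiv ℝ F ((2 * Real.pi)⁻¹ • w)).comp ((2 * Real.pi)⁻¹ • ContinuousLinearMap.id ℝ (Eucl n))) w := by
    intro w
    rw [hk]
    exact (hd w).const_mul _
  refine ⟨fun w => (hd2 w).differentiableAt, fun w => ?_⟩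
  rw [(hd2 w).fderiv]
  have h1 := congrArg (fun g : SchwartzMap (Eucl n) ℂ => g ((2 * Real.pi)⁻¹ • w))
    (SchwartzMap.lineDerivOp_fourierInv_eq hQ.schwartz (EuclideanSpace.single l 1))
  have ht : (inner ℝ · (EuclideanSpace.single l (1 : ℝ)) : Eucl n → ℝ).HasTemperateGrowth := by fun_prop
  simp only [SchwartzMap.lineDerivOp_apply_eq_fderiv, SchwartzMap.fourierInv_coe (f := _ • _)] at h1
  have h2 : ⇑((2 * Real.pi * Complex.I) • SchwartzMap.smulLeftCLM ℂ
      (inner ℝ · (EuclideanSpace.single l (1 : ℝ))) hQ.schwartz) =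
      fun η => (2 * Real.pi : ℂ) * (Complex.I * (η l : ℂ) * Q η) := by
    ext η
    rw [smul_apply, SchwartzMap.smulLeftCLM_apply_apply ht, IsSymbol.coe_schwartz,
      EuclideanSpace.inner_single_right, smul_eq_mul, Complex.real_smul]
    simp
    ring
  rw [h2] at h1
  have h3 := ker_eq_fourierInv (fun η => (2 * Real.pi : ℂ) * (Complex.I * (η l : ℂ) * Q η)) w
  rw [ker_const_mul, ← h1] at h3
  have hpi : (2 * Real.pi : ℂ) ≠ 0 := by
    have := Real.pi_ne_zero
    simp [this]
  apply mul_left_cancel₀ hpi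
  rw [h3]
  simp only [smul_apply, ContinuousLinearMap.comp_apply, map_smul, ContinuousLinearMap.id_apply,
    smul_eq_mul, Complex.real_smul]
  push_cast
  field_simp
  rfl

theorem contDiff_I_mul_coord (l : Fin n) : ContDiff ℝ ∞ fun η : Eucl n => Complex.I * (η l : ℂ) :=
  contDiff_const.mul (Complex.ofRealCLM.contDiff.comp (EuclideanSpace.proj (𝕜 := ℝ) l).contDiff)

/-- Integration by parts: a derivative of the kernel produces a frequency factor. -/
theorem mul_Sg_deriv {p : Eucl n → Eucl n → ℂ} {Q : Eucl n → ℂ} (hQ : IsSymbol Q) {τ : ℝ} (hτ : 0 < τ)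
    (l : Fin n) {ξ : Eucl n} (hp : ContDiff ℝ ∞ fun x => p x ξ) {M : ℝ} (hM : ∀ x, ‖p x ξ‖ ≤ M)
    (hM' : ∀ x, ‖dx l p x ξ‖ ≤ M) (x : Eucl n) :
    τ * Sg p (dil τ (ker fun η => Complex.I * (η l : ℂ) * Q η)) x ξ =
      Complex.I * (ξ l : ℂ) * Sg p (dil τ (ker Q)) x ξ + Sg (dx l p) (dil τ (ker Q)) x ξ := by
  set e : Eucl n := EuclideanSpace.single l 1 with he
  set Q' : Eucl n → ℂ := fun η => Complex.I * (η l : ℂ) * Q η with hQ'def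
  have hQ' : IsSymbol Q' := hQ.mul (contDiff_I_mul_coord l)
  have hd := (fderiv_ker hQ l).1
  have hd' : ∀ w, fderiv ℝ (ker Q) w e = ker Q' w := (fderiv_ker hQ l).2
  have hk := integrable_dil hQ.integrable_ker hτ
  have hk' := integrable_dil hQ'.integrable_ker hτ
  have hdk : ∀ x', HasFDerivAt (fun x' => dil τ (ker Q) (x - x'))
      (((τ ^ n : ℝ) : ℂ) • (fderiv ℝ (ker Q) (τ • (x - x'))).comp
        (τ • (-ContinuousLinearMap.id ℝ (Eucl n)))) x' := by
    intro x'
    have h1 : HasFDerivAt (fun x' => τ • (x - x')) (τ • (-ContinuousLinearMap.id ℝ (Eucl n))) x' :=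
      ((hasFDerivAt_id x').const_sub x).const_smul τ
    exact (HasFDerivAt.comp (g := ker Q) x' (hd _).hasFDerivAt h1).const_mul _
  have hdk' : ∀ x', fderiv ℝ (fun x' => dil τ (ker Q) (x - x')) x' e = -τ * dil τ (ker Q') (x - x') := by
    intro x'
    rw [(hdk x').fderiv]
    simp only [smul_apply, ContinuousLinearMap.comp_apply, neg_apply,
      ContinuousLinearMap.id_apply, map_smul, map_neg, hd', smul_eq_mul, Complex.real_smul, dil]
    ring
  have hexp : ∀ x', HasFDerivAt (fun x' : Eucl n => expI (inner ℝ x' ξ))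
      ((expI (inner ℝ x' ξ) * Complex.I) • Complex.ofRealCLM.comp (innerSL ℝ ξ)) x' := by
    intro x'
    have h1 : HasFDerivAt (fun x' : Eucl n => ((inner ℝ x' ξ : ℝ) : ℂ) * Complex.I)
        (Complex.I • Complex.ofRealCLM.comp (innerSL ℝ ξ)) x' := by
      have h2 := ((Complex.ofRealCLM.comp (innerSL ℝ ξ)).hasFDerivAt (x := x')).mul_const Complex.I
      refine h2.congr_of_eventuallyEq (.of_forall fun y => ?_)
      simp [real_inner_comm]
    have h3 := h1.cexp
    rwa [smul_smul] at h3
  have hp1 : ∀ x', HasFDerivAt (fun x' => p x' ξ) (fderiv ℝ (fun x' => p x' ξ) x') x' := fun x' =>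
    (hp.differentiable (by simp) x').hasFDerivAt
  set v : Eucl n → ℂ := fun x' => expI (inner ℝ x' ξ) * p x' ξ with hv
  have hdv : ∀ x', DifferentiableAt ℝ v x' := fun x' => ((hexp x').mul (hp1 x')).differentiableAt
  have hdv' : ∀ x', fderiv ℝ v x' e =
      Complex.I * (ξ l : ℂ) * (expI (inner ℝ x' ξ) * p x' ξ) + expI (inner ℝ x' ξ) * dx l p x' ξ := by
    intro x'
    have h1 : HasFDerivAt v _ x' := (hexp x').mul (hp1 x')
    rw [h1.fderiv]
    simp only [add_apply, smul_apply, ContinuousLinearMap.comp_apply, innerSL_apply_apply, smul_eq_mul,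
      Complex.ofRealCLM_apply, dx, he, EuclideanSpace.inner_single_right]
    simp
    ring
  have hpc : Continuous fun x => p x ξ := hp.continuous
  have hdpc : Continuous fun x => dx l p x ξ := by
    unfold dx
    exact (hp.continuous_fderiv (by simp)).clm_apply continuous_const
  have i1 := Sg_integrable (p := p) hpc hM hk x
  have i2 := Sg_integrable (p := p) hpc hM hk' x
  have i3 := Sg_integrable (p := dx l p) hdpc hM' hk x
  have e1 : (fun x' => fderiv ℝ v x' e * dil τ (ker Q) (x - x')) = fun x' =>
      Complex.I * (ξ l : ℂ) * (expI (inner ℝ x' ξ) * p x' ξ * dil τ (ker Q) (x - x')) +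
        expI (inner ℝ x' ξ) * dx l p x' ξ * dil τ (ker Q) (x - x') := by
    ext x'; rw [hdv']; ring
  have e2 : (fun x' => v x' * fderiv ℝ (fun x' => dil τ (ker Q) (x - x')) x' e) = fun x' =>
      -τ * (expI (inner ℝ x' ξ) * p x' ξ * dil τ (ker Q') (x - x')) := by
    ext x'; rw [hdk']; ring
  -- All three products are integrable, because p and ∂_l p are bounded and the kernels are
  -- integrable, so there are no boundary terms.
  have key := integral_mul_fderiv_eq_neg_fderiv_mul_of_integrable (μ := volume) (f := v)
    (g := fun x' => dil τ (ker Q) (x - x')) (v := e)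
    (by rw [e1]; exact (i1.const_mul _).add i3) (by rw [e2]; exact i2.const_mul _) i1
    (fun x' _ => hdv x') (fun x' _ => (hdk x').differentiableAt)
  rw [e1, e2, integral_const_mul, integral_add (i1.const_mul _) i3, integral_const_mul] at key
  unfold Sg
  linear_combination -key

/-- Functions inverting multiplication by the coordinates away from the origin. -/
theorem exists_inverse_coord (n : ℕ) : ∃ om : Fin n → Eucl n → ℂ, (∀ l, ContDiff ℝ ∞ (om l)) ∧
    ∀ ζ, 1 / 4 ≤ ‖ζ‖ → ∑ l, Complex.I * (ζ l : ℂ) * om l ζ = 1 := by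
  -- The functions sought are -iζ_l/|ζ|². The bump, supported in |ζ| ≤ 1/4, only keeps the
  -- denominator away from zero at the origin.
  let b : ContDiffBump (0 : Eucl n) := ⟨1 / 8, 1 / 4, by norm_num, by norm_num⟩
  have hpos : ∀ ζ : Eucl n, 0 < ‖ζ‖ ^ 2 + b ζ := by
    intro ζ
    by_cases h : ζ = 0
    · have : 0 < b ζ := b.pos_of_mem_ball (by simp [h, b])
      positivity
    · have := b.nonneg (x := ζ)
      have : 0 < ‖ζ‖ := norm_pos_iff.2 h
      positivity
  refine ⟨fun l ζ => -(Complex.I * (ζ l : ℂ)) * (((‖ζ‖ ^ 2 + b ζ)⁻¹ : ℝ) : ℂ), fun l => ?_, fun ζ hζ => ?_⟩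
  · refine (contDiff_I_mul_coord l).neg.mul (Complex.ofRealCLM.contDiff.comp ?_)
    exact ((contDiff_norm_sq ℝ).add b.contDiff).inv fun ζ => (hpos ζ).ne'
  · have hb : b ζ = 0 := b.zero_of_le_dist (by simpa [b] using hζ)
    have h0 : (0 : ℝ) < ‖ζ‖ := by linarith
    have h1 : ∀ l, Complex.I * (ζ l : ℂ) * (-(Complex.I * (ζ l : ℂ)) * (((‖ζ‖ ^ 2 + b ζ)⁻¹ : ℝ) : ℂ)) =
        (((ζ l) ^ 2 * (‖ζ‖ ^ 2)⁻¹ : ℝ) : ℂ) := by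
      intro l
      rw [hb, add_zero]
      push_cast
      linear_combination (-(ζ l : ℂ) ^ 2 * ((‖ζ‖ : ℂ) ^ 2)⁻¹) * Complex.I_sq
    simp only [h1]
    rw [← Complex.ofReal_sum, ← Finset.sum_mul]
    have h2 : ∑ l, (ζ l) ^ 2 = ‖ζ‖ ^ 2 := by rw [EuclideanSpace.norm_sq_eq]; simp
    rw [h2, mul_inv_cancel₀ (by positivity)]
    simp

/-- Bounds of functions `S x ξ` that behave like bounds of a seminorm. -/
structure IsSeminormBound (𝓑 : (Eucl n → Eucl n → ℂ) → ℝ → Prop) : Prop where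
  zero : 𝓑 (fun _ _ => 0) 0
  add : ∀ S S' c c', 𝓑 S c → 𝓑 S' c' → 𝓑 (fun x ξ => S x ξ + S' x ξ) (c + c')
  smul : ∀ S c (t : ℝ), 0 ≤ t → 𝓑 S c → 𝓑 (fun x ξ => (t : ℂ) * S x ξ) (t * c)
  mono : ∀ S c c', c ≤ c' → 𝓑 S c → 𝓑 S c'

theorem IsSeminormBound.sum {𝓑 : (Eucl n → Eucl n → ℂ) → ℝ → Prop} (h : IsSeminormBound 𝓑)
    {ι : Type*} (s : Finset ι) (S : ι → Eucl n → Eucl n → ℂ) (c : ι → ℝ) (hS : ∀ i, 𝓑 (S i) (c i)) :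
    𝓑 (fun x ξ => ∑ i ∈ s, S i x ξ) (∑ i ∈ s, c i) := by
  classical
  induction s using Finset.induction_on with
  | empty => simpa using h.zero
  | insert i s hi ih =>
    simp only [Finset.sum_insert hi]
    exact h.add _ _ _ _ (hS i) ih

variable {r σ τ : ℝ} {A : ℕ → ℕ → ℝ} {p : Eucl n → Eucl n → ℂ} {Q : Eucl n → ℂ}

theorem IsAmp.Sg_integrable (hp : IsAmp r A p) (σ : ℝ) {κ : Eucl n → ℂ} (hκ : Integrable κ)
    (x ξ : Eucl n) : Integrable fun x' => expI (inner ℝ x' ξ) * sc σ p x' ξ * κ (x - x') :=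
  OscInt.Sg_integrable (p := sc σ p) (contDiff_left hp.smooth (σ⁻¹ • ξ)).continuous (fun x => hp.norm_le x _) hκ x

theorem IsAmp.mul_Sg_deriv (hp : IsAmp r A p) (σ : ℝ) (hQ : IsSymbol Q) (hτ : 0 < τ) (l : Fin n)
    (x ξ : Eucl n) : τ * Sg (sc σ p) (dil τ (ker fun η => Complex.I * (η l : ℂ) * Q η)) x ξ =
      Complex.I * (ξ l : ℂ) * Sg (sc σ p) (dil τ (ker Q)) x ξ + Sg (sc σ (dx l p)) (dil τ (ker Q)) x ξ := by
  obtain ⟨A', hA'⟩ := IsAmp.exists_dx r A l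
  exact OscInt.mul_Sg_deriv hQ hτ l (p := sc σ p) (M := max (A 0 0) (A' 0 0))
    (contDiff_left hp.smooth (σ⁻¹ • ξ)) (fun x => (hp.norm_le x _).trans (le_max_left _ _))
    (fun x => ((hA' p hp).norm_le x _).trans (le_max_right _ _)) x

theorem IsAnnular.mul (hQ : IsAnnular Q) {g : Eucl n → ℂ} (hg : ContDiff ℝ ∞ g) :
    IsAnnular fun ζ => g ζ * Q ζ :=
  ⟨hQ.toIsSymbol.mul hg, fun ζ h => by rw [hQ.eq_zero_near ζ h, mul_zero]⟩

/-- The symbol Q vanishes near the origin, so Q = Σ iη_l (om_l Q), and each factor iη_l is τ^{-1}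
times a derivative of the dilated kernel. By parts it falls on e^{ix'·ξ} p, which costs at most σ.
The result has the same shape with a new amplitude and a new symbol, so the step can be iterated. -/
theorem Sg_low_step {om : Fin n → Eucl n → ℂ} (hom : ∀ l, ContDiff ℝ ∞ (om l))
    (hsum : ∀ ζ, 1 / 4 ≤ ‖ζ‖ → ∑ l, Complex.I * (ζ l : ℂ) * om l ζ = 1)
    (hp : IsAmp r A p) (hσ : 0 < σ) (hτ : 0 < τ) (hQ : IsAnnular Q) (x ξ : Eucl n) :
    Sg (sc σ p) (dil τ (ker Q)) x ξ = ∑ l, ((σ / τ : ℝ) : ℂ) *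
      Sg (sc σ fun x ζ => Complex.I * (ζ l : ℂ) * p x ζ + ((σ⁻¹ : ℝ) : ℂ) * dx l p x ζ)
        (dil τ (ker fun η => om l η * Q η)) x ξ := by
  have hQl : ∀ l, IsAnnular fun η => om l η * Q η := fun l => hQ.mul (hom l)
  have hQl' : ∀ l, IsAnnular fun η => Complex.I * (η l : ℂ) * (om l η * Q η) := fun l =>
    (hQl l).mul (contDiff_I_mul_coord l)
  have h1 : ker Q = fun w => ∑ l, ker (fun η => Complex.I * (η l : ℂ) * (om l η * Q η)) w := by
    ext w
    unfold ker freqIntegral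
    rw [← Finset.mul_sum, ← integral_finsetSum]
    · congr 1
      refine integral_congr_ae (.of_forall fun ξ => ?_)
      simp only
      rw [← Finset.sum_mul]
      congr 1
      by_cases h : ‖ξ‖ ≤ 1 / 4
      · simp [hQ.eq_zero_near ξ h]
      · simp only [← mul_assoc]
        rw [← Finset.sum_mul, hsum ξ (le_of_lt (not_le.1 h)), one_mul]
    · intro l _
      refine ((hQl' l).integrable.mul_bdd (c := 1) ?_ (.of_forall fun x => (norm_expI _).le))
      exact (continuous_expI.comp (by fun_prop)).aestronglyMeasurable
  have h2 : Sg (sc σ p) (dil τ (ker Q)) x ξ =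
      ∑ l, Sg (sc σ p) (dil τ (ker fun η => Complex.I * (η l : ℂ) * (om l η * Q η))) x ξ := by
    unfold Sg
    rw [← integral_finsetSum]
    · refine integral_congr_ae (.of_forall fun x' => ?_)
      simp only [dil, h1, Finset.mul_sum]
    · exact fun l _ => hp.Sg_integrable σ (integrable_dil (hQl' l).integrable_ker hτ) x ξ
  rw [h2]
  refine Finset.sum_congr rfl fun l _ => ?_
  have h3 := hp.mul_Sg_deriv σ (hQl l).toIsSymbol hτ l x ξ
  obtain ⟨A', hA'⟩ := IsAmp.exists_dx r A l
  have hk := integrable_dil (hQl l).integrable_ker hτ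
  have i1 := hp.Sg_integrable σ hk x ξ
  have i2 := (hA' p hp).Sg_integrable σ hk x ξ
  have h4 : Sg (sc σ fun x ζ => Complex.I * (ζ l : ℂ) * p x ζ + ((σ⁻¹ : ℝ) : ℂ) * dx l p x ζ)
        (dil τ (ker fun η => om l η * Q η)) x ξ = ((σ⁻¹ : ℝ) : ℂ) *
      (Complex.I * (ξ l : ℂ) * Sg (sc σ p) (dil τ (ker fun η => om l η * Q η)) x ξ +
        Sg (sc σ (dx l p)) (dil τ (ker fun η => om l η * Q η)) x ξ) := by
    unfold Sg
    rw [← integral_const_mul, ← integral_add (i1.const_mul _) i2, ← integral_const_mul]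
    refine integral_congr_ae (.of_forall fun x' => ?_)
    simp only [sc, PiLp.smul_apply, smul_eq_mul, Complex.ofReal_mul]
    ring
  rw [h4, ← h3]
  have hσ' : (σ : ℂ) ≠ 0 := by exact_mod_cast hσ.ne'
  have hτ' : (τ : ℂ) ≠ 0 := by exact_mod_cast hτ.ne'
  push_cast
  field_simp

/-- The reverse exchange: the amplitude vanishes for |ζ| ≤ r with r ≥ 1/4, so Σ iζ_l om_l(ζ) = 1 may
be inserted into it. The factor ξ_l = σζ_l is a derivative of the exponential and moves to the
kernel at cost τ. -/
theorem Sg_high_step {om : Fin n → Eucl n → ℂ} (hom : ∀ l, ContDiff ℝ ∞ (om l))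
    (hsum : ∀ ζ, 1 / 4 ≤ ‖ζ‖ → ∑ l, Complex.I * (ζ l : ℂ) * om l ζ = 1)
    (hr : 1 / 4 ≤ r) (hp : IsAmp r A p) (hσ : 0 < σ) (hτ : 0 < τ) (hQ : IsAnnular Q) (x ξ : Eucl n) :
    Sg (sc σ p) (dil τ (ker Q)) x ξ = ∑ l, ((τ / σ : ℝ) : ℂ) *
      (Sg (sc σ fun x ζ => om l ζ * p x ζ) (dil τ (ker fun η => Complex.I * (η l : ℂ) * Q η)) x ξ +
      Sg (sc σ fun x ζ => -((τ⁻¹ : ℝ) : ℂ) * (om l ζ * dx l p x ζ)) (dil τ (ker Q)) x ξ) := by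
  have hk := integrable_dil hQ.integrable_ker hτ
  have hpl : ∀ l, ∃ A', IsAmp r A' fun x ζ => om l ζ * p x ζ := fun l => by
    obtain ⟨A', hA'⟩ := IsAmp.exists_mul r A (hom l)
    exact ⟨A', hA' p hp⟩
  have h2 : Sg (sc σ p) (dil τ (ker Q)) x ξ =
      ∑ l, Complex.I * (((σ⁻¹ • ξ) l : ℝ) : ℂ) * Sg (sc σ fun x ζ => om l ζ * p x ζ) (dil τ (ker Q)) x ξ := by
    unfold Sg
    simp only [← integral_const_mul]
    rw [← integral_finsetSum]
    · refine integral_congr_ae (.of_forall fun x' => ?_)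
      simp only [sc]
      by_cases h : ‖σ⁻¹ • ξ‖ ≤ r
      · simp [hp.eq_zero_near _ _ h]
      · have h3 := hsum (σ⁻¹ • ξ) (by linarith [not_le.1 h])
        calc _ = expI (inner ℝ x' ξ) * ((∑ l, Complex.I * (((σ⁻¹ • ξ) l : ℝ) : ℂ) * om l (σ⁻¹ • ξ)) *
              p x' (σ⁻¹ • ξ)) * dil τ (ker Q) (x - x') := by rw [h3, one_mul]
          _ = _ := by
            rw [Finset.sum_mul, Finset.mul_sum, Finset.sum_mul]
            exact Finset.sum_congr rfl fun l _ => by ring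
    · intro l _
      obtain ⟨A', hA'⟩ := hpl l
      exact (hA'.Sg_integrable σ hk x ξ).const_mul _
  rw [h2]
  refine Finset.sum_congr rfl fun l _ => ?_
  obtain ⟨A', hA'⟩ := hpl l
  have h3 := hA'.mul_Sg_deriv σ hQ.toIsSymbol hτ l x ξ
  have h5 : (dx l fun x ζ => om l ζ * p x ζ) = fun x ζ => om l ζ * dx l p x ζ := by
    ext x ζ
    unfold dx
    have hd : DifferentiableAt ℝ (fun y => p y ζ) x :=
      (contDiff_left hp.smooth ζ).differentiable (by simp) x
    rw [fderiv_const_mul hd]; rfl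
  have h4 : Sg (sc σ fun x ζ => -((τ⁻¹ : ℝ) : ℂ) * (om l ζ * dx l p x ζ)) (dil τ (ker Q)) x ξ =
      -((τ⁻¹ : ℝ) : ℂ) * Sg (sc σ (dx l fun x ζ => om l ζ * p x ζ)) (dil τ (ker Q)) x ξ := by
    rw [h5]
    unfold Sg
    rw [← integral_const_mul]
    refine integral_congr_ae (.of_forall fun x' => ?_)
    simp only [sc]
    ring
  rw [h4]
  have hσ' : (σ : ℂ) ≠ 0 := by exact_mod_cast hσ.ne'
  have hτ' : (τ : ℂ) ≠ 0 := by exact_mod_cast hτ.ne'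
  simp only [PiLp.smul_apply, smul_eq_mul, Complex.ofReal_mul]
  push_cast
  field_simp
  linear_combination -h3

/-! ### Gain of powers of the frequency ratio, for any seminorm-like bound -/

section Gain

variable {α : Type*} {σ τ E : α → ℝ} {𝓑 : α → (Eucl n → Eucl n → ℂ) → ℝ → Prop}

/-- If the amplitude lives at lower frequencies than the kernel, then bounds improve by powers of
the ratio of the frequencies. -/
theorem low_frequency_gain (hσ : ∀ a, 1 ≤ σ a) (hτ : ∀ a, 0 < τ a)
    (h𝓑 : ∀ a, IsSeminormBound (𝓑 a)) (r : ℝ)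
    (hbase : ∀ A Q, IsAnnular Q → ∃ C, ∀ a p, IsAmp r A p →
      𝓑 a (Sg (sc (σ a) p) (dil (τ a) (ker Q))) (C * E a)) (N : ℕ) :
    ∀ A Q, IsAnnular Q → ∃ C, ∀ a p, IsAmp r A p →
      𝓑 a (Sg (sc (σ a) p) (dil (τ a) (ker Q))) (C * ((σ a / τ a) ^ N * E a)) := by
  induction N with
  | zero => simpa using hbase
  | succ N ih =>
    intro A Q hQ
    obtain ⟨om, hom, hsum⟩ := exists_inverse_coord n
    have h1 : ∀ l : Fin n, ∃ A', ∀ (a : α) (p : Eucl n → Eucl n → ℂ), IsAmp r A p → IsAmp r A'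
        fun x ζ => Complex.I * (ζ l : ℂ) * p x ζ + (((σ a)⁻¹ : ℝ) : ℂ) * dx l p x ζ := by
      intro l
      obtain ⟨A₁, hA₁⟩ := IsAmp.exists_mul r A (contDiff_I_mul_coord l)
      obtain ⟨A₂, hA₂⟩ := IsAmp.exists_dx r A l
      -- Because σ ≥ 1, the term σ^{-1}∂_l p stays in a class with fixed constants.
      refine ⟨_, fun a p hp => (hA₁ p hp).add ((hA₂ p hp).const_mul (M := 1) ?_)⟩
      rw [Complex.norm_real, Real.norm_of_nonneg (inv_nonneg.2 (by linarith [hσ a]))]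
      exact inv_le_one_of_one_le₀ (hσ a)
    choose A' hA' using h1
    choose C hC using fun l => ih (A' l) _ (hQ.mul (hom l))
    refine ⟨∑ l, C l, fun a p hp => ?_⟩
    have hσa : 0 < σ a := by linarith [hσ a]
    have h2 := (h𝓑 a).sum Finset.univ _ _ fun l => (h𝓑 a).smul _ _ (σ a / τ a)
      (div_nonneg hσa.le (hτ a).le) (hC l a _ (hA' l a p hp))
    have h3 : Sg (sc (σ a) p) (dil (τ a) (ker Q)) = _ :=
      funext₂ fun x ξ => Sg_low_step hom hsum hp hσa (hτ a) hQ x ξ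
    rw [h3]
    refine (h𝓑 a).mono _ _ _ (le_of_eq ?_) h2
    rw [Finset.sum_mul]
    exact Finset.sum_congr rfl fun l _ => by ring

/-- If the amplitude lives at higher frequencies than the kernel, then bounds improve by powers of
the ratio of the frequencies. -/
theorem high_frequency_gain (hσ : ∀ a, 1 ≤ σ a) {t₀ : ℝ} (ht₀ : 0 < t₀) (hτ : ∀ a, t₀ ≤ τ a)
    (h𝓑 : ∀ a, IsSeminormBound (𝓑 a)) {r : ℝ} (hr : 1 / 4 ≤ r)
    (hbase : ∀ A Q, IsAnnular Q → ∃ C, ∀ a p, IsAmp r A p →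
      𝓑 a (Sg (sc (σ a) p) (dil (τ a) (ker Q))) (C * E a)) (N : ℕ) :
    ∀ A Q, IsAnnular Q → ∃ C, ∀ a p, IsAmp r A p →
      𝓑 a (Sg (sc (σ a) p) (dil (τ a) (ker Q))) (C * ((τ a / σ a) ^ N * E a)) := by
  induction N with
  | zero => simpa using hbase
  | succ N ih =>
    intro A Q hQ
    obtain ⟨om, hom, hsum⟩ := exists_inverse_coord n
    have h1 : ∀ l : Fin n, ∃ A', ∀ p : Eucl n → Eucl n → ℂ, IsAmp r A p → IsAmp r A'
        fun x ζ => om l ζ * p x ζ := fun l => IsAmp.exists_mul r A (hom l)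
    have h2 : ∀ l : Fin n, ∃ A', ∀ (a : α) (p : Eucl n → Eucl n → ℂ), IsAmp r A p → IsAmp r A'
        fun x ζ => -(((τ a)⁻¹ : ℝ) : ℂ) * (om l ζ * dx l p x ζ) := by
      intro l
      obtain ⟨A₂, hA₂⟩ := IsAmp.exists_dx r A l
      obtain ⟨A₁, hA₁⟩ := IsAmp.exists_mul r A₂ (hom l)
      -- The lower bound on τ, that is j ≥ k₀, keeps the amplitudes τ^{-1}∂_l p in a fixed class. It
      -- makes the constants depend on k₀.
      refine ⟨_, fun a p hp => (hA₁ _ (hA₂ p hp)).const_mul (M := t₀⁻¹) ?_⟩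
      rw [norm_neg, Complex.norm_real, Real.norm_of_nonneg (inv_nonneg.2 (ht₀.le.trans (hτ a)))]
      exact inv_anti₀ ht₀ (hτ a)
    choose A₁ hA₁ using h1
    choose A₂ hA₂ using h2
    choose C₁ hC₁ using fun l => ih (A₁ l) _ (hQ.mul (contDiff_I_mul_coord l))
    choose C₂ hC₂ using fun l => ih (A₂ l) _ hQ
    refine ⟨∑ l, (C₁ l + C₂ l), fun a p hp => ?_⟩
    have hσa : 0 < σ a := by linarith [hσ a]
    have hτa : 0 < τ a := ht₀.trans_le (hτ a)
    have h2 := (h𝓑 a).sum Finset.univ _ _ fun l => (h𝓑 a).smul _ _ (τ a / σ a)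
      (div_nonneg hτa.le hσa.le)
      ((h𝓑 a).add _ _ _ _ (hC₁ l a _ (hA₁ l p hp)) (hC₂ l a _ (hA₂ l a p hp)))
    have h3 : Sg (sc (σ a) p) (dil (τ a) (ker Q)) = _ :=
      funext₂ fun x ξ => Sg_high_step hom hsum hr hp hσa hτa hQ x ξ
    rw [h3]
    refine (h𝓑 a).mono _ _ _ (le_of_eq ?_) h2
    rw [Finset.sum_mul]
    exact Finset.sum_congr rfl fun l _ => by ring

end Gain

/-! ### Phases -/

theorem IsPhase.contDiffAt {s : ℝ} {c : ℕ → ℝ} {φ : Eucl n → ℝ} (hφ : IsPhase s c φ) {ζ : Eucl n}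
    (hζ : ζ ≠ 0) : ContDiffAt ℝ ∞ φ ζ :=
  hφ.smooth.contDiffAt (isOpen_compl_singleton.mem_nhds hζ)

theorem IsPhase.measurable {s : ℝ} {c : ℕ → ℝ} {φ : Eucl n → ℝ} (hφ : IsPhase s c φ) : Measurable φ :=
  measurable_of_continuousOn_compl_singleton 0 hφ.smooth.continuousOn

/-- The bounds |ξ|^{s-a} are homogeneous, so the normalised dilate is a phase with the same
constants. Frequency ρ is thereby reduced to the unit annulus, the phase being multiplied by ρ^s. -/
theorem IsPhase.rescale {s : ℝ} {c : ℕ → ℝ} {φ : Eucl n → ℝ} (hφ : IsPhase s c φ) {ρ : ℝ}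
    (hρ : 0 < ρ) : IsPhase s c fun ζ => ρ ^ (-s) * φ (ρ • ζ) := by
  have hne : ∀ ζ : Eucl n, ζ ≠ 0 → ρ • ζ ≠ 0 := fun ζ hζ => smul_ne_zero hρ.ne' hζ
  refine ⟨contDiffOn_const.mul (hφ.smooth.comp (contDiff_const_smul ρ).contDiffOn hne), fun a ξ hξ => ?_⟩
  let L : Eucl n ≃L[ℝ] Eucl n := ContinuousLinearEquiv.smulLeft (Units.mk0 ρ hρ.ne')
  have hL : (fun ζ => φ (ρ • ζ)) = φ ∘ L := rfl
  have hc : ContDiffAt ℝ a (φ ∘ L) ξ := by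
    rw [← hL]
    exact ((hφ.contDiffAt (hne ξ hξ)).comp ξ (contDiff_const_smul ρ).contDiffAt).of_le
      (by exact_mod_cast le_top)
  have h1 : iteratedFDeriv ℝ a (fun ζ => ρ ^ (-s) * φ (ρ • ζ)) ξ =
      ρ ^ (-s) • iteratedFDeriv ℝ a (φ ∘ L) ξ := iteratedFDeriv_const_smul_apply' (𝕜 := ℝ) (a := ρ ^ (-s)) hc
  have hcr : iteratedFDeriv ℝ a (φ ∘ L) ξ = (iteratedFDeriv ℝ a φ (L ξ)).compContinuousLinearMap
      fun _ => (L : Eucl n →L[ℝ] Eucl n) := by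
    have := L.iteratedFDerivWithin_comp_right φ uniqueDiffOn_univ (Set.mem_univ (L ξ)) a
    simpa only [Set.preimage_univ, iteratedFDerivWithin_univ] using this
  rw [h1, hcr, norm_smul, Real.norm_of_nonneg (by positivity)]
  have h2 := ContinuousMultilinearMap.norm_compContinuousLinearMap_le (iteratedFDeriv ℝ a φ (L ξ))
    fun _ : Fin a => (L : Eucl n →L[ℝ] Eucl n)
  have h3 : ‖(L : Eucl n →L[ℝ] Eucl n)‖ ≤ ρ := by
    refine ContinuousLinearMap.opNorm_le_bound _ hρ.le fun x => ?_
    change ‖ρ • x‖ ≤ _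
    rw [norm_smul, Real.norm_of_nonneg hρ.le]
  have h4 : ∏ _i : Fin a, ‖(L : Eucl n →L[ℝ] Eucl n)‖ ≤ ρ ^ a := by
    rw [Finset.prod_const, Finset.card_univ, Fintype.card_fin]
    gcongr
  have h5 := hφ.bound a (L ξ) (hne ξ hξ)
  have h6 : ‖L ξ‖ = ρ * ‖ξ‖ := by
    change ‖ρ • ξ‖ = _
    rw [norm_smul, Real.norm_of_nonneg hρ.le]
  have h7 : 0 < ‖ξ‖ := norm_pos_iff.2 hξ
  calc _ ≤ ρ ^ (-s) * (c a * ‖L ξ‖ ^ (s - a) * ρ ^ a) := by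
        refine mul_le_mul_of_nonneg_left (h2.trans (mul_le_mul h5 h4 ?_ ((norm_nonneg _).trans h5))) (by positivity)
        exact Finset.prod_nonneg fun _ _ => norm_nonneg _
    _ = c a * ‖ξ‖ ^ (s - a) * (ρ ^ (-s) * ρ ^ (s - a) * ρ ^ (a : ℝ)) := by
        rw [h6, Real.mul_rpow hρ.le h7.le, Real.rpow_natCast]; ring
    _ = _ := by
        have h8 : -s + (s - a) + (a : ℝ) = 0 := by ring
        rw [← Real.rpow_add hρ, ← Real.rpow_add hρ, h8, Real.rpow_zero, mul_one]

theorem exists_phase_bound (s : ℝ) (c : ℕ → ℝ) (N : ℕ) : ∃ K : ℝ, 1 ≤ K ∧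
    ∀ φ : Eucl n → ℝ, IsPhase s c φ → ∀ ζ, 1 / 2 ≤ ‖ζ‖ → ‖ζ‖ ≤ 2 → ∀ a ≤ N,
      ‖iteratedFDeriv ℝ a φ ζ‖ ≤ K := by
  refine ⟨1 + ∑ a ∈ Finset.range (N + 1), |c a| * 2 ^ |s - a|, ?_, fun φ hφ ζ h1 h2 a ha => ?_⟩
  · have : 0 ≤ ∑ a ∈ Finset.range (N + 1), |c a| * (2 : ℝ) ^ |s - a| :=
      Finset.sum_nonneg fun a _ => by positivity
    linarith
  · have h0 : 0 < ‖ζ‖ := by linarith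
    have h3 : ‖ζ‖ ^ (s - a) ≤ 2 ^ |s - a| := by
      rcases le_total 0 (s - a) with h | h
      · rw [abs_of_nonneg h]
        exact Real.rpow_le_rpow h0.le h2 h
      · rw [abs_of_nonpos h, Real.rpow_neg zero_le_two, ← Real.inv_rpow zero_le_two]
        exact Real.rpow_le_rpow_of_nonpos (by norm_num) (by linarith) h
    calc _ ≤ c a * ‖ζ‖ ^ (s - a) := hφ.bound a ζ (norm_pos_iff.1 h0)
      _ ≤ |c a| * 2 ^ |s - a| := by
          gcongr
          exact le_abs_self _
      _ ≤ ∑ a ∈ Finset.range (N + 1), |c a| * (2 : ℝ) ^ |s - a| :=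
          Finset.single_le_sum (f := fun a : ℕ => |c a| * (2 : ℝ) ^ |s - a|) (fun a _ => by positivity)
            (Finset.mem_range.2 (by omega))
      _ ≤ _ := by linarith

/-- The singularity of φ at the origin is invisible because p vanishes for |ζ| ≤ 1/2. -/
theorem isSymbol_comp_phase {s : ℝ} {c : ℕ → ℝ} {φ : Eucl n → ℝ} (hφ : IsPhase s c φ)
    {A : ℕ → ℕ → ℝ} {p : Eucl n → Eucl n → ℂ} (hp : IsAmp (1 / 2) A p) {g : ℝ → ℂ}
    (hg : ContDiff ℝ ∞ g) (x : Eucl n) : IsSymbol fun ζ => g (φ ζ) * p x ζ := by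
  refine ⟨contDiff_iff_contDiffAt.2 fun ζ => ?_, fun ζ hζ => by rw [hp.eq_zero x ζ (by linarith), mul_zero]⟩
  by_cases h : ζ = 0
  · refine (contDiffAt_const (c := 0)).congr_of_eventuallyEq ?_
    filter_upwards [Metric.ball_mem_nhds ζ (show (0 : ℝ) < 1 / 2 by norm_num)] with η hη
    rw [h, Metric.mem_ball, dist_zero_right] at hη
    rw [hp.eq_zero_near x η hη.le, mul_zero]
  · exact (hg.contDiffAt.comp ζ (hφ.contDiffAt h)).mul (contDiff_right hp.smooth x).contDiffAt

/-- Functions of a phase times an annular amplitude. -/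
theorem exists_norm_iteratedFDeriv_comp_phase_le (s : ℝ) (c : ℕ → ℝ) (A : ℕ → ℕ → ℝ) (N : ℕ) :
    ∃ K C : ℝ, 1 ≤ K ∧ 0 ≤ C ∧ ∀ (φ : Eucl n → ℝ) (p : Eucl n → Eucl n → ℂ) (g : ℝ → ℂ) (B L : ℝ),
      IsPhase s c φ → IsAmp (1 / 2) A p → ContDiff ℝ ∞ g → 0 ≤ B → 1 ≤ L →
      (∀ i ≤ N, ∀ t, |t| ≤ K → ‖iteratedDeriv i g t‖ ≤ B * L ^ i) →
      ∀ m ≤ N, ∀ x ζ, ‖iteratedFDeriv ℝ m (fun ζ => g (φ ζ) * p x ζ) ζ‖ ≤ C * B * L ^ m := by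
  obtain ⟨K, hK1, hK⟩ := exists_phase_bound (n := n) s c N
  refine ⟨K, ∑ m ∈ Finset.range (N + 1), ∑ i ∈ Finset.range (m + 1),
    (m.choose i : ℝ) * (i.factorial * K ^ i) * |A (m - i) 0|, hK1, by positivity,
    fun φ p g B L hφ hp hg hB hL hgB m hm x ζ => ?_⟩
  have hK0 : 0 ≤ K := by linarith
  have hL0 : 0 ≤ L := by linarith
  by_cases hζ : 1 / 2 ≤ ‖ζ‖ ∧ ‖ζ‖ ≤ 2
  · have h0 : ζ ≠ 0 := norm_pos_iff.1 (by linarith [hζ.1])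
    have hopen : IsOpen ({0}ᶜ : Set (Eucl n)) := isOpen_compl_singleton
    have hcomp : ∀ i ≤ m, ‖iteratedFDerivWithin ℝ i (g ∘ φ) {0}ᶜ ζ‖ ≤
        i.factorial * (B * L ^ i) * K ^ i := by
      intro i hi
      refine norm_iteratedFDerivWithin_comp_le (N := ∞) (t := Set.univ) hg.contDiffOn hφ.smooth
        (by exact_mod_cast le_top) uniqueDiffOn_univ hopen.uniqueDiffOn (Set.mapsTo_univ _ _) h0
        (fun k hk => ?_) fun k hk1 hk => ?_
      · rw [iteratedFDerivWithin_univ, norm_iteratedFDeriv_eq_norm_iteratedDeriv]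
        have ht : |φ ζ| ≤ K := by simpa using hK φ hφ ζ hζ.1 hζ.2 0 (by omega)
        refine (hgB k (by omega) _ ht).trans ?_
        gcongr
      · rw [iteratedFDerivWithin_of_isOpen k hopen h0]
        exact (hK φ hφ ζ hζ.1 hζ.2 k (by omega)).trans (le_self_pow₀ hK1 (by omega))
    have h1 : iteratedFDeriv ℝ m (fun ζ => g (φ ζ) * p x ζ) ζ =
        iteratedFDerivWithin ℝ m (fun ζ => (g ∘ φ) ζ * p x ζ) {0}ᶜ ζ :=
      (iteratedFDerivWithin_of_isOpen m hopen h0).symm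
    rw [h1]
    have hpx : ContDiff ℝ ∞ (p x) := contDiff_right hp.smooth x
    refine (norm_iteratedFDerivWithin_mul_le (N := ∞) (hg.comp_contDiffOn hφ.smooth) hpx.contDiffOn
      hopen.uniqueDiffOn h0 (by exact_mod_cast le_top)).trans ?_
    calc _ ≤ ∑ i ∈ Finset.range (m + 1),
          (m.choose i : ℝ) * (i.factorial * K ^ i) * |A (m - i) 0| * (B * L ^ m) := by
          refine Finset.sum_le_sum fun i hi => ?_
          have hi' : i ≤ m := by have := Finset.mem_range.1 hi; omega
          have h2 := hcomp i hi'
          have h3 : ‖iteratedFDerivWithin ℝ (m - i) (p x) {0}ᶜ ζ‖ ≤ |A (m - i) 0| := by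
            rw [iteratedFDerivWithin_of_isOpen _ hopen h0]
            exact (hp.norm_iteratedFDeriv_le _ x ζ).trans (le_abs_self _)
          have h4 : L ^ i ≤ L ^ m := pow_le_pow_right₀ hL hi'
          calc _ ≤ (m.choose i : ℝ) * (i.factorial * (B * L ^ m) * K ^ i) * |A (m - i) 0| := by
                refine mul_le_mul (mul_le_mul_of_nonneg_left (h2.trans ?_) (by positivity)) h3
                  (norm_nonneg _) (by positivity)
                gcongr
            _ = _ := by ring
      _ = (∑ i ∈ Finset.range (m + 1),
          (m.choose i : ℝ) * (i.factorial * K ^ i) * |A (m - i) 0|) * (B * L ^ m) := by rw [Finset.sum_mul]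
      _ ≤ _ := by
          rw [mul_assoc]
          refine mul_le_mul_of_nonneg_right ?_ (by positivity)
          exact Finset.single_le_sum (f := fun m : ℕ => ∑ i ∈ Finset.range (m + 1),
            (m.choose i : ℝ) * (i.factorial * K ^ i) * |A (m - i) 0|) (fun m _ => by positivity)
            (Finset.mem_range.2 (by omega))
  · have hz : (fun ζ => g (φ ζ) * p x ζ) =ᶠ[nhds ζ] fun _ => 0 := by
      have hcl : IsOpen {ζ : Eucl n | ¬(1 / 2 ≤ ‖ζ‖ ∧ ‖ζ‖ ≤ 2)} :=
        ((isClosed_le continuous_const continuous_norm).inter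
          (isClosed_le continuous_norm continuous_const)).isOpen_compl
      filter_upwards [hcl.mem_nhds hζ] with η hη
      have hη' : ¬(1 / 2 ≤ ‖η‖ ∧ ‖η‖ ≤ 2) := hη
      rw [not_and_or, not_le, not_le] at hη'
      rcases hη' with h | h
      · rw [hp.eq_zero_near x η h.le, mul_zero]
      · rw [hp.eq_zero x η h.le, mul_zero]
    rw [(hz.iteratedFDeriv ℝ m).eq_of_nhds]
    simp only [iteratedFDeriv_fun_zero, Pi.zero_apply, norm_zero]
    positivity

theorem hasDerivAt_expI_mul (μ t : ℝ) :
    HasDerivAt (fun t => expI (μ * t)) (μ * Complex.I * expI (μ * t)) t := by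
  have h1 : HasDerivAt (fun t : ℝ => ((μ * t : ℝ) : ℂ) * Complex.I) (μ * Complex.I) t := by
    have := ((hasDerivAt_id t).const_mul μ).ofReal_comp.mul_const Complex.I
    simpa using this
  have := h1.cexp
  unfold expI
  rwa [mul_comm] at this

theorem contDiff_expI : ContDiff ℝ ∞ expI :=
  (Complex.ofRealCLM.contDiff.mul contDiff_const).cexp

theorem iteratedDeriv_expI_mul (μ : ℝ) (i : ℕ) :
    iteratedDeriv i (fun t => expI (μ * t)) = fun t => (μ * Complex.I) ^ i * expI (μ * t) := by
  induction i with
  | zero => simp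
  | succ i ih =>
    rw [iteratedDeriv_succ, ih]
    ext t
    rw [((hasDerivAt_expI_mul μ t).const_mul _).deriv]
    ring

theorem norm_expI_sub_one_le (t : ℝ) : ‖expI t - 1‖ ≤ |t| := by
  unfold expI
  rw [mul_comm]
  simpa using Real.norm_exp_I_mul_ofReal_sub_one_le (x := t)

theorem exists_exp_phase_bound (s : ℝ) (c : ℕ → ℝ) (A : ℕ → ℕ → ℝ) (N : ℕ) : ∃ C : ℝ, 0 ≤ C ∧
    ∀ (φ : Eucl n → ℝ) (p : Eucl n → Eucl n → ℂ) (μ : ℝ),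
      IsPhase s c φ → IsAmp (1 / 2) A p → 1 ≤ μ → ∀ m ≤ N, ∀ x ζ,
      ‖iteratedFDeriv ℝ m (fun ζ => expI (μ * φ ζ) * p x ζ) ζ‖ ≤ C * μ ^ m := by
  obtain ⟨K, C, -, hC0, hC⟩ := exists_norm_iteratedFDeriv_comp_phase_le (n := n) s c A N
  refine ⟨C, hC0, fun φ p μ hφ hp hμ m hm x ζ => ?_⟩
  have := hC φ p (fun t => expI (μ * t)) 1 μ hφ hp (contDiff_expI.comp (contDiff_const.mul contDiff_id))
    zero_le_one hμ (fun i _ t _ => ?_) m hm x ζ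
  · simpa using this
  · rw [iteratedDeriv_expI_mul]
    simp [norm_expI, abs_of_pos (show 0 < μ by linarith)]

/-- The inequality |e^{iμt} - 1| ≤ μ|t| gives one factor μ, and each derivative in t carries at
least one. The bound μ ≤ M absorbs all further powers. -/
theorem exists_exp_phase_sub_one_bound (s : ℝ) (c : ℕ → ℝ) (A : ℕ → ℕ → ℝ) (M : ℝ) (hM : 1 ≤ M) (N : ℕ) :
    ∃ C : ℝ, 0 ≤ C ∧ ∀ (φ : Eucl n → ℝ) (p : Eucl n → Eucl n → ℂ) (μ : ℝ),
      IsPhase s c φ → IsAmp (1 / 2) A p → 0 ≤ μ → μ ≤ M → ∀ m ≤ N, ∀ x ζ,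
      ‖iteratedFDeriv ℝ m (fun ζ => (expI (μ * φ ζ) - 1) * p x ζ) ζ‖ ≤ C * μ := by
  obtain ⟨K, C, hK1, hC0, hC⟩ := exists_norm_iteratedFDeriv_comp_phase_le (n := n) s c A N
  have hM0 : 0 ≤ M := by linarith
  refine ⟨C * K * M ^ N, by positivity, fun φ p μ hφ hp hμ hμM m hm x ζ => ?_⟩
  have := hC φ p (fun t => expI (μ * t) - 1) (μ * K) M hφ hp
    ((contDiff_expI.comp (contDiff_const.mul contDiff_id)).sub contDiff_const)
    (by positivity) hM (fun i _ t ht => ?_) m hm x ζ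
  · refine this.trans ?_
    calc C * (μ * K) * M ^ m ≤ C * (μ * K) * M ^ N := by gcongr
      _ = _ := by ring
  · cases i with
    | zero =>
      simp only [iteratedDeriv_zero, pow_zero, mul_one]
      refine (norm_expI_sub_one_le _).trans ?_
      rw [abs_mul, abs_of_nonneg hμ]
      gcongr
    | succ i =>
      have h1 : deriv (fun t => expI (μ * t) - 1) = deriv fun t => expI (μ * t) := by
        ext t; rw [deriv_sub_const]
      rw [iteratedDeriv_succ', h1, ← iteratedDeriv_succ', iteratedDeriv_expI_mul]
      simp only [norm_mul, norm_pow, Complex.norm_real, Complex.norm_I, norm_expI, mul_one,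
        Real.norm_of_nonneg hμ]
      calc μ ^ (i + 1) = μ * 1 * (μ ^ i * 1) := by ring
        _ ≤ μ * K * (M ^ i * M) := by gcongr
        _ = _ := by ring

/-! ### Dyadic frequency pieces -/

/-- The dyadic partition function `ϑ(ζ) - ϑ(2 ζ)`. -/
def bet (ϑ : Eucl n → ℝ) (ζ : Eucl n) : ℂ := ((ϑ ζ - ϑ ((2 : ℝ) • ζ) : ℝ) : ℂ)

variable {ϑ : Eucl n → ℝ}

theorem IsCutoff.contDiff_ofReal (hϑ : IsCutoff ϑ) : ContDiff ℝ ∞ fun ζ => (ϑ ζ : ℂ) :=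
  Complex.ofRealCLM.contDiff.comp hϑ.smooth

theorem IsCutoff.contDiff_bet (hϑ : IsCutoff ϑ) : ContDiff ℝ ∞ (bet ϑ) :=
  Complex.ofRealCLM.contDiff.comp (hϑ.smooth.sub (hϑ.smooth.comp (contDiff_const_smul _)))

theorem IsCutoff.bet_eq_zero (hϑ : IsCutoff ϑ) {ζ : Eucl n} (h : 2 ≤ ‖ζ‖) : bet ϑ ζ = 0 := by
  unfold bet
  rw [hϑ.eq_zero ζ h, hϑ.eq_zero _ (by rw [norm_smul]; norm_num; linarith)]
  simp

theorem IsCutoff.bet_eq_zero_near (hϑ : IsCutoff ϑ) {ζ : Eucl n} (h : ‖ζ‖ ≤ 1 / 2) : bet ϑ ζ = 0 := by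
  unfold bet
  rw [hϑ.eq_one ζ (by linarith), hϑ.eq_one _ (by rw [norm_smul]; norm_num; linarith)]
  simp

/-- Annular pieces of an amplitude at frequencies `≤ 2`. -/
theorem exists_isAmp_bet_mul_comp_smul (hϑ : IsCutoff ϑ) (r : ℝ) (A : ℕ → ℕ → ℝ) :
    ∃ A', ∀ p (ρ : ℝ), IsAmp r A p → 0 ≤ ρ → ρ ≤ 2 →
      IsAmp (1 / 2) A' fun x ζ => bet ϑ ζ * p x (ρ • ζ) := by
  obtain ⟨B, hB0, hB⟩ := exists_bound_closedBall hϑ.contDiff_bet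
  refine ⟨_, fun p ρ hp hρ0 hρ => isAmp_mul (A := fun a b => 2 ^ a * |A a b|) ?_ (fun a b => by positivity)
    (fun a b x ζ _ _ => ?_) hϑ.contDiff_bet hB0 hB
    (fun x ζ h => by rw [hϑ.bet_eq_zero h, zero_mul])
    (fun x ζ h => by rw [hϑ.bet_eq_zero_near h, zero_mul])⟩
  · exact hp.smooth.comp (contDiff_fst.prodMk ((contDiff_const_smul _).comp contDiff_snd))
  · have hc : ContDiff ℝ a fun η => iteratedFDeriv ℝ b (fun y => p y η) x :=
      (hp.contDiff_iteratedFDeriv b x).of_le (by exact_mod_cast le_top)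
    have h := iteratedFDeriv_comp_const_smul ρ hc
    rw [h, norm_smul, norm_pow, Real.norm_of_nonneg hρ0]
    gcongr
    exact (hp.bound a b x _).trans (le_abs_self _)

theorem IsAmp.isSymbol {r : ℝ} {A : ℕ → ℕ → ℝ} {p : Eucl n → Eucl n → ℂ} (hp : IsAmp r A p)
    (x : Eucl n) : IsSymbol (p x) :=
  ⟨contDiff_right hp.smooth x, fun ζ hζ => hp.eq_zero x ζ (by linarith)⟩

theorem exists_ker_le_wt (n N : ℕ) : ∃ C : ℝ, 0 ≤ C ∧ ∀ (P : Eucl n → ℂ) (B : ℝ), IsSymbol P →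
    (∀ m ≤ N, ∀ ζ, ‖iteratedFDeriv ℝ m P ζ‖ ≤ B) → ∀ w, ‖ker P w‖ ≤ C * B * wt N w := by
  obtain ⟨C, hC0, hC⟩ := exists_ker_decay n N
  exact ⟨C, hC0, fun P B hP hB w => le_mul_wt_of_mul_pow_le (hC P B hP hB w)⟩

theorem integrable_mul_expI {P : Eucl n → ℂ} (hP : Integrable P) (w : Eucl n) :
    Integrable fun ξ => P ξ * expI (inner ℝ w ξ) :=
  hP.mul_bdd (c := 1) (continuous_expI.comp (by fun_prop)).aestronglyMeasurable
    (.of_forall fun x => (norm_expI _).le)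

theorem ker_add {P R : Eucl n → ℂ} (hP : Integrable P) (hR : Integrable R) (w : Eucl n) :
    ker (fun ξ => P ξ + R ξ) w = ker P w + ker R w := by
  unfold ker freqIntegral
  rw [← mul_add, ← integral_add (integrable_mul_expI hP w) (integrable_mul_expI hR w)]
  simp only [add_mul]

theorem ker_finsetSum {ι : Type*} (s : Finset ι) (P : ι → Eucl n → ℂ) (hP : ∀ i, Integrable (P i))
    (w : Eucl n) : ker (fun ξ => ∑ i ∈ s, P i ξ) w = ∑ i ∈ s, ker (P i) w := by
  unfold ker freqIntegral
  rw [← Finset.mul_sum, ← integral_finsetSum _ fun i _ => integrable_mul_expI (hP i) w]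
  simp only [Finset.sum_mul]

/-- The decay exponent n+1 is lowered to n+γ, and ρ(1+t) ≤ 2(1+ρt) for ρ ≤ 2 removes ρ from the
weight at the price of ρ^{-n-γ}. The remaining power ρ^{s-γ} is summable over dyadic ρ once γ < s.
-/
theorem dyadic_decay {ρ s γ t : ℝ} (hρ0 : 0 < ρ) (hρ : ρ ≤ 2) (hγ : 0 ≤ γ) (hγ1 : γ ≤ 1) (ht : 0 ≤ t) :
    ρ ^ n * ρ ^ s * (1 + ρ * t) ^ (-((n + 1 : ℕ) : ℝ)) ≤
      ρ ^ (s - γ) * (2 ^ ((n : ℝ) + γ) * (1 + t) ^ (-((n : ℝ) + γ))) := by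
  have h1 : (1 + ρ * t) ^ (-((n + 1 : ℕ) : ℝ)) ≤ (1 + ρ * t) ^ (-((n : ℝ) + γ)) := by
    refine Real.rpow_le_rpow_of_exponent_le ?_ ?_
    · have : 0 ≤ ρ * t := by positivity
      linarith
    · push_cast; linarith
  have h2 : (ρ * (1 + t)) ^ ((n : ℝ) + γ) ≤ (2 * (1 + ρ * t)) ^ ((n : ℝ) + γ) := by
    refine Real.rpow_le_rpow (by positivity) ?_ (by positivity)
    nlinarith [mul_nonneg hρ0.le ht]
  have h1t : 0 < 1 + t := by linarith
  have hρt : 0 < 1 + ρ * t := by positivity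
  rw [Real.mul_rpow hρ0.le h1t.le, Real.mul_rpow zero_le_two hρt.le] at h2
  have e : ρ ^ n * ρ ^ s = ρ ^ (s - γ) * ρ ^ ((n : ℝ) + γ) := by
    rw [← Real.rpow_natCast, ← Real.rpow_add hρ0, ← Real.rpow_add hρ0]
    congr 1; ring
  calc _ ≤ ρ ^ n * ρ ^ s * (1 + ρ * t) ^ (-((n : ℝ) + γ)) := by gcongr
    _ = ρ ^ (s - γ) * (ρ ^ ((n : ℝ) + γ) * (1 + ρ * t) ^ (-((n : ℝ) + γ))) := by rw [e]; ring
    _ ≤ _ := by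
        refine mul_le_mul_of_nonneg_left ?_ (by positivity)
        rw [Real.rpow_neg hρt.le, Real.rpow_neg h1t.le, ← div_eq_mul_inv, ← div_eq_mul_inv,
          div_le_div_iff₀ (by positivity) (by positivity)]
        exact h2

/-- Kernels at low frequencies, where the phase is singular at the origin. -/
theorem exists_low_ker_bound (hn : 1 ≤ n) (hϑ : IsCutoff ϑ) {s : ℝ} (hs : 0 < s) (c : ℕ → ℝ) (r : ℝ)
    (A : ℕ → ℕ → ℝ) : ∃ C : ℝ, 0 ≤ C ∧ ∀ (φ : Eucl n → ℝ) (p : Eucl n → Eucl n → ℂ),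
      IsPhase s c φ → IsAmp r A p → ∀ x w,
      ‖ker (fun ζ => expI (φ ζ) * p x ζ) w‖ ≤ C * wt (n + min s 1 / 2) w := by
  obtain ⟨A', hA'⟩ := exists_isAmp_bet_mul_comp_smul hϑ r A
  obtain ⟨C₁, hC₁0, hC₁⟩ := exists_exp_phase_sub_one_bound (n := n) s c A' (2 ^ s)
    (Real.one_le_rpow one_le_two hs.le) (n + 1)
  obtain ⟨C₂, hC₂0, hC₂⟩ := exists_ker_le_wt n (n + 1)
  -- The value satisfies 0 < γ ≤ 1 and γ < s: the first makes the decay n+γ integrable, the second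
  -- makes the dyadic sum converge.
  set γ : ℝ := min s 1 / 2 with hγ
  have hγ0 : 0 < γ := by have := lt_min hs one_pos; positivity
  have hγ1 : γ ≤ 1 := by have := min_le_right s 1; linarith
  have hγs : 0 < s - γ := by have := min_le_left s 1; linarith
  set G : ℝ := ∑ m ∈ Finset.range (n + 2), |A m 0| with hG
  have hG0 : 0 ≤ G := Finset.sum_nonneg fun _ _ => abs_nonneg _
  set θ : ℝ := (2 : ℝ) ^ (-(s - γ)) with hθ
  have hθ0 : 0 < θ := by positivity
  have hθ1 : θ < 1 := Real.rpow_lt_one_of_one_lt_of_neg one_lt_two (by linarith)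
  refine ⟨C₂ * G + C₂ * C₁ * 2 ^ ((n : ℝ) + γ) * (2 ^ (s - γ) * (1 - θ)⁻¹), ?_, fun φ p hφ hp x w => ?_⟩
  · have : 0 < 1 - θ := by linarith
    positivity
  -- The radii start at 2 so that ϑ(ξ/ρ₀) = 1 on the support of p. The annuli then exhaust that
  -- support down to the origin.
  set ρ : ℕ → ℝ := fun m => 2 * (2⁻¹) ^ m with hρ
  have hρ0 : ∀ m, 0 < ρ m := fun m => by positivity
  have hρ2 : ∀ m, ρ m ≤ 2 := fun m => by
    have : ((2 : ℝ)⁻¹) ^ m ≤ 1 := pow_le_one₀ (by norm_num) (by norm_num)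
    simp only [hρ]; linarith
  have hmeas : ∀ x, AEStronglyMeasurable (fun ζ => (expI (φ ζ) - 1) * p x ζ) volume := fun x => by
    have h1 : Measurable fun ζ => expI (φ ζ) := continuous_expI.measurable.comp hφ.measurable
    have h2 : Measurable (p x) := (hp.isSymbol x).smooth.continuous.measurable
    exact ((h1.sub_const 1).mul h2).aestronglyMeasurable
  have hnorm : ∀ ζ, ‖(expI (φ ζ) - 1) * p x ζ‖ ≤ 2 * ‖p x ζ‖ := fun ζ => by
    rw [norm_mul]
    gcongr
    refine (norm_sub_le _ _).trans ?_
    rw [norm_expI, norm_one]; norm_num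
  have hint : Integrable fun ζ => (expI (φ ζ) - 1) * p x ζ :=
    ((hp.isSymbol x).integrable.norm.const_mul 2).mono' (hmeas x) (.of_forall hnorm)
  set H : ℕ → Eucl n → ℂ := fun m ζ => (expI (φ (ρ m • ζ)) - 1) * (bet ϑ ζ * p x (ρ m • ζ)) with hH
  have hφm : ∀ m, IsPhase s c fun ζ => ρ m ^ (-s) * φ (ρ m • ζ) := fun m => hφ.rescale (hρ0 m)
  have hHeq : ∀ m, H m = fun ζ => (expI (ρ m ^ s * (ρ m ^ (-s) * φ (ρ m • ζ))) - 1) *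
      (bet ϑ ζ * p x (ρ m • ζ)) := fun m => by
    ext ζ
    rw [← mul_assoc (ρ m ^ s), ← Real.rpow_add (hρ0 m), add_neg_cancel, Real.rpow_zero, one_mul]
  have hHsym : ∀ m, IsSymbol (H m) := fun m => by
    rw [hHeq]
    exact isSymbol_comp_phase (hφm m) (hA' p (ρ m) hp (hρ0 m).le (hρ2 m))
      (g := fun t => expI (ρ m ^ s * t) - 1)
      ((contDiff_expI.comp (contDiff_const.mul contDiff_id)).sub contDiff_const) x
  have hHker : ∀ m, ‖ker (fun ξ => H m ((ρ m)⁻¹ • ξ)) w‖ ≤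
      C₂ * C₁ * 2 ^ ((n : ℝ) + γ) * wt (n + γ) w * (2 ^ (s - γ) * θ ^ m) := fun m => by
    have h1 : ∀ k ≤ n + 1, ∀ ζ, ‖iteratedFDeriv ℝ k (H m) ζ‖ ≤ C₁ * ρ m ^ s := fun k hk ζ => by
      rw [hHeq]
      exact hC₁ _ (fun x ζ => bet ϑ ζ * p x (ρ m • ζ)) (ρ m ^ s) (hφm m)
        (hA' p (ρ m) hp (hρ0 m).le (hρ2 m)) (by have := hρ0 m; positivity)
        (Real.rpow_le_rpow (hρ0 m).le (hρ2 m) hs.le) k hk x ζ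
    have h2 := hC₂ (H m) _ (hHsym m) h1 (ρ m • w)
    rw [ker_comp_inv_smul _ (hρ0 m)]
    unfold dil
    rw [norm_mul, Complex.norm_real, Real.norm_of_nonneg (by have := hρ0 m; positivity)]
    have h3 := dyadic_decay (n := n) (s := s) (hρ0 m) (hρ2 m) hγ0.le hγ1 (norm_nonneg w)
    have h4 : wt ((n + 1 : ℕ) : ℝ) (ρ m • w) = (1 + ρ m * ‖w‖) ^ (-((n + 1 : ℕ) : ℝ)) := by
      unfold wt; rw [norm_smul, Real.norm_of_nonneg (hρ0 m).le]
    have h5 : ρ m ^ (s - γ) = 2 ^ (s - γ) * θ ^ m := by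
      simp only [hρ, hθ]
      rw [Real.mul_rpow zero_le_two (by positivity), ← Real.rpow_natCast, ← Real.rpow_natCast,
        ← Real.rpow_mul (by norm_num), ← Real.rpow_mul (by norm_num), Real.inv_rpow zero_le_two,
        ← Real.rpow_neg zero_le_two]
      congr 2; ring
    calc _ ≤ ρ m ^ n * (C₂ * (C₁ * ρ m ^ s) * wt ((n + 1 : ℕ) : ℝ) (ρ m • w)) :=
          mul_le_mul_of_nonneg_left h2 (by have := hρ0 m; positivity)
      _ = C₂ * C₁ * (ρ m ^ n * ρ m ^ s * (1 + ρ m * ‖w‖) ^ (-((n + 1 : ℕ) : ℝ))) := by rw [h4]; ring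
      _ ≤ C₂ * C₁ * (ρ m ^ (s - γ) * (2 ^ ((n : ℝ) + γ) * (1 + ‖w‖) ^ (-((n : ℝ) + γ)))) :=
          mul_le_mul_of_nonneg_left h3 (by positivity)
      _ = _ := by rw [h5]; unfold wt; ring
  -- The annular cut-offs telescope, and the partial sums are the full symbol times 1 - ϑ(ξ/ρ_M).
  -- They are dominated by it.
  have htel : ∀ M ξ, ∑ m ∈ Finset.range M, H m ((ρ m)⁻¹ • ξ) =
      (expI (φ ξ) - 1) * p x ξ * (1 - (ϑ ((ρ M)⁻¹ • ξ) : ℂ)) := fun M ξ => by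
    have h1 : ∀ m, H m ((ρ m)⁻¹ • ξ) = (expI (φ ξ) - 1) * p x ξ *
        ((1 - (ϑ ((ρ (m + 1))⁻¹ • ξ) : ℂ)) - (1 - (ϑ ((ρ m)⁻¹ • ξ) : ℂ))) := fun m => by
      have h2 : (2 : ℝ) • (ρ m)⁻¹ • ξ = (ρ (m + 1))⁻¹ • ξ := by
        rw [smul_smul]; congr 1
        simp only [hρ, pow_succ]; field_simp
      simp only [hH, bet, smul_inv_smul₀ (hρ0 m).ne', h2]
      push_cast; ring
    simp only [h1]
    rw [← Finset.mul_sum, Finset.sum_range_sub fun m => 1 - (ϑ ((ρ m)⁻¹ • ξ) : ℂ)]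
    by_cases h : ‖ξ‖ ≤ 2
    · have : ϑ ((ρ 0)⁻¹ • ξ) = 1 := hϑ.eq_one _ (by simp [hρ, norm_smul]; linarith)
      rw [this]; simp
    · rw [hp.eq_zero x ξ (le_of_lt (not_le.1 h))]; simp
  have hlim : Filter.Tendsto (fun M => ker (fun ξ => ∑ m ∈ Finset.range M, H m ((ρ m)⁻¹ • ξ)) w)
      Filter.atTop (nhds (ker (fun ζ => (expI (φ ζ) - 1) * p x ζ) w)) := by
    unfold ker freqIntegral
    refine Filter.Tendsto.const_mul _ ?_
    refine tendsto_integral_of_dominated_convergence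
      (fun ζ => ‖(expI (φ ζ) - 1) * p x ζ‖) (fun M => ?_) hint.norm (fun M => .of_forall fun ξ => ?_) ?_
    · simp only [htel]
      refine AEStronglyMeasurable.mul (AEStronglyMeasurable.mul (hmeas x) ?_) ?_
      · have : Continuous fun ξ => 1 - (ϑ ((ρ M)⁻¹ • ξ) : ℂ) :=
          continuous_const.sub (hϑ.contDiff_ofReal.continuous.comp (continuous_const_smul _))
        exact this.aestronglyMeasurable
      · exact (continuous_expI.comp (by fun_prop)).aestronglyMeasurable
    · simp only [htel]
      rw [norm_mul, norm_mul, norm_expI, mul_one]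
      refine mul_le_of_le_one_right (norm_nonneg _) ?_
      rw [← Complex.ofReal_one, ← Complex.ofReal_sub, Complex.norm_real, Real.norm_eq_abs, abs_le]
      constructor <;> linarith [hϑ.le_one ((ρ M)⁻¹ • ξ), hϑ.nonneg ((ρ M)⁻¹ • ξ)]
    -- At ξ ≠ 0 the partial sums are eventually constant. The origin is a null set since n ≥ 1.
    · have : Nonempty (Fin n) := ⟨⟨0, hn⟩⟩
      filter_upwards [compl_mem_ae_iff.2 (measure_singleton (μ := volume) (0 : Eucl n))] with ξ hξ
      have hξ0 : 0 < ‖ξ‖ := norm_pos_iff.2 hξ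
      refine Filter.Tendsto.mul_const _ ?_
      have h1 : Filter.Tendsto (fun M : ℕ => ((2 : ℝ)⁻¹) ^ M) Filter.atTop (nhds 0) :=
        tendsto_pow_atTop_nhds_zero_of_lt_one (by norm_num) (by norm_num)
      have h2 : ∀ᶠ M : ℕ in Filter.atTop, ((2 : ℝ)⁻¹) ^ M < ‖ξ‖ / 4 :=
        h1.eventually_lt_const (by positivity)
      refine tendsto_const_nhds.congr' ?_
      filter_upwards [h2] with M hM
      rw [htel, hϑ.eq_zero, Complex.ofReal_zero, sub_zero, mul_one]
      rw [norm_smul, norm_inv, Real.norm_of_nonneg (hρ0 M).le, ← div_eq_inv_mul, le_div_iff₀ (hρ0 M)]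
      simp only [hρ]
      linarith
  have hpart : ∀ M, ‖ker (fun ξ => ∑ m ∈ Finset.range M, H m ((ρ m)⁻¹ • ξ)) w‖ ≤
      C₂ * C₁ * 2 ^ ((n : ℝ) + γ) * (2 ^ (s - γ) * (1 - θ)⁻¹) * wt (n + γ) w := fun M => by
    rw [ker_finsetSum _ _ fun m => (hHsym m).integrable.comp_smul (inv_ne_zero (hρ0 m).ne')]
    refine (norm_sum_le _ _).trans ((Finset.sum_le_sum fun m _ => hHker m).trans ?_)
    rw [← Finset.mul_sum, ← Finset.mul_sum]
    have h1 : ∑ m ∈ Finset.range M, θ ^ m ≤ (1 - θ)⁻¹ := by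
      rw [← tsum_geometric_of_lt_one hθ0.le hθ1]
      exact (summable_geometric_of_lt_one hθ0.le hθ1).sum_le_tsum _ fun m _ => by positivity
    have h2 := wt_nonneg (n + γ) w
    calc _ ≤ C₂ * C₁ * 2 ^ ((n : ℝ) + γ) * wt (n + γ) w * (2 ^ (s - γ) * (1 - θ)⁻¹) := by gcongr
      _ = _ := by ring
  have h2 := le_of_tendsto hlim.norm (.of_forall hpart)
  have h1 : ‖ker (p x) w‖ ≤ C₂ * G * wt (n + γ) w := by
    refine (hC₂ (p x) G (hp.isSymbol x) (fun m hm ζ => ?_) w).trans ?_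
    · refine (hp.norm_iteratedFDeriv_le m x ζ).trans ((le_abs_self _).trans ?_)
      exact Finset.single_le_sum (f := fun m : ℕ => |A m 0|) (fun _ _ => abs_nonneg _)
        (Finset.mem_range.2 (by omega))
    · refine mul_le_mul_of_nonneg_left (wt_anti ?_ w) (by positivity)
      push_cast; linarith
  -- The term p alone is a smooth symbol with fast kernel decay; only (e^{iφ} - 1)p feels the
  -- singularity and limits the decay to n+γ.
  have h3 : ker (fun ζ => expI (φ ζ) * p x ζ) w =
      ker (p x) w + ker (fun ζ => (expI (φ ζ) - 1) * p x ζ) w := by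
    rw [← ker_add (hp.isSymbol x).integrable hint]
    congr 1
    ext ζ; ring
  rw [h3]
  exact (norm_add_le _ _).trans ((add_le_add h1 h2).trans (le_of_eq (by ring)))

/-- The pieces of a Hörmander symbol, normalised to unit scale. -/
theorem exists_isAmp_of_isAmplitude (m : ℝ) (A : ℕ → ℕ → ℝ) {r : ℝ} {g : Eucl n → ℂ}
    (hg : ContDiff ℝ ∞ g) (hg2 : ∀ ζ, 2 ≤ ‖ζ‖ → g ζ = 0) (hgr : ∀ ζ, ‖ζ‖ ≤ r → g ζ = 0) :
    ∃ A', ∀ (d : Eucl n → Eucl n → ℂ) (σ : ℝ), IsAmplitude m A d → 1 ≤ σ → (1 / 2 ≤ r ∨ σ = 1) →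
      IsAmp r A' fun x ζ => g ζ * (((σ ^ (-m) : ℝ) : ℂ) * d x (σ • ζ)) := by
  obtain ⟨B, hB0, hB⟩ := exists_bound_closedBall hg
  refine ⟨_, fun d σ hd hσ hrσ => isAmp_mul (A := fun a b => |A a b| * 5 ^ |(m - a) / 2|) ?_
    (fun a b => by positivity) (fun a b x ζ hζr hζ => ?_) hg hB0 hB
    (fun x ζ h => by rw [hg2 ζ h, zero_mul]) (fun x ζ h => by rw [hgr ζ h, zero_mul])⟩
  · exact contDiff_const.mul (hd.smooth.comp (contDiff_fst.prodMk ((contDiff_const_smul _).comp contDiff_snd)))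
  · have hσ0 : 0 < σ := by linarith
    have h1 : (fun η => iteratedFDeriv ℝ b (fun y => ((σ ^ (-m) : ℝ) : ℂ) * d y (σ • η)) x) =
        fun η => σ ^ (-m) • iteratedFDeriv ℝ b (fun y => d y (σ • η)) x := by
      ext1 η
      rw [← iteratedFDeriv_const_smul_apply' (𝕜 := ℝ) (a := σ ^ (-m))
        ((contDiff_left hd.smooth _).contDiffAt.of_le (by exact_mod_cast le_top))]
      simp only [Complex.real_smul]
    have hc : ContDiff ℝ ∞ fun η => iteratedFDeriv ℝ b (fun y => d y η) x :=
      contDiff_right (p := fun x η => iteratedFDeriv ℝ b (fun y => d y η) x)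
        (contDiff_iteratedFDeriv_left hd.smooth b) x
    have hc2 : ContDiff ℝ ∞ fun η => iteratedFDeriv ℝ b (fun y => d y (σ • η)) x :=
      hc.comp (contDiff_const_smul σ)
    have hc3 : ContDiff ℝ a fun η => iteratedFDeriv ℝ b (fun y => d y η) x :=
      hc.of_le (by exact_mod_cast le_top)
    have h2 := iteratedFDeriv_comp_const_smul σ hc3
    rw [h1, iteratedFDeriv_const_smul_apply' (hc2.contDiffAt.of_le (by exact_mod_cast le_top)), h2,
      norm_smul, norm_smul, norm_pow, Real.norm_of_nonneg hσ0.le, Real.norm_of_nonneg (by positivity)]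
    have h3 := hd.bound a b x (σ • ζ)
    -- On the relevant frequencies y lies in [1/5, 5]: for |ζ| ≥ 1/2 because |ζ|² ≥ 1/4, and for σ =
    -- 1 trivially. Hence (1+|σζ|²)^{1/2} is comparable to σ.
    set y : ℝ := (1 + ‖σ • ζ‖ ^ 2) / σ ^ 2 with hy
    have hyeq : 1 + ‖σ • ζ‖ ^ 2 = σ ^ 2 * y := by rw [hy]; field_simp
    have hn : ‖σ • ζ‖ = σ * ‖ζ‖ := by rw [norm_smul, Real.norm_of_nonneg hσ0.le]
    have hy1 : y ≤ 5 := by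
      rw [hy, div_le_iff₀ (by positivity), hn]
      nlinarith [norm_nonneg ζ, mul_le_mul hζ hζ (norm_nonneg ζ) zero_le_two]
    have hy2 : 5⁻¹ ≤ y := by
      rw [hy, le_div_iff₀ (by positivity), hn]
      rcases hrσ with h | h
      · have : 1 / 2 ≤ ‖ζ‖ := h.trans hζr
        nlinarith [mul_le_mul this this (by norm_num) (norm_nonneg ζ)]
      · rw [h]; nlinarith [norm_nonneg ζ]
    have hy0 : 0 < y := lt_of_lt_of_le (by norm_num) hy2
    have hye : ∀ e : ℝ, y ^ e ≤ 5 ^ |e| := by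
      intro e
      rcases le_total 0 e with h | h
      · rw [abs_of_nonneg h]
        exact Real.rpow_le_rpow hy0.le hy1 h
      · rw [abs_of_nonpos h, Real.rpow_neg (by norm_num), ← Real.inv_rpow (by norm_num)]
        exact Real.rpow_le_rpow_of_nonpos (by norm_num) hy2 h
    have h4 : σ ^ (-m) * (σ ^ a * (1 + ‖σ • ζ‖ ^ 2) ^ ((m - a) / 2)) = y ^ ((m - a) / 2) := by
      rw [hyeq, Real.mul_rpow (by positivity) hy0.le, ← Real.rpow_natCast σ 2, ← Real.rpow_mul hσ0.le,
        ← Real.rpow_natCast σ a, ← mul_assoc, ← mul_assoc, ← Real.rpow_add hσ0, ← Real.rpow_add hσ0]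
      have : -m + (a : ℝ) + ((2 : ℕ) : ℝ) * ((m - a) / 2) = 0 := by push_cast; ring
      rw [this, Real.rpow_zero, one_mul]
    calc _ ≤ σ ^ (-m) * (σ ^ a * (|A a b| * (1 + ‖σ • ζ‖ ^ 2) ^ ((m - a) / 2))) := by
          have h5 : A a b * (1 + ‖σ • ζ‖ ^ 2) ^ ((m - a) / 2) ≤ |A a b| * (1 + ‖σ • ζ‖ ^ 2) ^ ((m - a) / 2) :=
            mul_le_mul_of_nonneg_right (le_abs_self _) (by positivity)
          have h6 := h3.trans h5
          gcongr
      _ = |A a b| * (σ ^ (-m) * (σ ^ a * (1 + ‖σ • ζ‖ ^ 2) ^ ((m - a) / 2))) := by ring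
      _ ≤ _ := by
          rw [h4]
          exact mul_le_mul_of_nonneg_left (hye _) (abs_nonneg _)

/-! ### Local `BMO` -/

/-- The cube with centre `z` and side length `r`. -/
def ccube (z : Eucl n) (r : ℝ) : Set (Eucl n) := cube (WithLp.toLp 2 fun i => z i - r / 2) r

theorem mem_ccube {z x : Eucl n} {r : ℝ} : x ∈ ccube z r ↔ ∀ i, |z i - x i| ≤ r / 2 := by
  unfold ccube cube
  simp only [Set.mem_ofPred_eq, abs_le]
  refine forall_congr' fun i => ⟨fun h => ⟨by linarith [h.2], by linarith [h.1]⟩,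
    fun h => ⟨by linarith [h.2], by linarith [h.1]⟩⟩

theorem ccube_subset (z : Eucl n) {r r' : ℝ} (h : r ≤ r') : ccube z r ⊆ ccube z r' := fun x hx => by
  rw [mem_ccube] at hx ⊢
  exact fun i => (hx i).trans (by linarith)

/-- Mean oscillations bounded by `S` on all cubes. -/
structure HasOsc (S : ℝ) (f : Eucl n → ℂ) : Prop where
  nonneg : 0 ≤ S
  locallyIntegrable : LocallyIntegrable f volume
  bound : ∀ a r, 0 < r → ∫ x in cube a r, ‖f x - ⨍ y in cube a r, f y‖ ≤ S * r ^ n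

theorem integrableOn_cube {f : Eucl n → ℂ} (hf : LocallyIntegrable f volume) (a : Eucl n) (r : ℝ) :
    IntegrableOn f (cube a r) := by
  refine hf.integrableOn_isCompact ?_
  refine Metric.isCompact_of_isClosed_isBounded (isClosed_cube a r) ?_
  have h : Bornology.IsBounded ((WithLp.ofLp : Eucl n → Fin n → ℝ) '' cube a r) := by
    refine (Metric.isBounded_Icc (WithLp.ofLp a) (WithLp.ofLp a + fun _ => r)).subset ?_
    rintro _ ⟨x, hx, rfl⟩
    exact ⟨fun i => (hx i).1, fun i => (hx i).2⟩
  exact (EuclideanSpace.equiv (Fin n) ℝ).antilipschitz.isBounded_preimage h |>.subset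
    (Set.subset_preimage_image _ _)

theorem hasOsc_of_memBmo {ϑ : Eucl n → ℝ} {f : Eucl n → ℂ} (hf : MemBmo ϑ f) :
    HasOsc (bmoNorm ϑ f).toReal f := by
  refine ⟨ENNReal.toReal_nonneg, hf.1, fun a r hr => ?_⟩
  have hi : IntegrableOn (fun x => f x - ⨍ y in cube a r, f y) (cube a r) :=
    (integrableOn_cube hf.1 a r).sub (integrableOn_const (volume_cube_lt_top a r).ne)
  have h1 : (∫⁻ x in cube a r, ‖f x - ⨍ y in cube a r, f y‖ₑ) / volume (cube a r) ≤ bmoNorm ϑ f := by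
    refine le_trans ?_ (le_add_right le_rfl)
    unfold bmoSeminorm
    exact le_iSup_of_le a (le_iSup_of_le r (le_iSup_of_le hr le_rfl))
  rw [ENNReal.div_le_iff (volume_cube_pos a hr).ne' (volume_cube_lt_top a r).ne] at h1
  rw [integral_norm_eq_lintegral_enorm hi.aestronglyMeasurable]
  refine (ENNReal.toReal_mono (ENNReal.mul_ne_top hf.2.ne (volume_cube_lt_top a r).ne) h1).trans ?_
  rw [ENNReal.toReal_mul]
  exact le_of_eq (congrArg _ (volume_real_cube a hr.le))

theorem norm_average_sub_mul_le {f : Eucl n → ℂ} (hf : LocallyIntegrable f volume) (a : Eucl n) {r : ℝ}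
    (hr : 0 < r) (c : ℂ) : ‖(⨍ y in cube a r, f y) - c‖ * r ^ n ≤ ∫ x in cube a r, ‖f x - c‖ := by
  have hi := integrableOn_cube hf a r
  have hc : IntegrableOn (fun _ : Eucl n => c) (cube a r) := integrableOn_const (volume_cube_lt_top a r).ne
  have h0 : (0 : ℝ) < r ^ n := by positivity
  have h1 : r ^ n • ((⨍ y in cube a r, f y) - c) = ∫ x in cube a r, (f x - c) := by
    rw [integral_sub hi hc, setIntegral_const, setAverage_eq, volume_real_cube a hr.le, smul_sub,
      smul_inv_smul₀ h0.ne']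
  calc _ = ‖r ^ n • ((⨍ y in cube a r, f y) - c)‖ := by
        rw [norm_smul, Real.norm_of_nonneg h0.le, mul_comm]
    _ ≤ _ := by rw [h1]; exact norm_integral_le_integral_norm _

/-- Each doubling of the cube changes the average by at most 2^n S. The growth is linear in the
number of doublings, hence beaten by any geometric decay. -/
theorem HasOsc.norm_average_sub_le {S : ℝ} {f : Eucl n → ℂ} (hf : HasOsc S f) (z : Eucl n) {r : ℝ}
    (hr : 0 < r) (m : ℕ) :
    ‖(⨍ y in ccube z r, f y) - ⨍ y in ccube z (2 ^ m * r), f y‖ ≤ m * 2 ^ n * S := by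
  induction m with
  | zero => simp
  | succ m ih =>
    set R : ℝ := 2 ^ m * r with hR
    have hR0 : 0 < R := by positivity
    have e : (2 : ℝ) ^ (m + 1) * r = 2 * R := by rw [hR, pow_succ]; ring
    rw [e]
    have h1 := norm_average_sub_mul_le hf.locallyIntegrable (WithLp.toLp 2 fun i => z i - R / 2) hR0
      (⨍ y in ccube z (2 * R), f y)
    have h2 := hf.bound (WithLp.toLp 2 fun i => z i - (2 * R) / 2) (2 * R) (by positivity)
    have hi : IntegrableOn (fun x => ‖f x - ⨍ y in ccube z (2 * R), f y‖) (ccube z (2 * R)) :=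
      ((integrableOn_cube hf.locallyIntegrable _ _).sub
        (integrableOn_const (volume_cube_lt_top _ _).ne)).norm
    have h3 : ∫ x in ccube z R, ‖f x - ⨍ y in ccube z (2 * R), f y‖ ≤
        ∫ x in ccube z (2 * R), ‖f x - ⨍ y in ccube z (2 * R), f y‖ :=
      setIntegral_mono_set hi (.of_forall fun _ => norm_nonneg _)
        (ccube_subset z (by linarith)).eventuallyLE
    have h4 : ‖(⨍ y in ccube z R, f y) - ⨍ y in ccube z (2 * R), f y‖ * R ^ n ≤ 2 ^ n * S * R ^ n := by
      refine h1.trans (h3.trans (h2.trans (le_of_eq ?_)))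
      rw [mul_pow]; ring
    have h5 := le_of_mul_le_mul_right h4 (by positivity)
    calc _ ≤ ‖(⨍ y in ccube z r, f y) - ⨍ y in ccube z R, f y‖ +
          ‖(⨍ y in ccube z R, f y) - ⨍ y in ccube z (2 * R), f y‖ := norm_sub_le_norm_sub_add_norm_sub ..
      _ ≤ m * 2 ^ n * S + 2 ^ n * S := add_le_add ih h5
      _ = _ := by push_cast; ring

theorem HasOsc.integral_ccube_le {S : ℝ} {f : Eucl n → ℂ} (hf : HasOsc S f) (z : Eucl n) {r : ℝ}
    (hr : 0 < r) (m : ℕ) : ∫ x in ccube z (2 ^ m * r), ‖f x - ⨍ y in ccube z r, f y‖ ≤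
      (1 + m * 2 ^ n) * S * (2 ^ m * r) ^ n := by
  set R : ℝ := 2 ^ m * r with hR
  have hR0 : 0 < R := by positivity
  have hi : ∀ c : ℂ, IntegrableOn (fun x => ‖f x - c‖) (ccube z R) := fun c =>
    ((integrableOn_cube hf.locallyIntegrable _ _).sub
      (integrableOn_const (volume_cube_lt_top _ _).ne)).norm
  have hc : ∀ c : ℝ, IntegrableOn (fun _ => c) (ccube z R) := fun c =>
    integrableOn_const (volume_cube_lt_top _ _).ne
  have h1 := hf.norm_average_sub_le z hr m
  rw [← hR, norm_sub_rev] at h1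
  calc _ ≤ ∫ x in ccube z R, (‖f x - ⨍ y in ccube z R, f y‖ + m * 2 ^ n * S) :=
        integral_mono (hi _) ((hi _).add (hc _)) fun x =>
          (norm_sub_le_norm_sub_add_norm_sub ..).trans (add_le_add le_rfl h1)
    _ = (∫ x in ccube z R, ‖f x - ⨍ y in ccube z R, f y‖) + R ^ n * (m * 2 ^ n * S) := by
        rw [integral_add (hi _) (hc _), setIntegral_const]
        congr 1
        rw [smul_eq_mul, ccube, volume_real_cube _ hR0.le]
    _ ≤ S * R ^ n + R ^ n * (m * 2 ^ n * S) := by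
        have := hf.bound (WithLp.toLp 2 fun i => z i - R / 2) R hR0
        exact add_le_add this le_rfl
    _ = _ := by ring

/-- Each y is charged to the smallest cube of the dyadic concentric family that contains it. Being
outside the previous cube bounds |z - y| from below; the factor 4^p covers the loss. -/
theorem wt_le_tsum_indicator {p : ℝ} (hp : 0 ≤ p) {ρ : ℝ} (hρ : 0 < ρ) (z y : Eucl n) :
    ENNReal.ofReal (wt p (ρ • (z - y))) ≤ ∑' m : ℕ, ENNReal.ofReal (4 ^ p * (2 ^ (-p)) ^ m) *
      (ccube z (2 ^ m * ρ⁻¹)).indicator 1 y := by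
  have hex : ∃ m : ℕ, y ∈ ccube z (2 ^ m * ρ⁻¹) := by
    obtain ⟨m, hm⟩ := pow_unbounded_of_one_lt (2 * ρ * ‖z - y‖) one_lt_two
    refine ⟨m, mem_ccube.2 fun i => ?_⟩
    have h1 : |z i - y i| ≤ ‖z - y‖ := by simpa using PiLp.norm_apply_le (z - y) i
    have h2 : ‖z - y‖ ≤ 2 ^ m * ρ⁻¹ / 2 := by
      rw [le_div_iff₀ two_pos, ← div_eq_mul_inv, le_div_iff₀ hρ]; linarith
    exact h1.trans h2
  classical
  set m := Nat.find hex with hm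
  have hmem : y ∈ ccube z (2 ^ m * ρ⁻¹) := Nat.find_spec hex
  refine le_trans ?_ (ENNReal.le_tsum m)
  rw [Set.indicator_of_mem hmem, Pi.one_apply, mul_one]
  refine ENNReal.ofReal_le_ofReal ?_
  rcases Nat.eq_zero_or_pos m with h0 | h0
  · rw [h0, pow_zero, mul_one]
    exact (wt_le_one hp _).trans (Real.one_le_rpow (by norm_num) hp)
  · have h1 : y ∉ ccube z (2 ^ (m - 1) * ρ⁻¹) := Nat.find_min hex (by omega)
    rw [mem_ccube] at h1
    push Not at h1
    obtain ⟨i, hi⟩ := h1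
    have h2 : |z i - y i| ≤ ‖z - y‖ := by simpa using PiLp.norm_apply_le (z - y) i
    have h3 : (2 : ℝ) ^ m / 4 ≤ 1 + ‖ρ • (z - y)‖ := by
      rw [norm_smul, Real.norm_of_nonneg hρ.le]
      have h4 : 2 ^ (m - 1) * ρ⁻¹ / 2 ≤ ‖z - y‖ := hi.le.trans h2
      have h5 : (2 : ℝ) ^ m = 2 ^ (m - 1) * 2 := by rw [← pow_succ]; congr 1; omega
      have h6 : ρ * (2 ^ (m - 1) * ρ⁻¹ / 2) ≤ ρ * ‖z - y‖ := mul_le_mul_of_nonneg_left h4 hρ.le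
      have h7 : ρ * (2 ^ (m - 1) * ρ⁻¹ / 2) = 2 ^ (m - 1) / 2 := by field_simp
      rw [h5]; linarith
    unfold wt
    calc _ ≤ ((2 : ℝ) ^ m / 4) ^ (-p) := Real.rpow_le_rpow_of_nonpos (by positivity) h3 (by linarith)
      _ = _ := by
          rw [Real.div_rpow (by positivity) (by norm_num), Real.rpow_neg (by norm_num : (0 : ℝ) ≤ 4) p,
            ← Real.rpow_natCast, ← Real.rpow_natCast, ← Real.rpow_mul zero_le_two,
            ← Real.rpow_mul zero_le_two, div_inv_eq_mul, mul_comm]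
          congr 2; ring

/-- On the m-th concentric cube the weight 2^{-m(n+γ)} meets volume 2^{mn} and oscillation at most
(1 + m 2^n)S. The series Σ (1 + m 2^n) 2^{-γm} converges for every γ > 0. -/
theorem exists_weighted_osc_bound (n : ℕ) {γ : ℝ} (hγ : 0 < γ) : ∃ C : ℝ, 0 ≤ C ∧
    ∀ (S : ℝ) (f : Eucl n → ℂ), HasOsc S f → ∀ (z : Eucl n) (ρ : ℝ), 0 < ρ →
      ∫⁻ y, ‖f y - ⨍ x in ccube z ρ⁻¹, f x‖ₑ * ENNReal.ofReal (wt (n + γ) (ρ • (z - y))) ≤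
        ENNReal.ofReal (C * S * (ρ⁻¹) ^ n) := by
  have hq0 : (0 : ℝ) < 2 ^ (-γ) := by positivity
  have hq1 : (2 : ℝ) ^ (-γ) < 1 := Real.rpow_lt_one_of_one_lt_of_neg one_lt_two (by linarith)
  have hsum : Summable fun m : ℕ => (1 + (m : ℝ) * 2 ^ n) * ((2 : ℝ) ^ (-γ)) ^ m := by
    have h1 := summable_geometric_of_lt_one hq0.le hq1
    have h2 := summable_pow_mul_geometric_of_norm_lt_one (R := ℝ) 1
      (r := 2 ^ (-γ)) (by rwa [Real.norm_of_nonneg hq0.le])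
    refine (h1.add (h2.mul_left (2 ^ n))).congr fun m => ?_
    simp only [pow_one]; ring
  refine ⟨4 ^ ((n : ℝ) + γ) * ∑' m : ℕ, (1 + (m : ℝ) * 2 ^ n) * ((2 : ℝ) ^ (-γ)) ^ m, by positivity,
    fun S f hf z ρ hρ => ?_⟩
  have hS := hf.nonneg
  set c := ⨍ x in ccube z ρ⁻¹, f x with hc
  have hmc : ∀ m : ℕ, MeasurableSet (ccube z (2 ^ m * ρ⁻¹)) := fun m => measurableSet_cube _ _
  have hfm : AEMeasurable (fun y => ‖f y - c‖ₑ) volume :=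
    (hf.locallyIntegrable.aestronglyMeasurable.sub aestronglyMeasurable_const).enorm
  have hterm : ∀ m : ℕ, ∫⁻ y, ‖f y - c‖ₑ * (ENNReal.ofReal (4 ^ ((n : ℝ) + γ) * (2 ^ (-((n : ℝ) + γ))) ^ m) *
      (ccube z (2 ^ m * ρ⁻¹)).indicator 1 y) ≤ ENNReal.ofReal (4 ^ ((n : ℝ) + γ) * S * (ρ⁻¹) ^ n *
        ((1 + (m : ℝ) * 2 ^ n) * ((2 : ℝ) ^ (-γ)) ^ m)) := fun m => by
    have h1 : ∀ y, ‖f y - c‖ₑ * (ENNReal.ofReal (4 ^ ((n : ℝ) + γ) * (2 ^ (-((n : ℝ) + γ))) ^ m) *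
        (ccube z (2 ^ m * ρ⁻¹)).indicator 1 y) = ENNReal.ofReal (4 ^ ((n : ℝ) + γ) * (2 ^ (-((n : ℝ) + γ))) ^ m) *
        (ccube z (2 ^ m * ρ⁻¹)).indicator (fun y => ‖f y - c‖ₑ) y := fun y => by
      by_cases hy : y ∈ ccube z (2 ^ m * ρ⁻¹)
      · rw [Set.indicator_of_mem hy, Set.indicator_of_mem hy, Pi.one_apply, mul_one, mul_comm]
      · rw [Set.indicator_of_notMem hy, Set.indicator_of_notMem hy, mul_zero, mul_zero]
    simp only [h1]
    rw [lintegral_const_mul' _ _ ENNReal.ofReal_ne_top, lintegral_indicator (hmc m)]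
    have hi : IntegrableOn (fun x => f x - c) (ccube z (2 ^ m * ρ⁻¹)) :=
      (integrableOn_cube hf.locallyIntegrable _ _).sub (integrableOn_const (volume_cube_lt_top _ _).ne)
    rw [← ofReal_integral_norm_eq_lintegral_enorm hi, ← ENNReal.ofReal_mul (by positivity)]
    refine ENNReal.ofReal_le_ofReal ?_
    refine (mul_le_mul_of_nonneg_left (hf.integral_ccube_le z (inv_pos.2 hρ) m) (by positivity)).trans
      (le_of_eq ?_)
    have h2 : ((2 : ℝ) ^ (-((n : ℝ) + γ))) ^ m * (2 ^ m) ^ n = (2 ^ (-γ)) ^ m := by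
      rw [← Real.rpow_natCast, ← Real.rpow_natCast, ← Real.rpow_natCast, ← Real.rpow_natCast,
        ← Real.rpow_mul zero_le_two, ← Real.rpow_mul zero_le_two, ← Real.rpow_mul zero_le_two,
        ← Real.rpow_add two_pos]
      congr 1; ring
    rw [mul_pow, ← h2]; ring
  calc _ ≤ ∫⁻ y, ∑' m : ℕ, ‖f y - c‖ₑ * (ENNReal.ofReal (4 ^ ((n : ℝ) + γ) * (2 ^ (-((n : ℝ) + γ))) ^ m) *
        (ccube z (2 ^ m * ρ⁻¹)).indicator 1 y) := by
        refine lintegral_mono fun y => ?_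
        simp only
        rw [ENNReal.tsum_mul_left]
        gcongr
        exact wt_le_tsum_indicator (by positivity) hρ z y
    _ = ∑' m : ℕ, ∫⁻ y, ‖f y - c‖ₑ * (ENNReal.ofReal (4 ^ ((n : ℝ) + γ) * (2 ^ (-((n : ℝ) + γ))) ^ m) *
        (ccube z (2 ^ m * ρ⁻¹)).indicator 1 y) :=
        lintegral_tsum fun m => hfm.mul ((measurable_one.indicator (hmc m)).const_mul _).aemeasurable
    _ ≤ ∑' m : ℕ, ENNReal.ofReal (4 ^ ((n : ℝ) + γ) * S * (ρ⁻¹) ^ n *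
        ((1 + (m : ℝ) * 2 ^ n) * ((2 : ℝ) ^ (-γ)) ^ m)) := ENNReal.tsum_le_tsum hterm
    _ = _ := by
        rw [← ENNReal.ofReal_tsum_of_nonneg (fun m => by positivity) (hsum.mul_left _), tsum_mul_left]
        congr 1; ring

/-- The properties of functions in local `BMO` with norm `Λ` that are used below. -/
structure IsTame (γ Λ : ℝ) (f : Eucl n → ℂ) : Prop where
  measurable : Measurable f
  nonneg : 0 ≤ Λ
  integrable : ∀ z, Integrable fun y => ‖f y‖ * wt (n + γ) (z - y)
  integral_le : ∀ z, ∫ y, ‖f y‖ * wt (n + γ) (z - y) ≤ Λ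
  osc : ∀ M : Eucl n → ℂ, Continuous M → (∀ w, ‖M w‖ ≤ wt (n + 1) w) → ∫ w, M w = 0 →
    ∀ ρ : ℝ, 1 ≤ ρ → ∀ z, ‖∫ y, dil ρ M (z - y) * f y‖ ≤ Λ

theorem exists_weighted_integral_osc_bound (n : ℕ) {γ : ℝ} (hγ : 0 < γ) : ∃ C : ℝ, 0 ≤ C ∧
    ∀ (S : ℝ) (f : Eucl n → ℂ), HasOsc S f → ∀ (z : Eucl n) (ρ : ℝ), 0 < ρ → ∃ c : ℂ,
      (Integrable fun y => ‖f y - c‖ * wt (n + γ) (ρ • (z - y))) ∧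
        ρ ^ n * ∫ y, ‖f y - c‖ * wt (n + γ) (ρ • (z - y)) ≤ C * S := by
  obtain ⟨C, hC0, hC⟩ := exists_weighted_osc_bound n hγ
  refine ⟨C, hC0, fun S f hf z ρ hρ => ⟨⨍ x in ccube z ρ⁻¹, f x, ?_⟩⟩
  have hS := hf.nonneg
  have h := hC S f hf z ρ hρ
  set c := ⨍ x in ccube z ρ⁻¹, f x
  have h1 : ∀ y, ‖‖f y - c‖ * wt (n + γ) (ρ • (z - y))‖ₑ =
      ‖f y - c‖ₑ * ENNReal.ofReal (wt (n + γ) (ρ • (z - y))) := fun y => by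
    rw [enorm_mul, enorm_norm, Real.enorm_of_nonneg (wt_nonneg _ _)]
  have hm : AEStronglyMeasurable (fun y => ‖f y - c‖ * wt (n + γ) (ρ • (z - y))) volume :=
    (hf.locallyIntegrable.aestronglyMeasurable.sub aestronglyMeasurable_const).norm.mul
      ((continuous_wt _).comp (by fun_prop)).aestronglyMeasurable
  refine ⟨⟨hm, ?_⟩, ?_⟩
  · unfold HasFiniteIntegral
    simp only [h1]
    exact h.trans_lt ENNReal.ofReal_lt_top
  · have h2 : ∫ y, ‖f y - c‖ * wt (n + γ) (ρ • (z - y)) ≤ C * S * (ρ⁻¹) ^ n := by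
      rw [integral_eq_lintegral_of_nonneg_ae
        (.of_forall fun y => mul_nonneg (norm_nonneg _) (wt_nonneg _ _)) hm]
      refine ENNReal.toReal_le_of_le_ofReal (by positivity) (le_trans (le_of_eq ?_) h)
      refine lintegral_congr fun y => ?_
      rw [ENNReal.ofReal_mul (norm_nonneg _), ofReal_norm]
    calc _ ≤ ρ ^ n * (C * S * (ρ⁻¹) ^ n) := by gcongr
      _ = C * S := by rw [inv_pow]; field_simp

theorem integral_dil (M : Eucl n → ℂ) {ρ : ℝ} (hρ : 0 < ρ) (z : Eucl n) :
    ∫ y, dil ρ M (z - y) = ∫ w, M w := by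
  rw [integral_sub_left_eq_self (dil ρ M)]
  unfold dil
  rw [integral_const_mul, Measure.integral_comp_smul_of_nonneg _ _ _ (hR := hρ.le)]
  simp only [finrank_euclideanSpace, Fintype.card_fin, Complex.real_smul]
  have : (((ρ ^ n : ℝ)) : ℂ) ≠ 0 := by exact_mod_cast (pow_pos hρ n).ne'
  push_cast at this ⊢
  field_simp

/-- Pairing a locally integrable function with a decaying kernel, after subtraction of a constant. -/
theorem integral_dil_mul_eq {γ : ℝ} (hγ1 : γ ≤ 1) {f : Eucl n → ℂ} {M : Eucl n → ℂ}
    (hM : Continuous M) {K : ℝ} (hK : ∀ w, ‖M w‖ ≤ K * wt (n + 1) w) {ρ : ℝ} (hρ : 0 < ρ) {z : Eucl n}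
    {c : ℂ} (hf : AEStronglyMeasurable f volume)
    (hi : Integrable fun y => ‖f y - c‖ * wt (n + γ) (ρ • (z - y))) :
    ‖(∫ y, dil ρ M (z - y) * f y) - c * ∫ w, M w‖ ≤
      K * (ρ ^ n * ∫ y, ‖f y - c‖ * wt (n + γ) (ρ • (z - y))) := by
  have hK0 : 0 ≤ K := by
    have h := (norm_nonneg _).trans (hK 0)
    exact nonneg_of_mul_nonneg_left h (wt_pos _ _)
  have hMi : Integrable M := by
    have hw : Integrable fun w : Eucl n => K * wt ((n : ℝ) + 1) w := (integrable_wt (by linarith)).const_mul K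
    exact hw.mono' hM.aestronglyMeasurable (.of_forall hK)
  have hdi : Integrable fun y => dil ρ M (z - y) := (integrable_dil hMi hρ).comp_sub_left z
  have hb : ∀ y, ‖dil ρ M (z - y) * (f y - c)‖ ≤
      K * (ρ ^ n * (‖f y - c‖ * wt (n + γ) (ρ • (z - y)))) := fun y => by
    unfold dil
    rw [norm_mul, norm_mul, Complex.norm_real, Real.norm_of_nonneg (by positivity)]
    have h1 := (hK (ρ • (z - y))).trans (mul_le_mul_of_nonneg_left
      (wt_anti (show (n : ℝ) + γ ≤ n + 1 by linarith) (ρ • (z - y))) hK0)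
    calc _ ≤ ρ ^ n * (K * wt (n + γ) (ρ • (z - y))) * ‖f y - c‖ := by gcongr
      _ = _ := by ring
  have hfi : Integrable fun y => dil ρ M (z - y) * (f y - c) := by
    refine ((hi.const_mul (ρ ^ n)).const_mul K).mono' ?_ (.of_forall hb)
    exact hdi.aestronglyMeasurable.mul (hf.sub aestronglyMeasurable_const)
  have h2 : ∫ y, dil ρ M (z - y) * f y = (∫ y, dil ρ M (z - y) * (f y - c)) + c * ∫ w, M w := by
    rw [← integral_dil M hρ z, ← integral_const_mul, ← integral_add hfi (hdi.const_mul c)]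
    congr 1
    ext y; ring
  rw [h2, add_sub_cancel_right, ← integral_const_mul, ← integral_const_mul]
  exact norm_integral_le_of_norm_le ((hi.const_mul _).const_mul _) (.of_forall hb)

/-- Peetre's inequality, from 1+|b| ≤ (1+|a-b|)(1+|a|). -/
theorem wt_le_mul_wt {p : ℝ} (hp : 0 ≤ p) (a b : Eucl n) : wt p a ≤ (1 + ‖a - b‖) ^ p * wt p b := by
  have ha : 0 < 1 + ‖a‖ := by positivity
  have hb : 0 < 1 + ‖b‖ := by positivity
  have h : (1 + ‖b‖) ^ p ≤ ((1 + ‖a - b‖) * (1 + ‖a‖)) ^ p := by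
    refine Real.rpow_le_rpow hb.le ?_ hp
    have h1 : ‖b‖ ≤ ‖a‖ + ‖a - b‖ := by
      have := norm_sub_norm_le b a
      rw [norm_sub_rev] at this
      linarith
    nlinarith [norm_nonneg a, norm_nonneg (a - b), mul_nonneg (norm_nonneg a) (norm_nonneg (a - b))]
  rw [Real.mul_rpow (by positivity) ha.le] at h
  unfold wt
  rw [Real.rpow_neg ha.le, Real.rpow_neg hb.le, ← div_eq_mul_inv, le_div_iff₀ (by positivity),
    inv_mul_le_iff₀ (by positivity)]
  linarith

theorem IsCutoff.isSymbol {ϑ : Eucl n → ℝ} (hϑ : IsCutoff ϑ) : IsSymbol fun ξ => (ϑ ξ : ℂ) :=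
  ⟨hϑ.contDiff_ofReal, fun ζ h => by rw [hϑ.eq_zero ζ (by linarith)]; simp⟩

theorem IsSymbol.exists_ker_le_wt {P : Eucl n → ℂ} (hP : IsSymbol P) (N : ℕ) :
    ∃ K : ℝ, 0 < K ∧ ∀ w, ‖ker P w‖ ≤ K * wt N w := by
  obtain ⟨B, hB⟩ := hP.exists_bound N
  obtain ⟨C, hC0, hC⟩ := OscInt.exists_ker_le_wt n N
  refine ⟨C * |B| + 1, by positivity, fun w => (hC P B hP hB w).trans ?_⟩
  refine mul_le_mul_of_nonneg_right ?_ (wt_nonneg _ _)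
  have := mul_le_mul_of_nonneg_left (le_abs_self B) hC0
  linarith

theorem IsSymbol.integral_ker {P : Eucl n → ℂ} (hP : IsSymbol P) : ∫ w, ker P w = P 0 := by
  have := integral_ker_mul_expI hP 0
  simpa [expI_zero] using this

/-- Oscillation controls f only modulo constants. The constant c near z is recovered from ϑ(D)f: its
kernel has integral ϑ(0) = 1, so ϑ(D)f - c is the convolution of that kernel with f - c and is
bounded by the oscillation. This bounds c, and then the weighted integral of |f|. -/
theorem exists_isTame {ϑ : Eucl n → ℝ} (hϑ : IsCutoff ϑ) {γ : ℝ} (hγ : 0 < γ) (hγ1 : γ ≤ 1) :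
    ∃ C : ℝ, 0 ≤ C ∧ ∀ f : Eucl n → ℂ, MemBmo ϑ f → Measurable f →
      IsTame γ (C * (bmoNorm ϑ f).toReal) f := by
  obtain ⟨C, hC0, hC⟩ := exists_weighted_integral_osc_bound n hγ
  obtain ⟨K, hK0, hK⟩ := hϑ.isSymbol.exists_ker_le_wt (n + 1)
  have hK' : ∀ w, ‖ker (fun ξ => (ϑ ξ : ℂ)) w‖ ≤ K * wt ((n : ℝ) + 1) w := by exact_mod_cast hK
  have hp : (0 : ℝ) ≤ n + γ := by positivity
  set W : ℝ := ∫ y : Eucl n, wt ((n : ℝ) + γ) y with hW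
  have hW0 : 0 ≤ W := integral_nonneg fun y => wt_nonneg _ _
  set D : ℝ := 2 ^ ((n : ℝ) + γ) * (C + (1 + K * C) * W) with hD
  have hD0 : 0 ≤ D := by positivity
  refine ⟨C + D, by positivity, fun f hf hfm => ?_⟩
  have hosc := hasOsc_of_memBmo hf
  set Λ := (bmoNorm ϑ f).toReal with hΛ
  have hΛ0 : 0 ≤ Λ := hosc.nonneg
  have key : ∀ z, (Integrable fun y => ‖f y‖ * wt (n + γ) (z - y)) ∧
      ∫ y, ‖f y‖ * wt (n + γ) (z - y) ≤ D * Λ := fun z => by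
    have hae : ∀ᵐ x, ‖lowFreq ϑ f x‖ ≤ Λ := by
      have h1 : eLpNorm (lowFreq ϑ f) ∞ volume ≤ bmoNorm ϑ f := le_add_left le_rfl
      filter_upwards [enorm_ae_le_eLpNormEssSup (lowFreq ϑ f) volume] with x hx
      rw [eLpNorm_exponent_top] at h1
      have h2 := ENNReal.toReal_mono hf.2.ne (hx.trans h1)
      simpa using h2
    -- The bound on ϑ(D)f holds almost everywhere only, so a good point within distance 1 of z is
    -- used. The weights centred at the two points are comparable.
    obtain ⟨x, hxz, hx⟩ : ∃ x, ‖z - x‖ ≤ 1 ∧ ‖lowFreq ϑ f x‖ ≤ Λ := by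
      have h1 : ∃ᵐ x, x ∈ Metric.ball z 1 := by
        rw [frequently_ae_mem_iff]
        exact (Metric.measure_ball_pos volume z one_pos).ne'
      obtain ⟨x, hx1, hx2⟩ := (h1.and_eventually hae).exists
      refine ⟨x, ?_, hx2⟩
      rw [norm_sub_rev, ← dist_eq_norm]
      exact (Metric.mem_ball.1 hx1).le
    obtain ⟨c, hci, hcb⟩ := hC Λ f hosc x 1 one_pos
    have h1 := integral_dil_mul_eq hγ1 (continuous_ker hϑ.isSymbol.integrable) hK' one_pos
      hfm.aestronglyMeasurable hci
    have h2 : (∫ y, dil 1 (ker fun ξ => (ϑ ξ : ℂ)) (x - y) * f y) = lowFreq ϑ f x := by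
      unfold lowFreq dil ker
      simp
    rw [h2, hϑ.isSymbol.integral_ker, hϑ.eq_one 0 (by simp), Complex.ofReal_one, mul_one] at h1
    simp only [one_smul, one_pow, one_mul] at h1 hcb hci
    have hcn : ‖c‖ ≤ (1 + K * C) * Λ := by
      have h3 : ‖c‖ ≤ ‖lowFreq ϑ f x‖ + ‖lowFreq ϑ f x - c‖ := by
        have := norm_sub_norm_le c (lowFreq ϑ f x)
        rw [norm_sub_rev] at this
        linarith
      have h4 := h1.trans (mul_le_mul_of_nonneg_left hcb hK0.le)
      linarith
    have hwi : Integrable fun y : Eucl n => ‖c‖ * wt ((n : ℝ) + γ) (x - y) :=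
      (integrable_wt_sub (by linarith) x).const_mul _
    have hwtle : ∀ y, wt ((n : ℝ) + γ) (z - y) ≤ 2 ^ ((n : ℝ) + γ) * wt ((n : ℝ) + γ) (x - y) := fun y => by
      refine (wt_le_mul_wt hp (z - y) (x - y)).trans (mul_le_mul_of_nonneg_right ?_ (wt_nonneg _ _))
      refine Real.rpow_le_rpow (by positivity) ?_ hp
      rw [sub_sub_sub_cancel_right]; linarith
    have hpt : ∀ y, ‖f y‖ * wt (n + γ) (z - y) ≤ 2 ^ ((n : ℝ) + γ) *
        (‖f y - c‖ * wt (n + γ) (x - y) + ‖c‖ * wt (n + γ) (x - y)) := fun y => by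
      have h3 : ‖f y‖ ≤ ‖f y - c‖ + ‖c‖ := by
        have := norm_sub_norm_le (f y) c; linarith
      calc _ ≤ (‖f y - c‖ + ‖c‖) * (2 ^ ((n : ℝ) + γ) * wt ((n : ℝ) + γ) (x - y)) :=
            mul_le_mul h3 (hwtle y) (wt_nonneg _ _) (by positivity)
        _ = _ := by ring
    have hi : Integrable fun y => ‖f y‖ * wt (n + γ) (z - y) := by
      refine ((hci.add hwi).const_mul (2 ^ ((n : ℝ) + γ))).mono' ?_ (.of_forall fun y => ?_)
      · exact hfm.norm.aestronglyMeasurable.mul ((continuous_wt _).comp (by fun_prop)).aestronglyMeasurable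
      · rw [Real.norm_of_nonneg (mul_nonneg (norm_nonneg _) (wt_nonneg _ _))]
        exact hpt y
    refine ⟨hi, ?_⟩
    refine (integral_mono hi ((hci.add hwi).const_mul (2 ^ ((n : ℝ) + γ))) hpt).trans ?_
    rw [integral_const_mul]
    have h5 : ∫ y, (‖f y - c‖ * wt (n + γ) (x - y) + ‖c‖ * wt (n + γ) (x - y)) ≤
        C * Λ + (1 + K * C) * Λ * W := by
      rw [integral_add hci hwi, integral_const_mul, integral_wt_sub]
      exact add_le_add hcb (mul_le_mul_of_nonneg_right hcn hW0)
    calc _ ≤ 2 ^ ((n : ℝ) + γ) * (C * Λ + (1 + K * C) * Λ * W) :=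
          mul_le_mul_of_nonneg_left h5 (by positivity)
      _ = _ := by rw [hD]; ring
  refine ⟨hfm, by positivity, fun z => (key z).1, fun z => (key z).2.trans ?_,
    fun M hM hMb hM0 ρ hρ z => ?_⟩
  · nlinarith
  -- A kernel of mean zero annihilates the constant c, so only the oscillation at scale 1/ρ remains
  -- and the size of c is irrelevant.
  · obtain ⟨c, hci, hcb⟩ := hC Λ f hosc z ρ (by linarith)
    have h1 := integral_dil_mul_eq hγ1 hM (K := 1) (by simpa using hMb) (show 0 < ρ by linarith)
      hfm.aestronglyMeasurable hci
    rw [hM0, mul_zero, sub_zero, one_mul] at h1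
    refine h1.trans (hcb.trans ?_)
    nlinarith

/-! ### Kernels of the composed operators -/

/-- The kernel with frequency side `S`. -/
def opKer (φ : Eucl n → ℝ) (S : Eucl n → Eucl n → ℂ) (x y : Eucl n) : ℂ :=
  freqIntegral fun ξ => expI (-inner ℝ y ξ + φ ξ) * S x ξ

theorem opKer_eq_ker (φ : Eucl n → ℝ) (S : Eucl n → Eucl n → ℂ) (x y : Eucl n) :
    opKer φ S x y = ker (fun ξ => expI (φ ξ) * S x ξ) (-y) := by
  unfold opKer ker
  congr 1
  ext ξ
  rw [expI_add, inner_neg_left]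
  ring

theorem integrable_expI_mul {φ : Eucl n → ℝ} (hφ : Measurable φ) {F : Eucl n → ℂ} (hF : Integrable F) :
    Integrable fun ξ => expI (φ ξ) * F ξ :=
  hF.bdd_mul (c := 1) (continuous_expI.measurable.comp hφ).aestronglyMeasurable
    (.of_forall fun _ => (norm_expI _).le)

theorem opKer_add {φ : Eucl n → ℝ} (hφ : Measurable φ) {S S' : Eucl n → Eucl n → ℂ} {x : Eucl n}
    (hS : Integrable (S x)) (hS' : Integrable (S' x)) (y : Eucl n) :
    opKer φ (fun x ξ => S x ξ + S' x ξ) x y = opKer φ S x y + opKer φ S' x y := by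
  simp only [opKer_eq_ker]
  rw [← ker_add (integrable_expI_mul hφ hS) (integrable_expI_mul hφ hS')]
  simp only [mul_add]

theorem opKer_const_mul (φ : Eucl n → ℝ) (S : Eucl n → Eucl n → ℂ) (c : ℂ) (x y : Eucl n) :
    opKer φ (fun x ξ => c * S x ξ) x y = c * opKer φ S x y := by
  simp only [opKer_eq_ker]
  rw [← ker_const_mul]
  congr 1; ext ξ; ring

theorem opKer_zero (φ : Eucl n → ℝ) (x y : Eucl n) : opKer φ (fun _ _ => 0) x y = 0 := by
  simp [opKer, freqIntegral]

theorem continuous_opKer {φ : Eucl n → ℝ} (hφ : Measurable φ) {S : Eucl n → Eucl n → ℂ} {x : Eucl n}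
    (hS : Integrable (S x)) : Continuous fun y => opKer φ S x y := by
  simp only [opKer_eq_ker]
  exact (continuous_ker (integrable_expI_mul hφ hS)).comp continuous_neg

/-! ### Kernels of the compositions Q_j T for one frequency piece -/

variable {r : ℝ} {A : ℕ → ℕ → ℝ} {p : Eucl n → Eucl n → ℂ} {κ : Eucl n → ℂ}

theorem IsAmp.norm_sc_le (hp : IsAmp r A p) {σ : ℝ} (hσ : 0 < σ) (x ξ : Eucl n) :
    ‖sc σ p x ξ‖ ≤ (Metric.closedBall (0 : Eucl n) (2 * σ)).indicator (fun _ => A 0 0) ξ := by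
  by_cases h : ξ ∈ Metric.closedBall (0 : Eucl n) (2 * σ)
  · rw [Set.indicator_of_mem h]; exact hp.norm_le _ _
  · rw [Set.indicator_of_notMem h]
    rw [mem_closedBall_zero_iff, not_le] at h
    unfold sc
    rw [hp.eq_zero, norm_zero]
    rw [norm_smul, norm_inv, Real.norm_of_nonneg hσ.le, ← div_eq_inv_mul, le_div_iff₀ hσ]
    exact h.le

theorem measurable_sc (hp : IsAmp r A p) (σ : ℝ) : Measurable (Function.uncurry (sc σ p)) :=
  (hp.continuous.comp (continuous_fst.prodMk ((continuous_const_smul σ⁻¹).comp continuous_snd))).measurable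

theorem integrable_indicator_closedBall (R c : ℝ) :
    Integrable ((Metric.closedBall (0 : Eucl n) R).indicator fun _ => c) :=
  (integrable_indicator_iff Metric.isClosed_closedBall.measurableSet).2
    (integrableOn_const (isCompact_closedBall _ _).measure_lt_top.ne)

theorem IsAmp.integrable_Sg (hp : IsAmp r A p) {σ : ℝ} (hσ : 0 < σ) (hκc : Continuous κ)
    (hκ : Integrable κ) (x : Eucl n) : Integrable (Sg (sc σ p) κ x) ∧
      ∫ ξ, ‖Sg (sc σ p) κ x ξ‖ ≤ A 0 0 * (∫ w, ‖κ w‖) * volume.real (Metric.closedBall (0 : Eucl n) (2 * σ)) := by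
  have hm : StronglyMeasurable (Sg (sc σ p) κ x) := by
    unfold Sg
    refine StronglyMeasurable.integral_prod_right
      (f := fun ξ x' => expI (inner ℝ x' ξ) * sc σ p x' ξ * κ (x - x')) (Measurable.stronglyMeasurable ?_)
    refine Measurable.mul (Measurable.mul ?_ ?_) ?_
    · exact (continuous_expI.comp (continuous_snd.inner continuous_fst)).measurable
    · exact (measurable_sc hp σ).comp measurable_swap
    · exact (hκc.comp (continuous_const.sub continuous_snd)).measurable
  have hb : ∀ ξ, ‖Sg (sc σ p) κ x ξ‖ ≤
      (Metric.closedBall (0 : Eucl n) (2 * σ)).indicator (fun _ => A 0 0 * ∫ w, ‖κ w‖) ξ := fun ξ => by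
    unfold Sg
    refine (norm_integral_le_of_norm_le (g := fun x' =>
      (Metric.closedBall (0 : Eucl n) (2 * σ)).indicator (fun _ => A 0 0) ξ * ‖κ (x - x')‖)
      ((hκ.comp_sub_left x).norm.const_mul _) (.of_forall fun x' => ?_)).trans (le_of_eq ?_)
    · rw [norm_mul, norm_mul, norm_expI, one_mul]
      exact mul_le_mul_of_nonneg_right (hp.norm_sc_le hσ x' ξ) (norm_nonneg _)
    · rw [integral_const_mul, integral_sub_left_eq_self fun v => ‖κ v‖]
      by_cases h : ξ ∈ Metric.closedBall (0 : Eucl n) (2 * σ) <;> simp [h]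
  have hi := integrable_indicator_closedBall (n := n) (2 * σ) (A 0 0 * ∫ w, ‖κ w‖)
  have hSi : Integrable (Sg (sc σ p) κ x) := hi.mono' hm.aestronglyMeasurable (.of_forall hb)
  refine ⟨hSi, (integral_mono hSi.norm hi hb).trans (le_of_eq ?_)⟩
  rw [integral_indicator Metric.isClosed_closedBall.measurableSet, setIntegral_const, smul_eq_mul, mul_comm]

/-- The frequency symbol of the oscillatory operator at unit scale. -/
def oscSymbol (φ : Eucl n → ℝ) (σ : ℝ) (p : Eucl n → Eucl n → ℂ) (x ζ : Eucl n) : ℂ :=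
  expI (φ (σ • ζ)) * p x ζ

theorem dil_ker_oscSymbol (φ : Eucl n → ℝ) {σ : ℝ} (hσ : 0 < σ) (p : Eucl n → Eucl n → ℂ) (x w : Eucl n) :
    dil σ (ker (oscSymbol φ σ p x)) w = freqIntegral fun ξ => expI (φ ξ) * sc σ p x ξ * expI (inner ℝ w ξ) := by
  rw [← ker_comp_inv_smul _ hσ]
  unfold ker oscSymbol sc
  simp only [smul_inv_smul₀ hσ.ne']

/-- Fubini, using the compact frequency support: the kernel of the composition is the kernel of Q_j
at (x, x') integrated against the oscillatory kernel at (x', y). -/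
theorem opKer_Sg (hp : IsAmp r A p) {φ : Eucl n → ℝ} (hφ : Measurable φ) {σ : ℝ} (hσ : 0 < σ)
    (hκc : Continuous κ) (hκ : Integrable κ) (x y : Eucl n) : opKer φ (Sg (sc σ p) κ) x y =
      ∫ x', κ (x - x') * dil σ (ker (oscSymbol φ σ p x')) (x' - y) := by
  have hint : Integrable (Function.uncurry fun ξ x' : Eucl n => expI (-inner ℝ y ξ + φ ξ) *
      (expI (inner ℝ x' ξ) * sc σ p x' ξ * κ (x - x'))) (volume.prod volume) := by
    refine (((integrable_indicator_closedBall (n := n) (2 * σ) (A 0 0)).mul_prod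
      (hκ.comp_sub_left x).norm)).mono' ?_ (.of_forall fun q => ?_)
    · refine Measurable.aestronglyMeasurable (Measurable.mul ?_ (Measurable.mul (Measurable.mul ?_ ?_) ?_))
      · refine continuous_expI.measurable.comp (Measurable.add ?_ (hφ.comp measurable_fst))
        exact (continuous_const.inner continuous_fst).neg.measurable
      · exact (continuous_expI.comp (continuous_snd.inner continuous_fst)).measurable
      · exact (measurable_sc hp σ).comp measurable_swap
      · exact (hκc.comp (continuous_const.sub continuous_snd)).measurable
    · simp only [Function.uncurry]
      rw [norm_mul, norm_mul, norm_mul, norm_expI, norm_expI, one_mul, one_mul]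
      exact mul_le_mul_of_nonneg_right (hp.norm_sc_le hσ _ _) (norm_nonneg _)
  unfold opKer freqIntegral Sg
  have e1 : ∀ ξ : Eucl n, expI (-inner ℝ y ξ + φ ξ) *
      (∫ x', expI (inner ℝ x' ξ) * sc σ p x' ξ * κ (x - x')) =
      ∫ x', expI (-inner ℝ y ξ + φ ξ) * (expI (inner ℝ x' ξ) * sc σ p x' ξ * κ (x - x')) :=
    fun ξ => (integral_const_mul _ _).symm
  simp only [e1]
  rw [integral_integral_swap hint, ← integral_const_mul]
  refine integral_congr_ae (.of_forall fun x' => ?_)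
  simp only
  rw [dil_ker_oscSymbol φ hσ, freqIntegral, mul_left_comm, ← integral_const_mul, ← integral_const_mul,
    ← integral_const_mul]
  refine integral_congr_ae (.of_forall fun ξ => ?_)
  simp only
  rw [expI_add, inner_sub_left, sub_eq_add_neg (inner ℝ x' ξ), expI_add]
  ring

theorem norm_dil_le_wt {q : ℝ} (hq : 0 ≤ q) {κ : Eucl n → ℂ} {G : ℝ} (hκ : ∀ w, ‖κ w‖ ≤ G * wt q w) {σ : ℝ}
    (hσ : 1 ≤ σ) (w : Eucl n) : ‖dil σ κ w‖ ≤ σ ^ n * G * wt q w := by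
  have hσ0 : 0 < σ := by linarith
  have hG : 0 ≤ G := nonneg_of_mul_nonneg_left ((norm_nonneg _).trans (hκ 0)) (wt_pos _ _)
  unfold dil
  rw [norm_mul, Complex.norm_real, Real.norm_of_nonneg (by positivity), mul_assoc]
  refine mul_le_mul_of_nonneg_left ((hκ _).trans (mul_le_mul_of_nonneg_left ?_ hG)) (by positivity)
  unfold wt
  refine Real.rpow_le_rpow_of_nonpos (by positivity) ?_ (by linarith)
  rw [norm_smul, Real.norm_of_nonneg hσ0.le]
  nlinarith [norm_nonneg w]

/-- The weighted mass of dilates of kernels, uniformly for scales bounded from below. -/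
theorem exists_weighted_mass (t₀ : ℝ) (ht₀ : 0 < t₀) {Q : Eucl n → ℂ} (hQ : IsSymbol Q) {q : ℝ}
    (hq0 : 0 ≤ q) (hq : q ≤ n + 1) : ∃ C : ℝ, 0 ≤ C ∧ ∀ τ, t₀ ≤ τ →
      (Integrable fun v : Eucl n => ‖dil τ (ker Q) v‖ * (1 + ‖v‖) ^ q) ∧
        ∫ v, ‖dil τ (ker Q) v‖ * (1 + ‖v‖) ^ q ≤ C := by
  have h1 := hQ.integrable_ker_rpow (n + 1)
  set D : ℝ := max 1 t₀⁻¹ with hD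
  have hD1 : 1 ≤ D := le_max_left _ _
  refine ⟨D ^ q * ∫ w, (1 + ‖w‖) ^ (n + 1) * ‖ker Q w‖, by positivity, fun τ hτ => ?_⟩
  have hτ0 : 0 < τ := by linarith
  set F : Eucl n → ℝ := fun w => ‖ker Q w‖ * (1 + ‖τ⁻¹ • w‖) ^ q with hF
  have hFb : ∀ w, F w ≤ D ^ q * ((1 + ‖w‖) ^ (n + 1) * ‖ker Q w‖) := fun w => by
    have h2 : 1 + ‖τ⁻¹ • w‖ ≤ D * (1 + ‖w‖) := by
      rw [norm_smul, norm_inv, Real.norm_of_nonneg hτ0.le]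
      have h3 : τ⁻¹ ≤ D := (inv_anti₀ ht₀ hτ).trans (le_max_right _ _)
      nlinarith [norm_nonneg w]
    have h4 : (1 + ‖τ⁻¹ • w‖) ^ q ≤ D ^ q * (1 + ‖w‖) ^ (n + 1) := by
      refine (Real.rpow_le_rpow (by positivity) h2 hq0).trans ?_
      rw [Real.mul_rpow (by positivity) (by positivity)]
      refine mul_le_mul_of_nonneg_left ?_ (by positivity)
      rw [← Real.rpow_natCast]
      refine Real.rpow_le_rpow_of_exponent_le (by linarith [norm_nonneg w]) ?_
      push_cast; linarith
    calc F w ≤ ‖ker Q w‖ * (D ^ q * (1 + ‖w‖) ^ (n + 1)) := by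
          simp only [hF]; gcongr
      _ = _ := by ring
  have hFc : Continuous F := by
    refine (continuous_ker hQ.integrable).norm.mul (Continuous.rpow_const (by fun_prop) fun w => Or.inl ?_)
    positivity
  have hFi : Integrable F := by
    refine (h1.const_mul (D ^ q)).mono' hFc.aestronglyMeasurable (.of_forall fun w => ?_)
    rw [Real.norm_of_nonneg (by positivity)]
    exact hFb w
  have he : (fun v : Eucl n => ‖dil τ (ker Q) v‖ * (1 + ‖v‖) ^ q) = fun v => τ ^ n * F (τ • v) := by
    ext v
    simp only [dil, hF, norm_mul, Complex.norm_real, inv_smul_smul₀ hτ0.ne']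
    rw [Real.norm_of_nonneg (by positivity)]
    ring
  rw [he]
  refine ⟨(hFi.comp_smul hτ0.ne').const_mul _, ?_⟩
  rw [integral_const_mul, Measure.integral_comp_smul_of_nonneg _ _ _ (hR := hτ0.le), finrank_euclideanSpace,
    Fintype.card_fin, smul_eq_mul, mul_inv_cancel_left₀ (by positivity), ← integral_const_mul]
  exact integral_mono hFi (h1.const_mul _) hFb

theorem continuous_dil {κ : Eucl n → ℂ} (hκ : Continuous κ) (τ : ℝ) : Continuous (dil τ κ) := by
  unfold dil
  exact continuous_const.mul (hκ.comp (continuous_const_smul τ))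

/-- Size of the frequency side and of the kernel. -/
structure KerBound (q : ℝ) (φ : Eucl n → ℝ) (S : Eucl n → Eucl n → ℂ) (c : ℝ) : Prop where
  integrable : ∀ x, Integrable (S x)
  integral_le : ∀ x, ∫ ξ, ‖S x ξ‖ ≤ c
  le_wt : ∀ x y, ‖opKer φ S x y‖ ≤ c * wt q (x - y)

theorem isSeminormBound_kerBound (q : ℝ) {φ : Eucl n → ℝ} (hφ : Measurable φ) :
    IsSeminormBound (KerBound q φ) where
  zero := ⟨fun _ => integrable_zero _ _ _, fun _ => by simp, fun x y => by simp [opKer_zero]⟩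
  add S S' c c' h h' := by
    refine ⟨fun x => (h.integrable x).add (h'.integrable x), fun x => ?_, fun x y => ?_⟩
    · calc _ ≤ ∫ ξ, (‖S x ξ‖ + ‖S' x ξ‖) := integral_mono ((h.integrable x).add (h'.integrable x)).norm
            ((h.integrable x).norm.add (h'.integrable x).norm) fun ξ => norm_add_le _ _
        _ ≤ _ := by
            rw [integral_add (h.integrable x).norm (h'.integrable x).norm]
            exact add_le_add (h.integral_le x) (h'.integral_le x)
    · rw [opKer_add hφ (h.integrable x) (h'.integrable x), add_mul]
      exact (norm_add_le _ _).trans (add_le_add (h.le_wt x y) (h'.le_wt x y))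
  smul S c t ht h := by
    refine ⟨fun x => (h.integrable x).const_mul _, fun x => ?_, fun x y => ?_⟩
    · simp only [norm_mul, Complex.norm_real, Real.norm_of_nonneg ht]
      rw [integral_const_mul]
      exact mul_le_mul_of_nonneg_left (h.integral_le x) ht
    · rw [opKer_const_mul, norm_mul, Complex.norm_real, Real.norm_of_nonneg ht, mul_assoc]
      exact mul_le_mul_of_nonneg_left (h.le_wt x y) ht
  mono S c c' hc h := ⟨h.integrable, fun x => (h.integral_le x).trans hc,
    fun x y => (h.le_wt x y).trans (mul_le_mul_of_nonneg_right hc (wt_nonneg _ _))⟩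

/-- The crude bound of kernels: the operator `Q_j` costs nothing. -/
theorem exists_kerBound (t₀ : ℝ) (ht₀ : 0 < t₀) {Q : Eucl n → ℂ} (hQ : IsSymbol Q) {q : ℝ}
    (hq0 : 0 ≤ q) (hq : q ≤ n + 1) (r : ℝ) (A : ℕ → ℕ → ℝ) : ∃ C : ℝ, 0 ≤ C ∧
    ∀ (p : Eucl n → Eucl n → ℂ) (φ : Eucl n → ℝ) (σ τ G : ℝ), IsAmp r A p → Measurable φ → 1 ≤ σ → t₀ ≤ τ →
      1 ≤ G → (∀ x w, ‖ker (oscSymbol φ σ p x) w‖ ≤ G * wt q w) →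
      KerBound q φ (Sg (sc σ p) (dil τ (ker Q))) (C * (σ ^ n * G)) := by
  obtain ⟨C, hC0, hC⟩ := exists_weighted_mass t₀ ht₀ hQ hq0 hq
  set V := volume.real (Metric.closedBall (0 : Eucl n) 2) with hV
  refine ⟨C + |A 0 0| * C * V, by positivity, fun p φ σ τ G hp hφ hσ hτ hG hker => ?_⟩
  have hσ0 : 0 < σ := by linarith
  have hτ0 : 0 < τ := by linarith
  have hκc := continuous_dil (continuous_ker hQ.integrable) τ
  have hκ := integrable_dil hQ.integrable_ker hτ0
  obtain ⟨hi, hle⟩ := hC τ hτ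
  have hG0 : 0 ≤ G := by linarith
  refine ⟨fun x => (hp.integrable_Sg hσ0 hκc hκ x).1, fun x => ?_, fun x y => ?_⟩
  · have h1 : ∫ w, ‖dil τ (ker Q) w‖ ≤ C := by
      refine (integral_mono hκ.norm hi fun v => ?_).trans hle
      exact le_mul_of_one_le_right (norm_nonneg _) (Real.one_le_rpow (by linarith [norm_nonneg v]) hq0)
    have h2 : volume.real (Metric.closedBall (0 : Eucl n) (2 * σ)) = σ ^ n * V := by
      rw [hV, mul_comm, measureReal_def, Measure.addHaar_closedBall_mul _ _ hσ0.le zero_le_two,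
        ENNReal.toReal_mul, finrank_euclideanSpace, Fintype.card_fin,
        ENNReal.toReal_ofReal (by positivity), measureReal_def]
    calc _ ≤ A 0 0 * (∫ w, ‖dil τ (ker Q) w‖) * volume.real (Metric.closedBall (0 : Eucl n) (2 * σ)) :=
          (hp.integrable_Sg hσ0 hκc hκ x).2
      _ ≤ |A 0 0| * C * (σ ^ n * V) := by
          rw [h2]
          have : 0 ≤ ∫ w, ‖dil τ (ker Q) w‖ := integral_nonneg fun _ => norm_nonneg _
          gcongr
          exact le_abs_self _
      _ = |A 0 0| * C * V * (σ ^ n * 1) := by ring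
      _ ≤ |A 0 0| * C * V * (σ ^ n * G) := by gcongr
      _ ≤ _ := by
          refine mul_le_mul_of_nonneg_right ?_ (by positivity)
          linarith
  · rw [opKer_Sg hp hφ hσ0 hκc hκ]
    have hb : ∀ x', ‖dil τ (ker Q) (x - x') * dil σ (ker (oscSymbol φ σ p x')) (x' - y)‖ ≤
        ‖dil τ (ker Q) (x - x')‖ * (1 + ‖x - x'‖) ^ q * (σ ^ n * G * wt q (x - y)) := fun x' => by
      rw [norm_mul, mul_assoc]
      refine mul_le_mul_of_nonneg_left ?_ (norm_nonneg _)
      refine (norm_dil_le_wt hq0 (hker x') hσ _).trans ?_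
      -- Peetre's inequality recentres the weight from x' to x. The price (1+|x-x'|)^q is paid by
      -- the weighted mass of the kernel of Q_j.
      have h1 := wt_le_mul_wt hq0 (x' - y) (x - y)
      rw [sub_sub_sub_cancel_right, norm_sub_rev] at h1
      calc _ ≤ σ ^ n * G * ((1 + ‖x - x'‖) ^ q * wt q (x - y)) := by gcongr
        _ = _ := by ring
    refine (norm_integral_le_of_norm_le ((hi.comp_sub_left x).mul_const _) (.of_forall hb)).trans ?_
    rw [integral_mul_const, integral_sub_left_eq_self fun v => ‖dil τ (ker Q) v‖ * (1 + ‖v‖) ^ q]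
    have h2 := wt_nonneg q (x - y)
    have h3 : 0 ≤ |A 0 0| * C * V := by positivity
    calc _ ≤ C * (σ ^ n * G * wt q (x - y)) := by gcongr
      _ ≤ (C + |A 0 0| * C * V) * (σ ^ n * G * wt q (x - y)) := by gcongr; linarith
      _ = _ := by ring

/-! ### Square function bounds of annular pieces -/

theorem conj_ker {P : Eucl n → ℂ} (w : Eucl n) :
    (starRingEnd ℂ) (ker P w) = ker (fun ζ => (starRingEnd ℂ) (P ζ)) (-w) := by
  unfold ker freqIntegral
  rw [map_mul, map_inv₀, Complex.conj_ofReal, ← integral_conj]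
  congr 1
  refine integral_congr_ae (.of_forall fun ζ => ?_)
  simp only [map_mul, conj_expI, inner_neg_left]

theorem integral_ker_sub_mul_ker {P R : Eucl n → ℂ} (hP : IsSymbol P) (hR : IsSymbol R) (x y : Eucl n) :
    ∫ z, ker P (x - z) * ker R (z - y) = ker (fun ζ => P ζ * R ζ) (x - y) := by
  have h := integral_ker_sub_mul_conj hP hR.conj x y
  simp only [conj_ker, Complex.conj_conj, neg_sub] at h
  exact h

theorem integral_dil_sub_mul_dil {k₁ k₂ k : Eucl n → ℂ} (h : ∀ x y, ∫ z, k₁ (x - z) * k₂ (z - y) = k (x - y))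
    {σ : ℝ} (hσ : 0 < σ) (x y : Eucl n) : ∫ z, dil σ k₁ (x - z) * dil σ k₂ (z - y) = dil σ k (x - y) := by
  unfold dil
  have h1 := Measure.integral_comp_smul_of_nonneg (volume : Measure (Eucl n))
    (fun z => k₁ (σ • x - z) * k₂ (z - σ • y)) σ (hR := hσ.le)
  rw [h, finrank_euclideanSpace, Fintype.card_fin, Complex.real_smul] at h1
  have h2 : ∀ z, ((σ ^ n : ℝ) : ℂ) * k₁ (σ • (x - z)) * (((σ ^ n : ℝ) : ℂ) * k₂ (σ • (z - y))) =
      ((σ ^ n : ℝ) : ℂ) ^ 2 * (k₁ (σ • x - σ • z) * k₂ (σ • z - σ • y)) := fun z => by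
    rw [smul_sub, smul_sub]; ring
  simp only [h2]
  have h3 : ((σ ^ n : ℝ) : ℂ) ≠ 0 := by exact_mod_cast (pow_pos hσ n).ne'
  rw [integral_const_mul, h1, smul_sub]
  push_cast at h3 ⊢
  field_simp

theorem oscSymbol_eq (φ : Eucl n → ℝ) {σ : ℝ} (hσ : 0 < σ) (s : ℝ) (p : Eucl n → Eucl n → ℂ) (x : Eucl n) :
    oscSymbol φ σ p x = fun ζ => expI (σ ^ s * (σ ^ (-s) * φ (σ • ζ))) * p x ζ := by
  ext ζ
  unfold oscSymbol
  rw [← mul_assoc (σ ^ s), ← Real.rpow_add hσ, add_neg_cancel, Real.rpow_zero, one_mul]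

theorem isSymbol_oscSymbol {s : ℝ} {c : ℕ → ℝ} {φ : Eucl n → ℝ} (hφ : IsPhase s c φ) {A : ℕ → ℕ → ℝ}
    {p : Eucl n → Eucl n → ℂ} (hp : IsAmp (1 / 2) A p) {σ : ℝ} (hσ : 0 < σ) (x : Eucl n) :
    IsSymbol (oscSymbol φ σ p x) := by
  rw [oscSymbol_eq φ hσ s]
  exact isSymbol_comp_phase (hφ.rescale hσ) hp (g := fun t => expI (σ ^ s * t))
    (contDiff_expI.comp (contDiff_const.mul contDiff_id)) x

/-- A derivative of the symbol costs σ^s. In the product that governs T T* the phase factors cancel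
because φ does not depend on x, so that product is as smooth as the amplitude, uniformly in σ. -/
theorem exists_oscSymbol_bound {s : ℝ} (hs : 0 < s) (c : ℕ → ℝ) (A : ℕ → ℕ → ℝ) (N : ℕ) : ∃ B : ℝ, 1 ≤ B ∧
    ∀ (φ : Eucl n → ℝ) (p : Eucl n → Eucl n → ℂ) (σ : ℝ), IsPhase s c φ → IsAmp (1 / 2) A p → 1 ≤ σ →
      (∀ x, ∀ m ≤ N, ∀ ζ, ‖iteratedFDeriv ℝ m (oscSymbol φ σ p x) ζ‖ ≤ B * (σ ^ s) ^ m) ∧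
      ∀ x x', ∀ m ≤ N, ∀ ζ, ‖iteratedFDeriv ℝ m
        (fun η => oscSymbol φ σ p x η * (starRingEnd ℂ) (oscSymbol φ σ p x' η)) ζ‖ ≤ B ^ 2 := by
  obtain ⟨C, hC0, hC⟩ := exists_exp_phase_bound (n := n) s c A N
  set D : ℝ := ∑ m ∈ Finset.range (N + 1), ∑ i ∈ Finset.range (m + 1),
    (m.choose i : ℝ) * |A i 0| * |A (m - i) 0| with hD
  have hD0 : 0 ≤ D := by positivity
  refine ⟨1 + C + D, by linarith, fun φ p σ hφ hp hσ => ⟨fun x m hm ζ => ?_, fun x x' m hm ζ => ?_⟩⟩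
  · have hσ0 : 0 < σ := by linarith
    have h := hC _ p (σ ^ s) (hφ.rescale hσ0) hp (Real.one_le_rpow hσ hs.le) m hm x ζ
    rw [oscSymbol_eq φ hσ0 s]
    refine h.trans (mul_le_mul_of_nonneg_right (by linarith) (by positivity))
  · have e : (fun η => oscSymbol φ σ p x η * (starRingEnd ℂ) (oscSymbol φ σ p x' η)) =
        fun η => p x η * (starRingEnd ℂ) (p x' η) := by
      ext η
      unfold oscSymbol
      have h1 : expI (φ (σ • η)) * (starRingEnd ℂ) (expI (φ (σ • η))) = 1 := by
        rw [conj_expI, ← expI_add, add_neg_cancel, expI_zero]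
      rw [map_mul]
      linear_combination (p x η * (starRingEnd ℂ) (p x' η)) * h1
    rw [e]
    have hc : ContDiff ℝ ∞ fun η => (starRingEnd ℂ) (p x' η) := (hp.isSymbol x').conj.smooth
    have hcn : ∀ i, ‖iteratedFDeriv ℝ i (fun η => (starRingEnd ℂ) (p x' η)) ζ‖ = ‖iteratedFDeriv ℝ i (p x') ζ‖ :=
      fun i => Complex.conjLIE.norm_iteratedFDeriv_comp_left (p x') ζ i
    refine (norm_iteratedFDeriv_mul_le (hp.isSymbol x).smooth hc ζ (by exact_mod_cast le_top)).trans ?_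
    have hDB : D ≤ (1 + C + D) ^ 2 := by nlinarith
    refine le_trans ?_ hDB
    refine le_trans (Finset.sum_le_sum fun i _ => ?_) (Finset.single_le_sum
      (f := fun m => ∑ i ∈ Finset.range (m + 1), (m.choose i : ℝ) * |A i 0| * |A (m - i) 0|)
      (fun m _ => by positivity) (Finset.mem_range.2 (show m < N + 1 by omega)))
    rw [hcn]
    exact mul_le_mul (mul_le_mul_of_nonneg_left ((hp.norm_iteratedFDeriv_le _ _ _).trans (le_abs_self _))
      (by positivity)) ((hp.norm_iteratedFDeriv_le _ _ _).trans (le_abs_self _)) (norm_nonneg _) (by positivity)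

theorem measurable_oscSymbol {r : ℝ} {A : ℕ → ℕ → ℝ} {p : Eucl n → Eucl n → ℂ} (hp : IsAmp r A p)
    {φ : Eucl n → ℝ} (hφ : Measurable φ) (σ : ℝ) : Measurable (Function.uncurry (oscSymbol φ σ p)) := by
  refine Measurable.mul ?_ hp.continuous.measurable
  exact continuous_expI.measurable.comp (hφ.comp (measurable_snd.const_smul σ))

theorem dil_ker_sub (P : Eucl n → ℂ) (σ : ℝ) (x z : Eucl n) :
    dil σ (ker P) (x - z) = ((σ ^ n : ℝ) : ℂ) * ker P (σ • x - σ • z) := by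
  unfold dil; rw [smul_sub]

theorem measurable_dil_ker_sub {P : Eucl n → Eucl n → ℂ} (hP : Measurable (Function.uncurry P)) {σ : ℝ}
    (hσ : 0 < σ) : Measurable (Function.uncurry fun x z : Eucl n => dil σ (ker (P x)) (x - z)) := by
  have h1 : Measurable (Function.uncurry fun x => P (σ⁻¹ • x)) :=
    hP.comp ((measurable_fst.const_smul σ⁻¹).prodMk measurable_snd)
  have h2 := (measurable_ker_sub h1).comp
    ((measurable_fst.const_smul σ).prodMk (measurable_snd.const_smul σ) : Measurable
      fun q : Eucl n × Eucl n => (σ • q.1, σ • q.2))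
  have h3 : (Function.uncurry fun x z : Eucl n => dil σ (ker (P x)) (x - z)) = fun q =>
      ((σ ^ n : ℝ) : ℂ) * (Function.uncurry fun x z => ker (P (σ⁻¹ • x)) (x - z)) (σ • q.1, σ • q.2) := by
    ext q
    simp only [Function.uncurry, dil_ker_sub, inv_smul_smul₀ hσ.ne']
  rw [h3]
  exact h2.const_mul _

/-- Change of scale in integrals over cubes. -/
theorem lintegral_cube_comp_smul {σ : ℝ} (hσ : 0 < σ) (a : Eucl n) (r : ℝ) (h : Eucl n → ℝ≥0∞) :
    ∫⁻ x in cube a r, h (σ • x) = ENNReal.ofReal ((σ ^ n)⁻¹) * ∫⁻ u in cube (σ • a) (σ * r), h u := by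
  have hmem : ∀ x : Eucl n, σ • x ∈ cube (σ • a) (σ * r) ↔ x ∈ cube a r := fun x => by
    unfold cube
    simp only [Set.mem_ofPred_eq, PiLp.smul_apply, smul_eq_mul, ← mul_add]
    exact forall_congr' fun i => by rw [mul_le_mul_iff_right₀ hσ, mul_le_mul_iff_right₀ hσ]
  rw [← lintegral_indicator (measurableSet_cube _ _), ← lintegral_indicator (measurableSet_cube _ _)]
  have h1 : (fun x => (cube a r).indicator (fun x => h (σ • x)) x) =
      fun x => (cube (σ • a) (σ * r)).indicator h (σ • x) := by
    ext x
    by_cases hx : x ∈ cube a r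
    · rw [Set.indicator_of_mem hx, Set.indicator_of_mem ((hmem x).2 hx)]
    · rw [Set.indicator_of_notMem hx, Set.indicator_of_notMem (mt (hmem x).1 hx)]
  rw [h1]
  have h2 := Measure.map_addHaar_smul (volume : Measure (Eucl n)) hσ.ne'
  rw [finrank_euclideanSpace, Fintype.card_fin, abs_of_nonneg (by positivity)] at h2
  rw [← smul_eq_mul (ENNReal.ofReal _), ← lintegral_smul_measure, ← h2]
  exact ((Homeomorph.smulOfNeZero σ hσ.ne').measurableEmbedding.lintegral_map _).symm

/-- The local square estimate after dilation by σ: the oscillation is λ = σ^s and the cube has side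
σr. -/
theorem exists_osc_sq_estimate (hn : 1 ≤ n) {δ : ℝ} (hδ₀ : 0 < δ) (hδ₁ : δ < 1) {s : ℝ} (hs : 0 < s)
    (c : ℕ → ℝ) (A : ℕ → ℕ → ℝ) : ∃ C : ℝ, 0 ≤ C ∧
    ∀ (φ : Eucl n → ℝ) (p : Eucl n → Eucl n → ℂ) (σ Λ : ℝ) (g : Eucl n → ℂ) (a : Eucl n) (r : ℝ),
      IsPhase s c φ → IsAmp (1 / 2) A p → 1 ≤ σ → Measurable g → (∀ z, ‖g z‖ ≤ Λ) → 0 < r →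
      ∫⁻ x in cube a r, ‖∫ z, dil σ (ker (oscSymbol φ σ p x)) (x - z) * g z‖ₑ ^ 2
        ≤ ENNReal.ofReal (C * Λ ^ 2 * (1 + (σ ^ s) ^ n * (σ * r) ^ (-(n * δ))) * r ^ n) := by
  obtain ⟨N, C, hC0, hC⟩ := exists_local_sq_estimate hn hδ₀ hδ₁
  obtain ⟨B, hB1, hB⟩ := exists_oscSymbol_bound (n := n) hs c A (max N (n + 1))
  refine ⟨C * B ^ 2, by positivity, fun φ p σ Λ g a r hφ hp hσ hg hgΛ hr => ?_⟩
  have hσ0 : 0 < σ := by linarith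
  obtain ⟨hB1, hB2⟩ := hB φ p σ hφ hp hσ
  set P : Eucl n → Eucl n → ℂ := fun u => oscSymbol φ σ p (σ⁻¹ • u) with hP
  have hPm : Measurable (Function.uncurry P) :=
    (measurable_oscSymbol hp hφ.measurable σ).comp ((measurable_fst.const_smul σ⁻¹).prodMk measurable_snd)
  have h1 := hC P B (σ ^ s) Λ (fun z => g (σ⁻¹ • z)) (σ • a) (σ * r) hPm
    (fun x => isSymbol_oscSymbol hφ hp hσ0 _) (Real.one_le_rpow hσ hs.le)
    (fun x m hm ζ => hB1 _ m (hm.trans (le_max_left _ _)) ζ)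
    (fun x x' m hm ζ => hB2 _ _ m (hm.trans (le_max_right _ _)) ζ)
    (hg.comp (measurable_const_smul σ⁻¹)) (fun z => hgΛ _) (by positivity)
  have h2 : ∀ x, ∫ z, dil σ (ker (oscSymbol φ σ p x)) (x - z) * g z =
      ∫ z, ker (P (σ • x)) (σ • x - z) * g (σ⁻¹ • z) := fun x => by
    have h3 := Measure.integral_comp_smul_of_nonneg (volume : Measure (Eucl n))
      (fun z => ker (P (σ • x)) (σ • x - z) * g (σ⁻¹ • z)) σ (hR := hσ0.le)
    simp only [inv_smul_smul₀ hσ0.ne'] at h3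
    rw [finrank_euclideanSpace, Fintype.card_fin, Complex.real_smul] at h3
    simp only [dil_ker_sub, mul_assoc]
    rw [integral_const_mul]
    simp only [hP, inv_smul_smul₀ hσ0.ne'] at h3 ⊢
    rw [h3]
    have h4 : ((σ ^ n : ℝ) : ℂ) ≠ 0 := by exact_mod_cast (pow_pos hσ0 n).ne'
    push_cast at h4 ⊢
    field_simp
  simp only [h2]
  rw [lintegral_cube_comp_smul hσ0 a r fun u => ‖∫ z, ker (P u) (u - z) * g (σ⁻¹ • z)‖ₑ ^ 2]
  refine (mul_le_mul_right h1 _).trans ?_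
  rw [← ENNReal.ofReal_mul (by positivity)]
  refine ENNReal.ofReal_le_ofReal (le_of_eq ?_)
  rw [mul_pow σ r n]
  field_simp

/-- Minkowski's inequality for convolutions, in square means over cubes. -/
theorem lintegral_cube_conv_sq_le {k g : Eucl n → ℝ≥0∞} (hk : Measurable k) (hg : Measurable g)
    {r : ℝ} {X : ℝ≥0∞} (hX : ∀ a, ∫⁻ x in cube a r, g x ^ 2 ≤ X) (a : Eucl n) :
    ∫⁻ x in cube a r, (∫⁻ v, k v * g (x - v)) ^ 2 ≤ (∫⁻ v, k v) ^ 2 * X := by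
  have hsq : ∀ t : ℝ≥0∞, (t ^ (1 / 2 : ℝ)) ^ 2 = t := fun t => by
    rw [← ENNReal.rpow_natCast, ← ENNReal.rpow_mul]; norm_num
  -- Cauchy–Schwarz for the measure k(v) dv. The hypothesis is uniform in the corner of the cube, so
  -- it applies to every translate of g.
  have h1 : ∀ x, (∫⁻ v, k v * g (x - v)) ^ 2 ≤ (∫⁻ v, k v) * ∫⁻ v, k v * g (x - v) ^ 2 := fun x => by
    have hgx : Measurable fun v => g (x - v) := hg.comp (measurable_id.const_sub x)
    have h := lintegral_mul_sq_le volume (f := fun v => k v ^ (1 / 2 : ℝ))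
      (g := fun v => k v ^ (1 / 2 : ℝ) * g (x - v)) (hk.pow_const _).aemeasurable
      ((hk.pow_const _).mul hgx).aemeasurable
    simp only [mul_pow, hsq] at h
    refine le_trans (le_of_eq ?_) h
    congr 1
    refine lintegral_congr fun v => ?_
    rw [← mul_assoc, ← sq, hsq]
  have htr : ∀ v, ∫⁻ x in cube a r, g (x - v) ^ 2 ≤ X := fun v => by
    refine le_trans (le_of_eq ?_) (hX (a - v))
    rw [← lintegral_indicator (measurableSet_cube _ _), ← lintegral_indicator (measurableSet_cube _ _),
      ← lintegral_sub_right_eq_self (fun x => (cube (a - v) r).indicator (fun x => g x ^ 2) x) v]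
    refine lintegral_congr fun x => ?_
    have hmem : x - v ∈ cube (a - v) r ↔ x ∈ cube a r := by
      unfold cube
      simp only [Set.mem_ofPred_eq, PiLp.sub_apply]
      exact forall_congr' fun i => ⟨fun h => ⟨by linarith [h.1], by linarith [h.2]⟩,
        fun h => ⟨by linarith [h.1], by linarith [h.2]⟩⟩
    by_cases hx : x ∈ cube a r
    · rw [Set.indicator_of_mem hx, Set.indicator_of_mem (hmem.2 hx)]
    · rw [Set.indicator_of_notMem hx, Set.indicator_of_notMem (mt hmem.1 hx)]
  have hm : Measurable (Function.uncurry fun x v => k v * g (x - v) ^ 2) :=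
    (hk.comp measurable_snd).mul ((hg.comp (measurable_fst.sub measurable_snd)).pow_const 2)
  calc _ ≤ ∫⁻ x in cube a r, (∫⁻ v, k v) * ∫⁻ v, k v * g (x - v) ^ 2 := lintegral_mono fun x => h1 x
    _ = (∫⁻ v, k v) * ∫⁻ x in cube a r, ∫⁻ v, k v * g (x - v) ^ 2 :=
        lintegral_const_mul _ (hm.lintegral_prod_right (ν := volume))
    _ = (∫⁻ v, k v) * ∫⁻ v, ∫⁻ x in cube a r, k v * g (x - v) ^ 2 := by
        rw [lintegral_lintegral_swap hm.aemeasurable]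
    _ = (∫⁻ v, k v) * ∫⁻ v, k v * ∫⁻ x in cube a r, g (x - v) ^ 2 := by
        congr 1
        refine lintegral_congr fun v => lintegral_const_mul _ ?_
        exact (hg.comp (measurable_id.sub_const v)).pow_const 2
    _ ≤ (∫⁻ v, k v) * ∫⁻ v, k v * X := by
        gcongr with v
        exact htr v
    _ = _ := by rw [lintegral_mul_const _ hk]; ring

/-- A fattened annular cut-off, equal to `1` for `1/2 ≤ |ζ| ≤ 2`. -/
def fatBet (ϑ : Eucl n → ℝ) (ζ : Eucl n) : ℂ := ((ϑ ((2 : ℝ)⁻¹ • ζ) - ϑ ((4 : ℝ) • ζ) : ℝ) : ℂ)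

variable {ϑ : Eucl n → ℝ}

theorem IsCutoff.isSymbol_fatBet (hϑ : IsCutoff ϑ) : IsSymbol (fatBet ϑ) := by
  refine ⟨Complex.ofRealCLM.contDiff.comp ((hϑ.smooth.comp (contDiff_const_smul _)).sub
    (hϑ.smooth.comp (contDiff_const_smul _))), fun ζ hζ => ?_⟩
  unfold fatBet
  rw [hϑ.eq_zero _ (by rw [norm_smul]; norm_num; linarith),
    hϑ.eq_zero _ (by rw [norm_smul]; norm_num; linarith)]
  simp

theorem IsCutoff.fatBet_eq_one (hϑ : IsCutoff ϑ) {ζ : Eucl n} (h1 : 1 / 2 ≤ ‖ζ‖) (h2 : ‖ζ‖ ≤ 2) :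
    fatBet ϑ ζ = 1 := by
  unfold fatBet
  rw [hϑ.eq_one _ (by rw [norm_smul]; norm_num; linarith),
    hϑ.eq_zero _ (by rw [norm_smul]; norm_num; linarith)]
  simp

theorem fatBet_zero : fatBet ϑ (0 : Eucl n) = 0 := by
  simp [fatBet]

/-- The frequency localisation of a function at scale `σ`. -/
def freqPiece (ϑ : Eucl n → ℝ) (σ : ℝ) (f : Eucl n → ℂ) (z : Eucl n) : ℂ :=
  ∫ y, dil σ (ker (fatBet ϑ)) (z - y) * f y

theorem measurable_freqPiece (hϑ : IsCutoff ϑ) (σ : ℝ) {f : Eucl n → ℂ} (hf : Measurable f) :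
    Measurable (freqPiece ϑ σ f) := by
  have hc := continuous_dil (continuous_ker hϑ.isSymbol_fatBet.integrable) σ
  exact (StronglyMeasurable.integral_prod_right (ν := (volume : Measure (Eucl n)))
    (f := fun z y => dil σ (ker (fatBet ϑ)) (z - y) * f y)
    (((hc.comp continuous_sub).measurable.mul (hf.comp measurable_snd)).stronglyMeasurable)).measurable

/-- The cut-off `fatBet` vanishes at the origin, so its kernel has mean zero and the oscillation
bound applies after normalisation by K. This turns bmo into L^∞, frequency by frequency. -/
theorem exists_freqPiece_bound (hϑ : IsCutoff ϑ) : ∃ K : ℝ, 0 < K ∧ ∀ (γ Λ : ℝ) (f : Eucl n → ℂ) (σ : ℝ),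
    IsTame γ Λ f → 1 ≤ σ → ∀ z, ‖freqPiece ϑ σ f z‖ ≤ K * Λ := by
  obtain ⟨K, hK0, hK⟩ := hϑ.isSymbol_fatBet.exists_ker_le_wt (n + 1)
  refine ⟨K, hK0, fun γ Λ f σ hf hσ z => ?_⟩
  have hKc : (K : ℂ) ≠ 0 := by exact_mod_cast hK0.ne'
  have h := hf.osc (fun w => (K : ℂ)⁻¹ * ker (fatBet ϑ) w)
    (continuous_const.mul (continuous_ker hϑ.isSymbol_fatBet.integrable)) (fun w => ?_) ?_ σ hσ z
  · have e : freqPiece ϑ σ f z =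
        K * ∫ y, dil σ (fun w => (K : ℂ)⁻¹ * ker (fatBet ϑ) w) (z - y) * f y := by
      unfold freqPiece dil
      rw [← integral_const_mul]
      refine integral_congr_ae (.of_forall fun y => ?_)
      simp only
      field_simp
    rw [e, norm_mul, Complex.norm_real, Real.norm_of_nonneg hK0.le]
    exact mul_le_mul_of_nonneg_left h hK0.le
  · rw [norm_mul, norm_inv, Complex.norm_real, Real.norm_of_nonneg hK0.le, inv_mul_le_iff₀ hK0]
    exact_mod_cast hK w
  · rw [integral_const_mul, hϑ.isSymbol_fatBet.integral_ker, fatBet_zero, mul_zero]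

/-- Kernels with one-sided weighted integrability can be moved past a tame function. -/
theorem integrable_prod_tame {γ Λ : ℝ} {f : Eucl n → ℂ} (hf : IsTame γ Λ f) {x : Eucl n}
    {k : Eucl n → ℝ} (hk : Integrable fun v : Eucl n => k v * (1 + ‖v‖) ^ ((n : ℝ) + γ))
    (hγ : 0 ≤ (n : ℝ) + γ) {c : ℝ} {H : Eucl n → Eucl n → ℂ}
    (hH : Measurable (Function.uncurry H)) (hk0 : ∀ v, 0 ≤ k v) (hc : 0 ≤ c)
    (hb : ∀ z y, ‖H z y‖ ≤ k (x - z) * (c * wt (n + γ) (z - y))) :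
    Integrable (Function.uncurry fun z y => H z y * f y) (volume.prod volume) := by
  refine (((hk.comp_sub_left x).mul_prod (hf.integrable x)).const_mul c).mono' ?_ (.of_forall fun q => ?_)
  · exact (hH.mul (hf.measurable.comp measurable_snd)).aestronglyMeasurable
  · simp only [Function.uncurry]
    rw [norm_mul]
    have h1 := wt_le_mul_wt hγ (q.1 - q.2) (x - q.2)
    rw [sub_sub_sub_cancel_right, norm_sub_rev] at h1
    have h2 := hk0 (x - q.1)
    calc _ ≤ k (x - q.1) * (c * ((1 + ‖x - q.1‖) ^ ((n : ℝ) + γ) * wt (n + γ) (x - q.2))) * ‖f q.2‖ := by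
          refine mul_le_mul_of_nonneg_right ((hb _ _).trans ?_) (norm_nonneg _)
          exact mul_le_mul_of_nonneg_left (mul_le_mul_of_nonneg_left h1 hc) h2
      _ = _ := by ring

/-- The fattened cut-off is 1 on the support of p, so the oscillatory operator reproduces itself
through the frequency piece of f. The unbounded f is thereby replaced by a bounded function. -/
theorem integral_oscKer_eq (hϑ : IsCutoff ϑ) {s : ℝ} {c : ℕ → ℝ} {φ : Eucl n → ℝ} (hφ : IsPhase s c φ)
    {A : ℕ → ℕ → ℝ} {p : Eucl n → Eucl n → ℂ} (hp : IsAmp (1 / 2) A p) {σ : ℝ} (hσ : 1 ≤ σ)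
    {γ Λ : ℝ} (hγ : 0 ≤ γ) (hγ1 : γ ≤ 1) {f : Eucl n → ℂ} (hf : IsTame γ Λ f) (x : Eucl n) :
    ∫ y, dil σ (ker (oscSymbol φ σ p x)) (x - y) * f y =
      ∫ z, dil σ (ker (oscSymbol φ σ p x)) (x - z) * freqPiece ϑ σ f z := by
  have hσ0 : 0 < σ := by linarith
  have hq0 : 0 ≤ (n : ℝ) + γ := by positivity
  have hP := isSymbol_oscSymbol hφ hp hσ0 x
  set P := oscSymbol φ σ p x with hPdef
  have hPβ : (fun ζ => P ζ * fatBet ϑ ζ) = P := by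
    ext ζ
    by_cases h1 : ‖ζ‖ ≤ 1 / 2
    · rw [hPdef, oscSymbol, hp.eq_zero_near x ζ h1]; simp
    by_cases h2 : 2 ≤ ‖ζ‖
    · rw [hPdef, oscSymbol, hp.eq_zero x ζ h2]; simp
    · rw [hϑ.fatBet_eq_one (not_le.1 h1).le (not_le.1 h2).le, mul_one]
  have hconv : ∀ x y, ∫ z, ker P (x - z) * ker (fatBet ϑ) (z - y) = ker P (x - y) := fun x y => by
    rw [integral_ker_sub_mul_ker hP hϑ.isSymbol_fatBet, hPβ]
  have hcP := continuous_dil (continuous_ker hP.integrable) σ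
  have hcβ := continuous_dil (continuous_ker hϑ.isSymbol_fatBet.integrable) σ
  obtain ⟨K, hK0, hK⟩ := hϑ.isSymbol_fatBet.exists_ker_le_wt (n + 1)
  have hK' : ∀ w, ‖ker (fatBet ϑ) w‖ ≤ K * wt (n + γ) w := fun w =>
    (hK w).trans (mul_le_mul_of_nonneg_left (wt_anti (by push_cast; linarith) w) hK0.le)
  obtain ⟨_, -, hmass⟩ := exists_weighted_mass 1 one_pos hP hq0 (by linarith)
  have hint := integrable_prod_tame hf (x := x) (k := fun v => ‖dil σ (ker P) v‖) (hmass σ hσ).1 hq0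
    (c := σ ^ n * K) (H := fun z y => dil σ (ker P) (x - z) * dil σ (ker (fatBet ϑ)) (z - y))
    (((hcP.comp (continuous_const.sub continuous_fst)).mul (hcβ.comp continuous_sub)).measurable)
    (fun v => norm_nonneg _) (by positivity) (fun z y => by
      rw [norm_mul]
      exact mul_le_mul_of_nonneg_left (norm_dil_le_wt hq0 hK' hσ _) (norm_nonneg _))
  have hswap := integral_integral_swap hint
  have h1 : ∀ y, dil σ (ker P) (x - y) * f y =
      ∫ z, dil σ (ker P) (x - z) * dil σ (ker (fatBet ϑ)) (z - y) * f y := fun y => by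
    rw [integral_mul_const, integral_dil_sub_mul_dil hconv hσ0]
  rw [integral_congr_ae (.of_forall h1), ← hswap]
  refine integral_congr_ae (.of_forall fun z => ?_)
  simp only [mul_assoc, freqPiece]
  exact integral_const_mul _ _

theorem KerBound.integrable_mul {γ Λ c : ℝ} {f : Eucl n → ℂ} (hf : IsTame γ Λ f) {φ : Eucl n → ℝ}
    (hφ : Measurable φ) {S : Eucl n → Eucl n → ℂ} (h : KerBound (n + γ) φ S c) (x : Eucl n) :
    (Integrable fun y => f y * opKer φ S x y) ∧ ‖∫ y, f y * opKer φ S x y‖ ≤ c * Λ := by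
  have hb : ∀ y, ‖f y * opKer φ S x y‖ ≤ c * (‖f y‖ * wt (n + γ) (x - y)) := fun y => by
    rw [norm_mul, mul_left_comm]
    exact mul_le_mul_of_nonneg_left (h.le_wt x y) (norm_nonneg _)
  have hc : 0 ≤ c := (integral_nonneg fun _ => norm_nonneg _).trans (h.integral_le x)
  refine ⟨((hf.integrable x).const_mul c).mono' (hf.measurable.mul
    (continuous_opKer hφ (h.integrable x)).measurable).aestronglyMeasurable (.of_forall hb), ?_⟩
  refine (norm_integral_le_of_norm_le ((hf.integrable x).const_mul c) (.of_forall hb)).trans ?_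
  rw [integral_const_mul]
  exact mul_le_mul_of_nonneg_left (hf.integral_le x) hc

theorem eLpNorm_two_sq {α : Type*} [MeasurableSpace α] (μ : Measure α) (F : α → ℂ) :
    eLpNorm F 2 μ ^ 2 = ∫⁻ x, ‖F x‖ₑ ^ 2 ∂μ := by
  have h := eLpNorm_nnreal_pow_eq_lintegral (μ := μ) (f := F) (p := 2) two_ne_zero
  simpa using h

/-- Square means of the composed operators over a cube. -/
structure SqBound (φ : Eucl n → ℝ) (f : Eucl n → ℂ) (a : Eucl n) (r : ℝ)
    (S : Eucl n → Eucl n → ℂ) (c : ℝ) : Prop where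
  integrable : ∀ x, Integrable (S x)
  integrable_mul : ∀ x, Integrable fun y => f y * opKer φ S x y
  aestronglyMeasurable : AEStronglyMeasurable (fun x => ∫ y, f y * opKer φ S x y) volume
  le : eLpNorm (fun x => ∫ y, f y * opKer φ S x y) 2 (volume.restrict (cube a r)) ≤ ENNReal.ofReal c
  nonneg : 0 ≤ c

/-- Integrability and measurability belong to the structure because additivity of the pairing with f
and Minkowski's inequality require them. In this form the gain lemmas apply to square means. -/
theorem isSeminormBound_sqBound {φ : Eucl n → ℝ} (hφ : Measurable φ) (f : Eucl n → ℂ) (a : Eucl n) (r : ℝ) :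
    IsSeminormBound (SqBound φ f a r) where
  zero := ⟨fun _ => integrable_zero _ _ _, fun _ => by simp [opKer_zero], by
    simp [opKer_zero, aestronglyMeasurable_const], by simp [opKer_zero], le_rfl⟩
  add S S' c c' h h' := by
    have e1 : ∀ x, (fun y => f y * opKer φ (fun x ξ => S x ξ + S' x ξ) x y) =
        fun y => f y * opKer φ S x y + f y * opKer φ S' x y := fun x => funext fun y => by
      rw [opKer_add hφ (h.integrable x) (h'.integrable x), mul_add]
    have e2 : (fun x => ∫ y, f y * opKer φ (fun x ξ => S x ξ + S' x ξ) x y) =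
        (fun x => ∫ y, f y * opKer φ S x y) + fun x => ∫ y, f y * opKer φ S' x y := funext fun x => by
      rw [e1, integral_add (h.integrable_mul x) (h'.integrable_mul x)]; rfl
    refine ⟨fun x => (h.integrable x).add (h'.integrable x), fun x => ?_, ?_, ?_, add_nonneg h.nonneg h'.nonneg⟩
    · rw [e1]; exact (h.integrable_mul x).add (h'.integrable_mul x)
    · rw [e2]; exact h.aestronglyMeasurable.add h'.aestronglyMeasurable
    · rw [e2, ENNReal.ofReal_add h.nonneg h'.nonneg]
      exact (eLpNorm_add_le h.aestronglyMeasurable.restrict h'.aestronglyMeasurable.restrict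
        one_le_two).trans (add_le_add h.le h'.le)
  smul S c t ht h := by
    have e1 : ∀ x, (fun y => f y * opKer φ (fun x ξ => (t : ℂ) * S x ξ) x y) =
        fun y => (t : ℂ) * (f y * opKer φ S x y) := fun x => funext fun y => by
      rw [opKer_const_mul, mul_left_comm]
    have e2 : (fun x => ∫ y, f y * opKer φ (fun x ξ => (t : ℂ) * S x ξ) x y) =
        (t : ℂ) • fun x => ∫ y, f y * opKer φ S x y := funext fun x => by
      rw [e1, integral_const_mul]; rfl
    refine ⟨fun x => (h.integrable x).const_mul _, fun x => ?_, ?_, ?_, mul_nonneg ht h.nonneg⟩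
    · rw [e1]; exact (h.integrable_mul x).const_mul _
    · rw [e2]; exact h.aestronglyMeasurable.const_smul _
    · rw [e2, eLpNorm_const_smul, ENNReal.ofReal_mul ht, ← ofReal_norm, Complex.norm_real,
        Real.norm_of_nonneg ht]
      exact mul_le_mul_right h.le _
  mono S c c' hc h := ⟨h.integrable, h.integrable_mul, h.aestronglyMeasurable,
    h.le.trans (ENNReal.ofReal_le_ofReal hc), h.nonneg.trans hc⟩

/-- A crude bound that loses (σ^s)^N. It is needed only for Fubini and for absolute convergence, not
for the square estimate. -/
theorem exists_oscSymbol_ker_bound {s : ℝ} (hs : 0 < s) (c : ℕ → ℝ) (A : ℕ → ℕ → ℝ) (N : ℕ) :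
    ∃ B : ℝ, 1 ≤ B ∧ ∀ (φ : Eucl n → ℝ) (p : Eucl n → Eucl n → ℂ) (σ : ℝ),
      IsPhase s c φ → IsAmp (1 / 2) A p → 1 ≤ σ →
      ∀ x w, ‖ker (oscSymbol φ σ p x) w‖ ≤ B * (σ ^ s) ^ N * wt N w := by
  obtain ⟨B, hB1, hB⟩ := exists_oscSymbol_bound (n := n) hs c A N
  obtain ⟨C, hC0, hC⟩ := exists_ker_le_wt n N
  refine ⟨1 + C * B, by nlinarith, fun φ p σ hφ hp hσ x w => ?_⟩
  have hσs := Real.one_le_rpow hσ hs.le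
  refine (hC _ (B * (σ ^ s) ^ N) (isSymbol_oscSymbol hφ hp (by linarith) x) (fun m hm ζ =>
    ((hB φ p σ hφ hp hσ).1 x m hm ζ).trans ?_) w).trans ?_
  · exact mul_le_mul_of_nonneg_left (pow_le_pow_right₀ hσs hm) (by linarith)
  · refine mul_le_mul_of_nonneg_right ?_ (wt_nonneg _ _)
    rw [← mul_assoc]
    exact mul_le_mul_of_nonneg_right (by linarith) (by positivity)

/-- The square function estimate for a single frequency piece. -/
theorem exists_sqBound (hn : 1 ≤ n) {δ : ℝ} (hδ₀ : 0 < δ) (hδ₁ : δ < 1) {s : ℝ} (hs : 0 < s)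
    (hϑ : IsCutoff ϑ) (t₀ : ℝ) (ht₀ : 0 < t₀) {γ : ℝ} (hγ0 : 0 ≤ γ) (hγ1 : γ ≤ 1) (c : ℕ → ℝ)
    (A : ℕ → ℕ → ℝ) {Q : Eucl n → ℂ} (hQ : IsSymbol Q) : ∃ C : ℝ, 0 ≤ C ∧
    ∀ (φ : Eucl n → ℝ) (p : Eucl n → Eucl n → ℂ) (σ τ Λ : ℝ) (f : Eucl n → ℂ) (a : Eucl n) (r : ℝ),
      IsPhase s c φ → IsAmp (1 / 2) A p → 1 ≤ σ → t₀ ≤ τ → IsTame γ Λ f → 0 < r →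
      SqBound φ f a r (Sg (sc σ p) (dil τ (ker Q)))
        (C * (Λ * √((1 + (σ ^ s) ^ n * (σ * r) ^ (-(n * δ))) * r ^ n))) := by
  have hq0 : 0 ≤ (n : ℝ) + γ := by positivity
  obtain ⟨K, hK0, hK⟩ := exists_freqPiece_bound hϑ
  obtain ⟨C₁, hC₁0, hC₁⟩ := exists_osc_sq_estimate hn hδ₀ hδ₁ hs c A
  obtain ⟨m, hm0, hm⟩ := exists_weighted_mass t₀ ht₀ hQ le_rfl (by positivity)
  obtain ⟨C₂, -, hC₂⟩ := exists_kerBound t₀ ht₀ hQ hq0 (by linarith) (1 / 2) A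
  obtain ⟨C₃, hC₃, hB⟩ := exists_oscSymbol_ker_bound (n := n) hs c A (n + 1)
  refine ⟨m * K * √C₁, by positivity, fun φ p σ τ Λ f a r hφ hp hσ hτ hf hr => ?_⟩
  have hσ0 : 0 < σ := by linarith
  have hτ0 : 0 < τ := by linarith
  have hσs := Real.one_le_rpow hσ hs.le
  have hΛ := hf.nonneg
  have hκc := continuous_dil (continuous_ker hQ.integrable) τ
  have hκ := integrable_dil hQ.integrable_ker hτ0
  set κ := dil τ (ker Q) with hκdef
  have hbd : ∀ x w, ‖ker (oscSymbol φ σ p x) w‖ ≤ C₃ * (σ ^ s) ^ (n + 1) * wt (n + γ) w := fun x w =>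
    (hB φ p σ hφ hp hσ x w).trans (mul_le_mul_of_nonneg_left (wt_anti (by push_cast; linarith) w)
      (by positivity))
  have hG1 : 1 ≤ C₃ * (σ ^ s) ^ (n + 1) := one_le_mul_of_one_le_of_one_le hC₃ (one_le_pow₀ hσs)
  have hkb := hC₂ p φ σ τ _ hp hφ.measurable hσ hτ hG1 hbd
  have hmk := measurable_dil_ker_sub (measurable_oscSymbol hp hφ.measurable σ) hσ0
  set G : Eucl n → ℂ := fun x' => ∫ y, dil σ (ker (oscSymbol φ σ p x')) (x' - y) * f y with hG
  have hGm : Measurable G :=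
    (StronglyMeasurable.integral_prod_right (ν := (volume : Measure (Eucl n)))
      (f := fun x y => dil σ (ker (oscSymbol φ σ p x)) (x - y) * f y)
      ((hmk.mul (hf.measurable.comp measurable_snd)).stronglyMeasurable)).measurable
  set X : ℝ := (1 + (σ ^ s) ^ n * (σ * r) ^ (-(n * δ))) * r ^ n with hX
  have hX0 : 0 ≤ X := by positivity
  have hGsq : ∀ a, ∫⁻ x in cube a r, ‖G x‖ₑ ^ 2 ≤ ENNReal.ofReal (C₁ * (K * Λ) ^ 2 * X) := fun a => by
    have h := hC₁ φ p σ (K * Λ) (freqPiece ϑ σ f) a r hφ hp hσ (measurable_freqPiece hϑ σ hf.measurable)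
      (hK γ Λ f σ hf hσ) hr
    simp only [← integral_oscKer_eq hϑ hφ hp hσ hγ0 hγ1 hf] at h
    rwa [mul_assoc (C₁ * (K * Λ) ^ 2)] at h
  -- By Fubini the composed operator is the convolution of the kernel of Q_j with G. Square means of
  -- G over all cubes of side r then pass to it by Minkowski's inequality.
  have hF : ∀ x, ∫ y, f y * opKer φ (Sg (sc σ p) κ) x y = ∫ v, κ v * G (x - v) := fun x => by
    obtain ⟨_, -, hmass⟩ := exists_weighted_mass t₀ ht₀ hQ hq0 (by linarith)
    have hint := integrable_prod_tame hf (x := x) (k := fun v => ‖κ v‖) (hmass τ hτ).1 hq0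
      (c := σ ^ n * (C₃ * (σ ^ s) ^ (n + 1)))
      (H := fun z y => κ (x - z) * dil σ (ker (oscSymbol φ σ p z)) (z - y))
      (((hκc.comp (continuous_const.sub continuous_fst)).measurable).mul hmk)
      (fun v => norm_nonneg _) (by positivity) (fun z y => by
        rw [norm_mul]
        exact mul_le_mul_of_nonneg_left (norm_dil_le_wt hq0 (hbd z) hσ _) (norm_nonneg _))
    have hswap := integral_integral_swap hint
    have h1 : ∀ y, f y * opKer φ (Sg (sc σ p) κ) x y =
        ∫ z, κ (x - z) * dil σ (ker (oscSymbol φ σ p z)) (z - y) * f y := fun y => by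
      rw [integral_mul_const, opKer_Sg hp hφ.measurable hσ0 hκc hκ, mul_comm]
    rw [integral_congr_ae (.of_forall h1), ← hswap,
      ← integral_sub_left_eq_self (fun v => κ v * G (x - v)) volume x]
    refine integral_congr_ae (.of_forall fun z => ?_)
    simp only [mul_assoc, sub_sub_cancel, hG]
    exact integral_const_mul _ _
  refine ⟨hkb.integrable, fun x => (hkb.integrable_mul hf hφ.measurable x).1, ?_, ?_, by positivity⟩
  · simp only [hF]
    exact (StronglyMeasurable.integral_prod_right (ν := (volume : Measure (Eucl n)))
      (f := fun x v => κ v * G (x - v)) (((hκc.measurable.comp measurable_snd).mul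
        (hGm.comp measurable_sub)).stronglyMeasurable)).aestronglyMeasurable
  · have h1 := lintegral_cube_conv_sq_le (k := fun v => ‖κ v‖ₑ) (g := fun x => ‖G x‖ₑ)
      hκc.measurable.enorm hGm.enorm hGsq a
    have h2 : ∫⁻ v, ‖κ v‖ₑ ≤ ENNReal.ofReal m := by
      rw [← ofReal_integral_norm_eq_lintegral_enorm hκ]
      refine ENNReal.ofReal_le_ofReal ?_
      simpa using (hm τ hτ).2
    rw [← ENNReal.pow_le_pow_left_iff two_ne_zero, eLpNorm_two_sq]
    calc ∫⁻ x in cube a r, ‖∫ y, f y * opKer φ (Sg (sc σ p) κ) x y‖ₑ ^ 2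
        ≤ ∫⁻ x in cube a r, (∫⁻ v, ‖κ v‖ₑ * ‖G (x - v)‖ₑ) ^ 2 := by
          refine lintegral_mono fun x => ?_
          rw [hF]
          refine pow_le_pow_left' ((enorm_integral_le_lintegral_enorm _).trans_eq ?_) 2
          simp only [enorm_mul]
      _ ≤ _ := h1
      _ ≤ ENNReal.ofReal m ^ 2 * ENNReal.ofReal (C₁ * (K * Λ) ^ 2 * X) := by gcongr
      _ = _ := by
          rw [← ENNReal.ofReal_pow hm0, ← ENNReal.ofReal_mul (by positivity),
            ← ENNReal.ofReal_pow (by positivity)]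
          congr 1
          simp only [mul_pow, Real.sq_sqrt hC₁0, Real.sq_sqrt hX0]
          ring

/-! ### Bounds for annular pieces and for the lowest frequency piece -/

variable {ϑ : Eucl n → ℝ}

/-- The data on which the bounds for a single frequency piece depend. -/
structure Setup (n : ℕ) (s γ t₀ : ℝ) (c : ℕ → ℝ) where
  phase : Eucl n → ℝ
  input : Eucl n → ℂ
  ampScale : ℝ
  kerScale : ℝ
  size : ℝ
  corner : Eucl n
  side : ℝ
  isPhase : IsPhase s c phase
  one_le_ampScale : 1 ≤ ampScale
  le_kerScale : t₀ ≤ kerScale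
  isTame : IsTame γ size input
  side_pos : 0 < side

/-- The bounds for annular frequency pieces, with rapid gain away from the diagonal. -/
theorem exists_annular_bounds (hn : 1 ≤ n) {δ : ℝ} (hδ₀ : 0 < δ) (hδ₁ : δ < 1) {s : ℝ} (hs : 0 < s)
    (hϑ : IsCutoff ϑ) (t₀ : ℝ) (ht₀ : 0 < t₀) {γ : ℝ} (hγ0 : 0 ≤ γ) (hγ1 : γ ≤ 1) (c : ℕ → ℝ)
    (A : ℕ → ℕ → ℝ) {Q : Eucl n → ℂ} (hQ : IsAnnular Q) (N : ℕ) : ∃ C : ℝ, 0 ≤ C ∧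
    ∀ (φ : Eucl n → ℝ) (p : Eucl n → Eucl n → ℂ) (σ τ Λ : ℝ) (f : Eucl n → ℂ) (a : Eucl n) (r : ℝ),
      IsPhase s c φ → IsAmp (1 / 2) A p → 1 ≤ σ → t₀ ≤ τ → IsTame γ Λ f → 0 < r →
      SqBound φ f a r (Sg (sc σ p) (dil τ (ker Q))) (C * (min (σ / τ) (τ / σ) ^ N *
        (Λ * √((1 + (σ ^ s) ^ n * (σ * r) ^ (-(n * δ))) * r ^ n)))) ∧
      KerBound (n + γ) φ (Sg (sc σ p) (dil τ (ker Q)))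
        (C * ((τ / σ) ^ N * (σ ^ n * (σ ^ s) ^ (n + 1)))) := by
  have hq0 : 0 ≤ (n : ℝ) + γ := by positivity
  have hσ : ∀ b : Setup n s γ t₀ c, 1 ≤ b.ampScale := fun b => b.one_le_ampScale
  have hτ : ∀ b : Setup n s γ t₀ c, t₀ ≤ b.kerScale := fun b => b.le_kerScale
  have hbase : ∀ A (Q : Eucl n → ℂ), IsAnnular Q → ∃ C, ∀ (b : Setup n s γ t₀ c) p, IsAmp (1 / 2) A p →
      SqBound b.phase b.input b.corner b.side (Sg (sc b.ampScale p) (dil b.kerScale (ker Q)))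
        (C * (b.size * √((1 + (b.ampScale ^ s) ^ n * (b.ampScale * b.side) ^ (-(n * δ))) * b.side ^ n))) :=
    fun A Q hQ => by
      obtain ⟨C, -, hC⟩ := exists_sqBound hn hδ₀ hδ₁ hs hϑ t₀ ht₀ hγ0 hγ1 c A hQ.toIsSymbol
      exact ⟨C, fun b p hp => hC _ p _ _ _ _ _ _ b.isPhase hp b.one_le_ampScale b.le_kerScale b.isTame
        b.side_pos⟩
  have hbase' : ∀ A (Q : Eucl n → ℂ), IsAnnular Q → ∃ C, ∀ (b : Setup n s γ t₀ c) p, IsAmp (1 / 2) A p →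
      KerBound (n + γ) b.phase (Sg (sc b.ampScale p) (dil b.kerScale (ker Q)))
        (C * (b.ampScale ^ n * (b.ampScale ^ s) ^ (n + 1))) := fun A Q hQ => by
      obtain ⟨C, -, hC⟩ := exists_kerBound t₀ ht₀ hQ.toIsSymbol hq0 (by linarith) (1 / 2) A
      obtain ⟨B, hB1, hB⟩ := exists_oscSymbol_ker_bound (n := n) hs c A (n + 1)
      refine ⟨C * B, fun b p hp => ?_⟩
      have h1 := Real.one_le_rpow b.one_le_ampScale hs.le
      have h := hC p b.phase b.ampScale b.kerScale (B * (b.ampScale ^ s) ^ (n + 1)) hp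
        b.isPhase.measurable b.one_le_ampScale b.le_kerScale
        (one_le_mul_of_one_le_of_one_le hB1 (one_le_pow₀ h1)) fun x w =>
          (hB _ p _ b.isPhase hp b.one_le_ampScale x w).trans
            (mul_le_mul_of_nonneg_left (wt_anti (by push_cast; linarith) w) (by positivity))
      exact (isSeminormBound_kerBound _ b.isPhase.measurable).mono _ _ _ (le_of_eq (by ring)) h
  have hsq := fun b : Setup n s γ t₀ c =>
    isSeminormBound_sqBound b.isPhase.measurable b.input b.corner b.side
  have hkb := fun b : Setup n s γ t₀ c => isSeminormBound_kerBound (n + γ) b.isPhase.measurable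
  obtain ⟨C₁, hC₁⟩ := low_frequency_gain hσ (fun b => ht₀.trans_le (hτ b)) hsq _ hbase N A Q hQ
  obtain ⟨C₂, hC₂⟩ := high_frequency_gain hσ ht₀ hτ hsq (by norm_num) hbase N A Q hQ
  obtain ⟨C₃, hC₃⟩ := high_frequency_gain hσ ht₀ hτ hkb (by norm_num) hbase' N A Q hQ
  refine ⟨|C₁| + |C₂| + |C₃|, by positivity, fun φ p σ τ Λ f a r hφ hp hσ1 hτ1 hf hr => ?_⟩
  have hσ0 : 0 < σ := by linarith
  have hτ0 : 0 < τ := by linarith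
  have hΛ := hf.nonneg
  have e1 := le_abs_self C₁
  have e2 := le_abs_self C₂
  have e3 := le_abs_self C₃
  have a1 := abs_nonneg C₁
  have a2 := abs_nonneg C₂
  have a3 := abs_nonneg C₃
  let b : Setup n s γ t₀ c := ⟨φ, f, σ, τ, Λ, a, r, hφ, hσ1, hτ1, hf, hr⟩
  refine ⟨?_, (hkb b).mono _ _ _ (mul_le_mul_of_nonneg_right (by linarith) (by positivity)) (hC₃ b p hp)⟩
  -- Both gains hold for all σ and τ; the one whose ratio is the smaller is kept.
  rcases le_total (σ / τ) (τ / σ) with h | h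
  · rw [min_eq_left h]
    exact (hsq b).mono _ _ _ (mul_le_mul_of_nonneg_right (by linarith) (by positivity)) (hC₁ b p hp)
  · rw [min_eq_right h]
    exact (hsq b).mono _ _ _ (mul_le_mul_of_nonneg_right (by linarith) (by positivity)) (hC₂ b p hp)

/-- The kernel bound for the low frequency piece, with rapid decay in the scale of the kernel. -/
theorem exists_low_bound (hn : 1 ≤ n) {s : ℝ} (hs : 0 < s) (hϑ : IsCutoff ϑ) (t₀ : ℝ) (ht₀ : 0 < t₀)
    (c : ℕ → ℝ) (r : ℝ) (A : ℕ → ℕ → ℝ) {Q : Eucl n → ℂ} (hQ : IsAnnular Q) (N : ℕ) : ∃ C : ℝ, 0 ≤ C ∧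
    ∀ (φ : Eucl n → ℝ) (p : Eucl n → Eucl n → ℂ) (τ : ℝ), IsPhase s c φ → IsAmp r A p → t₀ ≤ τ →
      KerBound (n + min s 1 / 2) φ (Sg (sc 1 p) (dil τ (ker Q))) (C * (1 / τ) ^ N) := by
  have hγ0 : 0 < min s 1 / 2 := by have := lt_min hs one_pos; positivity
  have hγ1 : min s 1 / 2 ≤ 1 := by have := min_le_right s 1; linarith
  let α := {b : (Eucl n → ℝ) × ℝ // IsPhase s c b.1 ∧ t₀ ≤ b.2}
  have hbase : ∀ A (Q : Eucl n → ℂ), IsAnnular Q → ∃ C, ∀ (b : α) p, IsAmp r A p →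
      KerBound (n + min s 1 / 2) b.1.1 (Sg (sc 1 p) (dil b.1.2 (ker Q))) (C * 1) := fun A Q hQ => by
    obtain ⟨C, -, hC⟩ := exists_kerBound t₀ ht₀ hQ.toIsSymbol (q := n + min s 1 / 2) (by positivity)
      (by linarith) r A
    obtain ⟨B, hB0, hB⟩ := exists_low_ker_bound hn hϑ hs c r A
    refine ⟨C * (1 + B), fun b p hp => ?_⟩
    have h := hC p b.1.1 1 b.1.2 (1 + B) hp b.2.1.measurable le_rfl b.2.2 (by linarith) fun x w => by
      refine le_trans ?_ (mul_le_mul_of_nonneg_right (by linarith : B ≤ 1 + B) (wt_nonneg _ _))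
      have h := hB b.1.1 p b.2.1 hp x w
      have e : oscSymbol b.1.1 1 p x = fun ζ => expI (b.1.1 ζ) * p x ζ := by
        ext ζ; rw [oscSymbol, one_smul]
      rwa [e]
    simpa using h
  obtain ⟨C, hC⟩ := low_frequency_gain (α := α) (σ := fun _ => 1) (τ := fun b => b.1.2) (E := fun _ => 1)
    (fun _ => le_rfl) (fun b => ht₀.trans_le b.2.2)
    (fun b => isSeminormBound_kerBound (n + min s 1 / 2) b.2.1.measurable) r hbase N A Q hQ
  refine ⟨|C|, abs_nonneg _, fun φ p τ hφ hp hτ => ?_⟩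
  have hτ0 : 0 < τ := by linarith
  refine (isSeminormBound_kerBound _ hφ.measurable).mono _ _ _ ?_ (hC ⟨(φ, τ), hφ, hτ⟩ p hp)
  rw [mul_one]
  exact mul_le_mul_of_nonneg_right (le_abs_self _) (by positivity)

theorem measurable_integral_opKer {r : ℝ} {A : ℕ → ℕ → ℝ} {p : Eucl n → Eucl n → ℂ} (hp : IsAmp r A p)
    {φ : Eucl n → ℝ} (hφ : Measurable φ) {σ : ℝ} (hσ : 0 < σ) {κ : Eucl n → ℂ} (hκc : Continuous κ)
    (hκ : Integrable κ) {f : Eucl n → ℂ} (hf : Measurable f) :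
    Measurable fun x => ∫ y, f y * opKer φ (Sg (sc σ p) κ) x y := by
  have hmk := measurable_dil_ker_sub (measurable_oscSymbol hp hφ σ) hσ
  have h1 : StronglyMeasurable fun q : Eucl n × Eucl n =>
      ∫ x', κ (q.1 - x') * dil σ (ker (oscSymbol φ σ p x')) (x' - q.2) :=
    StronglyMeasurable.integral_prod_right (ν := (volume : Measure (Eucl n)))
      (f := fun (q : Eucl n × Eucl n) x' => κ (q.1 - x') * dil σ (ker (oscSymbol φ σ p x')) (x' - q.2))
      ((hκc.measurable.comp ((measurable_fst.comp measurable_fst).sub measurable_snd)).mul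
        (hmk.comp (measurable_snd.prodMk (measurable_snd.comp measurable_fst)))).stronglyMeasurable
  simp only [opKer_Sg hp hφ hσ hκc hκ]
  exact (StronglyMeasurable.integral_prod_right (ν := (volume : Measure (Eucl n)))
    (f := fun x y => f y * ∫ x', κ (x - x') * dil σ (ker (oscSymbol φ σ p x')) (x' - y))
    ((hf.comp measurable_snd).mul h1.measurable).stronglyMeasurable).measurable

/-- A pointwise bound, squared and integrated over the cube. This is enough for the lowest piece,
whose kernel bound already decays like τ^{-N}. -/
theorem KerBound.sqBound {γ Λ c : ℝ} {f : Eucl n → ℂ} (hf : IsTame γ Λ f) {φ : Eucl n → ℝ}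
    (hφ : Measurable φ) {S : Eucl n → Eucl n → ℂ} (h : KerBound (n + γ) φ S c)
    (hm : AEStronglyMeasurable (fun x => ∫ y, f y * opKer φ S x y) volume) (a : Eucl n) {r : ℝ} (hr : 0 < r) :
    SqBound φ f a r S (c * (Λ * √(r ^ n))) := by
  have hc : 0 ≤ c := (integral_nonneg fun _ => norm_nonneg _).trans (h.integral_le 0)
  have hΛ := hf.nonneg
  refine ⟨h.integrable, fun x => (h.integrable_mul hf hφ x).1, hm, ?_, by positivity⟩
  rw [← ENNReal.pow_le_pow_left_iff two_ne_zero, eLpNorm_two_sq]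
  calc _ ≤ ∫⁻ x in cube a r, ENNReal.ofReal (c * Λ) ^ 2 := by
        refine lintegral_mono fun x => pow_le_pow_left' ?_ 2
        rw [← ofReal_norm]
        exact ENNReal.ofReal_le_ofReal (h.integrable_mul hf hφ x).2
    _ = _ := by
        rw [lintegral_const, Measure.restrict_apply_univ, volume_cube, ← ENNReal.ofReal_pow hr.le,
          ← ENNReal.ofReal_pow (by positivity), ← ENNReal.ofReal_mul (by positivity),
          ← ENNReal.ofReal_pow (by positivity)]
        congr 1
        rw [mul_pow, mul_pow, mul_pow, Real.sq_sqrt (by positivity)]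
        ring

variable {ϑ : Eucl n → ℝ}

/-! ### The inhomogeneous dyadic decomposition -/

/-- The dyadic partition of unity in frequency. -/
def dyadic (ϑ : Eucl n → ℝ) : ℕ → Eucl n → ℂ
  | 0, ξ => ϑ ξ
  | i + 1, ξ => bet ϑ (((2 : ℝ) ^ (i + 1))⁻¹ • ξ)

theorem sum_dyadic (ϑ : Eucl n → ℝ) (M : ℕ) (ξ : Eucl n) :
    ∑ i ∈ Finset.range (M + 1), dyadic ϑ i ξ = ϑ (((2 : ℝ) ^ M)⁻¹ • ξ) := by
  induction M with
  | zero => simp [dyadic]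
  | succ M ih =>
    rw [Finset.sum_range_succ, ih, dyadic, bet, smul_smul]
    have : (2 : ℝ) * (2 ^ (M + 1))⁻¹ = (2 ^ M)⁻¹ := by rw [pow_succ]; field_simp
    rw [this]
    push_cast
    ring

theorem IsCutoff.hasSum_dyadic (hϑ : IsCutoff ϑ) (ξ : Eucl n) : HasSum (fun i => dyadic ϑ i ξ) 1 := by
  obtain ⟨M, hM⟩ := pow_unbounded_of_one_lt ‖ξ‖ (one_lt_two : (1 : ℝ) < 2)
  have h1 : ∑ i ∈ Finset.range (M + 1), dyadic ϑ i ξ = 1 := by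
    rw [sum_dyadic, hϑ.eq_one, Complex.ofReal_one]
    rw [norm_smul, norm_inv, norm_pow, Real.norm_ofNat, inv_mul_le_iff₀ (by positivity), mul_one]
    exact hM.le
  rw [← h1]
  refine hasSum_sum_of_ne_finset_zero fun i hi => ?_
  rw [Finset.mem_range, not_lt] at hi
  obtain ⟨k, rfl⟩ : ∃ k, i = k + 1 := ⟨i - 1, by omega⟩
  refine hϑ.bet_eq_zero_near ?_
  rw [norm_smul, norm_inv, norm_pow, Real.norm_ofNat, inv_mul_le_iff₀ (by positivity), pow_succ]
  have : (2 : ℝ) ^ M ≤ 2 ^ k := pow_le_pow_right₀ one_le_two (by omega)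
  linarith

/-- Moves the order m of d out of the amplitude: what remains at unit scale is bounded uniformly in
σ, and the prefactor is σ^m. -/
theorem mul_Sg_eq_Sg_sc (d : Eucl n → Eucl n → ℂ) (κ : Eucl n → ℂ) (g : Eucl n → ℂ) {σ : ℝ} (hσ : 0 < σ)
    (m : ℝ) (x ξ : Eucl n) : g (σ⁻¹ • ξ) * Sg d κ x ξ = ((σ ^ m : ℝ) : ℂ) *
      Sg (sc σ fun x ζ => g ζ * (((σ ^ (-m) : ℝ) : ℂ) * d x (σ • ζ))) κ x ξ := by
  unfold Sg sc
  rw [← integral_const_mul, ← integral_const_mul]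
  refine integral_congr_ae (.of_forall fun x' => ?_)
  have h : ((σ ^ m : ℝ) : ℂ) * ((σ ^ (-m) : ℝ) : ℂ) = 1 := by
    rw [← Complex.ofReal_mul, ← Real.rpow_add hσ, add_neg_cancel, Real.rpow_zero, Complex.ofReal_one]
  simp only [smul_inv_smul₀ hσ.ne']
  linear_combination (-(expI (inner ℝ x' ξ) * g (σ⁻¹ • ξ) * d x' ξ * κ (x - x'))) * h

/-- Of the N powers of the ratio, one is kept for the summation over σ and e of them trade σ^{-e}
for τ^{-e}. -/
theorem min_ratio_pow_mul_le {σ τ e : ℝ} (hσ : 0 < σ) (hτ : 0 < τ) (he : 0 ≤ e) {N : ℕ} (hN : e + 1 ≤ N) :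
    min (σ / τ) (τ / σ) ^ N * σ ^ (-e) ≤ min (σ / τ) (τ / σ) * τ ^ (-e) := by
  set ρ := min (σ / τ) (τ / σ) with hρ
  have hρ0 : 0 < ρ := lt_min (by positivity) (by positivity)
  have hρ1 : ρ ≤ 1 := by
    rcases le_total σ τ with h | h
    · exact (min_le_left _ _).trans ((div_le_one hτ).2 h)
    · exact (min_le_right _ _).trans ((div_le_one hσ).2 h)
  have h1 : ρ ^ N ≤ ρ * ρ ^ e := by
    rw [← Real.rpow_natCast, ← Real.rpow_one_add' hρ0.le (by linarith)]
    exact Real.rpow_le_rpow_of_exponent_ge hρ0 hρ1 (by linarith)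
  have h2 : ρ ^ e ≤ σ ^ e * τ ^ (-e) := by
    rw [Real.rpow_neg hτ.le, ← div_eq_mul_inv, ← Real.div_rpow hσ.le hτ.le]
    exact Real.rpow_le_rpow hρ0.le (min_le_left _ _) he
  have h3 : σ ^ e * σ ^ (-e) = 1 := by rw [← Real.rpow_add hσ, add_neg_cancel, Real.rpow_zero]
  calc ρ ^ N * σ ^ (-e) ≤ ρ * ρ ^ e * σ ^ (-e) := by gcongr
    _ ≤ ρ * (σ ^ e * τ ^ (-e)) * σ ^ (-e) := by gcongr
    _ = ρ * τ ^ (-e) * (σ ^ e * σ ^ (-e)) := by ring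
    _ = _ := by rw [h3, mul_one]

/-- By √(1+a²) ≤ 1+a the oscillatory loss is at most σ^{ns/2}, precisely what the order -ns/2 of d
compensates. The two terms then decay like σ^{-ns/2} and (σr)^{-nδ/2}, and the frequency gain
converts σ into τ in each. -/
theorem annular_sq_weight_le {s δ σ τ r Λ : ℝ} (hs : 0 < s) (hδ : 0 < δ) (hσ : 0 < σ) (hτ : 0 < τ)
    (hr : 0 < r) (hΛ : 0 ≤ Λ) {N : ℕ} (hN : (n : ℝ) * s / 2 + 1 ≤ N) (hN' : (n : ℝ) * δ / 2 + 1 ≤ N) :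
    σ ^ (-((n : ℝ) * s / 2)) * (min (σ / τ) (τ / σ) ^ N *
        (Λ * √((1 + (σ ^ s) ^ n * (σ * r) ^ (-((n : ℝ) * δ))) * r ^ n))) ≤
      min (σ / τ) (τ / σ) * (Λ * √(r ^ n) * (τ ^ (-((n : ℝ) * s / 2)) + (τ * r) ^ (-((n : ℝ) * δ / 2)))) := by
  set e := (n : ℝ) * s / 2 with he
  set g := (n : ℝ) * δ / 2 with hg
  have he0 : 0 ≤ e := by positivity
  have hg0 : 0 ≤ g := by positivity
  have h1 : (σ ^ s) ^ n = (σ ^ e) ^ 2 := by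
    rw [← Real.rpow_natCast, ← Real.rpow_natCast, ← Real.rpow_mul hσ.le, ← Real.rpow_mul hσ.le]
    congr 1; rw [he]; push_cast; ring
  have h2 : (σ * r) ^ (-((n : ℝ) * δ)) = ((σ * r) ^ (-g)) ^ 2 := by
    rw [← Real.rpow_natCast, ← Real.rpow_mul (by positivity)]
    congr 1; rw [hg]; push_cast; ring
  have h3 : √((1 + (σ ^ s) ^ n * (σ * r) ^ (-((n : ℝ) * δ))) * r ^ n) ≤
      (1 + σ ^ e * (σ * r) ^ (-g)) * √(r ^ n) := by
    rw [Real.sqrt_mul (by positivity), h1, h2]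
    refine mul_le_mul_of_nonneg_right ?_ (Real.sqrt_nonneg _)
    rw [Real.sqrt_le_left (by positivity)]
    have : 0 ≤ σ ^ e * (σ * r) ^ (-g) := by positivity
    nlinarith
  have h4 : σ ^ (-e) * σ ^ e = 1 := by rw [← Real.rpow_add hσ, neg_add_cancel, Real.rpow_zero]
  set ρ := min (σ / τ) (τ / σ) with hρ
  have hρ0 : 0 < ρ := lt_min (by positivity) (by positivity)
  have h5 := min_ratio_pow_mul_le hσ hτ he0 hN
  have h6 := min_ratio_pow_mul_le hσ hτ hg0 hN'
  rw [← hρ] at h5 h6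
  calc σ ^ (-e) * (ρ ^ N * (Λ * √((1 + (σ ^ s) ^ n * (σ * r) ^ (-((n : ℝ) * δ))) * r ^ n)))
      ≤ σ ^ (-e) * (ρ ^ N * (Λ * ((1 + σ ^ e * (σ * r) ^ (-g)) * √(r ^ n)))) := by gcongr
    _ = Λ * √(r ^ n) * (ρ ^ N * σ ^ (-e) + σ ^ (-e) * σ ^ e * (ρ ^ N * σ ^ (-g) * r ^ (-g))) := by
        rw [Real.mul_rpow hσ.le hr.le]; ring
    _ ≤ Λ * √(r ^ n) * (ρ * τ ^ (-e) + σ ^ (-e) * σ ^ e * (ρ * τ ^ (-g) * r ^ (-g))) := by gcongr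
    _ = _ := by rw [h4, Real.mul_rpow hτ.le hr.le]; ring

/-- Here only summability in σ matters: N powers of 1/σ beat the growth σ^{n+s(n+1)} with one to
spare. The factor τ^N is harmless because τ is fixed when the series is summed. -/
theorem annular_ker_weight_le {s e σ τ : ℝ} (he : 0 ≤ e) (hσ : 1 ≤ σ) (hτ : 0 < τ)
    {N : ℕ} (hN : (n : ℝ) + s * (n + 1) + 1 ≤ N) :
    σ ^ (-e) * ((τ / σ) ^ N * (σ ^ n * (σ ^ s) ^ (n + 1))) ≤ τ ^ N * σ⁻¹ := by
  have hσ0 : 0 < σ := by linarith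
  have h1 : σ ^ n * (σ ^ s) ^ (n + 1) ≤ σ ^ N * σ⁻¹ := by
    rw [← Real.rpow_natCast, ← Real.rpow_natCast, ← Real.rpow_natCast, ← Real.rpow_mul hσ0.le,
      ← Real.rpow_neg_one, ← Real.rpow_add hσ0, ← Real.rpow_add hσ0]
    refine Real.rpow_le_rpow_of_exponent_le hσ ?_
    push_cast
    linarith
  have h2 : σ ^ (-e) ≤ 1 := Real.rpow_le_one_of_one_le_of_nonpos hσ (by linarith)
  calc σ ^ (-e) * ((τ / σ) ^ N * (σ ^ n * (σ ^ s) ^ (n + 1)))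
      ≤ 1 * ((τ / σ) ^ N * (σ ^ N * σ⁻¹)) := by gcongr
    _ = _ := by rw [div_pow]; field_simp

/-- In either case of the minimum the quotient of the two sides is a power τ^{e±1-N} with
nonpositive exponent, hence at most its value at t₀. -/
theorem low_sq_weight_le {t₀ τ e : ℝ} (ht₀ : 0 < t₀) (hτ : t₀ ≤ τ) {N : ℕ} (hN : e + 1 ≤ N) :
    (1 / τ) ^ N ≤ (t₀ ^ (e + 1 - N) + t₀ ^ (e - 1 - N)) * (min (1 / τ) (τ / 1) * τ ^ (-e)) := by
  have hτ0 : 0 < τ := by linarith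
  have h0 : (1 / τ) ^ N = τ ^ (-(N : ℝ)) := by
    rw [Real.rpow_neg hτ0.le, Real.rpow_natCast, one_div, inv_pow]
  have hc := Real.rpow_pos_of_pos ht₀ (e + 1 - N)
  have hc' := Real.rpow_pos_of_pos ht₀ (e - 1 - N)
  have ha := Real.rpow_pos_of_pos hτ0 (-e)
  rw [h0]
  rcases min_choice (1 / τ) (τ / 1) with h | h <;> rw [h]
  · have h1 : τ ^ (e + 1 - N) ≤ t₀ ^ (e + 1 - N) := Real.rpow_le_rpow_of_nonpos ht₀ hτ (by linarith)
    have h2 : τ ^ (-(N : ℝ)) = τ ^ (e + 1 - N) * (1 / τ * τ ^ (-e)) := by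
      rw [one_div, ← Real.rpow_neg_one, ← Real.rpow_add hτ0, ← Real.rpow_add hτ0]
      congr 1; ring
    rw [h2]
    exact mul_le_mul_of_nonneg_right (by linarith) (by positivity)
  · have h1 : τ ^ (e - 1 - N) ≤ t₀ ^ (e - 1 - N) := Real.rpow_le_rpow_of_nonpos ht₀ hτ (by linarith)
    have h2 : τ ^ (-(N : ℝ)) = τ ^ (e - 1 - N) * (τ / 1 * τ ^ (-e)) := by
      have h3 : τ * τ ^ (-e) = τ ^ (1 + -e) := by rw [Real.rpow_add hτ0, Real.rpow_one]
      rw [div_one, h3, ← Real.rpow_add hτ0]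
      congr 1; ring
    rw [h2]
    exact mul_le_mul_of_nonneg_right (by linarith) (by positivity)

/-- Bounds for all pieces of the dyadic decomposition. -/
theorem exists_piece_bounds (hn : 1 ≤ n) {δ : ℝ} (hδ₀ : 0 < δ) (hδ₁ : δ < 1) {s : ℝ} (hs : 0 < s)
    (hϑ : IsCutoff ϑ) (t₀ : ℝ) (ht₀ : 0 < t₀) (c : ℕ → ℝ) (A : ℕ → ℕ → ℝ) {Q : Eucl n → ℂ}
    (hQ : IsAnnular Q) : ∃ C : ℝ, 0 ≤ C ∧ ∃ N : ℕ,
    ∀ (d : Eucl n → Eucl n → ℂ) (φ : Eucl n → ℝ) (τ Λ : ℝ) (f : Eucl n → ℂ) (a : Eucl n) (r : ℝ),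
      IsAmplitude (-(n * s / 2)) A d → IsPhase s c φ → t₀ ≤ τ → IsTame (min s 1 / 2) Λ f → 0 < r →
      ∀ i : ℕ,
      SqBound φ f a r (fun x ξ => dyadic ϑ i ξ * Sg d (dil τ (ker Q)) x ξ)
        (C * (min (2 ^ i / τ) (τ / 2 ^ i) *
          (Λ * √(r ^ n) * (τ ^ (-((n : ℝ) * s / 2)) + (τ * r) ^ (-((n : ℝ) * δ / 2)))))) ∧
      KerBound (n + min s 1 / 2) φ (fun x ξ => dyadic ϑ i ξ * Sg d (dil τ (ker Q)) x ξ)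
        (C * (1 + τ ^ N) * (1 / 2) ^ i) := by
  have hγ0 : 0 < min s 1 / 2 := by have := lt_min hs one_pos; positivity
  have hγ1 : min s 1 / 2 ≤ 1 := by have := min_le_right s 1; linarith
  -- The number of integrations by parts dominates each of the thresholds required by the weight
  -- inequalities.
  obtain ⟨N, hN⟩ := exists_nat_ge ((n : ℝ) * s / 2 + 1 + (n * δ / 2) + (n + s * (n + 1)))
  set e := (n : ℝ) * s / 2 with he
  have he0 : 0 ≤ e := by positivity
  have hp0 : 0 ≤ (n : ℝ) * δ / 2 := by positivity
  have hp1 : 0 ≤ (n : ℝ) + s * (n + 1) := by positivity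
  -- With r = -1 the condition near the origin is void: the lowest piece is not cut off there.
  obtain ⟨A₀, hA₀⟩ := exists_isAmp_of_isAmplitude (-e) A (r := -1) hϑ.contDiff_ofReal
    (fun ζ hζ => by rw [hϑ.eq_zero ζ hζ, Complex.ofReal_zero])
    (fun ζ hζ => absurd hζ (by linarith [norm_nonneg ζ]))
  obtain ⟨A₁, hA₁⟩ := exists_isAmp_of_isAmplitude (-e) A (r := 1 / 2) hϑ.contDiff_bet
    (fun ζ hζ => hϑ.bet_eq_zero hζ) (fun ζ hζ => hϑ.bet_eq_zero_near hζ)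
  obtain ⟨C₀, hC₀0, hC₀⟩ := exists_low_bound hn hs hϑ t₀ ht₀ c (-1) A₀ hQ N
  obtain ⟨C₁, hC₁0, hC₁⟩ := exists_annular_bounds hn hδ₀ hδ₁ hs hϑ t₀ ht₀ hγ0.le hγ1 c A₁ hQ N
  set D := t₀ ^ (e + 1 - N) + t₀ ^ (e - 1 - N) with hD
  have hD0 : 0 < D := by positivity
  refine ⟨C₀ * D + C₀ * (1 / t₀) ^ N + C₁, by positivity, N, fun d φ τ Λ f a r hd hφ hτ hf hr i => ?_⟩
  have hτ0 : 0 < τ := by linarith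
  have hΛ := hf.nonneg
  have hκc := continuous_dil (continuous_ker hQ.integrable) τ
  have hκ := integrable_dil hQ.integrable_ker hτ0
  have hkb := isSeminormBound_kerBound (n := n) (n + min s 1 / 2) hφ.measurable
  have hsq := isSeminormBound_sqBound hφ.measurable f a r
  set κ := dil τ (ker Q) with hκdef
  rcases i with _ | i
  · have e1 : (fun x ξ => dyadic ϑ 0 ξ * Sg d κ x ξ) = Sg (sc 1 fun x ζ => (ϑ ζ : ℂ) *
        ((((1 : ℝ) ^ (- -e) : ℝ) : ℂ) * d x ((1 : ℝ) • ζ))) κ := by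
      ext x ξ
      have h := mul_Sg_eq_Sg_sc d κ (fun ζ => (ϑ ζ : ℂ)) one_pos (-e) x ξ
      simp only [inv_one, one_smul, Real.one_rpow, Complex.ofReal_one, one_mul] at h ⊢
      exact h
    have hp := hA₀ d 1 hd le_rfl (.inr rfl)
    have h1 := hC₀ φ _ τ hφ hp hτ
    have h2 := h1.sqBound hf hφ.measurable
      (measurable_integral_opKer hp hφ.measurable one_pos hκc hκ hf.measurable).aestronglyMeasurable a hr
    rw [e1]
    refine ⟨hsq.mono _ _ _ ?_ h2, hkb.mono _ _ _ ?_ h1⟩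
    · have h3 := low_sq_weight_le ht₀ hτ (e := e) (N := N) (by linarith)
      rw [← hD] at h3
      set m := min (1 / τ) (τ / 1) with hm
      have hm0 : 0 ≤ m := le_min (by positivity) (by positivity)
      rw [pow_zero, ← hm]
      have h4 : 0 ≤ m * (Λ * √(r ^ n) * (τ ^ (-e) + (τ * r) ^ (-((n : ℝ) * δ / 2)))) := by positivity
      calc C₀ * (1 / τ) ^ N * (Λ * √(r ^ n)) ≤ C₀ * (D * (m * τ ^ (-e))) * (Λ * √(r ^ n)) := by gcongr
        _ = C₀ * D * (m * (Λ * √(r ^ n) * (τ ^ (-e) + 0))) := by ring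
        _ ≤ C₀ * D * (m * (Λ * √(r ^ n) * (τ ^ (-e) + (τ * r) ^ (-((n : ℝ) * δ / 2))))) := by
            gcongr; positivity
        _ ≤ _ := mul_le_mul_of_nonneg_right (by nlinarith [pow_nonneg (one_div_nonneg.2 ht₀.le) N]) h4
    · rw [pow_zero, mul_one]
      have h3 : (1 / τ) ^ N ≤ (1 / t₀) ^ N := by gcongr
      calc C₀ * (1 / τ) ^ N ≤ C₀ * (1 / t₀) ^ N * 1 := by rw [mul_one]; gcongr
        _ ≤ _ := mul_le_mul (by nlinarith [mul_nonneg hC₀0 hD0.le]) (by linarith [pow_pos hτ0 N]) zero_le_one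
            (by positivity)
  · set σ : ℝ := 2 ^ (i + 1) with hσ
    have hσ1 : 1 ≤ σ := one_le_pow₀ one_le_two
    have hσ0 : 0 < σ := by linarith
    have e1 : (fun x ξ => dyadic ϑ (i + 1) ξ * Sg d κ x ξ) = fun x ξ => ((σ ^ (-e) : ℝ) : ℂ) *
        Sg (sc σ fun x ζ => bet ϑ ζ * (((σ ^ (- -e) : ℝ) : ℂ) * d x (σ • ζ))) κ x ξ := by
      ext x ξ
      exact mul_Sg_eq_Sg_sc d κ (bet ϑ) hσ0 (-e) x ξ
    have hp := hA₁ d σ hd hσ1 (.inl le_rfl)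
    obtain ⟨h1, h2⟩ := hC₁ φ _ σ τ Λ f a r hφ hp hσ1 hτ hf hr
    have hσe : 0 ≤ σ ^ (-e) := by positivity
    rw [e1]
    refine ⟨hsq.mono _ _ _ ?_ (hsq.smul _ _ _ hσe h1), hkb.mono _ _ _ ?_ (hkb.smul _ _ _ hσe h2)⟩
    · have h3 := annular_sq_weight_le (n := n) (N := N) hs hδ₀ hσ0 hτ0 hr hΛ (by linarith) (by linarith)
      rw [mul_left_comm]
      have hm0 : 0 ≤ min (σ / τ) (τ / σ) := le_min (by positivity) (by positivity)
      refine (mul_le_mul_of_nonneg_left h3 hC₁0).trans (mul_le_mul_of_nonneg_right ?_ (by positivity))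
      have : 0 ≤ C₀ * D + C₀ * (1 / t₀) ^ N := by positivity
      linarith
    · have h3 := annular_ker_weight_le (n := n) (N := N) (s := s) (e := e) he0 hσ1 hτ0 (by linarith)
      rw [mul_left_comm]
      have e2 : (1 / 2 : ℝ) ^ (i + 1) = σ⁻¹ := by rw [hσ, one_div, inv_pow]
      rw [e2]
      have : 0 ≤ C₀ * D + C₀ * (1 / t₀) ^ N := by positivity
      calc C₁ * (σ ^ (-e) * ((τ / σ) ^ N * (σ ^ n * (σ ^ s) ^ (n + 1)))) ≤ C₁ * (τ ^ N * σ⁻¹) := by gcongr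
        _ = C₁ * τ ^ N * σ⁻¹ := by ring
        _ ≤ _ := by
            gcongr
            · linarith
            · linarith

variable {ϑ : Eucl n → ℝ}

open Filter Topology

/-! ### Summation of the pieces -/

/-- The geometric bound on the L¹ norms in ξ allows the dyadic series to be integrated term by term.
-/
theorem hasSum_opKer {q b : ℝ} {φ : Eucl n → ℝ} (hφ : Measurable φ) {S : Eucl n → Eucl n → ℂ}
    {T : ℕ → Eucl n → Eucl n → ℂ} (hT : ∀ i, KerBound q φ (T i) (b * (1 / 2) ^ i))
    (hS : ∀ x ξ, HasSum (fun i => T i x ξ) (S x ξ)) (x y : Eucl n) :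
    HasSum (fun i => opKer φ (T i) x y) (opKer φ S x y) := by
  have hnorm : ∀ θ : ℝ, ‖expI θ‖ = 1 := fun θ => Complex.norm_exp_ofReal_mul_I θ
  have hm : AEStronglyMeasurable (fun ξ => expI (-inner ℝ y ξ + φ ξ)) (volume : Measure (Eucl n)) :=
    (continuous_expI.measurable.comp (((continuous_const.inner continuous_id).neg.measurable).add
      hφ)).aestronglyMeasurable
  have h := hasSum_integral_of_summable_integral_norm
    (F := fun i ξ => expI (-inner ℝ y ξ + φ ξ) * T i x ξ) (μ := (volume : Measure (Eucl n)))
    (fun i => ((hT i).integrable x).bdd_mul hm (c := 1) (.of_forall fun ξ => (hnorm _).le)) (by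
      simp only [norm_mul, hnorm, one_mul]
      exact Summable.of_nonneg_of_le (fun i => integral_nonneg fun _ => norm_nonneg _)
        (fun i => (hT i).integral_le x) (summable_geometric_two.mul_left b))
  have e : ∀ ξ, ∑' i, expI (-inner ℝ y ξ + φ ξ) * T i x ξ = expI (-inner ℝ y ξ + φ ξ) * S x ξ :=
    fun ξ => ((hS x ξ).mul_left _).tsum_eq
  simp only [e] at h
  exact h.mul_left _

theorem hasSum_integral_mul_opKer {γ b Λ : ℝ} {φ : Eucl n → ℝ} (hφ : Measurable φ) {S : Eucl n → Eucl n → ℂ}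
    {T : ℕ → Eucl n → Eucl n → ℂ} (hT : ∀ i, KerBound (n + γ) φ (T i) (b * (1 / 2) ^ i))
    (hS : ∀ x ξ, HasSum (fun i => T i x ξ) (S x ξ)) {f : Eucl n → ℂ} (hf : IsTame γ Λ f) (x : Eucl n) :
    (Integrable fun y => f y * opKer φ S x y) ∧
      HasSum (fun i => ∫ y, f y * opKer φ (T i) x y) (∫ y, f y * opKer φ S x y) := by
  have hsum := fun y => hasSum_opKer hφ hT hS x y
  have hbd : ∀ y, ‖opKer φ S x y‖ ≤ b * 2 * wt (n + γ) (x - y) := fun y =>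
    (hsum y).norm_le_of_bounded ((hasSum_geometric_two.mul_left b).mul_right _) fun i => (hT i).le_wt x y
  have hmeas : Measurable fun y => opKer φ S x y :=
    measurable_of_tendsto_metrizable (fun N => Finset.measurable_fun_sum (Finset.range N) fun i _ =>
      (continuous_opKer hφ ((hT i).integrable x)).measurable)
      (tendsto_pi_nhds.2 fun y => (hsum y).tendsto_sum_nat)
  refine ⟨((hf.integrable x).const_mul (b * 2)).mono' (hf.measurable.mul hmeas).aestronglyMeasurable
    (.of_forall fun y => ?_), ?_⟩
  · rw [norm_mul, mul_left_comm]
    exact mul_le_mul_of_nonneg_left (hbd y) (norm_nonneg _)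
  · have h := hasSum_integral_of_summable_integral_norm
      (F := fun i y => f y * opKer φ (T i) x y) (μ := (volume : Measure (Eucl n)))
      (fun i => ((hT i).integrable_mul hf hφ x).1)
      (Summable.of_nonneg_of_le (fun i => integral_nonneg fun _ => norm_nonneg _) (fun i => ?_)
        (((summable_geometric_two.mul_left b).mul_right Λ)))
    · have e : ∀ y, ∑' i, f y * opKer φ (T i) x y = f y * opKer φ S x y :=
        fun y => ((hsum y).mul_left _).tsum_eq
      simpa only [e] using h
    · have hc : 0 ≤ b * (1 / 2) ^ i := (integral_nonneg fun _ => norm_nonneg _).trans ((hT i).integral_le x)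
      calc ∫ y, ‖f y * opKer φ (T i) x y‖ ≤ ∫ y, b * (1 / 2) ^ i * (‖f y‖ * wt (n + γ) (x - y)) := by
            refine integral_mono ((hT i).integrable_mul hf hφ x).1.norm ((hf.integrable x).const_mul _)
              fun y => ?_
            simp only [norm_mul]
            rw [mul_left_comm]
            exact mul_le_mul_of_nonneg_left ((hT i).le_wt x y) (norm_nonneg _)
        _ ≤ _ := by
            rw [integral_const_mul]
            exact mul_le_mul_of_nonneg_left (hf.integral_le x) hc

/-- Minkowski's inequality for the partial sums and Fatou's lemma for the pointwise limit. -/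
theorem eLpNorm_le_of_hasSum {α : Type*} [MeasurableSpace α] {μ : Measure α} {F : ℕ → α → ℂ} {G : α → ℂ}
    (hF : ∀ i, AEStronglyMeasurable (F i) μ) (hG : ∀ x, HasSum (fun i => F i x) (G x)) {w : ℕ → ℝ}
    (hw0 : ∀ i, 0 ≤ w i) (hw : ∀ i, eLpNorm (F i) 2 μ ≤ ENNReal.ofReal (w i)) {W : ℝ}
    (hW : ∀ N, ∑ i ∈ Finset.range N, w i ≤ W) : eLpNorm G 2 μ ≤ ENNReal.ofReal W := by
  have h1 := Lp.eLpNorm_lim_le_liminf_eLpNorm (p := 2)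
    (fun N => Finset.aestronglyMeasurable_sum (Finset.range N) fun i _ => hF i) G
    (.of_forall fun x => by simpa using (hG x).tendsto_sum_nat)
  refine h1.trans ((liminf_le_liminf (v := fun _ => ENNReal.ofReal W) (.of_forall fun N => ?_)).trans_eq
    (liminf_const _))
  calc _ ≤ ∑ i ∈ Finset.range N, eLpNorm (F i) 2 μ := eLpNorm_sum_le (fun i _ => hF i) one_le_two
    _ ≤ ∑ i ∈ Finset.range N, ENNReal.ofReal (w i) := Finset.sum_le_sum fun i _ => hw i
    _ = ENNReal.ofReal (∑ i ∈ Finset.range N, w i) := (ENNReal.ofReal_sum_of_nonneg fun i _ => hw0 i).symm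
    _ ≤ _ := ENNReal.ofReal_le_ofReal (hW N)

/-- The terms are 2^{-|i-j|}, so a two-sided geometric series bounds the sum uniformly in j. -/
theorem exists_sum_min_ratio_le : ∃ Z : ℝ, 0 ≤ Z ∧ ∀ (j : ℤ) (N : ℕ),
    ∑ i ∈ Finset.range N, min ((2 : ℝ) ^ i / 2 ^ j) (2 ^ j / 2 ^ i) ≤ Z := by
  set g : ℤ → ℝ := fun m => (1 / 2) ^ m.natAbs with hg
  have hg0 : ∀ m, 0 ≤ g m := fun m => by positivity
  have hs : Summable g := by
    refine Summable.of_nat_of_neg ?_ ?_ <;> simp only [hg, Int.natAbs_neg, Int.natAbs_natCast] <;>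
      exact summable_geometric_two
  refine ⟨∑' m, g m, tsum_nonneg hg0, fun j N => ?_⟩
  have hinj : Function.Injective fun i : ℕ => (i : ℤ) - j := fun a b h => by simpa using h
  have h1 : ∀ i : ℕ, min ((2 : ℝ) ^ i / 2 ^ j) (2 ^ j / 2 ^ i) ≤ g ((i : ℤ) - j) := fun i => by
    rw [hg, one_div]
    simp only [inv_pow]
    rcases le_total j i with h | h
    · refine (min_le_right _ _).trans (le_of_eq ?_)
      rw [← zpow_natCast (2 : ℝ) i, ← zpow_natCast, Int.natAbs_of_nonneg (by omega),
        ← zpow_sub₀ two_ne_zero, ← zpow_neg]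
      congr 1; ring
    · refine (min_le_left _ _).trans (le_of_eq ?_)
      rw [← zpow_natCast (2 : ℝ) i, ← zpow_natCast, ← Int.natAbs_neg, Int.natAbs_of_nonneg (by omega),
        ← zpow_sub₀ two_ne_zero, ← zpow_neg]
      congr 1; ring
  calc _ ≤ ∑ i ∈ Finset.range N, g ((i : ℤ) - j) := Finset.sum_le_sum fun i _ => h1 i
    _ = ∑ m ∈ (Finset.range N).map ⟨_, hinj⟩, g m := by rw [Finset.sum_map]; rfl
    _ ≤ _ := hs.sum_le_tsum _ fun m _ => hg0 m

/-- The square means of `Q_j T f` over cubes. -/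
theorem exists_sq_mean_bound (hn : 1 ≤ n) {δ : ℝ} (hδ₀ : 0 < δ) (hδ₁ : δ < 1) {s : ℝ} (hs : 0 < s)
    (hϑ : IsCutoff ϑ) (k₀ : ℤ) (c : ℕ → ℝ) (A : ℕ → ℕ → ℝ) {Q : Eucl n → ℂ}
    (hQ : IsAnnular Q) : ∃ C : ℝ, 0 ≤ C ∧
    ∀ (d : Eucl n → Eucl n → ℂ) (φ : Eucl n → ℝ) (j : ℤ) (Λ : ℝ) (f : Eucl n → ℂ),
      IsAmplitude (-(n * s / 2)) A d → IsPhase s c φ → k₀ ≤ j → IsTame (min s 1 / 2) Λ f →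
      (∀ x, Integrable fun y => f y * opKer φ (Sg d (dil (2 ^ j) (ker Q))) x y) ∧
      ∀ (a : Eucl n) (r : ℝ), 0 < r →
        ∫⁻ x in cube a r, ‖∫ y, f y * opKer φ (Sg d (dil (2 ^ j) (ker Q))) x y‖ₑ ^ 2 ≤ ENNReal.ofReal
          (C * Λ ^ 2 * (((2 : ℝ) ^ j) ^ (-((n : ℝ) * s)) + ((2 : ℝ) ^ j * r) ^ (-((n : ℝ) * δ))) * r ^ n) := by
  have ht₀ : (0 : ℝ) < 2 ^ k₀ := by positivity
  obtain ⟨C, hC0, N, hC⟩ := exists_piece_bounds hn hδ₀ hδ₁ hs hϑ _ ht₀ c A hQ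
  obtain ⟨Z, hZ0, hZ⟩ := exists_sum_min_ratio_le
  refine ⟨2 * (C * Z) ^ 2, by positivity, fun d φ j Λ f hd hφ hj hf => ?_⟩
  set τ : ℝ := 2 ^ j with hτ
  have hτ0 : 0 < τ := by positivity
  have hτ1 : (2 : ℝ) ^ k₀ ≤ τ := zpow_le_zpow_right₀ one_le_two hj
  have hΛ := hf.nonneg
  have hpc := fun a r hr i => hC d φ τ Λ f a r hd hφ hτ1 hf hr i
  -- The kernel bounds do not involve the cube, so any cube may be inserted.
  have hT := fun i => (hpc 0 1 one_pos i).2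
  have hS : ∀ x ξ, HasSum (fun i => dyadic ϑ i ξ * Sg d (dil τ (ker Q)) x ξ) (Sg d (dil τ (ker Q)) x ξ) :=
    fun x ξ => by simpa using (hϑ.hasSum_dyadic ξ).mul_right (Sg d (dil τ (ker Q)) x ξ)
  have hF := hasSum_integral_mul_opKer hφ.measurable hT hS hf
  refine ⟨fun x => (hF x).1, fun a r hr => ?_⟩
  set X : ℝ := Λ * √(r ^ n) * (τ ^ (-((n : ℝ) * s / 2)) + (τ * r) ^ (-((n : ℝ) * δ / 2))) with hX
  have hX0 : 0 ≤ X := by positivity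
  have h1 := eLpNorm_le_of_hasSum (μ := volume.restrict (cube a r)) (W := C * (Z * X))
    (fun i => (hpc a r hr i).1.aestronglyMeasurable.restrict) (fun x => (hF x).2)
    (fun i => (hpc a r hr i).1.nonneg) (fun i => (hpc a r hr i).1.le) (fun M => by
      rw [← Finset.mul_sum, ← Finset.sum_mul]
      exact mul_le_mul_of_nonneg_left (mul_le_mul_of_nonneg_right (hZ j M) hX0) hC0)
  rw [← eLpNorm_two_sq]
  refine (pow_le_pow_left' h1 2).trans ?_
  rw [← ENNReal.ofReal_pow (by positivity)]
  refine ENNReal.ofReal_le_ofReal ?_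
  have e1 : τ ^ (-((n : ℝ) * s)) = (τ ^ (-((n : ℝ) * s / 2))) ^ 2 := by
    rw [← Real.rpow_natCast, ← Real.rpow_mul hτ0.le]; congr 1; push_cast; ring
  have e2 : (τ * r) ^ (-((n : ℝ) * δ)) = ((τ * r) ^ (-((n : ℝ) * δ / 2))) ^ 2 := by
    rw [← Real.rpow_natCast, ← Real.rpow_mul (by positivity)]; congr 1; push_cast; ring
  have e3 : X ^ 2 = Λ ^ 2 * r ^ n * (τ ^ (-((n : ℝ) * s / 2)) + (τ * r) ^ (-((n : ℝ) * δ / 2))) ^ 2 := by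
    rw [hX, mul_pow, mul_pow, Real.sq_sqrt (by positivity)]
  rw [e1, e2]
  calc (C * (Z * X)) ^ 2 = (C * Z) ^ 2 * Λ ^ 2 * r ^ n *
        (τ ^ (-((n : ℝ) * s / 2)) + (τ * r) ^ (-((n : ℝ) * δ / 2))) ^ 2 := by
        rw [← mul_assoc, mul_pow, e3]; ring
    _ ≤ (C * Z) ^ 2 * Λ ^ 2 * r ^ n *
        (2 * ((τ ^ (-((n : ℝ) * s / 2))) ^ 2 + ((τ * r) ^ (-((n : ℝ) * δ / 2))) ^ 2)) :=
        mul_le_mul_of_nonneg_left add_sq_le (by positivity)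
    _ = _ := by ring

variable {ϑ : Eucl n → ℝ}

/-! ### The Carleson measure -/

theorem lintegral_cube_add_right (a v : Eucl n) (r : ℝ) (h : Eucl n → ℝ≥0∞) :
    ∫⁻ x in cube a r, h (x + v) = ∫⁻ x in cube (a + v) r, h x := by
  rw [← lintegral_indicator (measurableSet_cube _ _), ← lintegral_indicator (measurableSet_cube _ _),
    ← lintegral_add_right_eq_self ((cube (a + v) r).indicator h) v]
  refine lintegral_congr fun x => ?_
  have hmem : x + v ∈ cube (a + v) r ↔ x ∈ cube a r := by
    unfold cube
    simp only [Set.mem_ofPred_eq, PiLp.add_apply]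
    exact forall_congr' fun i => by
      constructor <;> rintro ⟨h1, h2⟩ <;> constructor <;> linarith
  by_cases hx : x ∈ cube a r
  · rw [Set.indicator_of_mem hx, Set.indicator_of_mem (hmem.2 hx)]
  · rw [Set.indicator_of_notMem hx, Set.indicator_of_notMem (mt hmem.1 hx)]

/-- Summation over the scales below the side length of a cube. -/
theorem tsum_dyadic_scales_le {r θ K : ℝ} (hθ0 : 0 ≤ θ) (hθ1 : θ < 1) (hK : 0 ≤ K) {g : ℕ → ℝ≥0∞}
    (h0 : ∀ l : ℕ, r < (2 : ℝ) ^ (-(l : ℤ)) → g l = 0)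
    (h1 : ∀ l m : ℕ, 1 ≤ (2 : ℝ) ^ l * r → g (m + l) ≤ ENNReal.ofReal (K * θ ^ m)) :
    ∑' l, g l ≤ ENNReal.ofReal (K * (1 - θ)⁻¹) := by
  have hP : ∀ l : ℕ, ¬ 1 ≤ (2 : ℝ) ^ l * r → g l = 0 := fun l hl => by
    refine h0 l ?_
    rw [zpow_neg, zpow_natCast, ← one_div, lt_div_iff₀ (by positivity), mul_comm]
    exact not_le.1 hl
  by_cases hex : ∃ l : ℕ, 1 ≤ (2 : ℝ) ^ l * r
  · classical
    -- The first scale 2^{-l₀} not exceeding the side length: earlier scales contribute nothing, and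
    -- the decay is counted from l₀.
    have hl := Nat.find_spec hex
    set l₀ := Nat.find hex with hl₀
    have h2 : ∑' l, g l = ∑' m, g (m + l₀) := by
      rw [← Summable.sum_add_tsum_nat_add' (f := g) (k := l₀) ENNReal.summable, Finset.sum_eq_zero, zero_add]
      exact fun l hl' => hP l (Nat.find_min hex (Finset.mem_range.1 hl'))
    rw [h2, ← tsum_geometric_of_lt_one hθ0 hθ1, ← tsum_mul_left,
      ENNReal.ofReal_tsum_of_nonneg (fun m => by positivity)
        ((summable_geometric_of_lt_one hθ0 hθ1).mul_left K)]
    exact ENNReal.tsum_le_tsum fun m => h1 l₀ m hl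
  · push Not at hex
    rw [ENNReal.tsum_eq_zero.2 fun l => hP l (not_le.2 (hex l))]
    exact zero_le

/-- Since ε does not exceed the exponent e and k ≥ k₀, the surplus decay is bounded by its value at
k₀. -/
theorem rpow_neg_mul_le {e ε : ℝ} (h : ε ≤ e) {k₀ k : ℤ} (hk : k₀ ≤ k) :
    ((2 : ℝ) ^ k) ^ (-e) ≤ ((2 : ℝ) ^ k₀) ^ (-(e - ε)) * (2 : ℝ) ^ (-ε * (k : ℝ)) := by
  have h1 : ((2 : ℝ) ^ k) ^ (-(e - ε)) ≤ ((2 : ℝ) ^ k₀) ^ (-(e - ε)) :=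
    Real.rpow_le_rpow_of_nonpos (by positivity) (zpow_le_zpow_right₀ one_le_two hk) (by linarith)
  have h2 : ((2 : ℝ) ^ k) ^ (-e) = ((2 : ℝ) ^ k) ^ (-(e - ε)) * (2 : ℝ) ^ (-ε * (k : ℝ)) := by
    rw [← Real.rpow_intCast, ← Real.rpow_mul zero_le_two, ← Real.rpow_mul zero_le_two,
      ← Real.rpow_add two_pos]
    congr 1; ring
  rw [h2]
  exact mul_le_mul_of_nonneg_right h1 (by positivity)

/-- The estimate for Q_j^u on a cube is that for u = 0 on the cube shifted by 2^{-j}u. At level j =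
k + l + m with 2^l r ≥ 1, both terms of the square mean are at most a constant times 2^{-εk} θ^m, so
the sum over scales is a geometric series. -/
theorem exists_carleson_bound (hn : 1 ≤ n) {δ : ℝ} (hδ₀ : 0 < δ) (hδ₁ : δ < 1) {s : ℝ} (hs : 0 < s)
    (hϑ : IsCutoff ϑ) (k₀ : ℤ) (c : ℕ → ℝ) (A : ℕ → ℕ → ℝ) : ∃ C : ℝ, 0 ≤ C ∧
    ∀ (d : Eucl n → Eucl n → ℂ) (φ : Eucl n → ℝ) (u : Eucl n) (Λ : ℝ) (f : Eucl n → ℂ),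
      IsAmplitude (-(n * s / 2)) A d → IsPhase s c φ → IsTame (min s 1 / 2) Λ f →
      (∀ (j : ℤ) (x : Eucl n), k₀ ≤ j → Integrable fun y =>
        f y * oioTranspose d φ (fun x' => lpKernel ϑ u j (x - x')) y) ∧
      ∀ k : ℤ, k₀ ≤ k → carlesonNorm (oioMeasure ϑ d φ u f k) ≤
        ENNReal.ofReal (C * (2 : ℝ) ^ (-(min (n * s / 2) (n * δ)) * (k : ℝ)) * Λ ^ 2) := by
  obtain ⟨C, hC0, hC⟩ := exists_sq_mean_bound hn hδ₀ hδ₁ hs hϑ k₀ c A (hϑ.isAnnular_psi hn)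
  have hn0 : (0 : ℝ) < n := by exact_mod_cast hn
  set ε := min ((n : ℝ) * s / 2) (n * δ) with hε
  have hns : 0 < (n : ℝ) * s := by positivity
  have hnδ : 0 < (n : ℝ) * δ := by positivity
  have hε1 : ε ≤ n * s := (min_le_left _ _).trans (by linarith)
  have hε2 : ε ≤ n * δ := min_le_right _ _
  set θ : ℝ := max ((2 : ℝ) ^ (-((n : ℝ) * s))) ((2 : ℝ) ^ (-((n : ℝ) * δ))) with hθ
  have hθ0 : 0 < θ := lt_max_of_lt_left (by positivity)
  have hθ1 : θ < 1 := max_lt (Real.rpow_lt_one_of_one_lt_of_neg one_lt_two (by linarith))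
    (Real.rpow_lt_one_of_one_lt_of_neg one_lt_two (by linarith))
  set D : ℝ := ((2 : ℝ) ^ k₀) ^ (-(n * s - ε)) + ((2 : ℝ) ^ k₀) ^ (-(n * δ - ε)) with hD
  have hD0 : 0 < D := by positivity
  have hθ2 : 0 < 1 - θ := by linarith
  refine ⟨C * D * (1 - θ)⁻¹, by positivity, fun d φ u Λ f hd hφ hf => ⟨fun j x hj => ?_, fun k hk => ?_⟩⟩
  · have h := (hC d φ j Λ f hd hφ hj hf).1 (x + (2 : ℝ) ^ (-j) • u)
    have e : (fun x' => lpKernel ϑ u j (x - x')) = fun x' => dil ((2 : ℝ) ^ j)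
        (ker fun ξ => (psi ϑ 0 ξ : ℂ)) (x + (2 : ℝ) ^ (-j) • u - x') := by
      ext x'
      rw [lpKernel_eq, sub_add_eq_add_sub]
    rw [e]
    exact h
  · have hpiece : ∀ j : ℤ, k₀ ≤ j → ∀ (a : Eucl n) (r : ℝ), 0 < r →
        ∫⁻ x in cube a r, ‖lpPiece ϑ u j (oio d φ f) x‖ₑ ^ 2 ≤ ENNReal.ofReal
          (C * Λ ^ 2 * (((2 : ℝ) ^ j) ^ (-((n : ℝ) * s)) + ((2 : ℝ) ^ j * r) ^ (-((n : ℝ) * δ))) * r ^ n) :=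
      fun j hj a r hr => by
        refine le_trans (le_of_eq ?_) ((hC d φ j Λ f hd hφ hj hf).2 (a + (2 : ℝ) ^ (-j) • u) r hr)
        rw [← lintegral_cube_add_right]
        refine lintegral_congr fun x => ?_
        rw [lpPiece_eq]
        rfl
    unfold carlesonNorm
    refine iSup_le fun a => iSup_le fun r => iSup_le fun hr => ?_
    refine ENNReal.div_le_of_le_mul ?_
    rw [oioMeasure, Measure.sum_apply _ ((measurableSet_cube a r).prod measurableSet_Ioc)]
    set E : ℝ := (2 : ℝ) ^ (-ε * (k : ℝ)) with hE
    have hE0 : 0 < E := by positivity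
    refine (tsum_dyadic_scales_le (r := r) (K := C * Λ ^ 2 * (D * E) * r ^ n) hθ0.le hθ1 (by positivity)
      (fun l hl => ?_) (fun l m hl => ?_)).trans (le_of_eq ?_)
    · rw [Measure.prod_prod, Measure.dirac_apply' _ measurableSet_Ioc,
        Set.indicator_of_notMem (fun h => absurd h.2 (not_le.2 hl)), mul_zero]
    · rw [Measure.prod_prod, withDensity_apply _ (measurableSet_cube a r)]
      have h1 := hpiece (k + (m + l : ℕ)) (by push_cast; omega) a r hr
      have h2 : (Measure.dirac ((2 : ℝ) ^ (-((m + l : ℕ) : ℤ)))) (Set.Ioc 0 r) ≤ 1 := prob_le_one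
      refine (mul_le_mul' h1 h2).trans ?_
      rw [mul_one]
      refine ENNReal.ofReal_le_ofReal ?_
      have e0 : (2 : ℝ) ^ (k + (m + l : ℕ)) = 2 ^ k * (2 ^ m * 2 ^ l) := by
        rw [zpow_add₀ two_ne_zero, zpow_natCast, pow_add]
      have e1 : ∀ q : ℝ, ((2 : ℝ) ^ m) ^ (-q) = ((2 : ℝ) ^ (-q)) ^ m := fun q => by
        rw [← Real.rpow_natCast, ← Real.rpow_natCast, ← Real.rpow_mul zero_le_two,
          ← Real.rpow_mul zero_le_two, mul_comm]
      -- In the first term 2^l contributes at most 1 and is discarded; 2^k gives the factor E and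
      -- 2^m the factor θ^m.
      have h3 : ((2 : ℝ) ^ (k + (m + l : ℕ))) ^ (-((n : ℝ) * s)) ≤
          ((2 : ℝ) ^ k₀) ^ (-(n * s - ε)) * E * θ ^ m := by
        rw [e0, Real.mul_rpow (by positivity) (by positivity), Real.mul_rpow (by positivity) (by positivity),
          e1]
        have h4 : ((2 : ℝ) ^ l) ^ (-((n : ℝ) * s)) ≤ 1 :=
          Real.rpow_le_one_of_one_le_of_nonpos (one_le_pow₀ one_le_two) (by linarith)
        calc _ ≤ ((2 : ℝ) ^ k) ^ (-((n : ℝ) * s)) * (θ ^ m * 1) := by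
              gcongr
              exact le_max_left _ _
          _ ≤ ((2 : ℝ) ^ k₀) ^ (-(n * s - ε)) * E * (θ ^ m * 1) :=
              mul_le_mul_of_nonneg_right (rpow_neg_mul_le hε1 hk) (by positivity)
          _ = _ := by rw [mul_one]
      -- In the second term 2^l is grouped with r. Since 2^l r ≥ 1, their product to a negative
      -- power is at most 1.
      have h5 : ((2 : ℝ) ^ (k + (m + l : ℕ)) * r) ^ (-((n : ℝ) * δ)) ≤
          ((2 : ℝ) ^ k₀) ^ (-(n * δ - ε)) * E * θ ^ m := by
        rw [e0, mul_assoc, mul_assoc, Real.mul_rpow (by positivity) (by positivity),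
          Real.mul_rpow (by positivity) (by positivity), e1]
        have h4 : ((2 : ℝ) ^ l * r) ^ (-((n : ℝ) * δ)) ≤ 1 :=
          Real.rpow_le_one_of_one_le_of_nonpos hl (by linarith)
        calc _ ≤ ((2 : ℝ) ^ k) ^ (-((n : ℝ) * δ)) * (θ ^ m * 1) := by
              gcongr
              exact le_max_right _ _
          _ ≤ ((2 : ℝ) ^ k₀) ^ (-(n * δ - ε)) * E * (θ ^ m * 1) :=
              mul_le_mul_of_nonneg_right (rpow_neg_mul_le hε2 hk) (by positivity)
          _ = _ := by rw [mul_one]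
      calc _ ≤ C * Λ ^ 2 * (((2 : ℝ) ^ k₀) ^ (-(n * s - ε)) * E * θ ^ m +
            ((2 : ℝ) ^ k₀) ^ (-(n * δ - ε)) * E * θ ^ m) * r ^ n := by gcongr
        _ = _ := by rw [hD]; ring
    · rw [volume_cube, ← ENNReal.ofReal_pow hr.le, ← ENNReal.ofReal_mul (by positivity)]
      congr 1
      ring

/-- All quantities depend on f only up to null sets. This permits the passage to a measurable
representative, which the Fubini arguments require. -/
theorem bmoNorm_congr (ϑ : Eucl n → ℝ) {f g : Eucl n → ℂ} (h : f =ᵐ[volume] g) :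
    bmoNorm ϑ f = bmoNorm ϑ g := by
  have h1 : bmoSeminorm f = bmoSeminorm g := by
    unfold bmoSeminorm
    congr! 5 with a r hr
    have h2 : ⨍ y in cube a r, f y = ⨍ y in cube a r, g y := average_congr (ae_restrict_of_ae h)
    rw [h2]
    congr 1
    refine lintegral_congr_ae ((ae_restrict_of_ae h).mono fun x hx => ?_)
    simp only [hx]
  have h2 : lowFreq ϑ f = lowFreq ϑ g := funext fun x =>
    integral_congr_ae (h.mono fun y hy => by simp only [hy])
  rw [bmoNorm, bmoNorm, h1, h2]

theorem MemBmo.congr {f g : Eucl n → ℂ} (hf : MemBmo ϑ f) (h : f =ᵐ[volume] g) : MemBmo ϑ g :=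
  ⟨hf.1.congr h, by rw [← bmoNorm_congr ϑ h]; exact hf.2⟩

end OscInt

end

/-! ### The main theorem -/

theorem mainTheorem4 (n : ℕ) (hn : 1 ≤ n) (s : ℝ) (hs : 0 < s)
    (δ : ℝ) (hδ₀ : 0 < δ) (hδ₁ : δ < 1)
    (ϑ : OscInt.Eucl n → ℝ) (hϑ : OscInt.IsCutoff ϑ) (k₀ : ℤ)
    (A : ℕ → ℕ → ℝ) (c : ℕ → ℝ) :
    ∃ C : ℝ, 0 < C ∧
      ∀ (d : OscInt.Eucl n → OscInt.Eucl n → ℂ), OscInt.IsAmplitude (-(n * s / 2)) A d →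
      ∀ (φ : OscInt.Eucl n → ℝ), OscInt.IsPhase s c φ →
      ∀ (u : OscInt.Eucl n) (f : OscInt.Eucl n → ℂ), OscInt.MemBmo ϑ f →
        (∀ (j : ℤ) (x : OscInt.Eucl n), k₀ ≤ j → MeasureTheory.Integrable (fun y : OscInt.Eucl n =>
          f y * OscInt.oioTranspose d φ (fun x' => OscInt.lpKernel ϑ u j (x - x')) y)) ∧
        ∀ k : ℤ, k₀ ≤ k →
          OscInt.IsCarleson (OscInt.oioMeasure ϑ d φ u f k) ∧
          OscInt.carlesonNorm (OscInt.oioMeasure ϑ d φ u f k) ≤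
            ENNReal.ofReal (C * (2 : ℝ) ^ (-(min (n * s / 2) (n * δ)) * (k : ℝ))) *
              OscInt.bmoNorm ϑ f ^ 2 := by
  have hγ0 : 0 < min s 1 / 2 := by have := lt_min hs one_pos; positivity
  have hγ1 : min s 1 / 2 ≤ 1 := by have := min_le_right s 1; linarith
  obtain ⟨C₁, hC₁0, hC₁⟩ := OscInt.exists_isTame hϑ hγ0 hγ1
  obtain ⟨C₂, hC₂0, hC₂⟩ := OscInt.exists_carleson_bound hn hδ₀ hδ₁ hs hϑ k₀ c A
  -- The estimate is quadratic in the tame norm C₁‖f‖_bmo, whence C₁²; adding 1 makes the constant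
  -- positive.
  refine ⟨C₂ * C₁ ^ 2 + 1, by positivity, fun d hd φ hφ u f hf => ?_⟩
  obtain ⟨g, hg, hfg⟩ := hf.1.aestronglyMeasurable
  have hgB := hf.congr hfg
  have htame := hC₁ g hgB hg.measurable
  obtain ⟨h1, h2⟩ := hC₂ d φ u _ g hd hφ htame
  have hoio : OscInt.oio d φ f = OscInt.oio d φ g := funext fun κ =>
    MeasureTheory.integral_congr_ae (hfg.mono fun y hy => by simp only [hy])
  have hmeas : ∀ k, OscInt.oioMeasure ϑ d φ u f k = OscInt.oioMeasure ϑ d φ u g k := fun k => by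
    unfold OscInt.oioMeasure
    rw [hoio]
  have hbmo := OscInt.bmoNorm_congr ϑ hfg
  refine ⟨fun j x hj => (h1 j x hj).congr (hfg.mono fun y hy => by simp only [hy]), fun k hk => ?_⟩
  have h3 : OscInt.carlesonNorm (OscInt.oioMeasure ϑ d φ u f k) ≤
      ENNReal.ofReal ((C₂ * C₁ ^ 2 + 1) * (2 : ℝ) ^ (-(min (n * s / 2) (n * δ)) * (k : ℝ))) *
        OscInt.bmoNorm ϑ f ^ 2 := by
    rw [hmeas, hbmo]
    refine (h2 k hk).trans ?_
    have hE : 0 < (2 : ℝ) ^ (-(min (n * s / 2) (n * δ)) * (k : ℝ)) := by positivity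
    set E := (2 : ℝ) ^ (-(min (n * s / 2) (n * δ)) * (k : ℝ))
    rw [← ENNReal.ofReal_toReal hgB.2.ne, ← ENNReal.ofReal_pow ENNReal.toReal_nonneg,
      ← ENNReal.ofReal_mul (by positivity), ENNReal.toReal_ofReal ENNReal.toReal_nonneg]
    refine ENNReal.ofReal_le_ofReal ?_
    have h4 : 0 ≤ E * (OscInt.bmoNorm ϑ g).toReal ^ 2 := by positivity
    linarith
  exact ⟨h3.trans_lt (ENNReal.mul_lt_top ENNReal.ofReal_lt_top (ENNReal.pow_lt_top hf.2)), h3⟩
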